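/- Let $\Gamma\subset\mathbb S^2$ be an (undirected) trivalent graph embedded in the round sphere, with finite vertex set $V\subset\Gamma$: $\Gamma$ is closed, near each $v\in V$ it is the union of three, and near each other point of $\Gamma$ the union of two, smooth regular simple arcs that start at the point and are otherwise disjoint. (Loops, multiple edges, circle components without vertices, disconnected graphs and $\Gamma=\emptyset$ are allowed.) Regard $(\mathbb S^2,\Gamma)$ as a surface with defects, with $0$-strata the points of $V$ and $1$-strata the components of $\Gamma\setminus V$. **Patterns.** In the unit square, read from bottom to top, with marked points equally spaced on the bottom and top sides, consider the four kinds of pictures: $I_n$ ($n$ vertical strands, $n\ge 0$); $\mu_i$ ($n\to n-1$, the strands $i,i+1$ are joined to one strand at a trivalent vertex); $\beta_i$ ($n\to n-2$, the strands $i,i+1$ are joined by an arc); $\gamma_i$ ($n-2\to n$, $\beta_i$ upside down); here $1\le i<n$ and all other strands are straight segments from bottom to top. **Decompositions.** A decomposition of $(\mathbb S^2,\Gamma)$ into elementary cylinders consists of an orientation-preserving homeomorphism $\Phi$ of $\mathbb S^2$ (one homotopic to the identity), heights $-1<t_0<\dots<t_m<1$ with $m\ge1$, and a composable sequence of patterns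 $\rho_1,\dots,\rho_m$ from $0$ to $0$ marked points, such that $(\Phi(\Gamma),\Phi(V))$ is the union of the pictures of the $\rho_j$ and their vertices, where $\rho_j$ is placed on the front half (a rectangle) of the cylinder $\{t_{j-1}\le z\le t_j\}\subset\mathbb S^2$. The back halves of the cylinders and the caps $\{z<t_0\}$, $\{z>t_m\}$ carry no defects. Thus $(\mathbb S^2,\Gamma)$ is presented as the composite $\rho_m\circ\dots\circ\rho_1$ (closed off by two caps without defects). The cylinder $\Phi^{-1}\{t_{j-1}\le z\le t_j\}$, its front rectangle, its back half and the circles $\Phi^{-1}\{z=t_j\}$ are called the elementary cylinder, rectangle, back and cross-sections of the decomposition. **PLCW decompositions.** A generalized cell complex is a finite collection of cells with continuous characteristic maps on closed balls, injective on the open ball, with the image of the open ball disjoint from the image of the boundary sphere, such that distinct open cells are disjoint and the boundary of every cell is a union of cells. It is PLCW if (inductively) for each cell of positive dimension the boundary sphere of its ball has a PLCW decomposition each of whose cells is mapped by the characteristic map onto a cell of the same dimension, injectively on its interior. A PLCW decomposition of $(\mathbb S^2,\Gamma)$ is a PLCW complex of dimension at most two with support $\mathbb S^2$ such that $\Gamma$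 avoids all $0$-cells, each closed $1$-cell meets $\Gamma$ in at most one point and contains no vertex, and each $2$-cell is, up to a homeomorphism of the disc, a basic-gon: (I) a polygon without defects; (II) a polygon without vertices of $\Gamma$ crossed by one arc which enters and leaves through the interiors of two different edges; or (III) a polygon with one vertex at its centre and three radial arcs, such that each edge is crossed in its interior by exactly one of them (so it is a triangle). **Proposition.** Every $(\mathbb S^2,\Gamma)$ as above has a decomposition into elementary cylinders, and for every such decomposition there is a PLCW decomposition of $(\mathbb S^2,\Gamma)$ which is compatible with it in the following sense: each cross-section is a union of closed $1$-cells; the back of each elementary cylinder is a single $2$-cell; and the rectangle of each elementary cylinder $\rho_j$ is a horizontal composite $P_1\otimes\dots\otimes P_k$, $k\ge1$, of distinct $2$-cells (basic-gons), i.e. it is their union, there are $1$-cells $e_0,\dots,e_k$, each running from the bottom side to the top side of the rectangle and meeting these sides only in its two end points, with $e_0$ the left side, $e_k$ the right side, $e_{a-1}\cup e_a\subset P_a$, $P_a\cap P_{a+1}=e_a$, and $P_a\cap P_b$ consists of $0$-cells for $b>a+1$. -/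

import Mathlib

open Set Metric Topology
open scoped ContDiff

namespace DefectBord

/-- Euclidean space of dimension `n`. -/
abbrev Euc (n : ℕ) : Type := EuclideanSpace ℝ (Fin n)

/-- The round two-sphere in Euclidean three-space. -/
abbrev S2 : Type := sphere (0 : Euc 3) 1

/-! ### Trivalent graphs embedded in the sphere -/

/-- Near `x` the set `Γ` is the union of `k` smooth regular arcs in the sphere which start at `x`
and are otherwise simple and pairwise disjoint. -/
def IsStarAt (Γ : Set S2) (k : ℕ) (x : S2) : Prop :=
  ∃ c : Fin k → ℝ → Euc 3,
    (∀ a, ContDiff ℝ ∞ (c a)) ∧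
    (∀ a, c a 0 = x) ∧
    (∀ a, ∀ s ∈ Icc (0 : ℝ) 1, c a s ∈ sphere (0 : Euc 3) 1 ∧ deriv (c a) s ≠ 0) ∧
    (∀ a b, ∀ s ∈ Icc (0 : ℝ) 1, ∀ t ∈ Icc (0 : ℝ) 1,
      c a s = c b t → (a = b ∧ s = t) ∨ (s = 0 ∧ t = 0)) ∧
    ∃ U ∈ 𝓝 (x : Euc 3), Subtype.val '' Γ ∩ U = (⋃ a, c a '' Icc (0 : ℝ) 1) ∩ U

/-- `Γ` is (the union of the vertices and edges of) a trivalent graph with vertex set `V` embedded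
in the sphere.  The 0-strata are the points of `V`, the 1-strata are the components of `Γ \ V` and
the 2-strata are the components of the complement of `Γ`.  Multiple edges, loops, circle components
without vertices, disconnected graphs and the empty graph are allowed; edges may have corners. -/
structure IsTrivalentGraph (Γ V : Set S2) : Prop where
  isClosed : IsClosed Γ
  finite_vertices : V.Finite
  subset : V ⊆ Γ
  vertex : ∀ x ∈ V, IsStarAt Γ 3 x
  edge : ∀ x ∈ Γ \ V, IsStarAt Γ 2 x

/-! ### The four patterns -/

/-- The four patterns, drawn in the unit square and read from bottom to top, with strands counted
from `0`.
* `I n` is the identity on `n` strands;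
* `mu n i` goes from `n + 2` to `n + 1` strands and joins the strands `i` and `i + 1` at a trivalent
  vertex;
* `beta n i` goes from `n + 2` to `n` strands and joins `i` and `i + 1` by an arc;
* `gamma n i` goes from `n` to `n + 2` strands; it is `beta n i` upside down. -/
inductive Pattern : Type
  | I (n : ℕ)
  | mu (n : ℕ) (i : Fin (n + 1))
  | beta (n : ℕ) (i : Fin (n + 1))
  | gamma (n : ℕ) (i : Fin (n + 1))

namespace Pattern

/-- The number of marked points on the lower boundary. -/
def source : Pattern → ℕ
  | I n => n
  | mu n _ => n + 2
  | beta n _ => n + 2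
  | gamma n _ => n

/-- The number of marked points on the upper boundary. -/
def target : Pattern → ℕ
  | I n => n
  | mu n _ => n + 1
  | beta n _ => n
  | gamma n _ => n + 2

/-- Position of the `k`-th of `n` equidistant marked points in the unit interval,
`k = 0, …, n - 1`. -/
noncomputable def mark (n k : ℕ) : ℝ := ((k : ℝ) + 1) / ((n : ℝ) + 1)

/-- The trivalent vertex of `mu n i`. -/
noncomputable def muVertex (n i : ℕ) : ℝ × ℝ := (mark (n + 1) i, 1 / 2)

/-- The highest point of the arc of `beta n i`. -/
noncomputable def betaTop (n i : ℕ) : ℝ × ℝ := ((mark (n + 2) i + mark (n + 2) (i + 1)) / 2, 1 / 2)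

/-- The picture of `mu n i` in the unit square. -/
noncomputable def muStrands (n i : ℕ) : Set (ℝ × ℝ) :=
  (⋃ k : ℕ, ⋃ _ : k < i, segment ℝ (mark (n + 2) k, (0 : ℝ)) (mark (n + 1) k, (1 : ℝ))) ∪
  (⋃ k : ℕ, ⋃ _ : i < k ∧ k < n + 1,
    segment ℝ (mark (n + 2) (k + 1), (0 : ℝ)) (mark (n + 1) k, (1 : ℝ))) ∪
  (segment ℝ (mark (n + 2) i, (0 : ℝ)) (muVertex n i) ∪
    segment ℝ (mark (n + 2) (i + 1), (0 : ℝ)) (muVertex n i) ∪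
    segment ℝ (muVertex n i) (mark (n + 1) i, (1 : ℝ)))

/-- The picture of `beta n i` in the unit square. -/
noncomputable def betaStrands (n i : ℕ) : Set (ℝ × ℝ) :=
  (⋃ k : ℕ, ⋃ _ : k < i, segment ℝ (mark (n + 2) k, (0 : ℝ)) (mark n k, (1 : ℝ))) ∪
  (⋃ k : ℕ, ⋃ _ : i ≤ k ∧ k < n,
    segment ℝ (mark (n + 2) (k + 2), (0 : ℝ)) (mark n k, (1 : ℝ))) ∪
  (segment ℝ (mark (n + 2) i, (0 : ℝ)) (betaTop n i) ∪
    segment ℝ (mark (n + 2) (i + 1), (0 : ℝ)) (betaTop n i))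

/-- The defect lines (with the vertex, if there is one) of a pattern, in the unit square. -/
noncomputable def strands : Pattern → Set (ℝ × ℝ)
  | I n => ⋃ k : ℕ, ⋃ _ : k < n, segment ℝ (mark n k, (0 : ℝ)) (mark n k, (1 : ℝ))
  | mu n i => muStrands n i
  | beta n i => betaStrands n i
  | gamma n i => {p | (p.1, 1 - p.2) ∈ betaStrands n i}

/-- The trivalent vertices of a pattern, in the unit square. -/
noncomputable def vertices : Pattern → Set (ℝ × ℝ)
  | mu n i => {muVertex n i}
  | _ => ∅

end Pattern

/-! ### Cylinders in the sphere -/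

/-- The cylinder on the sphere between the heights `a < b`, in coordinates `(x, s)`: the height is
`a + (b - a) s` and the longitude is `π (x - 1/2)`.  The unit square is the front half of the
cylinder, the points with `1 ≤ x ≤ 2` are the back half. -/
noncomputable def cyl (a b : ℝ) (p : ℝ × ℝ) : Euc 3 :=
  let z : ℝ := a + (b - a) * p.2
  let r : ℝ := Real.sqrt (1 - z ^ 2)
  !₂[r * Real.cos (Real.pi * (p.1 - 1 / 2)), r * Real.sin (Real.pi * (p.1 - 1 / 2)), z]

/-- The subset of the sphere which is given by `A` in the coordinates of `cyl a b`. -/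
def place (a b : ℝ) (A : Set (ℝ × ℝ)) : Set S2 := Subtype.val ⁻¹' (cyl a b '' A)

/-- A presentation of the surface with defects `(S², Γ)` as a composite of patterns
`ρ (m-1) ∘ ⋯ ∘ ρ 1 ∘ ρ 0`.  After an orientation preserving homeomorphism (that is, one homotopic to
the identity) `Γ` is the stack of the pictures of the patterns, placed on the front of consecutive
cylinders.  The cylinders are cut out by the cross-sections at the heights `level j`; their back
halves, and the two caps below the first and above the last cross-section, carry no defects. -/
structure Decomposition (Γ V : Set S2) where
  iso : S2 ≃ₜ S2
  orientation : (iso : C(S2, S2)).Homotopic (ContinuousMap.id S2)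
  m : ℕ
  m_pos : 0 < m
  ρ : Fin m → Pattern
  source_first : ∀ j : Fin m, (j : ℕ) = 0 → (ρ j).source = 0
  composable : ∀ i j : Fin m, (i : ℕ) + 1 = j → (ρ i).target = (ρ j).source
  target_last : ∀ j : Fin m, (j : ℕ) + 1 = m → (ρ j).target = 0
  level : Fin (m + 1) → ℝ
  level_mem : ∀ j, level j ∈ Ioo (-1 : ℝ) 1
  level_strictMono : StrictMono level
  graph_eq : iso '' Γ = ⋃ j, place (level j.castSucc) (level j.succ) (ρ j).strands
  vertices_eq : iso '' V = ⋃ j, place (level j.castSucc) (level j.succ) (ρ j).vertices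

namespace Decomposition

variable {Γ V : Set S2}

/-- The part of the `j`-th cylinder given by `A` in the coordinates `(x, s)`, as a subset of the
sphere containing `Γ`. -/
def part (D : Decomposition Γ V) (j : Fin D.m) (A : Set (ℝ × ℝ)) : Set S2 :=
  D.iso ⁻¹' place (D.level j.castSucc) (D.level j.succ) A

/-- The front rectangle of the `j`-th cylinder, which carries the picture of the pattern. -/
def rectangle (D : Decomposition Γ V) (j : Fin D.m) : Set S2 :=
  D.part j (Icc 0 1 ×ˢ Icc 0 1)

/-- The back of the `j`-th cylinder. -/
def back (D : Decomposition Γ V) (j : Fin D.m) : Set S2 :=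
  D.part j (Icc 1 2 ×ˢ Icc 0 1)

/-- The `j`-th cross-section circle. -/
def crossSection (D : Decomposition Γ V) (j : Fin (D.m + 1)) : Set S2 :=
  {p | (D.iso p : Euc 3) 2 = D.level j}

end Decomposition

/-! ### PLCW complexes -/

/-- A generalized cell complex in `X`: finitely many generalized cells, each given by its
characteristic map on the closed unit ball, such that the interiors of distinct cells are disjoint
and the boundary of each cell is a union of cells. -/
structure CellComplex (X : Type) [TopologicalSpace X] where
  /-- The cells of dimension `n`. -/
  Cell : ℕ → Type
  finite : Finite (Σ n, Cell n)
  /-- The characteristic map of a cell; only its values on the closed unit ball matter. -/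
  map : ∀ {n : ℕ}, Cell n → Euc n → X
  continuousOn : ∀ {n : ℕ} (c : Cell n), ContinuousOn (map c) (closedBall 0 1)
  injOn : ∀ {n : ℕ} (c : Cell n), InjOn (map c) (ball 0 1)
  disjoint_boundary : ∀ {n : ℕ} (c : Cell n),
    Disjoint (map c '' ball 0 1) (map c '' sphere 0 1)
  disjoint_interior : ∀ c d : Σ n, Cell n, c ≠ d →
    Disjoint (map c.2 '' ball 0 1) (map d.2 '' ball 0 1)
  boundary_eq : ∀ {n : ℕ} (c : Cell n), ∃ S : Set (Σ n, Cell n),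
    map c '' sphere 0 1 = ⋃ d ∈ S, map d.2 '' closedBall 0 1

namespace CellComplex

variable {X : Type} [TopologicalSpace X]

/-- The closed cell. -/
def closedCell (K : CellComplex X) {n : ℕ} (c : K.Cell n) : Set X := K.map c '' closedBall 0 1

/-- The interior of a cell. -/
def openCell (K : CellComplex X) {n : ℕ} (c : K.Cell n) : Set X := K.map c '' ball 0 1

/-- The boundary of a cell. -/
def boundary (K : CellComplex X) {n : ℕ} (c : K.Cell n) : Set X := K.map c '' sphere 0 1

/-- The union of all cells. -/
def support (K : CellComplex X) : Set X := ⋃ (n : ℕ) (c : K.Cell n), K.closedCell c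

/-- `L` is a cell decomposition of the boundary sphere of the standard ball for which the
characteristic map of `c` is a regular cellular map: it maps every cell of `L` onto a cell of `K` of
the same dimension, injectively on the interior. -/
def IsBoundaryDecomposition (K : CellComplex X) {n : ℕ} (c : K.Cell n)
    (L : CellComplex (Euc n)) : Prop :=
  L.support = sphere 0 1 ∧
  ∀ (k : ℕ) (d : L.Cell k), ∃ e : K.Cell k,
    K.map c '' L.closedCell d = K.closedCell e ∧ K.map c '' L.openCell d = K.openCell e ∧
    InjOn (K.map c) (L.openCell d)

/-- A PLCW complex of dimension at most `n`: the boundary sphere of each cell of positive dimension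
has a PLCW decomposition for which the characteristic map is a regular cellular map. -/
def IsPLCW : ℕ → ∀ {X : Type} [TopologicalSpace X], CellComplex X → Prop
  | 0, _, _, K => ∀ k, 0 < k → IsEmpty (K.Cell k)
  | n + 1, _, _, K => (∀ k, n + 1 < k → IsEmpty (K.Cell k)) ∧
      ∀ (k : ℕ) (c : K.Cell (k + 1)), ∃ L : CellComplex (Euc (k + 1)),
        IsPLCW n L ∧ K.IsBoundaryDecomposition c L

/-! ### Basic-gons -/

/-- Basic-gon of type I: a polygon without defects. -/
def IsTypeI (K : CellComplex S2) (Γ : Set S2) (c : K.Cell 2) : Prop :=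
  Disjoint (K.closedCell c) Γ

/-- Basic-gon of type II: up to a homeomorphism of the disc the defects form one diameter, whose
end points lie in the interiors of two different edges of the polygon. -/
def IsTypeII (K : CellComplex S2) (Γ V : Set S2) (c : K.Cell 2) : Prop :=
  Disjoint (K.closedCell c) V ∧
  ∃ h : Euc 2 ≃ₜ Euc 2, h '' closedBall 0 1 = closedBall 0 1 ∧
    (∀ p ∈ closedBall (0 : Euc 2) 1, K.map c (h p) ∈ Γ ↔ p 1 = 0) ∧
    ∃ L : CellComplex (Euc 2), K.IsBoundaryDecomposition c L ∧
      ∃ a b : L.Cell 1, a ≠ b ∧ h !₂[1, 0] ∈ L.openCell a ∧ h !₂[-1, 0] ∈ L.openCell b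

/-- The three third roots of unity in the plane. -/
noncomputable def tripod (k : Fin 3) : Euc 2 :=
  !₂[Real.cos (2 * Real.pi * (k : ℕ) / 3), Real.sin (2 * Real.pi * (k : ℕ) / 3)]

/-- Basic-gon of type III with three lines: up to a homeomorphism of the disc the defects are a
vertex at the centre and the three radii to the third roots of unity; each edge of the polygon is
crossed by exactly one of the three lines. -/
def IsTypeIII (K : CellComplex S2) (Γ V : Set S2) (c : K.Cell 2) : Prop :=
  ∃ h : Euc 2 ≃ₜ Euc 2, h '' closedBall 0 1 = closedBall 0 1 ∧
    (∀ p ∈ closedBall (0 : Euc 2) 1, K.map c (h p) ∈ Γ ↔ ∃ k, p ∈ segment ℝ 0 (tripod k)) ∧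
    (∀ p ∈ closedBall (0 : Euc 2) 1, K.map c (h p) ∈ V ↔ p = 0) ∧
    ∃ L : CellComplex (Euc 2), K.IsBoundaryDecomposition c L ∧
      ∃ e : Fin 3 ≃ L.Cell 1, ∀ k, h (tripod k) ∈ L.openCell (e k)

/-- A 2-cell of one of the three types. -/
def IsBasicGon (K : CellComplex S2) (Γ V : Set S2) (c : K.Cell 2) : Prop :=
  K.IsTypeI Γ c ∨ K.IsTypeII Γ V c ∨ K.IsTypeIII Γ V c

/-- `K` is a PLCW decomposition of the sphere which turns `(S², Γ)` into a surface with defects and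
cell decomposition: defects avoid the 0-cells, a 1-cell meets the 1-strata in at most one point and
does not meet the vertices, and all 2-cells are basic-gons. -/
structure IsDefectPLCW (K : CellComplex S2) (Γ V : Set S2) : Prop where
  isPLCW : IsPLCW 2 K
  support_eq : K.support = univ
  zero_cell : ∀ c : K.Cell 0, Disjoint (K.closedCell c) Γ
  one_cell : ∀ c : K.Cell 1, (K.closedCell c ∩ Γ).Subsingleton ∧ Disjoint (K.closedCell c) V
  two_cell : ∀ c : K.Cell 2, K.IsBasicGon Γ V c

/-- The rectangle `R` with the given four sides is the horizontal composite
`P 0 ⊗ P 1 ⊗ ⋯ ⊗ P k` of 2-cells, from left to right.  Consecutive cells `P a`, `P (a + 1)` are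
glued along their intersection, the 1-cell `e (a + 1)`; the other intersections consist of 0-cells.
Each `e a` runs from the bottom to the top of `R`; the first one is the left side of `R` and the last
one is the right side. -/
structure IsHorizontalComposite (K : CellComplex X) (R bottom top left right : Set X) {k : ℕ}
    (P : Fin (k + 1) → K.Cell 2) (e : Fin (k + 2) → K.Cell 1) : Prop where
  injective : Function.Injective P
  union_eq : R = ⋃ a, K.closedCell (P a)
  left_eq : K.closedCell (e 0) = left
  right_eq : K.closedCell (e (Fin.last (k + 1))) = right
  edge_left : ∀ a, K.closedCell (e a.castSucc) ⊆ K.closedCell (P a)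
  edge_right : ∀ a, K.closedCell (e a.succ) ⊆ K.closedCell (P a)
  glue : ∀ a b : Fin (k + 1), (a : ℕ) + 1 = b →
    K.closedCell (P a) ∩ K.closedCell (P b) = K.closedCell (e a.succ)
  far : ∀ a b : Fin (k + 1), (a : ℕ) + 1 < b →
    K.closedCell (P a) ∩ K.closedCell (P b) ⊆ ⋃ v : K.Cell 0, K.closedCell v
  vertical : ∀ i, (∃ p ∈ bottom, ∃ q ∈ top, K.boundary (e i) = {p, q}) ∧
    Disjoint (K.openCell (e i)) (bottom ∪ top)

/-- The PLCW decomposition `K` is compatible with the presentation `D` of `(S², Γ)` as a composite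
of patterns: the cross-sections are subcomplexes, the back of each cylinder is a single 2-cell, and
the rectangle of each cylinder is a horizontal composite of 2-cells. -/
structure IsCompatible (K : CellComplex S2) {Γ V : Set S2} (D : Decomposition Γ V) : Prop where
  crossSection : ∀ j, ∃ S : Set (K.Cell 1), D.crossSection j = ⋃ e ∈ S, K.closedCell e
  back : ∀ j, ∃ Q : K.Cell 2, K.closedCell Q = D.back j
  rectangle : ∀ j, ∃ (k : ℕ) (P : Fin (k + 1) → K.Cell 2) (e : Fin (k + 2) → K.Cell 1),
    K.IsHorizontalComposite (D.rectangle j)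
      (D.part j (Icc 0 1 ×ˢ {0})) (D.part j (Icc 0 1 ×ˢ {1}))
      (D.part j ({0} ×ˢ Icc 0 1)) (D.part j ({1} ×ˢ Icc 0 1)) P e

end CellComplex

end DefectBord

open Set Metric Topology
open scoped ContDiff

namespace DefectBord

/-! ### Piecewise linear interpolation with parameters -/

/-- Two nondecreasing sequences of control values with the same coincidences and the same ends. -/
structure Interpolates (n : ℕ) (f f' : ℕ → ℝ) : Prop where
  le : ∀ k < n, f k ≤ f (k + 1)
  le' : ∀ k < n, f' k ≤ f' (k + 1)
  eq_iff : ∀ k < n, f k = f (k + 1) ↔ f' k = f' (k + 1)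
  zero : f 0 = f' 0
  last : f n = f' n

/-- The piecewise linear map of the line which sends `f k` to `f' k`. -/
noncomputable def plMap (n : ℕ) (f f' : ℕ → ℝ) (x : ℝ) : ℝ :=
  x + ∑ k ∈ Finset.range n, ((f' (k + 1) - f' k) - (f (k + 1) - f k)) *
    max 0 (min 1 ((x - f k) / (f (k + 1) - f k)))

namespace Interpolates

variable {n : ℕ} {f f' : ℕ → ℝ}

theorem symm (h : Interpolates n f f') : Interpolates n f' f :=
  ⟨h.le', h.le, fun k hk => (h.eq_iff k hk).symm, h.zero.symm, h.last.symm⟩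

theorem le_of_le (h : Interpolates n f f') {i j : ℕ} (hij : i ≤ j) (hj : j ≤ n) : f i ≤ f j := by
  induction j, hij using Nat.le_induction with
  | base => exact le_rfl
  | succ j hij ih => exact (ih (by omega)).trans (h.le j (by omega))

theorem exists_mem (_ : Interpolates n f f') {x : ℝ} (h0 : f 0 ≤ x) (hn : x < f n) :
    ∃ j < n, f j ≤ x ∧ x ≤ f (j + 1) := by
  by_contra! hc
  have : ∀ j ≤ n, f j ≤ x := by
    intro j
    induction j with
    | zero => intro _; exact h0
    | succ j ih => intro hj; exact (hc j (by omega) (ih (by omega))).le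
  grind

theorem term_full (h : Interpolates n f f') {x : ℝ} {k : ℕ} (hk : k < n) (hx : f (k + 1) ≤ x) :
    ((f' (k + 1) - f' k) - (f (k + 1) - f k)) * max 0 (min 1 ((x - f k) / (f (k + 1) - f k))) =
      (f' (k + 1) - f (k + 1)) - (f' k - f k) := by
  rcases (h.le k hk).eq_or_lt with e | e
  · have := (h.eq_iff k hk).1 e
    grind
  · have : 1 ≤ (x - f k) / (f (k + 1) - f k) := by
      rw [le_div_iff₀ (by linarith)]; linarith
    grind

theorem term_zero (h : Interpolates n f f') {x : ℝ} {k : ℕ} (hk : k < n) (hx : x ≤ f k) :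
    ((f' (k + 1) - f' k) - (f (k + 1) - f k)) * max 0 (min 1 ((x - f k) / (f (k + 1) - f k))) =
      0 := by
  have : (x - f k) / (f (k + 1) - f k) ≤ 0 :=
    div_nonpos_of_nonpos_of_nonneg (by linarith) (by linarith [h.le k hk])
  rw [max_eq_left ((min_le_right _ _).trans this), mul_zero]

theorem plMap_eq (h : Interpolates n f f') {x : ℝ} {j : ℕ} (hj : j < n) (h1 : f j ≤ x)
    (h2 : x ≤ f (j + 1)) :
    plMap n f f' x = f' j + (f' (j + 1) - f' j) * ((x - f j) / (f (j + 1) - f j)) := by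
  have key : ∑ k ∈ Finset.range n, ((f' (k + 1) - f' k) - (f (k + 1) - f k)) *
      max 0 (min 1 ((x - f k) / (f (k + 1) - f k))) =
      (f' j - f j) + ((f' (j + 1) - f' j) - (f (j + 1) - f j)) *
        ((x - f j) / (f (j + 1) - f j)) := by
    rw [← Finset.sum_range_add_sum_Ico _ (show j + 1 ≤ n from hj), Finset.sum_range_succ,
      Finset.sum_eq_zero (s := Finset.Ico (j + 1) n), add_zero]
    · congr 1
      · rw [Finset.sum_congr rfl (g := fun k => (f' (k + 1) - f (k + 1)) - (f' k - f k))]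
        · rw [Finset.sum_range_sub (fun i => f' i - f i)]; rw [h.zero]; ring
        · intro k hk
          have hk := Finset.mem_range.1 hk
          exact h.term_full (by omega) ((h.le_of_le (by omega) (by omega)).trans h1)
      · congr 1
        have hd : 0 ≤ f (j + 1) - f j := by linarith
        rw [min_eq_right (div_le_one_of_le₀ (by linarith) hd),
          max_eq_right (div_nonneg (by linarith) hd)]
    · intro k hk
      have hk := Finset.mem_Ico.1 hk
      exact h.term_zero hk.2 (h2.trans (h.le_of_le hk.1 hk.2.le))
  rw [plMap, key]
  grind

theorem plMap_of_le (h : Interpolates n f f') {x : ℝ} (hx : x ≤ f 0) : plMap n f f' x = x := by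
  rw [plMap, Finset.sum_eq_zero, add_zero]
  intro k hk
  have hk := Finset.mem_range.1 hk
  exact h.term_zero hk (hx.trans (h.le_of_le (Nat.zero_le _) hk.le))

theorem plMap_of_ge (h : Interpolates n f f') {x : ℝ} (hx : f n ≤ x) : plMap n f f' x = x := by
  rw [plMap, Finset.sum_congr rfl (g := fun k => (f' (k + 1) - f (k + 1)) - (f' k - f k))]
  · rw [Finset.sum_range_sub (fun i => f' i - f i)]; rw [h.zero, h.last]; ring
  · intro k hk
    have hk := Finset.mem_range.1 hk
    exact h.term_full hk ((h.le_of_le hk le_rfl).trans hx)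

theorem plMap_apply (h : Interpolates n f f') {k : ℕ} (hk : k ≤ n) :
    plMap n f f' (f k) = f' k := by
  rcases hk.eq_or_lt with rfl | hk
  · rw [h.plMap_of_ge le_rfl, h.last]
  · rw [h.plMap_eq hk le_rfl (h.le k hk)]; simp

theorem plMap_plMap (h : Interpolates n f f') (x : ℝ) : plMap n f' f (plMap n f f' x) = x := by
  rcases lt_or_ge x (f 0) with h0 | h0
  · rw [h.plMap_of_le h0.le, h.symm.plMap_of_le (h.zero ▸ h0.le)]
  rcases lt_or_ge x (f n) with hn | hn
  swap
  · rw [h.plMap_of_ge hn, h.symm.plMap_of_ge (h.last ▸ hn)]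
  obtain ⟨j, hj, h1, h2⟩ := h.exists_mem h0 hn
  have hr0 : 0 ≤ (x - f j) / (f (j + 1) - f j) := div_nonneg (by linarith) (by linarith)
  have hr1 : (x - f j) / (f (j + 1) - f j) ≤ 1 := div_le_one_of_le₀ (by linarith) (by linarith)
  rw [h.plMap_eq hj h1 h2]
  have hd := h.le' j hj
  rw [h.symm.plMap_eq hj (by nlinarith) (by nlinarith)]
  rcases (h.le j hj).eq_or_lt with e | e
  · grind
  · have e' : f' (j + 1) - f' j ≠ 0 := fun e' => by
      have := (h.eq_iff j hj).2 (by linarith)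
      linarith
    grind

end Interpolates

theorem plMap_self {n : ℕ} {f f' : ℕ → ℝ} (h : ∀ k ≤ n, f k = f' k) (x : ℝ) :
    plMap n f f' x = x := by
  rw [plMap, Finset.sum_eq_zero, add_zero]
  grind

/-- Families of control functions. -/
structure Controls (n : ℕ) (f f' : ℕ → ℝ → ℝ) : Prop where
  cont : ∀ k, Continuous (f k)
  cont' : ∀ k, Continuous (f' k)
  interp : ∀ y, Interpolates n (fun k => f k y) (fun k => f' k y)

namespace Controls

variable {n : ℕ} {f f' : ℕ → ℝ → ℝ}

theorem symm (h : Controls n f f') : Controls n f' f :=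
  ⟨h.cont', h.cont, fun y => (h.interp y).symm⟩

theorem continuous (h : Controls n f f') :
    Continuous fun z : ℝ × ℝ => plMap n (fun k => f k z.2) (fun k => f' k z.2) z.1 := by
  refine continuous_fst.add (continuous_finsetSum _ fun k hk => ?_)
  have hk := Finset.mem_range.1 hk
  have c1 : ∀ k, Continuous fun z : ℝ × ℝ => f k z.2 := fun k => (h.cont k).comp continuous_snd
  have c2 : ∀ k, Continuous fun z : ℝ × ℝ => f' k z.2 := fun k => (h.cont' k).comp continuous_snd
  rw [continuous_iff_continuousAt]
  intro z
  rcases eq_or_ne (f k z.2) (f (k + 1) z.2) with e | e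
  · have e' : f' k z.2 = f' (k + 1) z.2 := ((h.interp z.2).eq_iff k hk).1 e
    have ht : Filter.Tendsto (fun z : ℝ × ℝ => |(f' (k + 1) z.2 - f' k z.2) - (f (k + 1) z.2 - f k z.2)|)
        (𝓝 z) (𝓝 0) := by
      have : Continuous (fun z : ℝ × ℝ =>
        |(f' (k + 1) z.2 - f' k z.2) - (f (k + 1) z.2 - f k z.2)|) :=
        (((c2 _).sub (c2 _)).sub ((c1 _).sub (c1 _))).abs
      have := this.tendsto z
      simpa [e, e'] using this
    rw [ContinuousAt]
    simp only [e, e', sub_self, zero_mul]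
    refine squeeze_zero_norm (fun w => ?_) ht
    rw [Real.norm_eq_abs, abs_mul]
    refine mul_le_of_le_one_right (abs_nonneg _) ?_
    grind
  · refine (((c2 _).sub (c2 _)).sub ((c1 _).sub (c1 _))).continuousAt.mul ?_
    refine continuousAt_const.max (continuousAt_const.min ?_)
    refine (continuous_fst.sub (c1 k)).continuousAt.div ((c1 _).sub (c1 _)).continuousAt ?_
    grind

/-- The level preserving homeomorphism of the plane which moves the graphs of the functions `f k`
to the graphs of the functions `f' k`. -/
noncomputable def homeo (h : Controls n f f') : ℝ × ℝ ≃ₜ ℝ × ℝ where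
  toFun z := (plMap n (fun k => f k z.2) (fun k => f' k z.2) z.1, z.2)
  invFun z := (plMap n (fun k => f' k z.2) (fun k => f k z.2) z.1, z.2)
  left_inv z := Prod.ext ((h.interp z.2).plMap_plMap z.1) rfl
  right_inv z := Prod.ext ((h.interp z.2).symm.plMap_plMap z.1) rfl
  continuous_toFun := h.continuous.prodMk continuous_snd
  continuous_invFun := h.symm.continuous.prodMk continuous_snd

theorem homeo_apply (h : Controls n f f') (z : ℝ × ℝ) :
    h.homeo z = (plMap n (fun k => f k z.2) (fun k => f' k z.2) z.1, z.2) := rfl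

theorem homeo_control (h : Controls n f f') {k : ℕ} (hk : k ≤ n) (y : ℝ) :
    h.homeo (f k y, y) = (f' k y, y) := by
  rw [homeo_apply]
  exact Prod.ext ((h.interp y).plMap_apply hk) rfl

theorem homeo_of_eq (h : Controls n f f') {z : ℝ × ℝ} (hz : ∀ k ≤ n, f k z.2 = f' k z.2) :
    h.homeo z = z := by
  rw [homeo_apply]
  exact Prod.ext (plMap_self hz _) rfl

theorem homeo_of_le (h : Controls n f f') {z : ℝ × ℝ} (hz : z.1 ≤ f 0 z.2) : h.homeo z = z := by
  rw [homeo_apply]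
  exact Prod.ext ((h.interp z.2).plMap_of_le hz) rfl

theorem homeo_of_ge (h : Controls n f f') {z : ℝ × ℝ} (hz : f n z.2 ≤ z.1) : h.homeo z = z := by
  rw [homeo_apply]
  exact Prod.ext ((h.interp z.2).plMap_of_ge hz) rfl

end Controls

theorem Interpolates.strictMono {n : ℕ} {f f' : ℕ → ℝ} (h : Interpolates n f f') :
    StrictMono (plMap n f f') := by
  have hc : Continuous (plMap n f f') := by
    unfold plMap
    fun_prop
  have hi : Function.Injective (plMap n f f') := Function.LeftInverse.injective h.plMap_plMap
  rcases hc.strictMono_of_inj hi with hm | hm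
  · exact hm
  · have := hm (show f 0 - 1 < f 0 by linarith)
    rw [h.plMap_of_le le_rfl, h.plMap_of_le (by linarith)] at this
    linarith

/-- A homeomorphism of the plane which preserves the second coordinate and increases in the first
one. -/
structure IsLevel (Φ : ℝ × ℝ ≃ₜ ℝ × ℝ) : Prop where
  snd : ∀ z, (Φ z).2 = z.2
  mono : ∀ y, StrictMono fun x => (Φ (x, y)).1

theorem Controls.isLevel {n : ℕ} {f f' : ℕ → ℝ → ℝ} (h : Controls n f f') : IsLevel h.homeo :=
  ⟨fun _ => rfl, fun y => (h.interp y).strictMono⟩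

theorem IsLevel.trans {Φ Ψ : ℝ × ℝ ≃ₜ ℝ × ℝ} (h : IsLevel Φ) (h' : IsLevel Ψ) :
    IsLevel (Φ.trans Ψ) := by
  refine ⟨fun z => by simp [h.snd, h'.snd], fun y a b hab => ?_⟩
  have e : ∀ x, Φ (x, y) = ((Φ (x, y)).1, y) := fun x => Prod.ext rfl (h.snd _)
  show (Ψ (Φ (a, y))).1 < (Ψ (Φ (b, y))).1
  rw [e a, e b]
  exact h'.mono y (h.mono y hab)

end DefectBord

namespace DefectBord

/-! ### Local types of points of planar graphs -/

/-- Near `z` the set `Γ` consists of `p` strands which reach `z` from below and `q` strands which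
leave it upwards; all strands are graphs over the second coordinate. -/
def HasType (Γ : Set (ℝ × ℝ)) (p q : ℕ) (z : ℝ × ℝ) : Prop :=
  ∃ (g : Fin p → ℝ → ℝ) (h : Fin q → ℝ → ℝ), (∀ k, Continuous (g k)) ∧ (∀ k, Continuous (h k)) ∧
    (∀ k, g k z.2 = z.1) ∧ (∀ k, h k z.2 = z.1) ∧
    (∀ᶠ y in 𝓝[<] z.2, StrictMono fun k => g k y) ∧
    (∀ᶠ y in 𝓝[>] z.2, StrictMono fun k => h k y) ∧
    ∀ᶠ w in 𝓝 z, (w ∈ Γ ↔ w = z ∨ (w.2 < z.2 ∧ ∃ k, w.1 = g k w.2) ∨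
      (z.2 < w.2 ∧ ∃ k, w.1 = h k w.2))

namespace HasType

variable {Γ Γ' : Set (ℝ × ℝ)} {p q : ℕ} {z : ℝ × ℝ}

theorem mem (h : HasType Γ p q z) : z ∈ Γ := by
  obtain ⟨g, h, -, -, -, -, -, -, H⟩ := h
  exact H.self_of_nhds.2 (Or.inl rfl)

theorem congr (h : HasType Γ p q z) (e : ∀ᶠ w in 𝓝 z, w ∈ Γ ↔ w ∈ Γ') : HasType Γ' p q z := by
  obtain ⟨g, h, c, c', e1, e2, m, m', H⟩ := h
  refine ⟨g, h, c, c', e1, e2, m, m', ?_⟩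
  filter_upwards [H, e] with w hw1 hw2
  rw [← hw2, hw1]

end HasType

theorem eventually_mem_image (F : ℝ × ℝ ≃ₜ ℝ × ℝ) {P : ℝ × ℝ → Prop} {z : ℝ × ℝ}
    (h : ∀ᶠ w in 𝓝 z, P w) : ∀ᶠ w in 𝓝 (F z), P (F.symm w) := by
  have : Filter.Tendsto F.symm (𝓝 (F z)) (𝓝 z) := by
    have := F.symm.continuous.tendsto (F z)
    rwa [F.symm_apply_apply] at this
  exact this.eventually h

theorem mem_image_homeo (F : ℝ × ℝ ≃ₜ ℝ × ℝ) (Γ : Set (ℝ × ℝ)) (w : ℝ × ℝ) :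
    w ∈ F '' Γ ↔ F.symm w ∈ Γ := by
  constructor
  · rintro ⟨v, hv, rfl⟩
    simpa using hv
  · intro h
    exact ⟨_, h, by simp⟩

theorem IsLevel.symm_snd {Φ : ℝ × ℝ ≃ₜ ℝ × ℝ} (h : IsLevel Φ) (z : ℝ × ℝ) :
    (Φ.symm z).2 = z.2 := by
  rw [← h.snd, Φ.apply_symm_apply]

theorem IsLevel.fst_symm_eq_iff {Φ : ℝ × ℝ ≃ₜ ℝ × ℝ} (h : IsLevel Φ) (w : ℝ × ℝ) (x : ℝ) :
    (Φ.symm w).1 = x ↔ w.1 = (Φ (x, w.2)).1 := by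
  constructor
  · rintro rfl
    have : ((Φ.symm w).1, w.2) = Φ.symm w := Prod.ext rfl (h.symm_snd w).symm
    rw [this, Φ.apply_symm_apply]
  · intro e
    have : w = Φ (x, w.2) := Prod.ext e (h.snd (x, w.2)).symm
    rw [this, Φ.symm_apply_apply]

theorem HasType.level {Γ : Set (ℝ × ℝ)} {p q : ℕ} {z : ℝ × ℝ} (h : HasType Γ p q z)
    {Φ : ℝ × ℝ ≃ₜ ℝ × ℝ} (hΦ : IsLevel Φ) : HasType (Φ '' Γ) p q (Φ z) := by
  obtain ⟨g, h, c, c', e1, e2, m, m', H⟩ := h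
  have ez : Φ (z.1, z.2) = Φ z := rfl
  refine ⟨fun k y => (Φ (g k y, y)).1, fun k y => (Φ (h k y, y)).1,
    fun k => (Φ.continuous.comp ((c k).prodMk continuous_id)).fst,
    fun k => (Φ.continuous.comp ((c' k).prodMk continuous_id)).fst,
    fun k => by simp only [hΦ.snd, e1, ez],
    fun k => by simp only [hΦ.snd, e2, ez], ?_, ?_, ?_⟩
  · rw [hΦ.snd]
    exact m.mono fun y hy k l hkl => hΦ.mono y (hy hkl)
  · rw [hΦ.snd]
    exact m'.mono fun y hy k l hkl => hΦ.mono y (hy hkl)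
  · filter_upwards [eventually_mem_image Φ H] with w hw
    rw [mem_image_homeo, hw, hΦ.symm_snd, hΦ.snd]
    simp only [hΦ.fst_symm_eq_iff]
    rw [Φ.symm_apply_eq]

/-- A homeomorphism which near `z` only changes heights monotonically preserves the type. -/
theorem HasType.vertical {Γ : Set (ℝ × ℝ)} {p q : ℕ} {z : ℝ × ℝ} (h : HasType Γ p q z)
    {F : ℝ × ℝ ≃ₜ ℝ × ℝ} (ψ : ℝ ≃o ℝ) (hF : ∀ᶠ w in 𝓝 z, F w = (w.1, ψ w.2)) :
    HasType (F '' Γ) p q (F z) := by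
  obtain ⟨g, h, c, c', e1, e2, m, m', H⟩ := h
  have ez : F z = (z.1, ψ z.2) := hF.self_of_nhds
  have cs : Continuous ψ.symm := ψ.symm.continuous
  refine ⟨fun k y => g k (ψ.symm y), fun k y => h k (ψ.symm y), fun k => (c k).comp cs,
    fun k => (c' k).comp cs, fun k => by simp [ez, e1], fun k => by simp [ez, e2], ?_, ?_, ?_⟩
  · have ht : Filter.Tendsto ψ.symm (𝓝[<] (ψ z.2)) (𝓝[<] z.2) := by
      refine tendsto_nhdsWithin_iff.2 ⟨?_, ?_⟩
      · have := cs.tendsto (ψ z.2)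
        rw [ψ.symm_apply_apply] at this
        exact this.mono_left nhdsWithin_le_nhds
      · filter_upwards [self_mem_nhdsWithin] with y hy
        exact ψ.symm_apply_lt.2 hy
    rw [ez]
    exact ht.eventually m
  · have ht : Filter.Tendsto ψ.symm (𝓝[>] (ψ z.2)) (𝓝[>] z.2) := by
      refine tendsto_nhdsWithin_iff.2 ⟨?_, ?_⟩
      · have := cs.tendsto (ψ z.2)
        rw [ψ.symm_apply_apply] at this
        exact this.mono_left nhdsWithin_le_nhds
      · filter_upwards [self_mem_nhdsWithin] with y hy
        exact ψ.lt_symm_apply.2 hy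
    rw [ez]
    exact ht.eventually m'
  · filter_upwards [eventually_mem_image F H, eventually_mem_image F hF] with w hw hw2
    rw [F.apply_symm_apply] at hw2
    rw [mem_image_homeo, hw, ez]
    generalize F.symm w = v at *
    subst hw2
    simp [Prod.ext_iff]

theorem HasType.of_eq_near {Γ : Set (ℝ × ℝ)} {p q : ℕ} {z : ℝ × ℝ} (h : HasType Γ p q z)
    {F : ℝ × ℝ ≃ₜ ℝ × ℝ} (hF : ∀ᶠ w in 𝓝 z, F w = w) : HasType (F '' Γ) p q (F z) :=
  h.vertical (OrderIso.refl ℝ) hF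

/-- The reflection of the plane which reverses heights. -/
def flip : ℝ × ℝ ≃ₜ ℝ × ℝ where
  toFun z := (z.1, -z.2)
  invFun z := (z.1, -z.2)
  left_inv z := by simp
  right_inv z := by simp

@[simp] theorem flip_apply (z : ℝ × ℝ) : flip z = (z.1, -z.2) := rfl

@[simp] theorem flip_symm : flip.symm = flip := rfl

theorem flip_flip (z : ℝ × ℝ) : flip (flip z) = z := by simp

theorem flip_image_image (Γ : Set (ℝ × ℝ)) : flip '' (flip '' Γ) = Γ := by
  rw [image_image]; simp

theorem HasType.flip {Γ : Set (ℝ × ℝ)} {p q : ℕ} {z : ℝ × ℝ} (h : HasType Γ p q z) :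
    HasType (flip '' Γ) q p (flip z) := by
  obtain ⟨g, h, c, c', e1, e2, m, m', H⟩ := h
  refine ⟨fun k y => h k (-y), fun k y => g k (-y), fun k => (c' k).comp continuous_neg,
    fun k => (c k).comp continuous_neg, fun k => by simp [e2], fun k => by simp [e1], ?_, ?_, ?_⟩
  · have ht : Filter.Tendsto (fun y : ℝ => -y) (𝓝[<] (-z.2)) (𝓝[>] z.2) := by
      refine tendsto_nhdsWithin_iff.2 ⟨?_, ?_⟩
      · have := (continuous_neg (G := ℝ)).tendsto (-z.2)
        rw [neg_neg] at this
        exact this.mono_left nhdsWithin_le_nhds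
      · filter_upwards [self_mem_nhdsWithin] with y hy
        grind
    exact ht.eventually m'
  · have ht : Filter.Tendsto (fun y : ℝ => -y) (𝓝[>] (-z.2)) (𝓝[<] z.2) := by
      refine tendsto_nhdsWithin_iff.2 ⟨?_, ?_⟩
      · have := (continuous_neg (G := ℝ)).tendsto (-z.2)
        rw [neg_neg] at this
        exact this.mono_left nhdsWithin_le_nhds
      · filter_upwards [self_mem_nhdsWithin] with y hy
        grind
    exact ht.eventually m
  · filter_upwards [eventually_mem_image DefectBord.flip H] with w hw
    rw [mem_image_homeo, hw]
    have e : DefectBord.flip.symm w = z ↔ w = DefectBord.flip z := by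
      rw [DefectBord.flip.symm_apply_eq]
    rw [e]
    simp only [flip_symm, flip_apply]
    grind

theorem hasType_one_one {Γ : Set (ℝ × ℝ)} {z : ℝ × ℝ} {f : ℝ → ℝ} (hf : Continuous f)
    (hz : f z.2 = z.1) (H : ∀ᶠ w in 𝓝 z, w ∈ Γ ↔ w.1 = f w.2) : HasType Γ 1 1 z := by
  refine ⟨fun _ => f, fun _ => f, fun _ => hf, fun _ => hf, fun _ => hz, fun _ => hz,
    Filter.Eventually.of_forall fun y => Subsingleton.strictMono _,
    Filter.Eventually.of_forall fun y => Subsingleton.strictMono _, ?_⟩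
  grind

theorem HasType.exists_graph {Γ : Set (ℝ × ℝ)} {z : ℝ × ℝ} (h : HasType Γ 1 1 z) :
    ∃ f : ℝ → ℝ, Continuous f ∧ f z.2 = z.1 ∧ ∀ᶠ w in 𝓝 z, w ∈ Γ ↔ w.1 = f w.2 := by
  obtain ⟨g, h, c, c', e1, e2, m, m', H⟩ := h
  refine ⟨fun y => if y ≤ z.2 then g 0 y else h 0 y,
    Continuous.if_le (c 0) (c' 0) continuous_id continuous_const
      (fun y hy => by rw [hy, e1, e2]), by simp [e1], ?_⟩
  filter_upwards [H] with w hw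
  rw [hw]
  rcases lt_trichotomy w.2 z.2 with hl | hl | hl
  · simp [hl, hl.le, hl.not_gt, Prod.ext_iff, hl.ne]
  · grind
  · simp [hl, hl.not_ge, hl.not_gt, Prod.ext_iff, hl.ne']

theorem HasType.eventually_one_one_below {Γ : Set (ℝ × ℝ)} {p q : ℕ} {z : ℝ × ℝ}
    (h : HasType Γ p q z) : ∀ᶠ w in 𝓝 z, w.2 < z.2 → w ∈ Γ → HasType Γ 1 1 w := by
  obtain ⟨g, h, c, c', e1, e2, m, m', H⟩ := h
  have hm : ∀ᶠ w : ℝ × ℝ in 𝓝 z, w.2 < z.2 → StrictMono fun k => g k w.2 :=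
    (continuous_snd.tendsto z).eventually (eventually_nhdsWithin_iff.1 m)
  filter_upwards [eventually_eventually_nhds.2 H, hm] with w hw hmw hlt hwΓ
  obtain ⟨k, hk⟩ : ∃ k, w.1 = g k w.2 := by
    rcases hw.self_of_nhds.1 hwΓ with rfl | ⟨-, h⟩ | ⟨h, -⟩
    all_goals grind
  refine hasType_one_one (c k) hk.symm ?_
  have h1 : ∀ᶠ v : ℝ × ℝ in 𝓝 w, v.2 < z.2 :=
    (continuous_snd.tendsto w).eventually (eventually_lt_nhds hlt)
  have h2 : ∀ᶠ v : ℝ × ℝ in 𝓝 w, ∀ l, l ≠ k → v.1 ≠ g l v.2 := by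
    rw [Filter.eventually_all]
    intro l
    by_cases hl : l = k
    · simp [hl]
    have hne : w.1 ≠ g l w.2 := by
      rw [hk]
      exact fun e => hl ((hmw hlt).injective e).symm
    filter_upwards [(isOpen_ne_fun continuous_fst ((c l).comp continuous_snd)).mem_nhds hne]
      with v hv _ using hv
  filter_upwards [hw, h1, h2] with v hv hv1 hv2
  grind

theorem HasType.eventually_one_one {Γ : Set (ℝ × ℝ)} {p q : ℕ} {z : ℝ × ℝ}
    (h : HasType Γ p q z) : ∀ᶠ w in 𝓝 z, w ≠ z → w ∈ Γ → HasType Γ 1 1 w := by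
  have h1 := h.flip.eventually_one_one_below
  have h2 := (DefectBord.flip.continuous.tendsto z).eventually h1
  have h3 : ∀ᶠ w in 𝓝 z, w ∈ Γ → w.2 = z.2 → w = z := by
    obtain ⟨g, h, c, c', e1, e2, m, m', H⟩ := h
    filter_upwards [H] with w hw hΓ he
    grind
  filter_upwards [h.eventually_one_one_below, h2, h3] with w hw1 hw2 hw3 hne hΓ
  rcases lt_trichotomy w.2 z.2 with hl | hl | hl
  · exact hw1 hl hΓ
  · grind
  · have := (hw2 (by simpa using hl) (mem_image_of_mem _ hΓ)).flip
    rwa [flip_image_image, flip_flip] at this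

end DefectBord

namespace DefectBord

/-! ### Moving heights -/

/-- The order isomorphism of the line given by a piecewise linear map. -/
noncomputable def Interpolates.orderIso {n : ℕ} {f f' : ℕ → ℝ} (h : Interpolates n f f') :
    ℝ ≃o ℝ :=
  h.strictMono.orderIsoOfRightInverse _ (plMap n f' f) h.symm.plMap_plMap

theorem Interpolates.orderIso_apply {n : ℕ} {f f' : ℕ → ℝ} (h : Interpolates n f f') (x : ℝ) :
    h.orderIso x = plMap n f f' x := rfl

namespace Controls

variable {n : ℕ} {f f' : ℕ → ℝ → ℝ}

/-- The homeomorphism of the plane which preserves the first coordinate and moves the graphs of the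
functions `f k` of the first coordinate to the graphs of the functions `f' k`. -/
noncomputable def vhomeo (h : Controls n f f') : ℝ × ℝ ≃ₜ ℝ × ℝ :=
  ((Homeomorph.prodComm ℝ ℝ).trans h.homeo).trans (Homeomorph.prodComm ℝ ℝ)

theorem vhomeo_apply (h : Controls n f f') (z : ℝ × ℝ) :
    h.vhomeo z = (z.1, plMap n (fun k => f k z.1) (fun k => f' k z.1) z.2) := rfl

theorem vhomeo_eq_swap (h : Controls n f f') (z : ℝ × ℝ) :
    h.vhomeo z = (h.homeo z.swap).swap := rfl

theorem vhomeo_control (h : Controls n f f') {k : ℕ} (hk : k ≤ n) (x : ℝ) :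
    h.vhomeo (x, f k x) = (x, f' k x) := by
  change (h.homeo (f k x, x)).swap = _
  rw [h.homeo_control hk, Prod.swap_prod_mk]

theorem vhomeo_of_eq (h : Controls n f f') {z : ℝ × ℝ} (hz : ∀ k ≤ n, f k z.1 = f' k z.1) :
    h.vhomeo z = z := by
  rw [vhomeo_eq_swap, h.homeo_of_eq hz, Prod.swap_swap]

theorem vhomeo_of_le (h : Controls n f f') {z : ℝ × ℝ} (hz : z.2 ≤ f 0 z.1) : h.vhomeo z = z := by
  rw [vhomeo_eq_swap, h.homeo_of_le hz, Prod.swap_swap]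

theorem vhomeo_of_ge (h : Controls n f f') {z : ℝ × ℝ} (hz : f n z.1 ≤ z.2) : h.vhomeo z = z := by
  rw [vhomeo_eq_swap, h.homeo_of_ge hz, Prod.swap_swap]

end Controls

/-- A control family with constant outer controls and one control in between. -/
noncomputable def threeControls (a b : ℝ) (m : ℝ → ℝ) (k : ℕ) (x : ℝ) : ℝ :=
  if k = 0 then a else if k = 1 then m x else b

theorem controls_three {a b : ℝ} {m m' : ℝ → ℝ} (hm : Continuous m) (hm' : Continuous m')
    (h : ∀ x, m x ∈ Ioo a b) (h' : ∀ x, m' x ∈ Ioo a b) :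
    Controls 2 (threeControls a b m) (threeControls a b m') := by
  refine ⟨fun k => ?_, fun k => ?_, fun y => ⟨?_, ?_, ?_, rfl, rfl⟩⟩
  · unfold threeControls
    split_ifs <;> fun_prop
  · unfold threeControls
    split_ifs <;> fun_prop
  all_goals
    intro k hk
    have := h y
    have := h' y
    simp only [mem_Ioo] at *
    interval_cases k <;> simp [threeControls] <;> first | linarith | (constructor <;> intro <;> linarith)

theorem HasType.exists_box {Γ N : Set (ℝ × ℝ)} {p q : ℕ} {z : ℝ × ℝ} (h : HasType Γ p q z)
    (hN : N ∈ 𝓝 z) : ∃ r > 0, ∃ ε > 0, ∀ w : ℝ × ℝ, |w.1 - z.1| ≤ r → |w.2 - z.2| ≤ ε →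
      w ∈ N ∧ (w ∈ Γ → |w.1 - z.1| < r / 2) := by
  obtain ⟨g, h, c, c', e1, e2, m, m', H⟩ := h
  obtain ⟨r, hr, hb⟩ := Metric.nhds_basis_closedBall.mem_iff.1 (Filter.inter_mem hN H)
  have hg : ∀ᶠ y in 𝓝 z.2, ∀ k, |g k y - z.1| < r / 2 := by
    rw [Filter.eventually_all]
    intro k
    have : Continuous fun y => |g k y - z.1| := ((c k).sub continuous_const).abs
    exact (this.tendsto z.2).eventually (eventually_lt_nhds (by simp [e1, hr]))
  have hh : ∀ᶠ y in 𝓝 z.2, ∀ k, |h k y - z.1| < r / 2 := by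
    rw [Filter.eventually_all]
    intro k
    have : Continuous fun y => |h k y - z.1| := ((c' k).sub continuous_const).abs
    exact (this.tendsto z.2).eventually (eventually_lt_nhds (by simp [e2, hr]))
  obtain ⟨ε, hε, hb2⟩ := Metric.nhds_basis_closedBall.mem_iff.1 (hg.and hh)
  refine ⟨r, hr, min ε r, lt_min hε hr, fun w h1 h2 => ?_⟩
  have hw := @hb w (by
    rw [mem_closedBall, Prod.dist_eq, max_le_iff, Real.dist_eq, Real.dist_eq]
    exact ⟨h1, h2.trans (min_le_right _ _)⟩)
  have hy := @hb2 w.2 (by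
    rw [mem_closedBall, Real.dist_eq]
    exact h2.trans (min_le_left _ _))
  grind

/-- A point of a graph can be moved vertically, by a homeomorphism which is supported nearby and
preserves all types. -/
theorem HasType.exists_lift {Γ N : Set (ℝ × ℝ)} {p q : ℕ} {z : ℝ × ℝ} (h : HasType Γ p q z)
    (hN : N ∈ 𝓝 z) : ∃ ε > 0, ∀ t, |t| < ε → ∃ Φ : ℝ × ℝ ≃ₜ ℝ × ℝ,
      (∀ w ∉ N, ∀ᶠ v in 𝓝 w, Φ v = v) ∧ Φ z = (z.1, z.2 + t) ∧
      ∀ p q w, HasType Γ p q w → HasType (Φ '' Γ) p q (Φ w) := by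
  obtain ⟨r, hr, ε, hε, hb⟩ := h.exists_box hN
  refine ⟨ε, hε, fun t ht => ?_⟩
  set pl : ℝ → ℝ := fun x => max 0 (min 1 (2 - 2 * |x - z.1| / r)) with hpl
  have pl0 : ∀ x, 0 ≤ pl x := fun x => le_max_left _ _
  have pl1 : ∀ x, pl x ≤ 1 := fun x => max_le zero_le_one (min_le_left _ _)
  have plin : ∀ x, |x - z.1| ≤ r / 2 → pl x = 1 := by
    intro x hx
    have : 2 * |x - z.1| / r ≤ 1 := by rw [div_le_one hr]; linarith
    grind
  have plout : ∀ x, r ≤ |x - z.1| → pl x = 0 := by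
    intro x hx
    have : 2 ≤ 2 * |x - z.1| / r := by rw [le_div_iff₀ hr]; linarith
    grind
  have hC := controls_three (a := z.2 - ε) (b := z.2 + ε) (m := fun _ => z.2)
    (m' := fun x => z.2 + t * pl x) (by fun_prop) (by simp only [hpl]; fun_prop)
    (fun x => ⟨by simpa using hε, by simpa using hε⟩) (fun x => by
      have := abs_lt.1 ht
      constructor <;> nlinarith [pl0 x, pl1 x])
  have hid : ∀ w : ℝ × ℝ, (r ≤ |w.1 - z.1| ∨ ε ≤ |w.2 - z.2|) → hC.vhomeo w = w := by
    rintro w (hw | hw)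
    · refine hC.vhomeo_of_eq fun k _ => ?_
      simp [threeControls, plout _ hw]
    · rcases le_abs.1 hw with hw | hw
      · refine hC.vhomeo_of_ge ?_
        simp [threeControls]; linarith
      · refine hC.vhomeo_of_le ?_
        simp [threeControls]; linarith
  have hev : ∀ w : ℝ × ℝ, (r < |w.1 - z.1| ∨ ε < |w.2 - z.2|) → ∀ᶠ v in 𝓝 w, hC.vhomeo v = v := by
    rintro w (hw | hw)
    · have : Continuous fun v : ℝ × ℝ => |v.1 - z.1| := by fun_prop
      filter_upwards [(this.tendsto w).eventually (eventually_gt_nhds hw)] with v hv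
      grind
    · have : Continuous fun v : ℝ × ℝ => |v.2 - z.2| := by fun_prop
      filter_upwards [(this.tendsto w).eventually (eventually_gt_nhds hw)] with v hv
      grind
  refine ⟨hC.vhomeo, fun w hw => hev w ?_, ?_, fun p q w hw => ?_⟩
  · grind
  · have := hC.vhomeo_control (k := 1) (by norm_num) z.1
    simpa [threeControls, plin z.1 (by rw [sub_self, abs_zero]; linarith)] using this
  · by_cases hin : |w.1 - z.1| < r / 2
    · have hi := hC.interp z.1
      refine hw.vertical hi.orderIso ?_
      have : Continuous fun v : ℝ × ℝ => |v.1 - z.1| := by fun_prop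
      filter_upwards [(this.tendsto w).eventually (eventually_lt_nhds hin)] with v hv
      rw [hC.vhomeo_apply, hi.orderIso_apply]
      simp only [threeControls, plin v.1 (le_of_lt hv), plin z.1 (by rw [sub_self, abs_zero]; linarith)]
    · refine hw.of_eq_near (hev w ?_)
      by_contra! hc
      exact hin ((hb w hc.1 hc.2).2 hw.mem)

end DefectBord

namespace DefectBord

/-! ### Bending an upper strand of a vertex down -/

/-- The highest upper strand is linear and to the right of the point, and all other strands are on
the left side. -/
def BendReady (Γ : Set (ℝ × ℝ)) (p q : ℕ) (z : ℝ × ℝ) : Prop :=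
  ∃ (g : Fin p → ℝ → ℝ) (h : Fin q → ℝ → ℝ), (∀ k, Continuous (g k)) ∧ (∀ k, Continuous (h k)) ∧
    (∀ k, g k z.2 = z.1) ∧ (∀ k, h k z.2 = z.1) ∧
    (∀ᶠ y in 𝓝[<] z.2, (StrictMono fun k => g k y) ∧ ∀ k, g k y ≤ z.1) ∧
    (∀ᶠ y in 𝓝[>] z.2, (StrictMono fun k => h k y) ∧ ∀ k, h k y ≤ z.1) ∧
    ∀ᶠ w in 𝓝 z, (w ∈ Γ ↔ w = z ∨ (w.2 < z.2 ∧ ∃ k, w.1 = g k w.2) ∨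
      (z.2 < w.2 ∧ ((∃ k, w.1 = h k w.2) ∨ w.1 = z.1 + 4 * (w.2 - z.2))))

theorem exists_sup_lower {p : ℕ} {g : Fin p → ℝ → ℝ} {c x₀ : ℝ} (hg : ∀ k, Continuous (g k))
    (hc : ∀ k, g k c = x₀) (hm : ∀ᶠ y in 𝓝[<] c, StrictMono fun k => g k y) :
    ∃ s : ℝ → ℝ, Continuous s ∧ s c = x₀ ∧ ∀ᶠ y in 𝓝[<] c, ∀ k, g k y ≤ s y := by
  cases p with
  | zero => exact ⟨fun _ => x₀, continuous_const, rfl, Filter.Eventually.of_forall fun _ k => k.elim0⟩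
  | succ p =>
    exact ⟨g (Fin.last p), hg _, hc _, hm.mono fun y hy k => hy.monotone (Fin.le_last k)⟩

theorem exists_sup_upper {q : ℕ} {h : Fin (q + 1) → ℝ → ℝ} {c x₀ : ℝ} (hh : ∀ k, Continuous (h k))
    (hc : ∀ k, h k c = x₀) (hm : ∀ᶠ y in 𝓝[>] c, StrictMono fun k => h k y) :
    ∃ s : ℝ → ℝ, Continuous s ∧ s c = x₀ ∧
      ∀ᶠ y in 𝓝[>] c, (∀ k : Fin q, h k.castSucc y ≤ s y) ∧ s y < h (Fin.last q) y := by
  cases q with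
  | zero =>
    refine ⟨fun y => h (Fin.last 0) y - (y - c), (hh _).sub (continuous_id.sub continuous_const),
      by simp [hc], ?_⟩
    filter_upwards [self_mem_nhdsWithin] with y hy
    exact ⟨fun k => k.elim0, by simp only [mem_Ioi] at hy; linarith⟩
  | succ q =>
    refine ⟨h (Fin.last q).castSucc, hh _, hc _, hm.mono fun y hy => ⟨fun k => ?_, ?_⟩⟩
    · exact hy.monotone (Fin.castSucc_le_castSucc_iff.2 (Fin.le_last k))
    · exact hy (Fin.castSucc_lt_last _)

theorem HasType.exists_bendReady {Γ N : Set (ℝ × ℝ)} {p q : ℕ} {z : ℝ × ℝ}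
    (h : HasType Γ p (q + 1) z) (hN : N ∈ 𝓝 z) : ∃ Φ : ℝ × ℝ ≃ₜ ℝ × ℝ, IsLevel Φ ∧
      (∀ w ∉ N, ∀ᶠ v in 𝓝 w, Φ v = v) ∧ Φ z = z ∧ BendReady (Φ '' Γ) p q z := by
  obtain ⟨g, h, c, c', e1, e2, m, m', H⟩ := h
  obtain ⟨sl, csl, sl0, hsl⟩ := exists_sup_lower c e1 m
  obtain ⟨su, csu, su0, hsu⟩ := exists_sup_upper c' e2 m'
  set s : ℝ → ℝ := fun y => if y ≤ z.2 then sl y else su y with hs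
  set f : ℝ → ℝ := fun y => if y ≤ z.2 then s y + (z.2 - y) else h (Fin.last q) y with hf
  have cs : Continuous s := Continuous.if_le csl csu continuous_id continuous_const
    (fun y hy => by rw [hy, sl0, su0])
  have cf : Continuous f := Continuous.if_le (cs.add (continuous_const.sub continuous_id)) (c' _)
    continuous_id continuous_const (fun y hy => by simp [hy, hs, sl0, e2])
  have s0 : s z.2 = z.1 := by simp [hs, sl0]
  have f0 : f z.2 = z.1 := by simp [hf, s0]
  obtain ⟨r, hr, hbN⟩ := Metric.nhds_basis_closedBall.mem_iff.1 hN
  have hsf : ∀ᶠ y in 𝓝 z.2, y ≠ z.2 → s y < f y := by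
    have := eventually_nhdsWithin_iff.1 hsu
    filter_upwards [this] with y hy hne
    grind
  have hsr : ∀ᶠ y in 𝓝 z.2, z.1 - r < s y :=
    (cs.tendsto _).eventually (eventually_gt_nhds (by linarith))
  have hfr : ∀ᶠ y in 𝓝 z.2, f y < z.1 + r :=
    (cf.tendsto _).eventually (eventually_lt_nhds (by linarith))
  obtain ⟨ε', hε', hb⟩ := Metric.nhds_basis_closedBall.mem_iff.1 (hsf.and (hsr.and hfr))
  obtain ⟨ε, hε, hεε', hεr⟩ : ∃ ε > 0, ε ≤ ε' ∧ 8 * ε ≤ r :=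
    ⟨min ε' (r / 8), lt_min hε' (by linarith), min_le_left _ _,
      by linarith [min_le_right ε' (r / 8)]⟩
  set cl : ℝ → ℝ := fun y => max (z.2 - ε) (min (z.2 + ε) y) with hcl
  have ccl : Continuous cl := by simp only [hcl]; fun_prop
  have cl_mem : ∀ y, |cl y - z.2| ≤ ε := by
    grind
  have cl_eq : ∀ y, |y - z.2| ≤ ε → cl y = y := by
    grind
  have cl_iff : ∀ y, cl y = z.2 → y = z.2 := by
    grind
  set θ : ℝ → ℝ := fun y => max 0 (min 1 (2 - 2 * |y - z.2| / ε)) with hθ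
  have cθ : Continuous θ := by simp only [hθ]; fun_prop
  have θ0 : ∀ x, 0 ≤ θ x := fun x => le_max_left _ _
  have θ1 : ∀ x, θ x ≤ 1 := fun x => max_le zero_le_one (min_le_left _ _)
  have θin : ∀ x, |x - z.2| ≤ ε / 2 → θ x = 1 := by
    intro x hx
    have : 2 * |x - z.2| / ε ≤ 1 := by rw [div_le_one hε]; linarith
    grind
  have θout : ∀ x, ε ≤ |x - z.2| → θ x = 0 := by
    intro x hx
    have : 2 ≤ 2 * |x - z.2| / ε := by rw [le_div_iff₀ hε]; linarith
    grind
  have hprop : ∀ y, (y ≠ z.2 → s (cl y) < f (cl y)) ∧ s (cl y) ≤ f (cl y) ∧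
      z.1 - r < s (cl y) ∧ f (cl y) < z.1 + r := by
    intro y
    have := @hb (cl y) (by rw [mem_closedBall, Real.dist_eq]; exact (cl_mem y).trans hεε')
    grind
  set F : ℕ → ℝ → ℝ := fun k y => if k = 0 then z.1 - r else if k = 1 then s (cl y) else
    if k = 2 then f (cl y) else z.1 + r with hF
  set F' : ℕ → ℝ → ℝ := fun k y => if k = 0 then z.1 - r else
    if k = 1 then θ y * z.1 + (1 - θ y) * s (cl y) else
    if k = 2 then θ y * (z.1 + 4 * |cl y - z.2|) + (1 - θ y) * f (cl y) else z.1 + r with hF'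
  have hC : Controls 3 F F' := by
    refine ⟨fun k => ?_, fun k => ?_, fun y => ⟨?_, ?_, ?_, rfl, rfl⟩⟩
    · simp only [hF]; split_ifs <;> fun_prop
    · simp only [hF']; split_ifs <;> fun_prop
    all_goals
      intro k hk
      obtain ⟨p0, p1, p2, p3⟩ := hprop y
      have t0 := θ0 y
      have t1 := θ1 y
      have a0 := abs_nonneg (cl y - z.2)
      have a1 := cl_mem y
    · grind
    · interval_cases k <;> simp [hF'] <;> nlinarith
    · interval_cases k
      · simp only [hF, hF', zero_add, if_true, if_false, one_ne_zero]
        constructor <;> intro <;> nlinarith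
      · simp only [hF, hF', one_ne_zero, if_true, if_false, show (1 + 1 : ℕ) = 2 from rfl,
          show (2 : ℕ) ≠ 0 by norm_num, show (2 : ℕ) ≠ 1 by norm_num]
        rcases eq_or_ne y z.2 with rfl | hy
        · grind
        · have h1 := p0 hy
          have h2 : 0 < |cl y - z.2| := abs_pos.2 (sub_ne_zero.2 fun e => hy (cl_iff y e))
          constructor
          · intro e; linarith
          · intro e
            rcases t0.eq_or_lt with t | t <;> nlinarith
      · simp [hF, hF']
        constructor <;> intro <;> nlinarith
  have hid : ∀ w : ℝ × ℝ, (r ≤ |w.1 - z.1| ∨ ε ≤ |w.2 - z.2|) → hC.homeo w = w := by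
    rintro w (hw | hw)
    · rcases le_abs.1 hw with hw | hw
      · refine hC.homeo_of_ge ?_
        simp [hF]; linarith
      · refine hC.homeo_of_le ?_
        simp [hF]; linarith
    · refine hC.homeo_of_eq fun k _ => ?_
      grind
  have hz : hC.homeo z = z := by
    have := hC.homeo_control (k := 1) (by norm_num) z.2
    grind
  have hsmall : ∀ᶠ y in 𝓝 z.2, |y - z.2| < ε / 2 := by
    have : Continuous fun y : ℝ => |y - z.2| := by fun_prop
    exact (this.tendsto _).eventually (eventually_lt_nhds (by rw [sub_self, abs_zero]; linarith))
  have ctl1 : ∀ y, |y - z.2| < ε / 2 → hC.homeo (s y, y) = (z.1, y) := by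
    intro y hy
    have := hC.homeo_control (k := 1) (by norm_num) y
    have e : cl y = y := cl_eq _ (by linarith)
    have e1 : F 1 y = s y := by simp [hF, e]
    grind
  have ctl2 : ∀ y, |y - z.2| < ε / 2 → z.2 < y →
      hC.homeo (h (Fin.last q) y, y) = (z.1 + 4 * (y - z.2), y) := by
    intro y hy hlt
    have := hC.homeo_control (k := 2) (by norm_num) y
    have e : cl y = y := cl_eq _ (by linarith)
    have e1 : F 2 y = h (Fin.last q) y := by simp [hF, e, hf, hlt.not_ge]
    have e2 : F' 2 y = z.1 + 4 * (y - z.2) := by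
      simp [hF', θin y hy.le, e, abs_of_pos (sub_pos.2 hlt)]
    rwa [e1, e2] at this
  have hL := hC.isLevel
  refine ⟨hC.homeo, hL, fun w hw => ?_, hz, ?_⟩
  · by_cases h1 : r < |w.1 - z.1|
    · have : Continuous fun v : ℝ × ℝ => |v.1 - z.1| := by fun_prop
      filter_upwards [(this.tendsto w).eventually (eventually_gt_nhds h1)] with v hv
      grind
    by_cases h2 : ε < |w.2 - z.2|
    · have : Continuous fun v : ℝ × ℝ => |v.2 - z.2| := by fun_prop
      filter_upwards [(this.tendsto w).eventually (eventually_gt_nhds h2)] with v hv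
      grind
    refine absurd (hbN ?_) hw
    rw [mem_closedBall, Prod.dist_eq, max_le_iff, Real.dist_eq, Real.dist_eq]
    grind
  · refine ⟨fun k y => (hC.homeo (g k y, y)).1, fun k y => (hC.homeo (h k.castSucc y, y)).1,
      fun k => (hC.homeo.continuous.comp ((c k).prodMk continuous_id)).fst,
      fun k => (hC.homeo.continuous.comp ((c' k.castSucc).prodMk continuous_id)).fst,
      fun k => by simp only [e1]; exact congrArg Prod.fst hz,
      fun k => by simp only [e2]; exact congrArg Prod.fst hz, ?_, ?_, ?_⟩
    · filter_upwards [m, hsl, nhdsWithin_le_nhds hsmall, self_mem_nhdsWithin] with y h1 h2 h3 h4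
      refine ⟨fun k l hkl => hL.mono y (h1 hkl), fun k => ?_⟩
      have := (hL.mono y).monotone (h2 k)
      grind
    · filter_upwards [m', hsu, nhdsWithin_le_nhds hsmall, self_mem_nhdsWithin] with y h1 h2 h3 h4
      refine ⟨fun k l hkl => hL.mono y (h1 (Fin.castSucc_lt_castSucc_iff.2 hkl)), fun k => ?_⟩
      have := (hL.mono y).monotone (h2.1 k)
      grind
    · have hsm : ∀ᶠ w : ℝ × ℝ in 𝓝 z, |w.2 - z.2| < ε / 2 :=
        (continuous_snd.tendsto z).eventually hsmall
      have H' := eventually_mem_image hC.homeo H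
      rw [hz] at H'
      filter_upwards [H', hsm] with w hw hw2
      rw [mem_image_homeo, hw, hL.symm_snd]
      simp only [hL.fst_symm_eq_iff]
      have e3 : hC.homeo.symm w = z ↔ w = z := by rw [Homeomorph.symm_apply_eq, hz]
      rw [e3, Fin.exists_fin_succ']
      refine or_congr_right (or_congr_right (and_congr_right fun hlt => or_congr_right ?_))
      rw [ctl2 w.2 hw2 hlt]

end DefectBord

namespace DefectBord

theorem BendReady.exists_box {Γ N : Set (ℝ × ℝ)} {p q : ℕ} {z : ℝ × ℝ} (h : BendReady Γ p q z)
    (hN : N ∈ 𝓝 z) : ∃ ε > 0, ∀ w : ℝ × ℝ, |w.1 - z.1| ≤ 2 * ε → |w.2 - z.2| ≤ ε →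
      w ∈ N ∧ (w ∈ Γ → w.2 = z.2 → w = z) ∧
      (z.1 < w.1 → (w ∈ Γ ↔ w.2 = z.2 + (w.1 - z.1) / 4)) := by
  obtain ⟨g, h, -, -, -, -, m, m', H⟩ := h
  have hm : ∀ᶠ w : ℝ × ℝ in 𝓝 z, w.2 < z.2 → ∀ k, g k w.2 ≤ z.1 :=
    ((continuous_snd.tendsto z).eventually (eventually_nhdsWithin_iff.1 m)).mono
      fun w hw hlt => (hw hlt).2
  have hm' : ∀ᶠ w : ℝ × ℝ in 𝓝 z, z.2 < w.2 → ∀ k, h k w.2 ≤ z.1 :=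
    ((continuous_snd.tendsto z).eventually (eventually_nhdsWithin_iff.1 m')).mono
      fun w hw hlt => (hw hlt).2
  obtain ⟨r, hr, hb⟩ := Metric.nhds_basis_closedBall.mem_iff.1
    (Filter.inter_mem hN (H.and (hm.and hm')))
  refine ⟨r / 2, by linarith, fun w h1 h2 => ?_⟩
  obtain ⟨a, b, c, d⟩ := @hb w (by
    rw [mem_closedBall, Prod.dist_eq, max_le_iff, Real.dist_eq, Real.dist_eq]
    constructor <;> linarith)
  grind

/-- The shape of a strand after it has been bent down; its argument is the horizontal distance. -/
noncomputable def bentStrand (ε u : ℝ) : ℝ :=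
  if u ≤ ε / 2 then -u / 4 else min (3 * u / 4 - ε / 2) (u / 4)

theorem BendReady.exists_bend {Γ N : Set (ℝ × ℝ)} {p q : ℕ} {z : ℝ × ℝ} (hB : BendReady Γ p q z)
    (hN : N ∈ 𝓝 z) : ∃ Φ : ℝ × ℝ ≃ₜ ℝ × ℝ, (∀ w ∉ N, ∀ᶠ v in 𝓝 w, Φ v = v) ∧ Φ z = z ∧
      HasType (Φ '' Γ) (p + 1) q z ∧
      ∀ w ∈ Γ, w ≠ z → ((∃ a b, a + b = 2 ∧ HasType Γ a b w) →
        ∃ a b, a + b = 2 ∧ HasType (Φ '' Γ) a b (Φ w)) := by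
  obtain ⟨ε, hε, hb⟩ := hB.exists_box hN
  set û : ℝ → ℝ := fun x => max 0 (min ε (x - z.1)) with hû
  have û0 : ∀ x, 0 ≤ û x := fun x => le_max_left _ _
  have û1 : ∀ x, û x ≤ ε := fun x => max_le hε.le (min_le_left _ _)
  have ûeq : ∀ x, z.1 ≤ x → x ≤ z.1 + ε → û x = x - z.1 := by
    grind
  set M : ℝ → ℝ := fun x => z.2 + û x / 4 with hM
  set M' : ℝ → ℝ := fun x => z.2 + max (-û x / 4) (3 * û x / 4 - ε / 2) with hM'
  have cM : Continuous M := by simp only [hM, hû]; fun_prop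
  have cM' : Continuous M' := by simp only [hM', hû]; fun_prop
  have bM : ∀ x, M x ∈ Ioo (z.2 - ε) (z.2 + ε) := fun x => by
    grind
  have bM' : ∀ x, M' x ∈ Ioo (z.2 - ε) (z.2 + ε) := fun x => by
    grind
  have hC := controls_three cM cM' bM bM'
  have hMM : ∀ x, (x ≤ z.1 ∨ z.1 + ε ≤ x) → M x = M' x := by
    grind
  set Φ := hC.vhomeo with hΦ
  have hid1 : ∀ w : ℝ × ℝ, (w.1 ≤ z.1 ∨ z.1 + ε ≤ w.1) → Φ w = w := fun w hw => by
    refine hC.vhomeo_of_eq fun k _ => ?_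
    simp [threeControls, hMM _ hw]
  have hid2 : ∀ w : ℝ × ℝ, ε ≤ |w.2 - z.2| → Φ w = w := by
    intro w hw
    rcases le_abs.1 hw with hw | hw
    · refine hC.vhomeo_of_ge ?_
      simp [threeControls]; linarith
    · refine hC.vhomeo_of_le ?_
      simp [threeControls]; linarith
  have hfst : ∀ w, (Φ w).1 = w.1 := fun w => rfl
  have hfst' : ∀ w, (Φ.symm w).1 = w.1 := fun w => by rw [← hfst (Φ.symm w), Φ.apply_symm_apply]
  have hctl : ∀ x, Φ (x, M x) = (x, M' x) := fun x => by
    have := hC.vhomeo_control (k := 1) (by norm_num) x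
    simpa [threeControls] using this
  have hmem : ∀ w, Φ w = w → (w ∈ Φ '' Γ ↔ w ∈ Γ) := by
    intro w hw
    rw [mem_image_homeo, Φ.symm_apply_eq.2 hw.symm]
  -- the image in the box, to the right of the point
  have himg : ∀ w : ℝ × ℝ, z.1 < w.1 → w.1 ≤ z.1 + 2 * ε → |w.2 - z.2| < ε →
      (w ∈ Φ '' Γ ↔ w.2 = z.2 + bentStrand ε (w.1 - z.1)) := by
    intro w h1 h2 h3
    rcases le_or_gt w.1 (z.1 + ε) with h4 | h4
    · have hin : |(Φ.symm w).2 - z.2| ≤ ε := by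
        by_contra! hc
        have := hid2 _ hc.le
        rw [Φ.apply_symm_apply] at this
        grind
      rw [mem_image_homeo, (hb (Φ.symm w) (by rw [hfst', abs_le]; constructor <;> linarith) hin).2.2
        (by rwa [hfst']), hfst']
      have e1 : M w.1 = z.2 + (w.1 - z.1) / 4 := by simp only [hM]; rw [ûeq _ h1.le h4]
      have e2 : M' w.1 = z.2 + bentStrand ε (w.1 - z.1) := by
        simp only [hM', bentStrand]
        rw [ûeq _ h1.le h4]
        split_ifs with h
        · rw [max_eq_left (by linarith)]
        · rw [max_eq_right (by linarith), min_eq_left (by linarith)]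
      rw [← e1, ← e2]
      constructor
      · intro e
        have : Φ.symm w = (w.1, M w.1) := Prod.ext (hfst' w) e
        rw [Φ.symm_apply_eq, hctl] at this
        rw [this]
      · intro e
        have : w = Φ (w.1, M w.1) := by rw [hctl]; exact Prod.ext rfl e
        rw [this, Φ.symm_apply_apply, hfst]
    · rw [hmem w (hid1 w (Or.inr h4.le)),
        (hb w (by rw [abs_le]; constructor <;> linarith) h3.le).2.2 h1, bentStrand,
        if_neg (by linarith), min_eq_right (by linarith)]
  have hidn : ∀ w : ℝ × ℝ, (w.1 < z.1 ∨ z.1 + ε < w.1 ∨ ε < |w.2 - z.2|) →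
      ∀ᶠ v in 𝓝 w, Φ v = v := by
    rintro w (hw | hw | hw)
    · filter_upwards [(continuous_fst.tendsto w).eventually (eventually_lt_nhds hw)] with v hv
      grind
    · filter_upwards [(continuous_fst.tendsto w).eventually (eventually_gt_nhds hw)] with v hv
      grind
    · have : Continuous fun v : ℝ × ℝ => |v.2 - z.2| := by fun_prop
      filter_upwards [(this.tendsto w).eventually (eventually_gt_nhds hw)] with v hv
      grind
  have hz : Φ z = z := hid1 z (Or.inl le_rfl)
  refine ⟨Φ, fun w hw => hidn w ?_, hz, ?_, fun w hΓ hne ⟨a, b, hab, ht⟩ => ?_⟩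
  · by_contra! hc
    exact hw (hb w (by rw [abs_le]; constructor <;> linarith) hc.2.2).1
  · obtain ⟨g, h, c, c', e1, e2, m, m', H⟩ := hB
    refine ⟨Fin.snoc g (fun y => z.1 - 4 * (y - z.2)), h, fun k => ?_, c', fun k => ?_, e2, ?_,
      m'.mono fun y hy => hy.1, ?_⟩
    · refine Fin.lastCases ?_ (fun i => ?_) k
      · rw [Fin.snoc_last]; fun_prop
      · rw [Fin.snoc_castSucc]; exact c i
    · refine Fin.lastCases ?_ (fun i => ?_) k
      · rw [Fin.snoc_last]; ring
      · rw [Fin.snoc_castSucc]; exact e1 i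
    · filter_upwards [m, self_mem_nhdsWithin] with y hy hlt k l
      simp only [mem_Iio] at hlt
      refine Fin.lastCases (fun hkl => ?_) (fun l hkl => ?_) l
      · obtain ⟨k, rfl⟩ := Fin.exists_castSucc_eq.2 hkl.ne
        simp only [Fin.snoc_last, Fin.snoc_castSucc]
        grind
      · obtain ⟨k, rfl⟩ := Fin.exists_castSucc_eq.2 (hkl.trans (Fin.castSucc_lt_last _)).ne
        simp only [Fin.snoc_castSucc]
        exact hy.1 (Fin.castSucc_lt_castSucc_iff.1 hkl)
    · have hm : ∀ᶠ w : ℝ × ℝ in 𝓝 z, w.2 < z.2 → ∀ k, g k w.2 ≤ z.1 :=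
        ((continuous_snd.tendsto z).eventually (eventually_nhdsWithin_iff.1 m)).mono
          fun w hw hlt => (hw hlt).2
      have hm' : ∀ᶠ w : ℝ × ℝ in 𝓝 z, z.2 < w.2 → ∀ k, h k w.2 ≤ z.1 :=
        ((continuous_snd.tendsto z).eventually (eventually_nhdsWithin_iff.1 m')).mono
          fun w hw hlt => (hw hlt).2
      have hs1 : ∀ᶠ w : ℝ × ℝ in 𝓝 z, w.1 < z.1 + ε / 2 :=
        (continuous_fst.tendsto z).eventually (eventually_lt_nhds (by linarith))
      have hs2 : ∀ᶠ w : ℝ × ℝ in 𝓝 z, |w.2 - z.2| < ε := by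
        have : Continuous fun v : ℝ × ℝ => |v.2 - z.2| := by fun_prop
        exact (this.tendsto z).eventually (eventually_lt_nhds (by rw [sub_self, abs_zero]; exact hε))
      filter_upwards [H, hm, hm', hs1, hs2] with w H hm hm' hs1 hs2
      rw [Fin.exists_fin_succ']
      simp only [Fin.snoc_last, Fin.snoc_castSucc]
      rcases le_or_gt w.1 z.1 with hl | hl
      · rw [hmem w (hid1 w (Or.inl hl)), H]
        refine or_congr_right (or_congr (and_congr_right fun hlt => ?_)
          (and_congr_right fun hlt => ?_))
        · rw [or_iff_left]; intro e; linarith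
        · rw [or_iff_left]; intro e; linarith
      · rw [himg w hl (by linarith) hs2, bentStrand, if_pos (by linarith)]
        constructor
        · grind
        · rintro (rfl | ⟨h, ⟨k, hk⟩ | hk⟩ | ⟨h, k, hk⟩)
          · grind
          · grind
          all_goals grind
  · by_cases hout : w.1 < z.1 ∨ z.1 + ε < w.1 ∨ ε < |w.2 - z.2|
    · exact ⟨a, b, hab, ht.of_eq_near (hidn w hout)⟩
    push Not at hout
    obtain ⟨h1, h2, h3⟩ := hout
    have hbw := hb w (by rw [abs_le]; constructor <;> linarith) h3
    rcases h1.eq_or_lt with h1 | h1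
    · -- on the vertical line through the point nothing changes
      have hw2 : w.2 ≠ z.2 := fun e => hne (hbw.2.1 hΓ e)
      rw [hid1 w (Or.inl h1.ge)]
      refine ⟨a, b, hab, ht.congr ?_⟩
      have hs1 : ∀ᶠ v : ℝ × ℝ in 𝓝 w, v.1 < z.1 + ε / 2 :=
        (continuous_fst.tendsto w).eventually (eventually_lt_nhds (by linarith))
      have hs2 : ∀ᶠ v : ℝ × ℝ in 𝓝 w, |v.1 - z.1| < |v.2 - z.2| := by
        refine (isOpen_lt (by fun_prop) (by fun_prop)).mem_nhds ?_
        rw [mem_ofPred_eq, ← h1, sub_self, abs_zero]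
        exact abs_pos.2 (sub_ne_zero.2 hw2)
      filter_upwards [hs1, hs2] with v hv1 hv2
      rcases le_or_gt v.1 z.1 with hl | hl
      · rw [hmem v (hid1 v (Or.inl hl))]
      rcases le_or_gt ε |v.2 - z.2| with hl2 | hl2
      · rw [hmem v (hid2 v hl2)]
      · rw [himg v hl (by linarith) hl2, bentStrand, if_pos (by linarith),
          (hb v (by rw [abs_le]; constructor <;> linarith) hl2.le).2.2 hl]
        rw [abs_of_pos (sub_pos.2 hl), lt_abs] at hv2
        constructor <;> intro e <;> rcases hv2 with h | h <;> linarith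
    · have hw : w.2 = z.2 + (w.1 - z.1) / 4 := (hbw.2.2 h1).1 hΓ
      have hM1 : w = (w.1, M w.1) := by
        grind
      have hv1 : (Φ w).1 = w.1 := rfl
      have hv2 : |(Φ w).2 - z.2| < ε := by
        rw [hM1, hctl, abs_lt]
        grind
      have hv3 : (Φ w).2 = z.2 + bentStrand ε (w.1 - z.1) := by
        have := (himg (Φ w) (by rwa [hv1]) (by rw [hv1]; linarith) hv2).1 (mem_image_of_mem _ hΓ)
        rwa [hv1] at this
      generalize Φ w = v at hv1 hv2 hv3 ⊢
      rw [← hv1] at hv3 h1 h2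
      have hs : ∀ᶠ v' : ℝ × ℝ in 𝓝 v, (v' ∈ Φ '' Γ ↔ v'.2 = z.2 + bentStrand ε (v'.1 - z.1)) := by
        have hs1 : ∀ᶠ v' : ℝ × ℝ in 𝓝 v, v'.1 < z.1 + 2 * ε :=
          (continuous_fst.tendsto v).eventually (eventually_lt_nhds (by linarith))
        have hs2 : ∀ᶠ v' : ℝ × ℝ in 𝓝 v, z.1 < v'.1 :=
          (continuous_fst.tendsto v).eventually (eventually_gt_nhds h1)
        have hs3 : ∀ᶠ v' : ℝ × ℝ in 𝓝 v, |v'.2 - z.2| < ε := by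
          have : Continuous fun v : ℝ × ℝ => |v.2 - z.2| := by fun_prop
          exact (this.tendsto v).eventually (eventually_lt_nhds hv2)
        filter_upwards [hs1, hs2, hs3] with v' g1 g2 g3
        exact himg v' g2 g1.le g3
      rcases lt_trichotomy (v.1 - z.1) (ε / 2) with hu | hu | hu
      · refine ⟨1, 1, rfl, hasType_one_one (f := fun y => z.1 - 4 * (y - z.2)) (by fun_prop) ?_ ?_⟩
        · rw [hv3, bentStrand, if_pos hu.le]; ring
        · have hs1 : ∀ᶠ v' : ℝ × ℝ in 𝓝 v, v'.1 < z.1 + ε / 2 :=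
            (continuous_fst.tendsto v).eventually (eventually_lt_nhds (by linarith))
          filter_upwards [hs, hs1] with v' g1 g2
          rw [g1, bentStrand, if_pos (by linarith)]
          constructor <;> intro <;> linarith
      · refine ⟨0, 2, rfl, fun k => k.elim0,
          ![fun y => z.1 - 4 * (y - z.2), fun y => z.1 + (y - z.2 + ε / 2) * (4 / 3)],
          fun k => k.elim0, fun k => ?_, fun k => k.elim0, fun k => ?_,
          Filter.Eventually.of_forall fun y k => k.elim0, ?_, ?_⟩
        · fin_cases k <;> simp <;> fun_prop
        · rw [bentStrand, if_pos hu.le] at hv3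
          fin_cases k <;> simp <;> linarith
        · filter_upwards [self_mem_nhdsWithin] with y hy k l hkl
          rw [bentStrand, if_pos hu.le] at hv3
          simp only [mem_Ioi] at hy
          fin_cases k <;> fin_cases l <;> simp at hkl ⊢
          linarith
        · rw [bentStrand, if_pos hu.le] at hv3
          have hs1 : ∀ᶠ v' : ℝ × ℝ in 𝓝 v, v'.1 < z.1 + ε :=
            (continuous_fst.tendsto v).eventually (eventually_lt_nhds (by linarith))
          have e : v = (z.1 + ε / 2, z.2 - ε / 8) := Prod.ext (by linarith) (by rw [hv3, hu]; ring)
          filter_upwards [hs, hs1] with v' g1 g2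
          rw [g1, e]
          simp only [IsEmpty.exists_iff, and_false, false_or, Fin.exists_fin_two,
            Matrix.cons_val_zero, Matrix.cons_val_one, Prod.ext_iff]
          rw [bentStrand]
          split_ifs with hh
          · constructor
            · intro e'
              rcases hh.eq_or_lt with h | h
              all_goals grind
            · rintro (⟨h, h'⟩ | ⟨h, h' | h'⟩) <;> linarith
          · rw [min_eq_left (by linarith)]
            constructor
            · intro e'
              right; exact ⟨by linarith, Or.inr (by linarith)⟩
            · rintro (⟨h, h'⟩ | ⟨h, h' | h'⟩) <;> linarith
      · have key : ∀ x y : ℝ, ε / 2 < x - z.1 → (y = z.2 + bentStrand ε (x - z.1) ↔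
            x = max (z.1 + (y - z.2 + ε / 2) * (4 / 3)) (z.1 + 4 * (y - z.2))) := by
          intro x y hx
          rw [bentStrand, if_neg hx.not_ge]
          rcases max_cases (z.1 + (y - z.2 + ε / 2) * (4 / 3)) (z.1 + 4 * (y - z.2)) with
            ⟨h, h'⟩ | ⟨h, h'⟩ <;>
          rcases min_cases (3 * (x - z.1) / 4 - ε / 2) ((x - z.1) / 4) with
            ⟨k, k'⟩ | ⟨k, k'⟩ <;> rw [h, k] <;> constructor <;> intro <;> linarith
        refine ⟨1, 1, rfl, hasType_one_one
          (f := fun y => max (z.1 + (y - z.2 + ε / 2) * (4 / 3)) (z.1 + 4 * (y - z.2)))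
          (by fun_prop) ((key _ _ hu).1 hv3).symm ?_⟩
        have hs1 : ∀ᶠ v' : ℝ × ℝ in 𝓝 v, z.1 + ε / 2 < v'.1 :=
          (continuous_fst.tendsto v).eventually (eventually_gt_nhds (by linarith))
        filter_upwards [hs, hs1] with v' g1 g2
        grind

end DefectBord

namespace DefectBord

/-! ### Planar graphs in general position -/

/-- The open rectangle in which planar graphs are drawn. -/
def region : Set (ℝ × ℝ) := Ioo 0 1 ×ˢ Ioo (-4 / 5) (4 / 5)

theorem isOpen_region : IsOpen region := isOpen_Ioo.prod isOpen_Ioo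

/-- Homeomorphisms of the plane which are supported in the rectangle. -/
def Supported (Φ : ℝ × ℝ ≃ₜ ℝ × ℝ) : Prop := ∀ z ∉ region, Φ z = z

theorem Supported.trans {Φ Ψ : ℝ × ℝ ≃ₜ ℝ × ℝ} (h : Supported Φ) (h' : Supported Ψ) :
    Supported (Φ.trans Ψ) := fun z hz => by simp [h z hz, h' z hz]

theorem Supported.mem {Φ : ℝ × ℝ ≃ₜ ℝ × ℝ} (h : Supported Φ) {z : ℝ × ℝ} (hz : z ∈ region) :
    Φ z ∈ region := by
  by_contra hc
  have := Φ.injective (h _ hc)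
  grind

/-- A compact planar graph with vertex set `V`, all of whose points have a type. -/
structure TypedGraph (Γ V : Set (ℝ × ℝ)) : Prop where
  isCompact : IsCompact Γ
  subset_region : Γ ⊆ region
  finite : V.Finite
  subset : V ⊆ Γ
  vertex : ∀ z ∈ V, ∃ p q, p + q = 3 ∧ HasType Γ p q z
  edge : ∀ z ∈ Γ, z ∉ V → ∃ p q, p + q = 2 ∧ HasType Γ p q z

theorem TypedGraph.exists_hasType {Γ V : Set (ℝ × ℝ)} (h : TypedGraph Γ V) {z : ℝ × ℝ}
    (hz : z ∈ Γ) : ∃ p q, HasType Γ p q z := by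
  by_cases hV : z ∈ V
  · obtain ⟨p, q, -, h⟩ := h.vertex z hV
    exact ⟨p, q, h⟩
  · obtain ⟨p, q, -, h⟩ := h.edge z hz hV
    exact ⟨p, q, h⟩

theorem flip_mem_region {z : ℝ × ℝ} : flip z ∈ region ↔ z ∈ region := by
  simp only [region, flip_apply, mem_prod, mem_Ioo]
  grind

theorem TypedGraph.flip {Γ V : Set (ℝ × ℝ)} (h : TypedGraph Γ V) :
    TypedGraph (flip '' Γ) (flip '' V) where
  isCompact := h.isCompact.image DefectBord.flip.continuous
  subset_region := by
    rintro _ ⟨z, hz, rfl⟩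
    exact flip_mem_region.2 (h.subset_region hz)
  finite := h.finite.image _
  subset := image_mono h.subset
  vertex := by
    rintro _ ⟨z, hz, rfl⟩
    obtain ⟨p, q, e, ht⟩ := h.vertex z hz
    exact ⟨q, p, by omega, ht.flip⟩
  edge := by
    rintro _ ⟨z, hz, rfl⟩ hzV
    obtain ⟨p, q, e, ht⟩ := h.edge z hz (fun hV => hzV (mem_image_of_mem _ hV))
    exact ⟨q, p, by omega, ht.flip⟩

/-- `Γ'` arises from `Γ` by a homeomorphism supported in the rectangle, which fixes the vertices and
preserves all types at the vertices, except at `z`. -/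
def IsMove (V : Set (ℝ × ℝ)) (z : ℝ × ℝ) (Γ Γ' : Set (ℝ × ℝ)) : Prop :=
  ∃ Φ : ℝ × ℝ ≃ₜ ℝ × ℝ, Supported Φ ∧ (∀ v ∈ V, Φ v = v) ∧ Γ' = Φ '' Γ ∧ TypedGraph Γ' V ∧
    ∀ v ∈ V, v ≠ z → ∀ p q, HasType Γ p q v → HasType Γ' p q v

theorem IsMove.trans {V : Set (ℝ × ℝ)} {z : ℝ × ℝ} {Γ Γ' Γ'' : Set (ℝ × ℝ)}
    (h : IsMove V z Γ Γ') (h' : IsMove V z Γ' Γ'') : IsMove V z Γ Γ'' := by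
  obtain ⟨Φ, a, b, rfl, d, e⟩ := h
  obtain ⟨Φ', a', b', rfl, d', e'⟩ := h'
  refine ⟨Φ.trans Φ', a.trans a', fun v hv => by simp [b v hv, b' v hv], ?_, d',
    fun v hv hne p q ht => e' v hv hne p q (e v hv hne p q ht)⟩
  rw [image_image]; rfl

theorem TypedGraph.exists_move_down {Γ V : Set (ℝ × ℝ)} (h : TypedGraph Γ V) {z : ℝ × ℝ}
    (hz : z ∈ V) {p q : ℕ} (ht : HasType Γ p (q + 1) z) (hpq : p + q + 1 = 3) :
    ∃ Γ', IsMove V z Γ Γ' ∧ HasType Γ' (p + 1) q z := by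
  have hN : region ∩ (V \ {z})ᶜ ∈ 𝓝 z := by
    refine Filter.inter_mem (isOpen_region.mem_nhds (h.subset_region (h.subset hz))) ?_
    exact (h.finite.sdiff.isClosed.isOpen_compl).mem_nhds (by simp)
  obtain ⟨Φ, hL, hΦ, hΦz, hB⟩ := ht.exists_bendReady hN
  obtain ⟨Ψ, hΨ, hΨz, hty, hrest⟩ := hB.exists_bend hN
  have hout : ∀ v ∈ V, v ≠ z → v ∉ region ∩ (V \ {z})ᶜ := fun v hv hne hc => hc.2 ⟨hv, hne⟩
  have hfixΦ : ∀ v ∈ V, Φ v = v := by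
    intro v hv
    by_cases hne : v = z
    · rw [hne, hΦz]
    · exact (hΦ v (hout v hv hne)).self_of_nhds
  have hfixΨ : ∀ v ∈ V, Ψ v = v := by
    intro v hv
    by_cases hne : v = z
    · rw [hne, hΨz]
    · exact (hΨ v (hout v hv hne)).self_of_nhds
  have sΦ : Supported Φ := fun w hw => (hΦ w fun hc => hw hc.1).self_of_nhds
  have sΨ : Supported Ψ := fun w hw => (hΨ w fun hc => hw hc.1).self_of_nhds
  have hold : ∀ v ∈ V, v ≠ z → ∀ p q, HasType Γ p q v → HasType (Ψ '' (Φ '' Γ)) p q v := by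
    intro v hv hne p q ht
    have h1 := ht.of_eq_near (hΦ v (hout v hv hne))
    rw [hfixΦ v hv] at h1
    have h2 := h1.of_eq_near (hΨ v (hout v hv hne))
    grind
  refine ⟨Ψ '' (Φ '' Γ), ⟨Φ.trans Ψ, sΦ.trans sΨ, fun v hv => ?_, ?_, ?_, hold⟩, hty⟩
  · simp [hfixΦ v hv, hfixΨ v hv]
  · rw [image_image]; rfl
  · refine ⟨(h.isCompact.image Φ.continuous).image Ψ.continuous, ?_, h.finite, ?_, ?_, ?_⟩
    · rintro _ ⟨_, ⟨w, hw, rfl⟩, rfl⟩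
      exact sΨ.mem (sΦ.mem (h.subset_region hw))
    · intro v hv
      exact ⟨v, ⟨v, h.subset hv, hfixΦ v hv⟩, hfixΨ v hv⟩
    · intro v hv
      by_cases hne : v = z
      · grind
      · obtain ⟨a, b, hab, ht⟩ := h.vertex v hv
        grind
    · rintro _ ⟨_, ⟨w, hw, rfl⟩, rfl⟩ hV
      have hwV : w ∉ V := fun hv => hV (by rwa [hfixΦ w hv, hfixΨ w hv])
      obtain ⟨a, b, hab, ht⟩ := h.edge w hw hwV
      refine hrest (Φ w) (mem_image_of_mem _ hw) (fun e => hwV ?_) ⟨a, b, hab, ht.level hL⟩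
      grind

theorem IsMove.flip {V : Set (ℝ × ℝ)} {z : ℝ × ℝ} {Γ Γ' : Set (ℝ × ℝ)}
    (h : IsMove (flip '' V) (flip z) (flip '' Γ) Γ') : IsMove V z Γ (flip '' Γ') := by
  obtain ⟨Φ, a, b, rfl, d, e⟩ := h
  have d' := d.flip
  rw [flip_image_image] at d'
  refine ⟨(DefectBord.flip.trans Φ).trans DefectBord.flip, fun w hw => ?_, fun v hv => ?_, ?_, d',
    fun v hv hne p q ht => ?_⟩
  · simp only [Homeomorph.trans_apply]
    rw [a _ (fun hc => hw (flip_mem_region.1 hc)), flip_flip]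
  · simp only [Homeomorph.trans_apply]
    rw [b _ (mem_image_of_mem _ hv), flip_flip]
  · simp only [image_image]; rfl
  · have := (e _ (mem_image_of_mem _ hv) (fun h => hne (DefectBord.flip.injective h)) q p
      ht.flip).flip
    rwa [flip_flip] at this

theorem TypedGraph.exists_move {Γ V : Set (ℝ × ℝ)} (h : TypedGraph Γ V) {z : ℝ × ℝ}
    (hz : z ∈ V) : ∃ Γ', IsMove V z Γ Γ' ∧ HasType Γ' 2 1 z := by
  have h12 : ∀ Γ, TypedGraph Γ V → HasType Γ 1 2 z → ∃ Γ', IsMove V z Γ Γ' ∧ HasType Γ' 2 1 z :=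
    fun Γ h ht => h.exists_move_down hz ht rfl
  obtain ⟨p, q, hpq, ht⟩ := h.vertex z hz
  obtain ⟨rfl, rfl⟩ | ⟨rfl, rfl⟩ | ⟨rfl, rfl⟩ | ⟨rfl, rfl⟩ :
      (p = 0 ∧ q = 3) ∨ (p = 1 ∧ q = 2) ∨ (p = 2 ∧ q = 1) ∨ (p = 3 ∧ q = 0) := by omega
  · obtain ⟨Γ', m, t⟩ := h.exists_move_down hz (p := 0) (q := 2) ht rfl
    obtain ⟨Γ'', m', t'⟩ := h12 Γ' (by obtain ⟨_, _, _, _, d, _⟩ := m; exact d) t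
    exact ⟨Γ'', m.trans m', t'⟩
  · exact h12 Γ h ht
  · exact ⟨Γ, ⟨Homeomorph.refl _, fun _ _ => rfl, fun _ _ => rfl, by simp, h,
      fun _ _ _ _ _ h => h⟩, ht⟩
  · obtain ⟨Γ', m, t⟩ := h.flip.exists_move_down (mem_image_of_mem _ hz) (p := 0) (q := 2)
      ht.flip rfl
    refine ⟨_, m.flip, ?_⟩
    have := t.flip
    rwa [flip_flip] at this

theorem TypedGraph.exists_vertices {Γ V : Set (ℝ × ℝ)} (h : TypedGraph Γ V) :
    ∃ Φ : ℝ × ℝ ≃ₜ ℝ × ℝ, Supported Φ ∧ TypedGraph (Φ '' Γ) (Φ '' V) ∧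
      ∀ z ∈ Φ '' V, HasType (Φ '' Γ) 2 1 z := by
  have key : ∀ S : Set (ℝ × ℝ), S.Finite → S ⊆ V → ∃ Φ : ℝ × ℝ ≃ₜ ℝ × ℝ, Supported Φ ∧
      (∀ v ∈ V, Φ v = v) ∧ TypedGraph (Φ '' Γ) V ∧ ∀ z ∈ S, HasType (Φ '' Γ) 2 1 z := by
    intro S hS
    induction S, hS using Set.Finite.induction_on with
    | empty =>
      intro _
      exact ⟨Homeomorph.refl _, fun _ _ => rfl, fun _ _ => rfl, by simpa using h, by simp⟩
    | @insert a S ha hS ih =>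
      intro hSV
      obtain ⟨Φ, h1, h2, h3, h4⟩ := ih ((subset_insert _ _).trans hSV)
      obtain ⟨Γ', ⟨Ψ, g1, g2, rfl, g4, g5⟩, t⟩ := h3.exists_move (hSV (mem_insert _ _))
      have e : (Φ.trans Ψ) '' Γ = Ψ '' (Φ '' Γ) := by rw [image_image]; rfl
      refine ⟨Φ.trans Ψ, h1.trans g1, fun v hv => by simp [h2 v hv, g2 v hv], by rwa [e], ?_⟩
      rw [e]
      rintro z (rfl | hz)
      · exact t
      · exact g5 z (hSV (mem_insert_of_mem _ hz)) (fun h => ha (h ▸ hz)) _ _ (h4 z hz)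
  obtain ⟨Φ, h1, h2, h3, h4⟩ := key V h.finite subset_rfl
  have e : Φ '' V = V := by
    grind
  grind

/-- Vertices and points where the height has a local extremum. -/
def IsSingular (Γ V : Set (ℝ × ℝ)) (z : ℝ × ℝ) : Prop :=
  z ∈ Γ ∧ (z ∈ V ∨ ¬ HasType Γ 1 1 z)

theorem TypedGraph.finite_singular {Γ V : Set (ℝ × ℝ)} (h : TypedGraph Γ V) :
    {z | IsSingular Γ V z}.Finite := by
  have h1 : {z | z ∈ Γ ∧ ¬ HasType Γ 1 1 z}.Finite := by
    by_contra hinf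
    obtain ⟨z, hz, hacc⟩ := Set.Infinite.exists_accPt_of_subset_isCompact hinf h.isCompact
      (fun z hz => hz.1)
    obtain ⟨p, q, ht⟩ := h.exists_hasType hz
    obtain ⟨w, hw, hS⟩ := ((accPt_iff_frequently.1 hacc).and_eventually ht.eventually_one_one).exists
    grind
  refine (h1.union h.finite).subset ?_
  rintro z ⟨hz, hV | ht⟩
  all_goals grind

/-- Planar graphs in general position with respect to the height. -/
structure GenericGraph (Γ V : Set (ℝ × ℝ)) : Prop extends TypedGraph Γ V where
  vertex_type : ∀ z ∈ V, HasType Γ 2 1 z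
  heights : ∀ z w, IsSingular Γ V z → IsSingular Γ V w → z.2 = w.2 → z = w

theorem TypedGraph.exists_heights {Γ V : Set (ℝ × ℝ)} (h : TypedGraph Γ V) :
    ∃ Φ : ℝ × ℝ ≃ₜ ℝ × ℝ, Supported Φ ∧ (∀ p q w, HasType Γ p q w → HasType (Φ '' Γ) p q (Φ w)) ∧
      InjOn (fun z => (Φ z).2) {z | IsSingular Γ V z} := by
  have key : ∀ S : Set (ℝ × ℝ), S.Finite → S ⊆ Γ → ∃ Φ : ℝ × ℝ ≃ₜ ℝ × ℝ, Supported Φ ∧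
      (∀ p q w, HasType Γ p q w → HasType (Φ '' Γ) p q (Φ w)) ∧ InjOn (fun z => (Φ z).2) S := by
    intro S hS
    induction S, hS using Set.Finite.induction_on with
    | empty =>
      intro _
      exact ⟨Homeomorph.refl _, fun _ _ => rfl, fun _ _ _ h => by simpa using h, by simp⟩
    | @insert a S ha hS ih =>
      intro hSΓ
      obtain ⟨Φ, h1, h2, h3⟩ := ih ((subset_insert _ _).trans hSΓ)
      have haΓ := hSΓ (mem_insert a S)
      obtain ⟨p, q, ht⟩ := h.exists_hasType haΓ
      have hN : region ∩ (Φ '' S)ᶜ ∈ 𝓝 (Φ a) := by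
        refine Filter.inter_mem (isOpen_region.mem_nhds (h1.mem (h.subset_region haΓ))) ?_
        refine ((hS.image _).isClosed.isOpen_compl).mem_nhds ?_
        rintro ⟨s, hs, e⟩
        exact ha (Φ.injective e ▸ hs)
      obtain ⟨ε, hε, hlift⟩ := (h2 p q a ht).exists_lift hN
      obtain ⟨t, ht1, ht2⟩ : ∃ t ∈ Ioo (-ε) ε, (Φ a).2 + t ∉ (fun z => (Φ z).2) '' S := by
        have hf : ((fun t => (Φ a).2 + t) ⁻¹' ((fun z => (Φ z).2) '' S)).Finite :=
          (hS.image _).preimage (add_right_injective _).injOn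
        obtain ⟨t, ht1, ht2⟩ := ((Ioo_infinite (show -ε < ε by linarith)).sdiff hf).nonempty
        grind
      obtain ⟨Ψ, g1, g2, g3⟩ := hlift t (abs_lt.2 ht1)
      have hfix : ∀ s ∈ S, Ψ (Φ s) = Φ s := fun s hs =>
        (g1 _ fun hc => hc.2 (mem_image_of_mem _ hs)).self_of_nhds
      have e : (Φ.trans Ψ) '' Γ = Ψ '' (Φ '' Γ) := by rw [image_image]; rfl
      refine ⟨Φ.trans Ψ, h1.trans fun w hw => (g1 w fun hc => hw hc.1).self_of_nhds,
        fun p q w hw => ?_, ?_⟩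
      · rw [e]; exact g3 _ _ _ (h2 _ _ _ hw)
      · refine (injOn_insert ha).2 ⟨fun x hx y hy hxy => ?_, ?_⟩
        · simp only [Homeomorph.trans_apply, hfix x hx, hfix y hy] at hxy
          exact h3 hx hy hxy
        · rintro ⟨s, hs, e⟩
          simp only [Homeomorph.trans_apply, hfix s hs, g2] at e
          exact ht2 ⟨s, hs, e⟩
  exact key _ h.finite_singular fun z hz => hz.1

theorem TypedGraph.exists_generic {Γ V : Set (ℝ × ℝ)} (h : TypedGraph Γ V) :
    ∃ Φ : ℝ × ℝ ≃ₜ ℝ × ℝ, Supported Φ ∧ GenericGraph (Φ '' Γ) (Φ '' V) := by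
  obtain ⟨Φ, h1, h2, h3⟩ := h.exists_vertices
  obtain ⟨Ψ, g1, g2, g3⟩ := h2.exists_heights
  refine ⟨Φ.trans Ψ, h1.trans g1, ?_⟩
  have e : ∀ A : Set (ℝ × ℝ), (Φ.trans Ψ) '' A = Ψ '' (Φ '' A) := fun A => by rw [image_image]; rfl
  rw [e, e]
  generalize Φ '' Γ = Γ at *
  generalize Φ '' V = V at *
  have hs : ∀ z, IsSingular (Ψ '' Γ) (Ψ '' V) (Ψ z) → IsSingular Γ V z := by
    rintro z ⟨hz, hz'⟩
    refine ⟨Ψ.injective.mem_set_image.1 hz, ?_⟩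
    rcases hz' with hz' | hz'
    · exact Or.inl (Ψ.injective.mem_set_image.1 hz')
    grind
  refine ⟨⟨h2.isCompact.image Ψ.continuous, ?_, h2.finite.image _, image_mono h2.subset, ?_, ?_⟩,
    ?_, ?_⟩
  · rintro _ ⟨z, hz, rfl⟩
    exact g1.mem (h2.subset_region hz)
  · grind
  · rintro _ ⟨z, hz, rfl⟩ hV
    obtain ⟨a, b, hab, ht⟩ := h2.edge z hz (fun hc => hV (mem_image_of_mem _ hc))
    grind
  · grind
  · intro z w hz hw hzw
    obtain ⟨z, -, rfl⟩ := hz.1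
    obtain ⟨w, -, rfl⟩ := hw.1
    rw [g3 (hs z hz) (hs w hw) hzw]

end DefectBord

namespace DefectBord

/-! ### The pictures of the patterns as families of functions of the height -/

theorem mem_segment_iff {a b s t x y : ℝ} (hst : s < t) :
    (x, y) ∈ segment ℝ (a, s) (b, t) ↔
      s ≤ y ∧ y ≤ t ∧ x = a + (b - a) * ((y - s) / (t - s)) := by
  have h0 : 0 < t - s := sub_pos.2 hst
  rw [segment_eq_image']
  simp only [mem_image, Prod.mk_sub_mk, Prod.smul_mk, smul_eq_mul, Prod.mk_add_mk, Prod.mk.injEq,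
    mem_Icc]
  constructor
  · rintro ⟨θ, ⟨h1, h2⟩, rfl, rfl⟩
    refine ⟨by nlinarith, by nlinarith, ?_⟩
    grind
  · rintro ⟨h1, h2, rfl⟩
    refine ⟨(y - s) / (t - s), ⟨div_nonneg (by linarith) h0.le,
      div_le_one_of_le₀ (by linarith) h0.le⟩, by ring, ?_⟩
    grind

theorem mem_segment_full {a b x y : ℝ} : (x, y) ∈ segment ℝ (a, (0 : ℝ)) (b, (1 : ℝ)) ↔
    0 ≤ y ∧ y ≤ 1 ∧ x = a + (b - a) * y := by
  rw [mem_segment_iff zero_lt_one]; simp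

theorem mem_segment_lower {a b x y : ℝ} : (x, y) ∈ segment ℝ (a, (0 : ℝ)) (b, (1 / 2 : ℝ)) ↔
    0 ≤ y ∧ y ≤ 1 / 2 ∧ x = a + (b - a) * (2 * y) := by
  rw [mem_segment_iff (by norm_num)]
  grind

theorem mem_segment_upper {a b x y : ℝ} : (x, y) ∈ segment ℝ (a, (1 / 2 : ℝ)) (b, (1 : ℝ)) ↔
    1 / 2 ≤ y ∧ y ≤ 1 ∧ x = a + (b - a) * (2 * y - 1) := by
  rw [mem_segment_iff (by norm_num)]
  grind

/-- A family of curves which run from `a k` at the bottom to `t k` at the top, straight except that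
the curves `j` and `j + 1` pass through `v` at half height. -/
noncomputable def mergeCurve (a t : ℕ → ℝ) (v : ℝ) (j k : ℕ) (s : ℝ) : ℝ :=
  if k = j ∨ k = j + 1 then a k + (v - a k) * min (2 * s) 1 + (t k - v) * max 0 (2 * s - 1)
  else a k + (t k - a k) * s

theorem continuous_mergeCurve (a t : ℕ → ℝ) (v : ℝ) (j k : ℕ) :
    Continuous (mergeCurve a t v j k) := by
  unfold mergeCurve
  split_ifs <;> fun_prop

theorem mergeCurve_zero (a t : ℕ → ℝ) (v : ℝ) (j k : ℕ) : mergeCurve a t v j k 0 = a k := by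
  simp [mergeCurve]

theorem mergeCurve_one (a t : ℕ → ℝ) (v : ℝ) (j k : ℕ) : mergeCurve a t v j k 1 = t k := by
  rw [mergeCurve, min_eq_right (by norm_num), max_eq_right (by norm_num)]
  split_ifs <;> ring

theorem mergeCurve_of_ne {a t : ℕ → ℝ} {v : ℝ} {j k : ℕ} (h : ¬(k = j ∨ k = j + 1)) (s : ℝ) :
    mergeCurve a t v j k s = a k + (t k - a k) * s := if_neg h

theorem mergeCurve_lower {a t : ℕ → ℝ} {v : ℝ} {j k : ℕ} (h : k = j ∨ k = j + 1) {s : ℝ}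
    (hs : s ≤ 1 / 2) : mergeCurve a t v j k s = a k + (v - a k) * (2 * s) := by
  rw [mergeCurve, if_pos h, min_eq_left (by linarith), max_eq_left (by linarith)]; ring

theorem mergeCurve_upper {a t : ℕ → ℝ} {v : ℝ} {j k : ℕ} (h : k = j ∨ k = j + 1) {s : ℝ}
    (hs : 1 / 2 ≤ s) : mergeCurve a t v j k s = v + (t k - v) * (2 * s - 1) := by
  rw [mergeCurve, if_pos h, min_eq_right (by linarith), max_eq_right (by linarith)]; ring

theorem convex_pos {A B u : ℝ} (hA : 0 < A) (hB : 0 < B) (h0 : 0 ≤ u) (h1 : u ≤ 1) :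
    0 < A + (B - A) * u := by
  rcases h1.eq_or_lt with rfl | h1
  · linarith
  · have := mul_nonneg hB.le h0
    have := mul_pos hA (sub_pos.2 h1)
    linarith

theorem mergeCurve_lt {a t : ℕ → ℝ} {v : ℝ} {j k : ℕ} (hk : k ≠ j) (ha : a k < a (k + 1))
    (ht : t k < t (k + 1)) (h1 : k + 1 = j → (a k + t k) / 2 < v)
    (h2 : k = j + 1 → v < (a (k + 1) + t (k + 1)) / 2) {s : ℝ} (hs : s ∈ Icc (0 : ℝ) 1) :
    mergeCurve a t v j k s < mergeCurve a t v j (k + 1) s := by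
  obtain ⟨hs0, hs1⟩ := hs
  by_cases hk1 : k + 1 = j
  · rw [mergeCurve_of_ne (k := k) (by omega)]
    have h1' := h1 hk1
    rcases le_total s (1 / 2) with hs | hs
    · rw [mergeCurve_lower (Or.inl hk1) hs]
      linarith [convex_pos (u := 2 * s) (sub_pos.2 ha) (sub_pos.2 h1') (by linarith) (by linarith)]
    · rw [mergeCurve_upper (Or.inl hk1) hs]
      subst hk1
      linarith [convex_pos (u := 2 * s - 1) (sub_pos.2 h1') (sub_pos.2 ht) (by linarith) (by linarith)]
  by_cases hk2 : k = j + 1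
  · rw [mergeCurve_of_ne (k := k + 1) (by omega)]
    have h2 := h2 hk2
    rcases le_total s (1 / 2) with hs | hs
    · rw [mergeCurve_lower (Or.inr hk2) hs]
      linarith [convex_pos (u := 2 * s) (sub_pos.2 ha) (sub_pos.2 h2) (by linarith) (by linarith)]
    · rw [mergeCurve_upper (Or.inr hk2) hs]
      linarith [convex_pos (u := 2 * s - 1) (sub_pos.2 h2) (sub_pos.2 ht) (by linarith) (by linarith)]
  · rw [mergeCurve_of_ne (k := k) (by omega), mergeCurve_of_ne (k := k + 1) (by omega)]
    linarith [convex_pos (sub_pos.2 ha) (sub_pos.2 ht) hs0 hs1]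

theorem mergeCurve_lt_self {a t : ℕ → ℝ} {v : ℝ} {j : ℕ} (ha : a j < a (j + 1)) {s : ℝ}
    (hs : s < 1 / 2) : mergeCurve a t v j j s < mergeCurve a t v j (j + 1) s := by
  rw [mergeCurve_lower (Or.inl rfl) hs.le, mergeCurve_lower (Or.inr rfl) hs.le]
  nlinarith

theorem mergeCurve_eq_self {a t : ℕ → ℝ} {v : ℝ} {j : ℕ} (ht : t j = t (j + 1)) {s : ℝ}
    (hs : 1 / 2 ≤ s) : mergeCurve a t v j j s = mergeCurve a t v j (j + 1) s := by
  rw [mergeCurve_upper (Or.inl rfl) hs, mergeCurve_upper (Or.inr rfl) hs, ht]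

/-- The `k`-th of the points dividing the unit interval into `n + 1` equal parts. -/
noncomputable def tick (n k : ℕ) : ℝ := (k : ℝ) / ((n : ℝ) + 1)

theorem mark_eq_tick (n k : ℕ) : Pattern.mark n k = tick n (k + 1) := by
  simp [Pattern.mark, tick]

theorem tick_zero (n : ℕ) : tick n 0 = 0 := by simp [tick]

theorem tick_last (n : ℕ) : tick n (n + 1) = 1 := by
  rw [tick]; push_cast; exact div_self (by positivity)

theorem tick_lt {n k l : ℕ} (h : k < l) : tick n k < tick n l := by
  unfold tick
  gcongr

/-- The tops of the curves of `mu n (j - 1)`. -/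
noncomputable def muTop (n j k : ℕ) : ℝ := if k ≤ j then tick (n + 1) k else tick (n + 1) (k - 1)

/-- The strands of `mu n (j - 1)`, together with the two sides of the square. -/
noncomputable def muCurve (n j : ℕ) : ℕ → ℝ → ℝ :=
  mergeCurve (tick (n + 2)) (muTop n j) (tick (n + 1) j) j

/-- The tops of the curves of `beta n (j - 1)`; the arc is prolonged to the top. -/
noncomputable def betaEnd (n j : ℕ) (e : ℝ) (k : ℕ) : ℝ :=
  if k < j then tick n k else if k ≤ j + 1 then e else tick n (k - 2)

/-- The strands of `beta n (j - 1)`, together with the two sides of the square and a prolongation of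
the arc to the point `e` of the top side. -/
noncomputable def betaCurve (n j : ℕ) (e : ℝ) : ℕ → ℝ → ℝ :=
  mergeCurve (tick (n + 2)) (betaEnd n j e) ((tick (n + 2) j + tick (n + 2) (j + 1)) / 2) j

theorem muTop_lt {n j k : ℕ} (h : k ≠ j) : muTop n j k < muTop n j (k + 1) := by
  unfold muTop
  split_ifs
  · exact tick_lt (by omega)
  · omega
  · omega
  · exact tick_lt (by omega)

theorem muCurve_lt {n j k : ℕ} (hj : j ≤ n + 1) (h : k ≠ j) {s : ℝ} (hs : s ∈ Icc (0 : ℝ) 1) :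
    muCurve n j k s < muCurve n j (k + 1) s := by
  refine mergeCurve_lt h (tick_lt (Nat.lt_succ_self k)) (muTop_lt h) ?_ ?_ hs
  · rintro rfl
    rw [muTop, if_pos (by omega)]
    have h1 := tick_lt (n := n + 1) (Nat.lt_succ_self k)
    have h2 : tick (n + 2) k ≤ tick (n + 1) k := by
      unfold tick; gcongr; linarith
    linarith
  · rintro rfl
    rw [muTop, if_neg (by omega)]
    have h1 := tick_lt (n := n + 1) (Nat.lt_succ_self j)
    have h2 : tick (n + 1) j < tick (n + 2) (j + 1 + 1) := by
      unfold tick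
      rw [div_lt_div_iff₀ (by positivity) (by positivity)]
      push_cast
      have : (j : ℝ) ≤ n + 1 := by exact_mod_cast hj
      nlinarith
    grind

theorem betaEnd_lt {n j k : ℕ} {e : ℝ} (he : e ∈ Ioo (tick n (j - 1)) (tick n j)) (h : k ≠ j) :
    betaEnd n j e k < betaEnd n j e (k + 1) := by
  unfold betaEnd
  split_ifs
  · exact tick_lt (by omega)
  · grind
  · omega
  · omega
  · omega
  · grind
  · omega
  · omega
  · exact tick_lt (by omega)

theorem betaCurve_lt {n j k : ℕ} (hj0 : 1 ≤ j) (hj : j ≤ n + 1) {e : ℝ}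
    (he : e ∈ Ioo (tick n (j - 1)) (tick n j)) (h : k ≠ j) {s : ℝ} (hs : s ∈ Icc (0 : ℝ) 1) :
    betaCurve n j e k s < betaCurve n j e (k + 1) s := by
  refine mergeCurve_lt h (tick_lt (Nat.lt_succ_self k)) (betaEnd_lt he h) ?_ ?_ hs
  · rintro rfl
    rw [betaEnd, if_pos (by omega)]
    unfold tick
    push_cast
    have : (k : ℝ) ≤ n := by exact_mod_cast (show k ≤ n by omega)
    have h1 : (k : ℝ) / ((n : ℝ) + 1) < (k + 3) / (n + 2 + 1) := by
      rw [div_lt_div_iff₀ (by positivity) (by positivity)]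
      nlinarith
    grind
  · rintro rfl
    rw [betaEnd, if_neg (by omega), if_neg (by omega), show j + 1 + 1 - 2 = j by omega]
    unfold tick
    push_cast
    have h0 : (1 : ℝ) ≤ j := by exact_mod_cast hj0
    have h1 : ((j : ℝ) - 1) / ((n : ℝ) + 2 + 1) < j / (n + 1) := by
      rw [div_lt_div_iff₀ (by positivity) (by positivity)]
      nlinarith
    grind

theorem muCurve_zero_left {n j : ℕ} (hj0 : 1 ≤ j) (s : ℝ) : muCurve n j 0 s = 0 := by
  rw [muCurve, mergeCurve_of_ne (by omega), muTop, if_pos (by omega), tick_zero, tick_zero]; ring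

theorem muCurve_last {n j : ℕ} (hj : j ≤ n + 1) (s : ℝ) : muCurve n j (n + 3) s = 1 := by
  rw [muCurve, mergeCurve_of_ne (by omega), muTop, if_neg (by omega),
    show n + 3 - 1 = n + 1 + 1 by omega, tick_last, tick_last]; simp

theorem betaCurve_zero_left {n j : ℕ} (e : ℝ) (hj0 : 1 ≤ j) (s : ℝ) : betaCurve n j e 0 s = 0 := by
  rw [betaCurve, mergeCurve_of_ne (by omega), betaEnd, if_pos (by omega), tick_zero, tick_zero]
  ring

theorem betaCurve_last {n j : ℕ} (e : ℝ) (hj : j ≤ n + 1) (s : ℝ) :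
    betaCurve n j e (n + 3) s = 1 := by
  rw [betaCurve, mergeCurve_of_ne (by omega), betaEnd, if_neg (by omega), if_neg (by omega),
    show n + 3 - 2 = n + 1 by omega, tick_last, tick_last]; simp

namespace Pattern

theorem mem_strands_I {n : ℕ} {x s : ℝ} : (x, s) ∈ (I n).strands ↔
    s ∈ Icc (0 : ℝ) 1 ∧ ∃ k, 1 ≤ k ∧ k ≤ n ∧ x = tick n k := by
  simp only [strands, mem_iUnion, mem_segment_full, mark_eq_tick, sub_self, zero_mul, add_zero,
    exists_prop, mem_Icc]
  constructor
  · grind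
  · rintro ⟨⟨h0, h1⟩, k, hk, hk', rfl⟩
    exact ⟨k - 1, by omega, h0, h1, by rw [Nat.sub_add_cancel hk]⟩

theorem mem_strands_mu {n : ℕ} {i : Fin (n + 1)} {x s : ℝ} : (x, s) ∈ (mu n i).strands ↔
    s ∈ Icc (0 : ℝ) 1 ∧ ∃ k, 1 ≤ k ∧ k ≤ n + 2 ∧ x = muCurve n (i + 1) k s := by
  have hi := i.2
  simp only [strands, muStrands, muVertex, mem_union, mem_iUnion, mem_segment_full,
    mem_segment_lower, mem_segment_upper, mark_eq_tick, exists_prop, mem_Icc, muCurve]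
  constructor
  · rintro ((⟨k, hk, h0, h1, rfl⟩ | ⟨k, hk, h0, h1, rfl⟩) | (⟨h0, h1, rfl⟩ | ⟨h0, h1, rfl⟩) |
      ⟨h0, h1, rfl⟩)
    · refine ⟨⟨h0, h1⟩, k + 1, by omega, by omega, ?_⟩
      rw [mergeCurve_of_ne (by omega), muTop, if_pos (by omega)]
    · refine ⟨⟨h0, h1⟩, k + 2, by omega, by omega, ?_⟩
      rw [mergeCurve_of_ne (by omega), muTop, if_neg (by omega)]
      rfl
    · refine ⟨⟨h0, by linarith⟩, i + 1, by omega, by omega, ?_⟩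
      rw [mergeCurve_lower (Or.inl rfl) h1]
    · refine ⟨⟨h0, by linarith⟩, i + 2, by omega, by omega, ?_⟩
      rw [mergeCurve_lower (Or.inr rfl) h1]
    · refine ⟨⟨by linarith, h1⟩, i + 1, by omega, by omega, ?_⟩
      rw [mergeCurve_upper (Or.inl rfl) h0, muTop, if_pos le_rfl]
  · rintro ⟨⟨h0, h1⟩, k, hk, hk', rfl⟩
    rcases lt_trichotomy k (i + 1) with h | h | h
    · refine Or.inl (Or.inl ⟨k - 1, by omega, h0, h1, ?_⟩)
      rw [mergeCurve_of_ne (by omega), muTop, if_pos (by omega), Nat.sub_add_cancel hk]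
    · subst h
      rcases le_total s (1 / 2) with hs | hs
      · refine Or.inr (Or.inl (Or.inl ⟨h0, hs, ?_⟩))
        rw [mergeCurve_lower (Or.inl rfl) hs]
      · refine Or.inr (Or.inr ⟨hs, h1, ?_⟩)
        rw [mergeCurve_upper (Or.inl rfl) hs, muTop, if_pos le_rfl]
    · by_cases h' : k = i + 2
      · subst h'
        rcases le_total s (1 / 2) with hs | hs
        · refine Or.inr (Or.inl (Or.inr ⟨h0, hs, ?_⟩))
          rw [mergeCurve_lower (Or.inr rfl) hs]
        · refine Or.inr (Or.inr ⟨hs, h1, ?_⟩)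
          rw [mergeCurve_upper (Or.inr rfl) hs, muTop, if_neg (by omega)]
          rfl
      · refine Or.inl (Or.inr ⟨k - 2, by omega, h0, h1, ?_⟩)
        rw [mergeCurve_of_ne (by omega), muTop, if_neg (by omega),
          show k - 2 + 1 + 1 = k by omega, show k - 2 + 1 = k - 1 by omega]

theorem mem_vertices_mu {n : ℕ} {i : Fin (n + 1)} {x s : ℝ} : (x, s) ∈ (mu n i).vertices ↔
    s = 1 / 2 ∧ x = muCurve n (i + 1) (i + 1) s := by
  simp only [vertices, muVertex, mem_singleton_iff, Prod.mk.injEq, mark_eq_tick, muCurve]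
  constructor
  · rintro ⟨rfl, rfl⟩
    refine ⟨rfl, ?_⟩
    rw [mergeCurve_lower (Or.inl rfl) le_rfl]; ring
  · rintro ⟨rfl, rfl⟩
    refine ⟨?_, rfl⟩
    rw [mergeCurve_lower (Or.inl rfl) le_rfl]; ring

theorem mem_betaStrands {n i : ℕ} (hi : i < n + 1) (e : ℝ) {x s : ℝ} :
    (x, s) ∈ betaStrands n i ↔ s ∈ Icc (0 : ℝ) 1 ∧ ∃ k, 1 ≤ k ∧ k ≤ n + 2 ∧
      x = betaCurve n (i + 1) e k s ∧ (k = i + 1 ∨ k = i + 1 + 1 → s ≤ 1 / 2) := by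
  simp only [betaStrands, betaTop, mem_union, mem_iUnion, mem_segment_full,
    mem_segment_lower, mark_eq_tick, exists_prop, mem_Icc, betaCurve]
  constructor
  · rintro ((⟨k, hk, h0, h1, rfl⟩ | ⟨k, hk, h0, h1, rfl⟩) | (⟨h0, h1, rfl⟩ | ⟨h0, h1, rfl⟩))
    · refine ⟨⟨h0, h1⟩, k + 1, by omega, by omega, ?_, by omega⟩
      rw [mergeCurve_of_ne (by omega), betaEnd, if_pos (by omega)]
    · refine ⟨⟨h0, h1⟩, k + 3, by omega, by omega, ?_, by omega⟩
      rw [mergeCurve_of_ne (by omega), betaEnd, if_neg (by omega), if_neg (by omega)]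
      rfl
    · refine ⟨⟨h0, by linarith⟩, i + 1, by omega, by omega, ?_, fun _ => h1⟩
      rw [mergeCurve_lower (Or.inl rfl) h1]
    · refine ⟨⟨h0, by linarith⟩, i + 2, by omega, by omega, ?_, fun _ => h1⟩
      rw [mergeCurve_lower (Or.inr rfl) h1]
  · rintro ⟨⟨h0, h1⟩, k, hk, hk', rfl, hs⟩
    rcases lt_trichotomy k (i + 1) with h | h | h
    · refine Or.inl (Or.inl ⟨k - 1, by omega, h0, h1, ?_⟩)
      rw [mergeCurve_of_ne (by omega), betaEnd, if_pos (by omega), Nat.sub_add_cancel hk]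
    · subst h
      refine Or.inr (Or.inl ⟨h0, hs (Or.inl rfl), ?_⟩)
      rw [mergeCurve_lower (Or.inl rfl) (hs (Or.inl rfl))]
    · by_cases h' : k = i + 2
      · subst h'
        refine Or.inr (Or.inr ⟨h0, hs (Or.inr rfl), ?_⟩)
        rw [mergeCurve_lower (Or.inr rfl) (hs (Or.inr rfl))]
      · refine Or.inl (Or.inr ⟨k - 3, by omega, h0, h1, ?_⟩)
        rw [mergeCurve_of_ne (by omega), betaEnd, if_neg (by omega), if_neg (by omega),
          show k - 3 + 2 + 1 = k by omega, show k - 3 + 1 = k - 2 by omega]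

theorem snd_mem_of_mem_strands {ρ : Pattern} {z : ℝ × ℝ} (h : z ∈ ρ.strands) :
    z.2 ∈ Icc (0 : ℝ) 1 := by
  obtain ⟨x, s⟩ := z
  cases ρ with
  | I n => exact (mem_strands_I.1 h).1
  | mu n i => exact (mem_strands_mu.1 h).1
  | beta n i => exact ((mem_betaStrands i.2 0).1 h).1
  | gamma n i =>
    have := ((mem_betaStrands i.2 0).1 h).1
    simp only [mem_Icc] at *
    constructor <;> linarith

theorem mem_strands_bottom {ρ : Pattern} {x : ℝ} :
    (x, (0 : ℝ)) ∈ ρ.strands ↔ ∃ k, 1 ≤ k ∧ k ≤ ρ.source ∧ x = tick ρ.source k := by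
  cases ρ with
  | I n => rw [mem_strands_I]; simp [source]
  | mu n i =>
    rw [mem_strands_mu]
    simp [source, muCurve, mergeCurve_zero]
  | beta n i =>
    refine (mem_betaStrands i.2 0).trans ?_
    simp [source, betaCurve, mergeCurve_zero]
  | gamma n i =>
    change (x, 1 - (0 : ℝ)) ∈ betaStrands n i ↔ _
    rw [mem_betaStrands i.2 0, sub_zero]
    simp only [source, betaCurve, mergeCurve_one, betaEnd]
    have hi := i.2
    constructor
    · rintro ⟨-, k, h1, h2, rfl, h3⟩
      split_ifs with h4 h5
      · exact ⟨k, h1, by omega, rfl⟩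
      · have := h3 (by omega); norm_num at this
      · exact ⟨k - 2, by omega, by omega, rfl⟩
    · rintro ⟨k, h1, h2, rfl⟩
      refine ⟨by norm_num, ?_⟩
      rcases lt_or_ge k (i + 1) with h | h
      · exact ⟨k, h1, by omega, by rw [if_pos h], by omega⟩
      · exact ⟨k + 2, by omega, by omega, by rw [if_neg (by omega), if_neg (by omega)]; rfl,
          by omega⟩

theorem mem_strands_top {ρ : Pattern} {x : ℝ} :
    (x, (1 : ℝ)) ∈ ρ.strands ↔ ∃ k, 1 ≤ k ∧ k ≤ ρ.target ∧ x = tick ρ.target k := by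
  cases ρ with
  | I n => rw [mem_strands_I]; simp [target]
  | mu n i =>
    rw [mem_strands_mu]
    simp only [target, muCurve, mergeCurve_one, muTop]
    have hi := i.2
    constructor
    · rintro ⟨-, k, h1, h2, rfl⟩
      split_ifs with h4
      · exact ⟨k, h1, by omega, rfl⟩
      · exact ⟨k - 1, by omega, by omega, rfl⟩
    · rintro ⟨k, h1, h2, rfl⟩
      refine ⟨by norm_num, ?_⟩
      rcases le_or_gt k (i + 1) with h | h
      · exact ⟨k, h1, by omega, by rw [if_pos h]⟩
      · exact ⟨k + 1, by omega, by omega, by rw [if_neg (by omega)]; rfl⟩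
  | beta n i =>
    have := mem_strands_bottom (ρ := gamma n i) (x := x)
    change (x, 1 - (0 : ℝ)) ∈ betaStrands n i ↔ _ at this
    rw [sub_zero] at this
    exact this
  | gamma n i =>
    have := mem_strands_bottom (ρ := beta n i) (x := x)
    change (x, 1 - (1 : ℝ)) ∈ betaStrands n i ↔ _
    rw [sub_self]
    exact this

end Pattern

end DefectBord

namespace DefectBord

/-! ### Stacks of pictures -/

/-- The picture `A` of the unit square, placed between the heights `a` and `b`. -/
def stackPlace (a b : ℝ) (A : Set (ℝ × ℝ)) : Set (ℝ × ℝ) :=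
  (fun p : ℝ × ℝ => (p.1, a + (b - a) * p.2)) '' A

theorem mem_stackPlace {a b : ℝ} (h : a < b) {A : Set (ℝ × ℝ)} {x s : ℝ} :
    (x, a + (b - a) * s) ∈ stackPlace a b A ↔ (x, s) ∈ A := by
  constructor
  · rintro ⟨⟨x', s'⟩, hp, e⟩
    simp only [Prod.mk.injEq] at e
    obtain ⟨rfl, e⟩ := e
    have : s' = s := mul_left_cancel₀ (sub_ne_zero.2 h.ne') (by linarith)
    rwa [← this]
  · intro hp
    exact ⟨_, hp, rfl⟩

/-- `(Γ, V)` is a stack of composable pictures from `0` to `n` strands with top at height `t`. -/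
def IsStack (Γ V : Set (ℝ × ℝ)) (t : ℝ) (n : ℕ) : Prop :=
  ∃ (m : ℕ) (ρ : ℕ → Pattern) (lev : ℕ → ℝ), 0 < m ∧ (ρ 0).source = 0 ∧
    (∀ j, j + 1 < m → (ρ j).target = (ρ (j + 1)).source) ∧ (ρ (m - 1)).target = n ∧
    (∀ j ≤ m, lev j ∈ Ioo (-4 / 5 : ℝ) (4 / 5)) ∧ (∀ j < m, lev j < lev (j + 1)) ∧ lev m = t ∧
    Γ = (⋃ j, ⋃ (_ : j < m), stackPlace (lev j) (lev (j + 1)) (ρ j).strands) ∧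
    V = ⋃ j, ⋃ (_ : j < m), stackPlace (lev j) (lev (j + 1)) (ρ j).vertices

namespace IsStack

variable {Γ V : Set (ℝ × ℝ)} {t : ℝ} {n : ℕ}

theorem base {t₀ t : ℝ} (h0 : -4 / 5 < t₀) (h1 : t₀ < t) (h2 : t < 4 / 5) :
    IsStack ∅ ∅ t 0 := by
  refine ⟨1, fun _ => Pattern.I 0, fun j => if j = 0 then t₀ else t, one_pos, rfl,
    fun _ _ => rfl, rfl, fun j _ => ?_, fun j hj => ?_, rfl, ?_, ?_⟩
  · grind
  · grind
  · symm
    simp only [iUnion_eq_empty]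
    intro j _
    simp [stackPlace, Pattern.strands]
  · symm
    simp only [iUnion_eq_empty]
    intro j _
    simp [stackPlace, Pattern.vertices]

theorem extend (h : IsStack Γ V t n) {ρ : Pattern} (hρ : ρ.source = n) {t' : ℝ} (h1 : t < t')
    (h2 : t' < 4 / 5) : IsStack (Γ ∪ stackPlace t t' ρ.strands) (V ∪ stackPlace t t' ρ.vertices)
      t' ρ.target := by
  obtain ⟨m, r, lev, hm, h0, hc, hn, hl, hlm, rfl, rfl, rfl⟩ := h
  have hU : ∀ A : Pattern → Set (ℝ × ℝ),
      (⋃ j, ⋃ (_ : j < m), stackPlace (lev j) (lev (j + 1)) (A (r j))) ∪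
        stackPlace (lev m) t' (A ρ) =
      ⋃ j, ⋃ (_ : j < m + 1), stackPlace ((fun j => if j ≤ m then lev j else t') j)
        ((fun j => if j ≤ m then lev j else t') (j + 1)) (A (if j < m then r j else ρ)) := by
    intro A
    ext z
    simp only [mem_union, mem_iUnion, exists_prop]
    grind
  refine ⟨m + 1, fun j => if j < m then r j else ρ, fun j => if j ≤ m then lev j else t',
    by omega, ?_, fun j hj => ?_, ?_, fun j hj => ?_, fun j hj => ?_, ?_,
    hU Pattern.strands, hU Pattern.vertices⟩
  all_goals grind

theorem mem_Ioo (h : IsStack Γ V t n) : t ∈ Ioo (-4 / 5 : ℝ) (4 / 5) := by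
  obtain ⟨m, r, lev, hm, h0, hc, hn, hl, hlm, rfl, -, -⟩ := h
  exact hl m le_rfl

theorem mem_top (h : IsStack Γ V t n) {x : ℝ} :
    (x, t) ∈ Γ ↔ ∃ k, 1 ≤ k ∧ k ≤ n ∧ x = tick n k := by
  obtain ⟨m, r, lev, hm, h0, hc, rfl, hl, hlm, rfl, rfl, -⟩ := h
  rw [← Pattern.mem_strands_top]
  have hmono : ∀ i j, i ≤ j → j ≤ m → lev i ≤ lev j := by
    intro i j hij
    induction j, hij using Nat.le_induction with
    | base => exact fun _ => le_rfl
    | succ j hij ih => exact fun hj => (ih (by omega)).trans (hlm j (by omega)).le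
  have e : m - 1 + 1 = m := Nat.sub_add_cancel hm
  have hlast := hlm (m - 1) (by omega)
  rw [e] at hlast
  simp only [mem_iUnion, exists_prop]
  constructor
  · rintro ⟨j, hj, ⟨⟨x', s⟩, hp, e'⟩⟩
    simp only [Prod.mk.injEq] at e'
    obtain ⟨rfl, e'⟩ := e'
    have hs := Pattern.snd_mem_of_mem_strands hp
    simp only [mem_Icc] at hs
    have h1 := hlm j hj
    rcases (show j + 1 ≤ m from hj).lt_or_eq with hj' | hj'
    · have h2 := hmono (j + 1) (m - 1) (by omega) (by omega)
      nlinarith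
    · obtain rfl : j = m - 1 := by omega
      rw [e] at e' h1
      have : s = 1 := mul_left_cancel₀ (sub_ne_zero.2 h1.ne') (by linarith)
      rwa [← this]
  · intro hp
    refine ⟨m - 1, by omega, _, hp, ?_⟩
    simp [e]

end IsStack

theorem Pattern.snd_mem_of_mem_vertices {ρ : Pattern} {z : ℝ × ℝ} (h : z ∈ ρ.vertices) :
    z.2 ∈ Icc (0 : ℝ) 1 := by
  obtain ⟨x, s⟩ := z
  cases ρ with
  | mu n i =>
    rw [(Pattern.mem_vertices_mu.1 h).1]
    norm_num
  | _ => exact h.elim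

theorem stackPlace_subset {a b : ℝ} (h : a < b) {A : Set (ℝ × ℝ)}
    (hA : ∀ z ∈ A, z.2 ∈ Icc (0 : ℝ) 1) {z : ℝ × ℝ} (hz : z ∈ stackPlace a b A) :
    a ≤ z.2 ∧ z.2 ≤ b := by
  obtain ⟨p, hp, rfl⟩ := hz
  have := hA p hp
  simp only [mem_Icc] at this ⊢
  constructor <;> nlinarith

/-- The curves `G k` of a graph between two heights are moved to the curves `C k` of a pattern. -/
theorem IsStack.step {Γ V : Set (ℝ × ℝ)} {t' t'' : ℝ} {N : ℕ} {ρ : Pattern}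
    (hs : IsStack (Γ ∩ {z | z.2 ≤ t'}) (V ∩ {z | z.2 ≤ t'}) t' ρ.source) (h1 : t' < t'')
    (h2 : t'' < 4 / 5) {G C : ℕ → ℝ → ℝ} (cG : ∀ k, Continuous (G k))
    (cC : ∀ k, Continuous (C k)) (G0 : ∀ s ∈ Icc (0 : ℝ) 1, G 0 s = 0 ∧ C 0 s = 0)
    (GN : ∀ s ∈ Icc (0 : ℝ) 1, G (N + 1) s = 1 ∧ C (N + 1) s = 1)
    (hG : ∀ k ≤ N, ∀ s ∈ Icc (0 : ℝ) 1, (G k s < G (k + 1) s ∧ C k s < C (k + 1) s) ∨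
      (G k s = G (k + 1) s ∧ C k s = C (k + 1) s))
    (hstart : ∀ k ≤ N + 1, G k 0 = C k 0) (A B : ℕ → ℝ → Prop)
    (hΓ : ∀ s ∈ Icc (0 : ℝ) 1, ∀ x, (x, t' + (t'' - t') * s) ∈ Γ ↔ ∃ k ≤ N, x = G k s ∧ A k s)
    (hρΓ : ∀ s ∈ Icc (0 : ℝ) 1, ∀ x, (x, s) ∈ ρ.strands ↔ ∃ k ≤ N, x = C k s ∧ A k s)
    (hV : ∀ s ∈ Icc (0 : ℝ) 1, ∀ x, (x, t' + (t'' - t') * s) ∈ V ↔ ∃ k ≤ N, x = G k s ∧ B k s)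
    (hρV : ∀ s ∈ Icc (0 : ℝ) 1, ∀ x, (x, s) ∈ ρ.vertices ↔ ∃ k ≤ N, x = C k s ∧ B k s) :
    ∃ Ψ : ℝ × ℝ ≃ₜ ℝ × ℝ, IsLevel Ψ ∧ Supported Ψ ∧
      IsStack (Ψ '' Γ ∩ {z | z.2 ≤ t''}) (Ψ '' V ∩ {z | z.2 ≤ t''}) t'' ρ.target := by
  have hd : 0 < t'' - t' := sub_pos.2 h1
  obtain ⟨τ, hτ1, hτ2⟩ := exists_between h2
  set σ : ℝ → ℝ := fun y => max 0 (min 1 ((y - t') / (t'' - t'))) with hσ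
  have cσ : Continuous σ := by simp only [hσ]; fun_prop
  have σmem : ∀ y, σ y ∈ Icc (0 : ℝ) 1 := fun y =>
    ⟨le_max_left _ _, max_le zero_le_one (min_le_left _ _)⟩
  have σlow : ∀ y, y ≤ t' → σ y = 0 := fun y hy =>
    max_eq_left ((min_le_right _ _).trans (div_nonpos_of_nonpos_of_nonneg (by linarith) hd.le))
  have σeq : ∀ s ∈ Icc (0 : ℝ) 1, σ (t' + (t'' - t') * s) = s := by
    grind
  have hy : ∀ y, t' ≤ y → y ≤ t'' → y = t' + (t'' - t') * σ y := by
    intro y h1 h2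
    have : (y - t') / (t'' - t') ≤ 1 := by rw [div_le_one hd]; linarith
    simp only [hσ]
    rw [min_eq_right this, max_eq_right (div_nonneg (by linarith) hd.le),
      mul_div_cancel₀ _ hd.ne']
    ring
  set θ : ℝ → ℝ := fun y => max 0 (min 1 ((y - t'') / (τ - t''))) with hθ
  have cθ : Continuous θ := by simp only [hθ]; fun_prop
  have θ0 : ∀ y, 0 ≤ θ y := fun y => le_max_left _ _
  have θ1 : ∀ y, θ y ≤ 1 := fun y => max_le zero_le_one (min_le_left _ _)
  have θlow : ∀ y, y ≤ t'' → θ y = 0 := fun y hy => max_eq_left ((min_le_right _ _).trans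
    (div_nonpos_of_nonpos_of_nonneg (by linarith) (by linarith)))
  have θhigh : ∀ y, τ ≤ y → θ y = 1 := by
    intro y hy
    have : 1 ≤ (y - t'') / (τ - t'') := by rw [one_le_div (by linarith)]; linarith
    grind
  set F : ℕ → ℝ → ℝ := fun k y => G k (σ y) with hF
  set F' : ℕ → ℝ → ℝ := fun k y => θ y * G k (σ y) + (1 - θ y) * C k (σ y) with hF'
  have hC : Controls (N + 1) F F' := by
    refine ⟨fun k => (cG k).comp cσ, fun k => (cθ.mul ((cG k).comp cσ)).add
      ((continuous_const.sub cθ).mul ((cC k).comp cσ)), fun y => ⟨?_, ?_, ?_, ?_, ?_⟩⟩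
    · grind
    · intro k hk
      have := θ0 y
      have := θ1 y
      simp only [hF']
      rcases hG k (by omega) _ (σmem y) with h | h
      · nlinarith
      · rw [h.1, h.2]
    · intro k hk
      simp only [hF, hF']
      rcases hG k (by omega) _ (σmem y) with h | h
      · have a0 := θ0 y
        have a1 := θ1 y
        constructor
        · grind
        · intro e
          rcases a0.eq_or_lt with t | t
          · grind
          · nlinarith
      · simp [h.1, h.2]
    all_goals grind
  have hL := hC.isLevel
  set Ψ := hC.homeo
  have hlow : ∀ z : ℝ × ℝ, z.2 ≤ t' → Ψ z = z := fun z hz => by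
    refine hC.homeo_of_eq fun k hk => ?_
    grind
  have hmid : ∀ k ≤ N, ∀ s ∈ Icc (0 : ℝ) 1,
      Ψ (G k s, t' + (t'' - t') * s) = (C k s, t' + (t'' - t') * s) := by
    intro k hk s hs
    have := hC.homeo_control (k := k) (by omega) (t' + (t'' - t') * s)
    have e2 : θ (t' + (t'' - t') * s) = 0 := θlow _ (by nlinarith [hs.2])
    grind
  have key : ∀ (Q : Set (ℝ × ℝ)) (P : Set (ℝ × ℝ)) (A : ℕ → ℝ → Prop),
      (∀ z ∈ P, z.2 ∈ Icc (0 : ℝ) 1) →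
      (∀ s ∈ Icc (0 : ℝ) 1, ∀ x, (x, t' + (t'' - t') * s) ∈ Q ↔ ∃ k ≤ N, x = G k s ∧ A k s) →
      (∀ s ∈ Icc (0 : ℝ) 1, ∀ x, (x, s) ∈ P ↔ ∃ k ≤ N, x = C k s ∧ A k s) →
      Ψ '' Q ∩ {z | z.2 ≤ t''} = (Q ∩ {z | z.2 ≤ t'}) ∪ stackPlace t' t'' P := by
    intro Q P A hP hQ hPA
    have hslab : ∀ s ∈ Icc (0 : ℝ) 1, ∀ x, (x, t' + (t'' - t') * s) ∈ Ψ '' Q ↔ (x, s) ∈ P := by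
      intro s hs x
      rw [mem_image_homeo, hPA s hs]
      have e : Ψ.symm (x, t' + (t'' - t') * s) =
          ((Ψ.symm (x, t' + (t'' - t') * s)).1, t' + (t'' - t') * s) :=
        Prod.ext rfl (hL.symm_snd _)
      rw [e, hQ s hs]
      simp only [hL.fst_symm_eq_iff]
      refine exists_congr fun k => and_congr_right fun hk => ?_
      rw [hmid k hk s hs]
    ext ⟨x, y⟩
    simp only [mem_inter_iff, mem_ofPred_eq, mem_union]
    constructor
    · rintro ⟨hz, hy2⟩
      rcases le_or_gt y t' with hy1 | hy1
      · left
        refine ⟨?_, hy1⟩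
        rw [mem_image_homeo, Ψ.symm_apply_eq.2 (hlow (x, y) hy1).symm] at hz
        exact hz
      · right
        have e := hy y hy1.le hy2
        rw [e] at hz ⊢
        rw [mem_stackPlace h1]
        exact (hslab _ (σmem y) x).1 hz
    · rintro (⟨hz, hy1⟩ | hz)
      · exact ⟨⟨_, hz, hlow _ hy1⟩, by linarith⟩
      · have hb := stackPlace_subset h1 hP hz
        refine ⟨?_, hb.2⟩
        have e := hy y hb.1 hb.2
        rw [e] at hz ⊢
        rw [mem_stackPlace h1] at hz
        exact (hslab _ (σmem y) x).2 hz
  refine ⟨Ψ, hL, fun z hz => ?_, ?_⟩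
  · by_cases hx : z.1 ∈ Ioo (0 : ℝ) 1
    · by_cases hz1 : z.2 ≤ t'
      · exact hlow z hz1
      · have hz2 : 4 / 5 ≤ z.2 := by
          by_contra! hc
          exact hz ⟨hx, by have := hs.mem_Ioo.1; linarith, hc⟩
        refine hC.homeo_of_eq fun k hk => ?_
        grind
    · simp only [Set.mem_Ioo, not_and_or, not_lt] at hx
      rcases hx with hx | hx
      · refine hC.homeo_of_le ?_
        grind
      · refine hC.homeo_of_ge ?_
        grind
  · rw [key Γ ρ.strands A (fun z => Pattern.snd_mem_of_mem_strands) hΓ hρΓ,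
      key V ρ.vertices B (fun z => Pattern.snd_mem_of_mem_vertices) hV hρV]
    exact hs.extend rfl h1 h2

end DefectBord

namespace DefectBord

/-! ### Extending stacks upwards -/

/-- Up to height `t` the graph is a stack of pictures, after a homeomorphism preserving heights. -/
def Reach (Γ V : Set (ℝ × ℝ)) (t : ℝ) : Prop :=
  ∃ Φ : ℝ × ℝ ≃ₜ ℝ × ℝ, IsLevel Φ ∧ Supported Φ ∧
    ∃ n, IsStack (Φ '' Γ ∩ {z | z.2 ≤ t}) (Φ '' V ∩ {z | z.2 ≤ t}) t n

theorem Supported.fst_eq {Φ : ℝ × ℝ ≃ₜ ℝ × ℝ} (h : Supported Φ) {x : ℝ} (hx : x ≤ 0 ∨ 1 ≤ x)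
    (y : ℝ) : (Φ (x, y)).1 = x := by
  rw [h]
  rintro ⟨h1, -⟩
  grind

theorem Reach.step {Γ V : Set (ℝ × ℝ)} {t' t'' : ℝ} (h : Reach Γ V t') (h1 : t' < t'')
    (h2 : t'' < 4 / 5) {N : ℕ} {F : ℕ → ℝ → ℝ} {A B : ℕ → ℝ → Prop} (cF : ∀ k, Continuous (F k))
    (F0 : ∀ y, F 0 y = 0) (FN : ∀ y, F (N + 1) y = 1)
    (hΓ : ∀ s ∈ Icc (0 : ℝ) 1, ∀ x, (x, t' + (t'' - t') * s) ∈ Γ ↔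
      ∃ k ≤ N, x = F k (t' + (t'' - t') * s) ∧ A k s)
    (hV : ∀ s ∈ Icc (0 : ℝ) 1, ∀ x, (x, t' + (t'' - t') * s) ∈ V ↔
      ∃ k ≤ N, x = F k (t' + (t'' - t') * s) ∧ B k s)
    (hρ : ∀ (n : ℕ) (u : ℕ → ℝ), u 0 = 0 → u (N + 1) = 1 → (∀ k ≤ N, F k t' < F (k + 1) t' → u k < u (k + 1)) →
      (∀ k ≤ N, F k t' = F (k + 1) t' → u k = u (k + 1)) →
      (∀ x, (∃ k ≤ N, x = u k ∧ A k 0) ↔ ∃ k, 1 ≤ k ∧ k ≤ n ∧ x = tick n k) →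
      ∃ (ρ : Pattern) (C : ℕ → ℝ → ℝ), ρ.source = n ∧ (∀ k, Continuous (C k)) ∧
        (∀ s ∈ Icc (0 : ℝ) 1, C 0 s = 0 ∧ C (N + 1) s = 1) ∧
        (∀ k ≤ N, ∀ s ∈ Icc (0 : ℝ) 1,
          (F k (t' + (t'' - t') * s) < F (k + 1) (t' + (t'' - t') * s) ∧ C k s < C (k + 1) s) ∨
          (F k (t' + (t'' - t') * s) = F (k + 1) (t' + (t'' - t') * s) ∧ C k s = C (k + 1) s)) ∧
        (∀ k ≤ N + 1, u k = C k 0) ∧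
        (∀ s ∈ Icc (0 : ℝ) 1, ∀ x, (x, s) ∈ ρ.strands ↔ ∃ k ≤ N, x = C k s ∧ A k s) ∧
        (∀ s ∈ Icc (0 : ℝ) 1, ∀ x, (x, s) ∈ ρ.vertices ↔ ∃ k ≤ N, x = C k s ∧ B k s)) :
    Reach Γ V t'' := by
  obtain ⟨Φ, hΦ, hsupp, n, hst⟩ := h
  set G : ℕ → ℝ → ℝ := fun k s =>
    (Φ (F k (t' + (t'' - t') * s), t' + (t'' - t') * s)).1 with hG
  have himg : ∀ (Q : Set (ℝ × ℝ)) (A : ℕ → ℝ → Prop),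
      (∀ s ∈ Icc (0 : ℝ) 1, ∀ x, (x, t' + (t'' - t') * s) ∈ Q ↔
        ∃ k ≤ N, x = F k (t' + (t'' - t') * s) ∧ A k s) →
      ∀ s ∈ Icc (0 : ℝ) 1, ∀ x, (x, t' + (t'' - t') * s) ∈ Φ '' Q ↔
        ∃ k ≤ N, x = G k s ∧ A k s := by
    intro Q A hQ s hs x
    rw [mem_image_homeo]
    have e : Φ.symm (x, t' + (t'' - t') * s) =
        ((Φ.symm (x, t' + (t'' - t') * s)).1, t' + (t'' - t') * s) :=
      Prod.ext rfl (hΦ.symm_snd _)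
    rw [e, hQ s hs]
    simp only [hΦ.fst_symm_eq_iff, hG]
  have hΓ' := himg Γ A hΓ
  have hV' := himg V B hV
  have hs0 : (0 : ℝ) ∈ Icc (0 : ℝ) 1 := by simp
  have e0 : t' + (t'' - t') * 0 = t' := by ring
  obtain ⟨ρ, C, rfl, cC, hC0, hC, hst0, hρ1, hρ2⟩ := hρ n (fun k => G k 0)
    (by simp only [hG, F0]; exact hsupp.fst_eq (Or.inl le_rfl) _)
    (by simp only [hG, FN]; exact hsupp.fst_eq (Or.inr le_rfl) _)
    (fun k hk hlt => by simp only [hG, e0]; exact hΦ.mono _ hlt)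
    (fun k hk he => by simp only [hG, e0, he])
    (fun x => by
      rw [← hΓ' 0 hs0, ← hst.mem_top, e0]
      exact ⟨fun h => ⟨h, le_refl t'⟩, fun h => h.1⟩)
  obtain ⟨Ψ, hΨ, hΨs, hΨst⟩ := hst.step h1 h2 (G := G) (C := C) (N := N)
    (fun k => by
      simp only [hG]
      exact continuous_fst.comp (Φ.continuous.comp (((cF k).comp (by fun_prop)).prodMk
        (by fun_prop)))) cC
    (fun s hs => ⟨by simp only [hG, F0]; exact hsupp.fst_eq (Or.inl le_rfl) _, (hC0 s hs).1⟩)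
    (fun s hs => ⟨by simp only [hG, FN]; exact hsupp.fst_eq (Or.inr le_rfl) _, (hC0 s hs).2⟩)
    (fun k hk s hs => by
      rcases hC k hk s hs with h | h
      · exact Or.inl ⟨hΦ.mono _ h.1, h.2⟩
      · exact Or.inr ⟨by simp only [hG, h.1], h.2⟩)
    hst0 A B hΓ' hρ1 hV' hρ2
  refine ⟨Φ.trans Ψ, hΦ.trans hΨ, hsupp.trans hΨs, ρ.target, ?_⟩
  have e : ∀ A : Set (ℝ × ℝ), (Φ.trans Ψ) '' A = Ψ '' (Φ '' A) := fun A => by rw [image_image]; rfl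
  rwa [e, e]

theorem eq_of_sorted {p q : ℕ} {u v : ℕ → ℝ} (hu : ∀ k l, 1 ≤ k → k < l → l ≤ p → u k < u l)
    (hv : ∀ k l, 1 ≤ k → k < l → l ≤ q → v k < v l)
    (h : ∀ x, (∃ k, 1 ≤ k ∧ k ≤ p ∧ x = u k) ↔ ∃ k, 1 ≤ k ∧ k ≤ q ∧ x = v k) :
    p = q ∧ ∀ k, 1 ≤ k → k ≤ p → u k = v k := by
  have hr : ∀ (p : ℕ) (u : ℕ → ℝ) x, x ∈ range (fun k : Fin p => u (k + 1)) ↔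
      ∃ k, 1 ≤ k ∧ k ≤ p ∧ x = u k := by
    intro p u x
    constructor
    · grind
    · rintro ⟨k, h1, h2, rfl⟩
      exact ⟨⟨k - 1, by omega⟩, by simp only [Nat.sub_add_cancel h1]⟩
  have hm : ∀ (p : ℕ) (u : ℕ → ℝ), (∀ k l, 1 ≤ k → k < l → l ≤ p → u k < u l) →
      StrictMono (fun k : Fin p => u (k + 1)) := fun p u hu k l hkl =>
    hu _ _ (by omega) (by have := Fin.lt_def.1 hkl; omega) (by omega)
  have e : range (fun k : Fin p => u (k + 1)) = range (fun k : Fin q => v (k + 1)) := by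
    ext x
    rw [hr, hr, h]
  have hc := congrArg Set.ncard e
  rw [← image_univ, ← image_univ, ncard_image_of_injective _ (hm p u hu).injective,
    ncard_image_of_injective _ (hm q v hv).injective, ncard_univ, ncard_univ, Nat.card_fin,
    Nat.card_fin] at hc
  subst hc
  refine ⟨rfl, fun k h1 h2 => ?_⟩
  have := congrFun ((StrictMono.range_inj (hm p u hu) (hm p v hv)).1 e) ⟨k - 1, by omega⟩
  grind

theorem lt_of_succ {N : ℕ} {u : ℕ → ℝ} (hu : ∀ k ≤ N, u k < u (k + 1)) {k l : ℕ} (hkl : k < l)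
    (hl : l ≤ N + 1) : u k < u l := by
  induction l, hkl using Nat.le_induction with
  | base => exact hu k (by omega)
  | succ l hkl ih => exact (ih (by omega)).trans (hu l (by omega))

/-- Passing a slab without singular points. -/
theorem Reach.identity {Γ V : Set (ℝ × ℝ)} {t' t'' : ℝ} (h : Reach Γ V t') (h1 : t' < t'')
    (h2 : t'' < 4 / 5) {N : ℕ} {F : ℕ → ℝ → ℝ} (cF : ∀ k, Continuous (F k))
    (F0 : ∀ y, F 0 y = 0) (FN : ∀ y, F (N + 1) y = 1)
    (hF : ∀ y ∈ Icc t' t'', ∀ k ≤ N, F k y < F (k + 1) y)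
    (hΓ : ∀ y ∈ Icc t' t'', ∀ x, (x, y) ∈ Γ ↔ ∃ k, 1 ≤ k ∧ k ≤ N ∧ x = F k y)
    (hV : ∀ y ∈ Icc t' t'', ∀ x, (x, y) ∉ V) : Reach Γ V t'' := by
  have hy : ∀ s ∈ Icc (0 : ℝ) 1, t' + (t'' - t') * s ∈ Icc t' t'' := fun s hs =>
    ⟨by nlinarith [hs.1], by nlinarith [hs.2]⟩
  refine h.step h1 h2 (A := fun k _ => 1 ≤ k) (B := fun _ _ => False) cF F0 FN
    (fun s hs x => (hΓ _ (hy s hs) x).trans (exists_congr fun k => by tauto))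
    (fun s hs x => iff_of_false (hV _ (hy s hs) x) (by simp)) ?_
  intro n u u0 uN hu1 hu2 hu
  have hlt : ∀ k ≤ N, u k < u (k + 1) := fun k hk =>
    hu1 k hk (hF t' ⟨le_rfl, h1.le⟩ k hk)
  obtain ⟨rfl, e⟩ := eq_of_sorted (u := u) (v := tick n) (p := N) (q := n)
    (fun k l _ hkl hl => lt_of_succ hlt hkl (by omega)) (fun k l _ hkl _ => tick_lt hkl)
    (fun x => by rw [← hu]; exact exists_congr fun k => by tauto)
  refine ⟨Pattern.I N, fun k _ => tick N k, rfl, fun k => continuous_const,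
    fun s _ => ⟨tick_zero _, tick_last _⟩,
    fun k hk s hs => Or.inl ⟨hF _ (hy s hs) k hk, tick_lt (Nat.lt_succ_self k)⟩, fun k hk => ?_,
    fun s hs x => ?_, fun s hs x => ?_⟩
  · rcases Nat.eq_zero_or_pos k with rfl | hk0
    · exact u0.trans (tick_zero N).symm
    rcases hk.lt_or_eq with hk' | rfl
    · grind
    · exact uN.trans (tick_last N).symm
  · rw [Pattern.mem_strands_I]
    grind
  · simp [Pattern.vertices]

/-- Passing a slab in which two strands merge at a vertex. -/
theorem Reach.merge {Γ V : Set (ℝ × ℝ)} {c δ : ℝ} (h : Reach Γ V (c - δ)) (h1 : 0 < δ)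
    (h2 : c + δ < 4 / 5) {n j : ℕ} (hj0 : 1 ≤ j) (hj : j ≤ n + 1) {F : ℕ → ℝ → ℝ}
    (cF : ∀ k, Continuous (F k)) (F0 : ∀ y, F 0 y = 0) (FN : ∀ y, F (n + 3) y = 1)
    (hF : ∀ y ∈ Icc (c - δ) (c + δ), ∀ k ≤ n + 2, k ≠ j → F k y < F (k + 1) y)
    (hF1 : ∀ y ∈ Icc (c - δ) (c + δ), y < c → F j y < F (j + 1) y)
    (hF2 : ∀ y ∈ Icc (c - δ) (c + δ), c ≤ y → F j y = F (j + 1) y)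
    (hΓ : ∀ y ∈ Icc (c - δ) (c + δ), ∀ x, (x, y) ∈ Γ ↔ ∃ k, 1 ≤ k ∧ k ≤ n + 2 ∧ x = F k y)
    (hV : ∀ y ∈ Icc (c - δ) (c + δ), ∀ x, (x, y) ∈ V ↔ y = c ∧ x = F j y) :
    Reach Γ V (c + δ) := by
  have hy : ∀ s ∈ Icc (0 : ℝ) 1, c - δ + (c + δ - (c - δ)) * s ∈ Icc (c - δ) (c + δ) :=
    fun s hs => ⟨by nlinarith [hs.1], by nlinarith [hs.2]⟩
  have hlt : ∀ s, c - δ + (c + δ - (c - δ)) * s < c ↔ s < 1 / 2 := fun s =>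
    ⟨fun h => by nlinarith, fun h => by nlinarith⟩
  have heq : ∀ s, c - δ + (c + δ - (c - δ)) * s = c ↔ s = 1 / 2 := fun s =>
    ⟨fun h => by
      have : 2 * δ * (s - 1 / 2) = 0 := by linarith
      rcases mul_eq_zero.1 this with h | h <;> linarith, fun h => by rw [h]; ring⟩
  refine h.step (by linarith) h2 (N := n + 2) (A := fun k _ => 1 ≤ k)
    (B := fun k s => k = j ∧ s = 1 / 2) cF F0 FN
    (fun s hs x => (hΓ _ (hy s hs) x).trans (exists_congr fun k => by tauto))
    (fun s hs x => (hV _ (hy s hs) x).trans ?_) ?_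
  · grind
  intro m u u0 uN hu1 hu2 hu
  have hcd : c - δ ∈ Icc (c - δ) (c + δ) := ⟨le_rfl, by linarith⟩
  have hult : ∀ k ≤ n + 2, u k < u (k + 1) := fun k hk => hu1 k hk (by
    by_cases hkj : k = j
    · grind
    · exact hF _ hcd k hk hkj)
  obtain ⟨rfl, e⟩ := eq_of_sorted (u := u) (v := tick m) (p := n + 2) (q := m)
    (fun k l _ hkl hl => lt_of_succ hult hkl (by omega)) (fun k l _ hkl _ => tick_lt hkl)
    (fun x => by rw [← hu]; exact exists_congr fun k => by tauto)
  have hmem : ∀ s (hs : s ∈ Icc (0 : ℝ) 1) x, (x, s) ∈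
      (Pattern.mu n ⟨j - 1, by omega⟩).strands ↔ ∃ k ≤ n + 2, x = muCurve n j k s ∧ 1 ≤ k := by
    intro s hs x
    rw [Pattern.mem_strands_mu]
    grind
  refine ⟨Pattern.mu n ⟨j - 1, by omega⟩, muCurve n j, rfl,
    fun k => continuous_mergeCurve _ _ _ _ _, fun s _ =>
      ⟨muCurve_zero_left hj0 s, muCurve_last hj s⟩,
    fun k hk s hs => ?_, fun k hk => ?_, hmem, fun s hs x => ?_⟩
  · by_cases hkj : k = j
    · subst hkj
      rcases lt_or_ge s (1 / 2) with hs' | hs'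
      · exact Or.inl ⟨hF1 _ (hy s hs) ((hlt s).2 hs'),
          mergeCurve_lt_self (tick_lt (Nat.lt_succ_self k)) hs'⟩
      · exact Or.inr ⟨hF2 _ (hy s hs) (not_lt.1 fun hc => hs'.not_gt ((hlt s).1 hc)),
          mergeCurve_eq_self (by simp [muTop]) hs'⟩
    · exact Or.inl ⟨hF _ (hy s hs) k hk hkj, muCurve_lt hj hkj hs⟩
  · rw [muCurve, mergeCurve_zero]
    rcases Nat.eq_zero_or_pos k with rfl | hk0
    · rw [u0, tick_zero]
    rcases hk.lt_or_eq with hk' | rfl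
    · grind
    · rw [uN, tick_last]
  · rw [Pattern.mem_vertices_mu]
    grind

/-- Passing a slab with a local maximum of the height. -/
theorem Reach.cap {Γ V : Set (ℝ × ℝ)} {c δ : ℝ} (h : Reach Γ V (c - δ)) (h1 : 0 < δ)
    (h2 : c + δ < 4 / 5) {n j : ℕ} (hj0 : 1 ≤ j) (hj : j ≤ n + 1) {F : ℕ → ℝ → ℝ}
    (cF : ∀ k, Continuous (F k)) (F0 : ∀ y, F 0 y = 0) (FN : ∀ y, F (n + 3) y = 1)
    (hF : ∀ y ∈ Icc (c - δ) (c + δ), ∀ k ≤ n + 2, k ≠ j → F k y < F (k + 1) y)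
    (hF1 : ∀ y ∈ Icc (c - δ) (c + δ), y < c → F j y < F (j + 1) y)
    (hF2 : ∀ y ∈ Icc (c - δ) (c + δ), c ≤ y → F j y = F (j + 1) y)
    (hΓ : ∀ y ∈ Icc (c - δ) (c + δ), ∀ x, (x, y) ∈ Γ ↔ ∃ k, 1 ≤ k ∧ k ≤ n + 2 ∧ x = F k y ∧
      (k = j ∨ k = j + 1 → y ≤ c))
    (hV : ∀ y ∈ Icc (c - δ) (c + δ), ∀ x, (x, y) ∉ V) :
    Reach Γ V (c + δ) := by
  have hy : ∀ s ∈ Icc (0 : ℝ) 1, c - δ + (c + δ - (c - δ)) * s ∈ Icc (c - δ) (c + δ) :=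
    fun s hs => ⟨by nlinarith [hs.1], by nlinarith [hs.2]⟩
  have hlt : ∀ s, c - δ + (c + δ - (c - δ)) * s < c ↔ s < 1 / 2 := fun s =>
    ⟨fun h => by nlinarith, fun h => by nlinarith⟩
  have hle : ∀ s, c - δ + (c + δ - (c - δ)) * s ≤ c ↔ s ≤ 1 / 2 := fun s =>
    ⟨fun h => by nlinarith, fun h => by nlinarith⟩
  refine h.step (by linarith) h2 (N := n + 2)
    (A := fun k s => 1 ≤ k ∧ (k = j ∨ k = j + 1 → s ≤ 1 / 2))
    (B := fun _ _ => False) cF F0 FN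
    (fun s hs x => (hΓ _ (hy s hs) x).trans (exists_congr fun k => by rw [hle]; tauto))
    (fun s hs x => iff_of_false (hV _ (hy s hs) x) (by simp)) ?_
  intro m u u0 uN hu1 hu2 hu
  have hcd : c - δ ∈ Icc (c - δ) (c + δ) := ⟨le_rfl, by linarith⟩
  have hult : ∀ k ≤ n + 2, u k < u (k + 1) := fun k hk => hu1 k hk (by
    by_cases hkj : k = j
    · grind
    · exact hF _ hcd k hk hkj)
  obtain ⟨rfl, e⟩ := eq_of_sorted (u := u) (v := tick m) (p := n + 2) (q := m)
    (fun k l _ hkl hl => lt_of_succ hult hkl (by omega)) (fun k l _ hkl _ => tick_lt hkl)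
    (fun x => by
      rw [← hu]
      refine exists_congr fun k => ?_
      have : (0 : ℝ) ≤ 1 / 2 := by norm_num
      tauto)
  obtain ⟨p, hp⟩ := exists_between (tick_lt (n := n) (show j - 1 < j by omega))
  have hi : j - 1 < n + 1 := by omega
  refine ⟨Pattern.beta n ⟨j - 1, hi⟩, betaCurve n j p, rfl,
    fun k => continuous_mergeCurve _ _ _ _ _, fun s _ =>
      ⟨betaCurve_zero_left p hj0 s, betaCurve_last p hj s⟩,
    fun k hk s hs => ?_, fun k hk => ?_, fun s hs x => ?_, fun s hs x => ?_⟩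
  · by_cases hkj : k = j
    · subst hkj
      rcases lt_or_ge s (1 / 2) with hs' | hs'
      · exact Or.inl ⟨hF1 _ (hy s hs) ((hlt s).2 hs'),
          mergeCurve_lt_self (tick_lt (Nat.lt_succ_self k)) hs'⟩
      · exact Or.inr ⟨hF2 _ (hy s hs) (not_lt.1 fun hc => hs'.not_gt ((hlt s).1 hc)),
          mergeCurve_eq_self (by simp [betaEnd]) hs'⟩
    · exact Or.inl ⟨hF _ (hy s hs) k hk hkj, betaCurve_lt hj0 hj hp hkj hs⟩
  · rw [betaCurve, mergeCurve_zero]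
    rcases Nat.eq_zero_or_pos k with rfl | hk0
    · rw [u0, tick_zero]
    rcases hk.lt_or_eq with hk' | rfl
    · grind
    · rw [uN, tick_last]
  · refine (Pattern.mem_betaStrands hi p).trans ?_
    grind
  · simp [Pattern.vertices]

/-- Passing a slab with a local minimum of the height. -/
theorem Reach.cup {Γ V : Set (ℝ × ℝ)} {c δ : ℝ} (h : Reach Γ V (c - δ)) (h1 : 0 < δ)
    (h2 : c + δ < 4 / 5) {n j : ℕ} (hj0 : 1 ≤ j) (hj : j ≤ n + 1) {F : ℕ → ℝ → ℝ}
    (cF : ∀ k, Continuous (F k)) (F0 : ∀ y, F 0 y = 0) (FN : ∀ y, F (n + 3) y = 1)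
    (hF : ∀ y ∈ Icc (c - δ) (c + δ), ∀ k ≤ n + 2, k ≠ j → F k y < F (k + 1) y)
    (hF1 : ∀ y ∈ Icc (c - δ) (c + δ), c < y → F j y < F (j + 1) y)
    (hF2 : ∀ y ∈ Icc (c - δ) (c + δ), y ≤ c → F j y = F (j + 1) y)
    (hΓ : ∀ y ∈ Icc (c - δ) (c + δ), ∀ x, (x, y) ∈ Γ ↔ ∃ k, 1 ≤ k ∧ k ≤ n + 2 ∧ x = F k y ∧
      (k = j ∨ k = j + 1 → c ≤ y))
    (hV : ∀ y ∈ Icc (c - δ) (c + δ), ∀ x, (x, y) ∉ V) :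
    Reach Γ V (c + δ) := by
  have hy : ∀ s ∈ Icc (0 : ℝ) 1, c - δ + (c + δ - (c - δ)) * s ∈ Icc (c - δ) (c + δ) :=
    fun s hs => ⟨by nlinarith [hs.1], by nlinarith [hs.2]⟩
  have hlt : ∀ s, c < c - δ + (c + δ - (c - δ)) * s ↔ 1 / 2 < s := fun s =>
    ⟨fun h => by nlinarith, fun h => by nlinarith⟩
  have hle : ∀ s, c ≤ c - δ + (c + δ - (c - δ)) * s ↔ 1 / 2 ≤ s := fun s =>
    ⟨fun h => by nlinarith, fun h => by nlinarith⟩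
  refine h.step (by linarith) h2 (N := n + 2)
    (A := fun k s => 1 ≤ k ∧ (k = j ∨ k = j + 1 → 1 / 2 ≤ s))
    (B := fun _ _ => False) cF F0 FN
    (fun s hs x => (hΓ _ (hy s hs) x).trans (exists_congr fun k => by rw [hle]; tauto))
    (fun s hs x => iff_of_false (hV _ (hy s hs) x) (by simp)) ?_
  intro m u u0 uN hu1 hu2 hu
  have hcd : c - δ ∈ Icc (c - δ) (c + δ) := ⟨le_rfl, by linarith⟩
  have hult : ∀ k ≤ n + 2, k ≠ j → u k < u (k + 1) := fun k hk hkj => hu1 k hk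
    (hF _ hcd k hk hkj)
  have hueq : u j = u (j + 1) := hu2 j (by omega) (hF2 _ hcd (by linarith))
  set v : ℕ → ℝ := fun k => if k < j then u k else u (k + 2) with hv
  have hvlt : ∀ k ≤ n, v k < v (k + 1) := by
    grind
  obtain ⟨rfl, e⟩ := eq_of_sorted (u := v) (v := tick m) (p := n) (q := m)
    (fun k l _ hkl hl => lt_of_succ hvlt hkl (by omega)) (fun k l _ hkl _ => tick_lt hkl)
    (fun x => by
      rw [← hu]
      have : ¬ (1 / 2 : ℝ) ≤ 0 := by norm_num
      constructor
      · grind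
      · rintro ⟨k, hk1, rfl, hk2, hk3⟩
        have hk4 : k ≠ j ∧ k ≠ j + 1 := by tauto
        rcases lt_or_ge k j with h | h
        · grind
        · refine ⟨k - 2, by omega, by omega, ?_⟩
          simp only [hv]
          rw [if_neg (by omega), show k - 2 + 2 = k by omega])
  have hv0 : ∀ k ≤ n + 1, v k = tick n k := by
    intro k hk
    rcases Nat.eq_zero_or_pos k with rfl | hk0
    · simp only [hv]; rw [if_pos (by omega), u0, tick_zero]
    rcases hk.lt_or_eq with hk' | rfl
    · grind
    · simp only [hv]; rw [if_neg (by omega), uN, tick_last]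
  have hp : u j ∈ Ioo (tick n (j - 1)) (tick n j) := by
    grind
  have hi : j - 1 < n + 1 := by omega
  have hs' : ∀ s ∈ Icc (0 : ℝ) 1, 1 - s ∈ Icc (0 : ℝ) 1 := fun s hs =>
    ⟨by linarith [hs.2], by linarith [hs.1]⟩
  refine ⟨Pattern.gamma n ⟨j - 1, hi⟩, fun k s => betaCurve n j (u j) k (1 - s), rfl,
    fun k => (continuous_mergeCurve _ _ _ _ _).comp (by fun_prop), fun s _ =>
      ⟨betaCurve_zero_left _ hj0 _, betaCurve_last _ hj _⟩,
    fun k hk s hs => ?_, fun k hk => ?_, fun s hs x => ?_, fun s hs x => ?_⟩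
  · by_cases hkj : k = j
    · subst hkj
      rcases lt_or_ge (1 / 2) s with hs' | hs'
      · exact Or.inl ⟨hF1 _ (hy s hs) ((hlt s).2 hs'),
          mergeCurve_lt_self (tick_lt (Nat.lt_succ_self k)) (by linarith)⟩
      · exact Or.inr ⟨hF2 _ (hy s hs) (not_lt.1 fun hc => hs'.not_gt ((hlt s).1 hc)),
          mergeCurve_eq_self (by simp [betaEnd]) (by linarith)⟩
    · exact Or.inl ⟨hF _ (hy s hs) k hk hkj, betaCurve_lt hj0 hj hp hkj (hs' s hs)⟩
  · simp only [sub_zero]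
    rw [betaCurve, mergeCurve_one, betaEnd]
    split_ifs with h1 h2
    · grind
    · rcases (show k = j ∨ k = j + 1 by omega) with rfl | rfl
      all_goals grind
    grind
  · refine (Pattern.mem_betaStrands hi (u j) (x := x) (s := 1 - s)).trans ?_
    simp only [Nat.sub_add_cancel hj0]
    grind
  · simp [Pattern.vertices]

end DefectBord

namespace DefectBord

/-! ### Slabs around a level -/

theorem eventually_fiber {Γ : Set (ℝ × ℝ)} (hc : IsClosed Γ) (hb : Γ ⊆ region) {c : ℝ} {N : ℕ}
    {F : ℕ → ℝ → ℝ} (cF : ∀ k, Continuous (F k)) {A : ℕ → ℝ → Prop}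
    (hfib : ∀ x, (x, c) ∈ Γ → ∃ k, 1 ≤ k ∧ k ≤ N ∧ F k c = x)
    (hloc : ∀ k, 1 ≤ k → k ≤ N → ∀ᶠ w : ℝ × ℝ in 𝓝 (F k c, c), w ∈ Γ ↔
      ∃ l, 1 ≤ l ∧ l ≤ N ∧ F l c = F k c ∧ w.1 = F l w.2 ∧ A l w.2) :
    ∀ᶠ y in 𝓝 c, ∀ x, (x, y) ∈ Γ ↔ ∃ k, 1 ≤ k ∧ k ≤ N ∧ x = F k y ∧ A k y := by
  have h1 : ∀ᶠ y in 𝓝 c, ∀ x ∈ Icc (0 : ℝ) 1, (x, y) ∈ Γ →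
      ∃ k, 1 ≤ k ∧ k ≤ N ∧ x = F k y ∧ A k y := by
    refine isCompact_Icc.eventually_forall_of_forall_eventually fun x _ => ?_
    have hsw : Filter.Tendsto (fun z : ℝ × ℝ => (z.2, z.1)) (𝓝 (c, x)) (𝓝 (x, c)) :=
      (continuous_snd.prodMk continuous_fst).tendsto (c, x)
    by_cases hx : (x, c) ∈ Γ
    · obtain ⟨k, hk1, hk2, rfl⟩ := hfib x hx
      filter_upwards [hsw.eventually (hloc k hk1 hk2)] with z hz hzΓ
      grind
    · filter_upwards [hsw.eventually (hc.isOpen_compl.mem_nhds hx)] with z hz hzΓ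
      exact absurd hzΓ hz
  have h2 : ∀ᶠ y in 𝓝 c, ∀ k ∈ Finset.Icc 1 N, A k y → (F k y, y) ∈ Γ := by
    rw [Filter.eventually_all_finset]
    intro k hk
    rw [Finset.mem_Icc] at hk
    have ht : Filter.Tendsto (fun y => (F k y, y)) (𝓝 c) (𝓝 (F k c, c)) :=
      ((cF k).prodMk continuous_id).tendsto c
    filter_upwards [ht.eventually (hloc k hk.1 hk.2)] with y hy hA
    grind
  filter_upwards [h1, h2] with y hy1 hy2 x
  constructor
  · intro hx
    have := (hb hx).1
    grind
  grind

theorem exists_sorted {S : Set ℝ} (hS : S.Finite) (h : S ⊆ Ioo 0 1) :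
    ∃ (r : ℕ) (X : ℕ → ℝ), X 0 = 0 ∧ X (r + 1) = 1 ∧ (∀ k ≤ r, X k < X (k + 1)) ∧
      ∀ x, x ∈ S ↔ ∃ k, 1 ≤ k ∧ k ≤ r ∧ x = X k := by
  set s := hS.toFinset
  set o := s.orderEmbOfFin rfl
  have ho : ∀ k, o k ∈ S := fun k => hS.mem_toFinset.1 (s.orderEmbOfFin_mem rfl k)
  obtain ⟨Y, Y0, Y1, Y2⟩ : ∃ Y : ℕ → ℝ, Y 0 = 0 ∧ Y (s.card + 1) = 1 ∧
      ∀ k : Fin s.card, Y (k + 1) = o k :=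
    ⟨fun k : ℕ => if hk : 1 ≤ k ∧ k ≤ s.card then o ⟨k - 1, Nat.sub_one_lt_of_le hk.1 hk.2⟩ else
      if k = 0 then 0 else 1,
      by simp, by simp, fun k => by
        have : 1 ≤ (k : ℕ) + 1 ∧ (k : ℕ) + 1 ≤ s.card := ⟨Nat.le_add_left _ _, k.2⟩
        simp only [dif_pos this]
        rfl⟩
  have hY : ∀ k, ∀ h1 : 1 ≤ k, ∀ h : k ≤ s.card, Y k = o ⟨k - 1, Nat.sub_one_lt_of_le h1 h⟩ := by
    grind
  have hY' : ∀ k, 1 ≤ k → k ≤ s.card → Y k ∈ S := fun k h1 h2 => by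
    grind
  refine ⟨s.card, Y, Y0, Y1, fun k hk => ?_, fun x => ?_⟩
  · rcases Nat.eq_zero_or_pos k with rfl | hk0
    · grind
    · rcases hk.lt_or_eq with h1 | rfl
      · rw [hY k hk0 hk, hY (k + 1) (by omega) h1]
        exact o.strictMono (Fin.lt_def.2 (show k - 1 < k + 1 - 1 by omega))
      grind
  · constructor
    · intro hx
      have : x ∈ range o := by
        rw [s.range_orderEmbOfFin rfl]; exact hS.mem_toFinset.2 hx
      obtain ⟨k, rfl⟩ := this
      grind
    grind

theorem TypedGraph.finite_fiber {Γ V : Set (ℝ × ℝ)} (h : TypedGraph Γ V) (c : ℝ) :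
    {x | (x, c) ∈ Γ}.Finite := by
  have hcomp : IsCompact {z : ℝ × ℝ | z ∈ Γ ∧ z.2 = c} :=
    h.isCompact.inter_right (isClosed_eq continuous_snd continuous_const)
  have hf : {z : ℝ × ℝ | z ∈ Γ ∧ z.2 = c}.Finite := by
    by_contra hinf
    obtain ⟨z, hz, hacc⟩ := Set.Infinite.exists_accPt_of_subset_isCompact hinf hcomp subset_rfl
    obtain ⟨p, q, g, k, -, -, -, -, -, -, H⟩ := h.exists_hasType hz.1
    obtain ⟨w, hw, hS⟩ := ((accPt_iff_frequently.1 hacc).and_eventually H).exists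
    grind
  refine (hf.image Prod.fst).subset fun x hx => ⟨(x, c), ⟨hx, rfl⟩, rfl⟩

theorem TypedGraph.exists_fiber {Γ V : Set (ℝ × ℝ)} (h : TypedGraph Γ V) (c : ℝ) :
    ∃ (r : ℕ) (X : ℕ → ℝ), X 0 = 0 ∧ X (r + 1) = 1 ∧ (∀ k ≤ r, X k < X (k + 1)) ∧
      ∀ x, (x, c) ∈ Γ ↔ ∃ k, 1 ≤ k ∧ k ≤ r ∧ x = X k :=
  exists_sorted (h.finite_fiber c) fun _ hx => (h.subset_region hx).1

theorem eventually_lt_of_lt {N : ℕ} {F : ℕ → ℝ → ℝ} (cF : ∀ k, Continuous (F k)) {c : ℝ}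
    {P : ℕ → Prop} (h : ∀ k ≤ N, P k → F k c < F (k + 1) c) :
    ∀ᶠ y in 𝓝 c, ∀ k ≤ N, P k → F k y < F (k + 1) y := by
  have : ∀ᶠ y in 𝓝 c, ∀ k ∈ Finset.range (N + 1), P k → F k y < F (k + 1) y := by
    rw [Filter.eventually_all_finset]
    intro k hk
    by_cases hP : P k
    · filter_upwards [(isOpen_lt (cF k) (cF (k + 1))).mem_nhds
        (h k (Nat.lt_succ_iff.1 (Finset.mem_range.1 hk)) hP)] with y hy _ using hy
    · exact Filter.Eventually.of_forall fun y h => absurd h hP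
  grind

theorem TypedGraph.exists_strands {Γ V : Set (ℝ × ℝ)} (_ : TypedGraph Γ V) {c : ℝ} {r : ℕ}
    {X : ℕ → ℝ} (P : ℕ → Prop) (hX : ∀ k, 1 ≤ k → k ≤ r → P k → HasType Γ 1 1 (X k, c)) :
    ∃ f : ℕ → ℝ → ℝ, ∀ k, Continuous (f k) ∧ f k c = X k ∧
      (1 ≤ k → k ≤ r → P k → ∀ᶠ w : ℝ × ℝ in 𝓝 (X k, c), w ∈ Γ ↔ w.1 = f k w.2) ∧
      (¬(1 ≤ k ∧ k ≤ r) → ∀ y, f k y = X k) := by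
  have : ∀ k, ∃ f : ℝ → ℝ, Continuous f ∧ f c = X k ∧
      (1 ≤ k → k ≤ r → P k → ∀ᶠ w : ℝ × ℝ in 𝓝 (X k, c), w ∈ Γ ↔ w.1 = f w.2) ∧
      (¬(1 ≤ k ∧ k ≤ r) → ∀ y, f y = X k) := by
    intro k
    by_cases hk : 1 ≤ k ∧ k ≤ r ∧ P k
    · obtain ⟨f, h1, h2, h3⟩ := (hX k hk.1 hk.2.1 hk.2.2).exists_graph
      grind
    · exact ⟨fun _ => X k, continuous_const, rfl, fun h1 h2 h3 => absurd ⟨h1, h2, h3⟩ hk,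
        fun _ _ => rfl⟩
  choose f hf using this
  exact ⟨f, hf⟩

theorem TypedGraph.eventually_notMem {Γ V : Set (ℝ × ℝ)} (h : TypedGraph Γ V) (c : ℝ) :
    ∀ᶠ y in 𝓝 c, y ≠ c → ∀ x, (x, y) ∉ V := by
  have hf : (Prod.snd '' V \ {c}).Finite := (h.finite.image _).sdiff
  filter_upwards [hf.isClosed.isOpen_compl.mem_nhds (show c ∈ _ by simp)] with y hy hne x hx
  grind

/-- There are no singular points near a level without singular points. -/
theorem TypedGraph.exists_regular_slab {Γ V : Set (ℝ × ℝ)} (h : TypedGraph Γ V) {c : ℝ}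
    (hc : ∀ x, ¬ IsSingular Γ V (x, c)) :
    ∃ ε > 0, ∀ t' t'', c - ε < t' → t' < t'' → t'' < c + ε → t'' < 4 / 5 → Reach Γ V t' →
      Reach Γ V t'' := by
  obtain ⟨r, X, X0, X1, hX, hfib⟩ := h.exists_fiber c
  have hreg : ∀ x, (x, c) ∈ Γ → HasType Γ 1 1 (x, c) := by
    intro x hx
    by_contra hn
    exact hc x ⟨hx, Or.inr hn⟩
  obtain ⟨f, hf⟩ := h.exists_strands (r := r) (X := X) (fun _ => True)
    fun k h1 h2 _ => hreg _ ((hfib _).2 ⟨k, h1, h2, rfl⟩)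
  have hinj : ∀ k l, k < l → l ≤ r + 1 → X k < X l := fun k l => lt_of_succ hX
  have E1 := eventually_fiber h.isCompact.isClosed h.subset_region (c := c) (N := r)
    (fun k => (hf k).1) (A := fun _ _ => True)
    (fun x hx => by
      obtain ⟨k, h1, h2, rfl⟩ := (hfib x).1 hx
      exact ⟨k, h1, h2, (hf k).2.1⟩)
    (fun k h1 h2 => by
      simp only [(hf _).2.1]
      filter_upwards [(hf k).2.2.1 h1 h2 trivial] with w hw
      rw [hw]
      constructor
      · grind
      · rintro ⟨l, h3, h4, e, e', -⟩
        rcases lt_trichotomy k l with hkl | rfl | hkl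
        · grind
        · exact e'
        · exact absurd e (hinj l k hkl (by omega)).ne)
  have E2 := eventually_lt_of_lt (N := r) (fun k => (hf k).1) (c := c) (P := fun _ => True)
    (fun k hk _ => by rw [(hf k).2.1, (hf (k + 1)).2.1]; exact hX k hk)
  obtain ⟨ε, hε, hball⟩ := Metric.eventually_nhds_iff_ball.1
    (E1.and (E2.and (h.eventually_notMem c)))
  refine ⟨ε, hε, fun t' t'' h1 h2 h3 h4 hR => ?_⟩
  have hy : ∀ y ∈ Icc t' t'', y ∈ ball c ε := by
    intro y hy
    rw [Real.ball_eq_Ioo]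
    grind
  refine hR.identity h2 h4 (N := r) (F := f) (fun k => (hf k).1) (fun y => ?_) (fun y => ?_)
    (fun y hy' k hk => (hball y (hy y hy')).2.1 k hk trivial)
    (fun y hy' x => ((hball y (hy y hy')).1 x).trans (exists_congr fun k => by tauto))
    (fun y hy' x hx => ?_)
  · grind
  · grind
  · by_cases hyc : y = c
    · subst hyc
      exact hc x ⟨h.subset hx, Or.inl hx⟩
    grind

/-- The strands near a level with one point where two strands meet. -/
theorem TypedGraph.exists_pair_slab {Γ V : Set (ℝ × ℝ)} (h : TypedGraph Γ V) {z : ℝ × ℝ}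
    (hz : z ∈ Γ) (hreg : ∀ x, (x, z.2) ∈ Γ → x ≠ z.1 → HasType Γ 1 1 (x, z.2)) {G₀ G₁ : ℝ → ℝ}
    (c0 : Continuous G₀) (c1 : Continuous G₁) (e0 : G₀ z.2 = z.1) (e1 : G₁ z.2 = z.1)
    {P Q : ℝ → Prop}
    (hloc : ∀ᶠ w in 𝓝 z, w ∈ Γ ↔ (w.1 = G₀ w.2 ∨ w.1 = G₁ w.2) ∧ P w.2)
    (hQ : ∀ᶠ y in 𝓝 z.2, (Q y → G₀ y < G₁ y) ∧ (¬ Q y → G₀ y = G₁ y)) :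
    ∃ (n j : ℕ) (F : ℕ → ℝ → ℝ), 1 ≤ j ∧ j ≤ n + 1 ∧ (∀ k, Continuous (F k)) ∧ (∀ y, F 0 y = 0) ∧
      (∀ y, F (n + 3) y = 1) ∧ F j z.2 = z.1 ∧
      ∀ᶠ y in 𝓝 z.2, (∀ k ≤ n + 2, k ≠ j → F k y < F (k + 1) y) ∧ (Q y → F j y < F (j + 1) y) ∧
        (¬ Q y → F j y = F (j + 1) y) ∧ ∀ x, (x, y) ∈ Γ ↔ ∃ k, 1 ≤ k ∧ k ≤ n + 2 ∧ x = F k y ∧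
          (k = j ∨ k = j + 1 → P y) := by
  obtain ⟨r, X, X0, X1, hX, hfib⟩ := h.exists_fiber z.2
  obtain ⟨j, hj1, hj2, hj⟩ := (hfib z.1).1 hz
  have hinj : ∀ k l, k < l → l ≤ r + 1 → X k < X l := fun k l => lt_of_succ hX
  have hne : ∀ k l, k ≤ r + 1 → l ≤ r + 1 → X k = X l → k = l := by
    intro k l hk hl e
    rcases lt_trichotomy k l with hkl | rfl | hkl
    all_goals grind
  obtain ⟨f, hf⟩ := h.exists_strands (c := z.2) (r := r) (X := X) (fun k => k ≠ j)
    fun k h1 h2 h3 => hreg _ ((hfib _).2 ⟨k, h1, h2, rfl⟩)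
      (fun e => h3 (hne k j (by omega) (by omega) (by rw [e, hj])))
  obtain ⟨n, rfl⟩ : ∃ n, r = n + 1 := ⟨r - 1, by omega⟩
  set d : ℕ → ℕ := fun k => if k ≤ j then k else k - 1 with hd
  set F : ℕ → ℝ → ℝ := fun k => if k = j then G₀ else if k = j + 1 then G₁ else f (d k) with hF
  have Fj : F j = G₀ := by simp [hF]
  have Fj1 : F (j + 1) = G₁ := by simp [hF]
  have Fne : ∀ k, k ≠ j → k ≠ j + 1 → F k = f (d k) := fun k h1 h2 => by simp [hF, h1, h2]
  have cF : ∀ k, Continuous (F k) := by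
    intro k
    simp only [hF]
    split_ifs
    all_goals grind
  have Fc : ∀ k, F k z.2 = X (d k) := by
    intro k
    by_cases h1 : k = j
    · grind
    by_cases h2 : k = j + 1
    · subst h2; rw [Fj1, e1, hj]; simp [hd]
    grind
  have dle : ∀ k, 1 ≤ k → k ≤ n + 2 → 1 ≤ d k ∧ d k ≤ n + 1 := by
    intro k h1 h2
    simp only [hd]
    split_ifs <;> omega
  have E1 := eventually_fiber h.isCompact.isClosed h.subset_region (c := z.2) (N := n + 2)
    cF (A := fun k y => k = j ∨ k = j + 1 → P y)
    (fun x hx => by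
      obtain ⟨k, h1, h2, rfl⟩ := (hfib x).1 hx
      rcases le_or_gt k j with h3 | h3
      · grind
      · refine ⟨k + 1, by omega, by omega, ?_⟩
        rw [Fc]; simp only [hd]; rw [if_neg (by omega), Nat.add_sub_cancel])
    (fun k h1 h2 => by
      have hd1 := dle k h1 h2
      have hFl : ∀ l, 1 ≤ l → l ≤ n + 2 → F l z.2 = F k z.2 → d l = d k := by
        grind
      by_cases hkj : k = j ∨ k = j + 1
      · have hdk : d k = j := by
          simp only [hd]; split_ifs <;> omega
        have ez : (F k z.2, z.2) = z := by rw [Fc, hdk, ← hj]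
        rw [ez]
        filter_upwards [hloc] with w hw
        rw [hw]
        constructor
        · rintro ⟨e | e, hP⟩
          · exact ⟨j, hj1, by omega, by rw [Fc, Fc, hdk]; simp [hd], by rw [Fj, e], fun _ => hP⟩
          · exact ⟨j + 1, by omega, by omega, by rw [Fc, Fc, hdk]; simp [hd], by rw [Fj1, e],
              fun _ => hP⟩
        · rintro ⟨l, h3, h4, e, e', hP⟩
          have hl := hFl l h3 h4 e
          rw [hdk] at hl
          have hl' : l = j ∨ l = j + 1 := by
            simp only [hd] at hl; split_ifs at hl <;> omega
          refine ⟨?_, hP hl'⟩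
          rcases hl' with rfl | rfl
          all_goals grind
      · have hdk : d k ≠ j := by
          simp only [hd]; split_ifs <;> omega
        rw [Fc]
        filter_upwards [(hf (d k)).2.2.1 hd1.1 hd1.2 hdk] with w hw
        rw [hw]
        constructor
        · grind
        · rintro ⟨l, h3, h4, e, e', -⟩
          have hl := hFl l h3 h4 (by rw [e, Fc])
          have : l = k := by
            simp only [hd] at hl hdk; split_ifs at hl hdk <;> omega
          subst this
          rw [e', Fne l (by tauto) (by tauto)])
  have E2 := eventually_lt_of_lt (N := n + 2) cF (c := z.2) (P := fun k => k ≠ j)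
    (fun k hk hkj => by
      rw [Fc, Fc]
      refine hinj _ _ ?_ ?_ <;>
      · simp only [hd]; split_ifs <;> omega)
  refine ⟨n, j, F, hj1, by omega, cF, fun y => ?_, fun y => ?_, by rw [Fj, e0], ?_⟩
  · rw [Fne 0 (by omega) (by omega), (hf _).2.2.2 (by simp [hd])]
    simp [hd, X0]
  · have : d (n + 3) = n + 1 + 1 := by simp only [hd]; rw [if_neg (by omega)]; omega
    rw [Fne _ (by omega) (by omega), this, (hf _).2.2.2 (by omega), X1]
  · filter_upwards [E1, E2, hQ] with y h1 h2 h3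
    grind

end DefectBord

namespace DefectBord

theorem Icc_subset_ball {c ε δ : ℝ} (h : δ < ε) {y : ℝ} (hy : y ∈ Icc (c - δ) (c + δ)) :
    y ∈ ball c ε := by
  rw [Real.ball_eq_Ioo]
  grind

theorem GenericGraph.exists_vertex_slab {Γ V : Set (ℝ × ℝ)} (h : GenericGraph Γ V) {z : ℝ × ℝ}
    (hz : z ∈ V) : ∃ ε > 0, ∀ δ, 0 < δ → δ < ε → z.2 + δ < 4 / 5 → Reach Γ V (z.2 - δ) →
      Reach Γ V (z.2 + δ) := by
  have hs : IsSingular Γ V z := ⟨h.subset hz, Or.inl hz⟩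
  obtain ⟨g, k, cg, ck, eg, ek, mg, -, H⟩ := h.vertex_type z hz
  obtain ⟨n, j, F, hj1, hj2, cF, F0, F1, hFj, hF⟩ := h.toTypedGraph.exists_pair_slab hs.1
    (fun x hx hne => by
      by_contra hn
      exact hne (congrArg Prod.fst (h.heights (x, z.2) z ⟨hx, Or.inr hn⟩ hs rfl)))
    (G₀ := fun y => g 0 (min y z.2) + k 0 (max y z.2) - z.1)
    (G₁ := fun y => g 1 (min y z.2) + k 0 (max y z.2) - z.1)
    (by have := cg 0; have := ck 0; fun_prop) (by have := cg 1; have := ck 0; fun_prop)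
    (by simp [eg, ek]) (by simp [eg, ek]) (P := fun _ => True) (Q := fun y => y < z.2)
    (by
      filter_upwards [H] with w hw
      rw [hw]
      rcases lt_trichotomy w.2 z.2 with hl | hl | hl
      · simp [hl, hl.le, hl.not_gt, Prod.ext_iff, hl.ne, ek, Fin.exists_fin_two]
      · grind
      · simp [hl, hl.le, hl.not_gt, Prod.ext_iff, hl.ne', eg])
    (by
      filter_upwards [eventually_nhdsWithin_iff.1 mg] with y hy
      constructor
      · intro hl
        have := hy hl (show (0 : Fin 2) < 1 by decide)
        grind
      · intro hl
        rw [min_eq_right (not_lt.1 hl), eg, eg])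
  obtain ⟨ε, hε, hball⟩ := Metric.eventually_nhds_iff_ball.1
    (hF.and (h.toTypedGraph.eventually_notMem z.2))
  refine ⟨ε, hε, fun δ h0 h1 h2 hR => ?_⟩
  have hb : ∀ y ∈ Icc (z.2 - δ) (z.2 + δ), _ := fun y hy => hball y (Icc_subset_ball h1 hy)
  refine hR.merge h0 h2 hj1 hj2 cF F0 F1 (fun y hy => (hb y hy).1.1) (fun y hy => (hb y hy).1.2.1)
    (fun y hy hl => (hb y hy).1.2.2.1 (not_lt.2 hl)) (fun y hy x => ?_) (fun y hy x => ?_)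
  · grind
  · by_cases hyz : y = z.2
    · subst hyz
      rw [hFj]
      refine ⟨fun hx => ⟨rfl, congrArg Prod.fst
        (h.heights (x, z.2) z ⟨h.subset hx, Or.inl hx⟩ hs rfl)⟩, ?_⟩
      grind
    grind

theorem GenericGraph.exists_cap_slab {Γ V : Set (ℝ × ℝ)} (h : GenericGraph Γ V) {z : ℝ × ℝ}
    (hs : IsSingular Γ V z) (hV : z ∉ V) (ht : HasType Γ 2 0 z) :
    ∃ ε > 0, ∀ δ, 0 < δ → δ < ε → z.2 + δ < 4 / 5 → Reach Γ V (z.2 - δ) →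
      Reach Γ V (z.2 + δ) := by
  obtain ⟨g, k, cg, -, eg, -, mg, -, H⟩ := ht
  obtain ⟨n, j, F, hj1, hj2, cF, F0, F1, hFj, hF⟩ := h.toTypedGraph.exists_pair_slab hs.1
    (fun x hx hne => by
      by_contra hn
      exact hne (congrArg Prod.fst (h.heights (x, z.2) z ⟨hx, Or.inr hn⟩ hs rfl)))
    (G₀ := fun y => g 0 (min y z.2)) (G₁ := fun y => g 1 (min y z.2))
    (by have := cg 0; fun_prop) (by have := cg 1; fun_prop)
    (by simp [eg]) (by simp [eg]) (P := fun y => y ≤ z.2) (Q := fun y => y < z.2)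
    (by
      filter_upwards [H] with w hw
      rw [hw]
      rcases lt_trichotomy w.2 z.2 with hl | hl | hl
      · simp [hl, hl.le, hl.not_gt, Prod.ext_iff, hl.ne, Fin.exists_fin_two]
      · grind
      · simp [hl.not_ge, hl.not_gt, Prod.ext_iff, hl.ne'])
    (by
      filter_upwards [eventually_nhdsWithin_iff.1 mg] with y hy
      constructor
      · intro hl
        have := hy hl (show (0 : Fin 2) < 1 by decide)
        grind
      · intro hl
        rw [min_eq_right (not_lt.1 hl), eg, eg])
  obtain ⟨ε, hε, hball⟩ := Metric.eventually_nhds_iff_ball.1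
    (hF.and (h.toTypedGraph.eventually_notMem z.2))
  refine ⟨ε, hε, fun δ h0 h1 h2 hR => ?_⟩
  have hb : ∀ y ∈ Icc (z.2 - δ) (z.2 + δ), _ := fun y hy => hball y (Icc_subset_ball h1 hy)
  refine hR.cap h0 h2 hj1 hj2 cF F0 F1 (fun y hy => (hb y hy).1.1) (fun y hy => (hb y hy).1.2.1)
    (fun y hy hl => (hb y hy).1.2.2.1 (not_lt.2 hl)) (fun y hy => (hb y hy).1.2.2.2)
    (fun y hy x hx => ?_)
  by_cases hyz : y = z.2
  · subst hyz
    exact hV (h.heights (x, z.2) z ⟨h.subset hx, Or.inl hx⟩ hs rfl ▸ hx)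
  grind

theorem GenericGraph.exists_cup_slab {Γ V : Set (ℝ × ℝ)} (h : GenericGraph Γ V) {z : ℝ × ℝ}
    (hs : IsSingular Γ V z) (hV : z ∉ V) (ht : HasType Γ 0 2 z) :
    ∃ ε > 0, ∀ δ, 0 < δ → δ < ε → z.2 + δ < 4 / 5 → Reach Γ V (z.2 - δ) →
      Reach Γ V (z.2 + δ) := by
  obtain ⟨k, g, -, cg, -, eg, -, mg, H⟩ := ht
  obtain ⟨n, j, F, hj1, hj2, cF, F0, F1, hFj, hF⟩ := h.toTypedGraph.exists_pair_slab hs.1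
    (fun x hx hne => by
      by_contra hn
      exact hne (congrArg Prod.fst (h.heights (x, z.2) z ⟨hx, Or.inr hn⟩ hs rfl)))
    (G₀ := fun y => g 0 (max y z.2)) (G₁ := fun y => g 1 (max y z.2))
    (by have := cg 0; fun_prop) (by have := cg 1; fun_prop)
    (by simp [eg]) (by simp [eg]) (P := fun y => z.2 ≤ y) (Q := fun y => z.2 < y)
    (by
      filter_upwards [H] with w hw
      rw [hw]
      rcases lt_trichotomy w.2 z.2 with hl | hl | hl
      · simp [hl.not_ge, hl.not_gt, Prod.ext_iff, hl.ne]
      · grind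
      · simp [hl, hl.le, hl.not_gt, Prod.ext_iff, hl.ne', Fin.exists_fin_two])
    (by
      filter_upwards [eventually_nhdsWithin_iff.1 mg] with y hy
      constructor
      · intro hl
        have := hy hl (show (0 : Fin 2) < 1 by decide)
        grind
      · intro hl
        rw [max_eq_right (not_lt.1 hl), eg, eg])
  obtain ⟨ε, hε, hball⟩ := Metric.eventually_nhds_iff_ball.1
    (hF.and (h.toTypedGraph.eventually_notMem z.2))
  refine ⟨ε, hε, fun δ h0 h1 h2 hR => ?_⟩
  have hb : ∀ y ∈ Icc (z.2 - δ) (z.2 + δ), _ := fun y hy => hball y (Icc_subset_ball h1 hy)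
  refine hR.cup h0 h2 hj1 hj2 cF F0 F1 (fun y hy => (hb y hy).1.1) (fun y hy => (hb y hy).1.2.1)
    (fun y hy hl => (hb y hy).1.2.2.1 (not_lt.2 hl)) (fun y hy => (hb y hy).1.2.2.2)
    (fun y hy x hx => ?_)
  by_cases hyz : y = z.2
  · subst hyz
    exact hV (h.heights (x, z.2) z ⟨h.subset hx, Or.inl hx⟩ hs rfl ▸ hx)
  grind

theorem GenericGraph.exists_singular_slab {Γ V : Set (ℝ × ℝ)} (h : GenericGraph Γ V) {z : ℝ × ℝ}
    (hs : IsSingular Γ V z) : ∃ ε > 0, ∀ δ, 0 < δ → δ < ε → z.2 + δ < 4 / 5 →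
      Reach Γ V (z.2 - δ) → Reach Γ V (z.2 + δ) := by
  by_cases hV : z ∈ V
  · exact h.exists_vertex_slab hV
  · obtain ⟨p, q, hpq, ht⟩ := h.edge z hs.1 hV
    have h11 : ¬ HasType Γ 1 1 z := hs.2.resolve_left hV
    obtain ⟨rfl, rfl⟩ | ⟨rfl, rfl⟩ | ⟨rfl, rfl⟩ :
        p = 2 ∧ q = 0 ∨ p = 1 ∧ q = 1 ∨ p = 0 ∧ q = 2 := by omega
    · exact h.exists_cap_slab hs hV ht
    · exact absurd ht h11
    · exact h.exists_cup_slab hs hV ht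

theorem TypedGraph.reach_of_regular {Γ V : Set (ℝ × ℝ)} (h : TypedGraph Γ V) {a b : ℝ}
    (hab : a ≤ b) (hb : b < 4 / 5) (hreg : ∀ z, IsSingular Γ V z → z.2 ∉ Icc a b)
    (hR : Reach Γ V a) : Reach Γ V b := by
  have hslab : ∀ c : Icc a b, ∃ ε > 0, ∀ t' t'', (c : ℝ) - ε < t' → t' < t'' → t'' < c + ε →
      t'' < 4 / 5 → Reach Γ V t' → Reach Γ V t'' := fun c =>
    h.exists_regular_slab fun x hx => hreg _ hx c.2
  choose ε hε hstep using hslab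
  obtain ⟨t, h0, hm, ⟨m, hm'⟩, hc⟩ := exists_monotone_Icc_subset_open_cover_Icc hab
    (c := fun c : Icc a b => ball c (ε c)) (fun _ => isOpen_ball)
    (fun c _ => mem_iUnion.2 ⟨c, mem_ball_self (hε c)⟩)
  have key : ∀ n, Reach Γ V (t n) := by
    intro n
    induction n with
    | zero => rwa [h0]
    | succ n ih =>
      rcases (hm (Nat.le_succ n)).lt_or_eq with hlt | heq
      · obtain ⟨c, hc⟩ := hc n
        have h1 := hc ⟨le_rfl, hlt.le⟩
        have h2 := hc ⟨hlt.le, le_rfl⟩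
        rw [mem_ball, Subtype.dist_eq, Real.dist_eq, abs_lt] at h1 h2
        exact hstep c _ _ (by linarith) hlt (by linarith) ((t (n + 1)).2.2.trans_lt hb) ih
      · rw [← heq]; exact ih
  have := key m
  grind

theorem exists_height_bound {Γ : Set (ℝ × ℝ)} (hc : IsCompact Γ) (h : Γ ⊆ region) :
    ∃ b, 0 < b ∧ b < 4 / 5 ∧ ∀ z ∈ Γ, z.2 ∈ Ioo (-b) b := by
  rcases Γ.eq_empty_or_nonempty with rfl | hne
  · exact ⟨1 / 2, by norm_num, by norm_num, by simp⟩
  obtain ⟨w, hw, hmax⟩ := hc.exists_isMaxOn hne (f := fun z : ℝ × ℝ => |z.2|)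
    (by fun_prop)
  have hw' : |w.2| < 4 / 5 := by
    rw [abs_lt]
    have := (h hw).2
    grind
  obtain ⟨b, hb1, hb2⟩ := exists_between hw'
  exact ⟨b, (abs_nonneg _).trans_lt hb1, hb2, fun z hz => abs_lt.1 ((hmax hz).trans_lt hb1)⟩

theorem GenericGraph.reach {Γ V : Set (ℝ × ℝ)} (h : GenericGraph Γ V) {b : ℝ} (hb : b < 4 / 5)
    (hΓ : ∀ z ∈ Γ, z.2 ∈ Ioo (-b) b) (N : ℕ) : ∀ t, -b < t → t ≤ b →
      (∀ z, IsSingular Γ V z → z.2 ≠ t) →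
      (Prod.snd '' {z | IsSingular Γ V z} ∩ Iio t).ncard = N → Reach Γ V t := by
  have hfin := h.toTypedGraph.finite_singular.image Prod.snd
  have hstart : Reach Γ V (-b) ∨ b ≤ -b := by
    rcases lt_or_ge (-b) b with hbb | hbb
    · left
      refine ⟨Homeomorph.refl _, ⟨fun _ => rfl, fun _ _ _ h => h⟩, fun _ _ => rfl, 0, ?_⟩
      have e : ∀ A : Set (ℝ × ℝ), A ⊆ Γ → (Homeomorph.refl (ℝ × ℝ)) '' A ∩ {z | z.2 ≤ -b} = ∅ := by
        intro A hA
        rw [eq_empty_iff_forall_notMem]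
        rintro z ⟨⟨w, hw, rfl⟩, hz⟩
        exact absurd (hΓ _ (hA hw)).1 (not_lt.2 hz)
      rw [e Γ subset_rfl, e V h.subset]
      exact IsStack.base (t₀ := (-4 / 5 - b) / 2) (by linarith) (by linarith) (by linarith)
    · exact Or.inr hbb
  induction N using Nat.strong_induction_on with
  | _ N ih =>
    intro t ht1 ht2 hreg hcard
    have hstart' : Reach Γ V (-b) := hstart.resolve_right (by linarith)
    rcases (Prod.snd '' {z | IsSingular Γ V z} ∩ Iio t).eq_empty_or_nonempty with he | hne
    · refine h.toTypedGraph.reach_of_regular ht1.le (by linarith) (fun z hz hzt => ?_) hstart'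
      have : z.2 ∈ Prod.snd '' {z | IsSingular Γ V z} ∩ Iio t :=
        ⟨mem_image_of_mem _ hz, lt_of_le_of_ne hzt.2 (hreg z hz)⟩
      rw [he] at this
      exact this
    · have hf' := hfin.inter_of_left (Iio t)
      obtain ⟨c, ⟨⟨z, hz, rfl⟩, hct⟩, hmax⟩ := hf'.exists_maximal hne
      obtain ⟨ε, hε, hslab⟩ := h.exists_singular_slab hz
      have hzb := hΓ z hz.1
      have hpos : 0 < min ε (min (z.2 + b) (t - z.2)) :=
        lt_min hε (lt_min (by linarith [hzb.1]) (sub_pos.2 hct))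
      have hf2 : ((fun δ => z.2 - δ) ⁻¹' (Prod.snd '' {z | IsSingular Γ V z})).Finite :=
        hfin.preimage (sub_right_injective).injOn
      obtain ⟨δ, hδ, hδ'⟩ := ((Ioo_infinite hpos).sdiff hf2).nonempty
      rw [mem_Ioo, lt_min_iff, lt_min_iff] at hδ
      obtain ⟨hδ0, hδ1, hδ2, hδ3⟩ := hδ
      have hsub : Prod.snd '' {z | IsSingular Γ V z} ∩ Iio (z.2 - δ) ⊂
          Prod.snd '' {z | IsSingular Γ V z} ∩ Iio t := by
        refine ⟨fun y hy => ⟨hy.1, ?_⟩, fun hc => ?_⟩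
        · grind
        · have := (hc ⟨mem_image_of_mem _ hz, hct⟩).2
          grind
      have h1 : Reach Γ V (z.2 - δ) := ih _ (hcard ▸ ncard_lt_ncard hsub hf') _ (by linarith)
        (by linarith) (fun w hw e => hδ' ⟨w, hw, e⟩) rfl
      have h2 := hslab δ hδ0 hδ1 (by linarith) h1
      refine h.toTypedGraph.reach_of_regular (by linarith) (by linarith) (fun w hw hwt => ?_) h2
      have h3 : w.2 ≤ z.2 := by
        grind
      linarith [hwt.1]

/-- A planar graph can be moved to a stack of pictures. -/
theorem TypedGraph.exists_stack {Γ V : Set (ℝ × ℝ)} (h : TypedGraph Γ V) :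
    ∃ Φ : ℝ × ℝ ≃ₜ ℝ × ℝ, Supported Φ ∧ ∃ t, IsStack (Φ '' Γ) (Φ '' V) t 0 := by
  obtain ⟨Φ, h1, h2⟩ := h.exists_generic
  obtain ⟨b, hb0, hb1, hb⟩ := exists_height_bound h2.isCompact h2.subset_region
  obtain ⟨Ψ, hL, hs, n, hst⟩ := h2.reach hb1 hb _ b (by linarith) le_rfl
    (fun z hz e => absurd (hb z hz.1).2 (by linarith)) rfl
  have e : ∀ A : Set (ℝ × ℝ), (Φ.trans Ψ) '' A = Ψ '' (Φ '' A) := fun A => by rw [image_image]; rfl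
  have e' : ∀ A : Set (ℝ × ℝ), A ⊆ Φ '' Γ → Ψ '' A ∩ {z | z.2 ≤ b} = Ψ '' A := by
    intro A hA
    rw [inter_eq_left]
    rintro _ ⟨z, hz, rfl⟩
    change (Ψ z).2 ≤ b
    rw [hL.snd]
    grind
  rw [e' _ subset_rfl, e' _ h2.subset] at hst
  refine ⟨Φ.trans Ψ, h1.trans hs, b, ?_⟩
  rw [e, e]
  convert hst using 1
  by_contra hn
  have h3 : (tick n 1, b) ∈ Ψ '' (Φ '' Γ) := hst.mem_top.2 ⟨1, le_rfl, by omega, rfl⟩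
  obtain ⟨z, hz, hzb⟩ := h3
  have h4 := hL.snd z
  grind

end DefectBord

namespace DefectBord

/-! ### Cylindrical coordinates on the sphere -/

theorem mem_sphere_iff {x : Euc 3} : x ∈ sphere (0 : Euc 3) 1 ↔ x 0 ^ 2 + x 1 ^ 2 + x 2 ^ 2 = 1 := by
  rw [mem_sphere_zero_iff_norm, EuclideanSpace.norm_eq, Real.sqrt_eq_one, Fin.sum_univ_three]
  simp

theorem S2.sq_add_sq (p : S2) : (p : Euc 3) 0 ^ 2 + (p : Euc 3) 1 ^ 2 + (p : Euc 3) 2 ^ 2 = 1 :=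
  mem_sphere_iff.1 p.2

theorem S2.ext {p q : S2} (h0 : (p : Euc 3) 0 = (q : Euc 3) 0) (h1 : (p : Euc 3) 1 = (q : Euc 3) 1)
    (h2 : (p : Euc 3) 2 = (q : Euc 3) 2) : p = q := by
  apply Subtype.ext
  ext i
  fin_cases i
  exacts [h0, h1, h2]

theorem cyl_eq (a b : ℝ) (p : ℝ × ℝ) : cyl a b p = cyl 0 1 (p.1, a + (b - a) * p.2) := by
  simp [cyl]

theorem cyl_mem_sphere {z : ℝ × ℝ} (h : z.2 ∈ Icc (-1 : ℝ) 1) : cyl 0 1 z ∈ sphere (0 : Euc 3) 1 := by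
  rw [mem_sphere_iff]
  have h1 : 0 ≤ 1 - z.2 ^ 2 := by nlinarith [h.1, h.2]
  simp only [cyl, zero_add, sub_zero, one_mul, PiLp.toLp_apply, Matrix.cons_val_zero,
    Matrix.cons_val_one, Matrix.cons_val, mul_pow, Real.sq_sqrt h1]
  linear_combination (1 - z.2 ^ 2) * Real.cos_sq_add_sin_sq (Real.pi * (z.1 - 1 / 2))

theorem clamp_mem (y : ℝ) : max (-1) (min 1 y) ∈ Icc (-1 : ℝ) 1 :=
  ⟨le_max_left _ _, max_le (by norm_num) (min_le_left _ _)⟩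

/-- The map from the strip `|y| ≤ 1` to the sphere given by longitude and height. -/
noncomputable def wrap (z : ℝ × ℝ) : S2 :=
  ⟨cyl 0 1 (z.1, max (-1) (min 1 z.2)), cyl_mem_sphere (clamp_mem z.2)⟩

theorem continuous_wrap : Continuous wrap := by
  refine Continuous.subtype_mk ?_ _
  unfold cyl
  fun_prop

theorem wrap_coe {z : ℝ × ℝ} (h : z.2 ∈ Icc (-1 : ℝ) 1) : (wrap z : Euc 3) = cyl 0 1 z := by
  simp only [wrap]
  grind

theorem wrap_zero {z : ℝ × ℝ} (h : z.2 ∈ Icc (-1 : ℝ) 1) : (wrap z : Euc 3) 0 =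
    Real.sqrt (1 - z.2 ^ 2) * Real.cos (Real.pi * (z.1 - 1 / 2)) := by
  rw [wrap_coe h]; simp [cyl]

theorem wrap_one {z : ℝ × ℝ} (h : z.2 ∈ Icc (-1 : ℝ) 1) : (wrap z : Euc 3) 1 =
    Real.sqrt (1 - z.2 ^ 2) * Real.sin (Real.pi * (z.1 - 1 / 2)) := by
  rw [wrap_coe h]; simp [cyl]

theorem wrap_two {z : ℝ × ℝ} (h : z.2 ∈ Icc (-1 : ℝ) 1) : (wrap z : Euc 3) 2 = z.2 := by
  rw [wrap_coe h]; simp [cyl]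

theorem place_eq {a b : ℝ} (ha : -1 < a) (hab : a < b) (hb : b < 1) {A : Set (ℝ × ℝ)}
    (hA : ∀ z ∈ A, z.2 ∈ Icc (0 : ℝ) 1) : place a b A = wrap '' stackPlace a b A := by
  have h : ∀ z ∈ A, (wrap (z.1, a + (b - a) * z.2) : Euc 3) = cyl a b z := by
    intro z hz
    rw [cyl_eq, wrap_coe]
    have := hA z hz
    constructor <;> simp only <;> nlinarith [this.1, this.2]
  ext p
  simp only [place, stackPlace, image_image, mem_preimage, mem_image]
  grind

/-- Longitude and height of a point on the front half of the sphere. -/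
noncomputable def planar (p : S2) : ℝ × ℝ :=
  (1 / 2 + Real.arcsin ((p : Euc 3) 1 / Real.sqrt (1 - (p : Euc 3) 2 ^ 2)) / Real.pi, (p : Euc 3) 2)

theorem S2.two_mem (p : S2) : (p : Euc 3) 2 ∈ Icc (-1 : ℝ) 1 := by
  have := p.sq_add_sq
  refine abs_le.1 ((sq_le_one_iff_abs_le_one _).1 ?_)
  nlinarith [sq_nonneg ((p : Euc 3) 0), sq_nonneg ((p : Euc 3) 1)]

theorem wrap_planar {p : S2} (h : 0 ≤ (p : Euc 3) 0) : wrap (planar p) = p := by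
  have hp := p.sq_add_sq
  have hm : (planar p).2 ∈ Icc (-1 : ℝ) 1 := p.two_mem
  have e : Real.pi * ((planar p).1 - 1 / 2) =
      Real.arcsin ((p : Euc 3) 1 / Real.sqrt (1 - (p : Euc 3) 2 ^ 2)) := by
    simp only [planar]
    field_simp
    ring
  have h0 : 0 ≤ 1 - (p : Euc 3) 2 ^ 2 := by
    nlinarith [sq_nonneg ((p : Euc 3) 0), sq_nonneg ((p : Euc 3) 1)]
  have hr := Real.sq_sqrt h0
  have hr0 := Real.sqrt_nonneg (1 - (p : Euc 3) 2 ^ 2)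
  rcases hr0.eq_or_lt with hz | hpos
  · rw [← hz] at hr
    have h1 : (p : Euc 3) 0 = 0 := by
      rw [← sq_eq_zero_iff]
      nlinarith [sq_nonneg ((p : Euc 3) 0), sq_nonneg ((p : Euc 3) 1)]
    have h2 : (p : Euc 3) 1 = 0 := by
      rw [← sq_eq_zero_iff]
      nlinarith [sq_nonneg ((p : Euc 3) 0), sq_nonneg ((p : Euc 3) 1)]
    apply S2.ext
    · rw [wrap_zero hm]; simp only [planar]; rw [← hz, h1]; ring
    · rw [wrap_one hm]; simp only [planar]; rw [← hz, h2]; ring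
    · rw [wrap_two hm]; rfl
  · have hle : ((p : Euc 3) 1 / Real.sqrt (1 - (p : Euc 3) 2 ^ 2)) ^ 2 ≤ 1 := by
      rw [div_pow, hr, div_le_one (by rw [← hr]; positivity)]
      nlinarith [sq_nonneg ((p : Euc 3) 0)]
    rw [sq_le_one_iff_abs_le_one, abs_le] at hle
    apply S2.ext
    · rw [wrap_zero hm, e, Real.cos_arcsin]
      simp only [planar]
      rw [← Real.sqrt_mul h0, div_pow, hr, mul_sub, mul_one, mul_div_cancel₀ _
        (by rw [← hr]; positivity), show 1 - (p : Euc 3) 2 ^ 2 - (p : Euc 3) 1 ^ 2 =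
        (p : Euc 3) 0 ^ 2 by linarith, Real.sqrt_sq h]
    · rw [wrap_one hm, e, Real.sin_arcsin hle.1 hle.2]
      simp only [planar]
      rw [mul_div_cancel₀ _ hpos.ne']
    · rw [wrap_two hm]; rfl

theorem planar_wrap {z : ℝ × ℝ} (h1 : z.1 ∈ Icc (0 : ℝ) 1) (h2 : z.2 ∈ Ioo (-1 : ℝ) 1) :
    planar (wrap z) = z := by
  have hm : z.2 ∈ Icc (-1 : ℝ) 1 := ⟨h2.1.le, h2.2.le⟩
  have hpos : 0 < Real.sqrt (1 - z.2 ^ 2) := Real.sqrt_pos.2 (by nlinarith [h2.1, h2.2])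
  apply Prod.ext
  · simp only [planar]
    rw [wrap_one hm, wrap_two hm, mul_div_cancel_left₀ _ hpos.ne', Real.arcsin_sin]
    · field_simp; ring
    · nlinarith [Real.pi_pos, h1.1]
    · nlinarith [Real.pi_pos, h1.2]
  · simp only [planar]; rw [wrap_two hm]

theorem wrap_zero_pos {z : ℝ × ℝ} (h1 : z.1 ∈ Ioo (0 : ℝ) 1) (h2 : z.2 ∈ Ioo (-1 : ℝ) 1) :
    0 < (wrap z : Euc 3) 0 := by
  rw [wrap_zero ⟨h2.1.le, h2.2.le⟩]
  refine mul_pos (Real.sqrt_pos.2 (by nlinarith [h2.1, h2.2])) (Real.cos_pos_of_mem_Ioo ⟨?_, ?_⟩)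
  · nlinarith [Real.pi_pos, h1.1]
  · nlinarith [Real.pi_pos, h1.2]

theorem continuousOn_planar : ContinuousOn planar {p : S2 | (p : Euc 3) 2 ^ 2 < 1} := by
  unfold planar
  refine ContinuousOn.prodMk (continuousOn_const.add ((Real.continuous_arcsin.comp_continuousOn
    (ContinuousOn.div (by fun_prop) (by fun_prop) ?_)).div_const _)) (by fun_prop)
  grind

/-! ### Planar homeomorphisms act on the sphere -/

theorem region_subset {z : ℝ × ℝ} (h : z ∈ region) : z.1 ∈ Ioo (0 : ℝ) 1 ∧ z.2 ∈ Ioo (-1 : ℝ) 1 :=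
  ⟨h.1, by linarith [h.2.1], by linarith [h.2.2]⟩

open Classical in
/-- The homeomorphism of the plane acts on the front half of the sphere. -/
noncomputable def frontMap (Φ : ℝ × ℝ ≃ₜ ℝ × ℝ) (p : S2) : S2 :=
  if 0 ≤ (p : Euc 3) 0 then wrap (Φ (planar p)) else p

theorem Supported.symm {Φ : ℝ × ℝ ≃ₜ ℝ × ℝ} (h : Supported Φ) : Supported Φ.symm := fun z hz => by
  rw [Φ.symm_apply_eq, h z hz]

theorem Supported.frontMap_cases {Φ : ℝ × ℝ ≃ₜ ℝ × ℝ} (h : Supported Φ) (p : S2) :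
    frontMap Φ p = p ∧ ((p : Euc 3) 0 < 0 ∨ (0 ≤ (p : Euc 3) 0 ∧ planar p ∉ region)) ∨
      0 ≤ (p : Euc 3) 0 ∧ planar p ∈ region ∧ frontMap Φ p = wrap (Φ (planar p)) := by
  rcases lt_or_ge ((p : Euc 3) 0) 0 with hp | hp
  · exact Or.inl ⟨if_neg hp.not_ge, Or.inl hp⟩
  · have e : frontMap Φ p = wrap (Φ (planar p)) := if_pos hp
    by_cases hr : planar p ∈ region
    · grind
    · exact Or.inl ⟨by rw [e, h _ hr, wrap_planar hp], Or.inr ⟨hp, hr⟩⟩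

theorem frontMap_wrap (Φ : ℝ × ℝ ≃ₜ ℝ × ℝ) {z : ℝ × ℝ} (hz : z ∈ region) :
    frontMap Φ (wrap z) = wrap (Φ z) := by
  have h := region_subset hz
  rw [frontMap, if_pos (wrap_zero_pos h.1 h.2).le, planar_wrap ⟨h.1.1.le, h.1.2.le⟩ h.2]

theorem Supported.frontMap_symm {Φ : ℝ × ℝ ≃ₜ ℝ × ℝ} (h : Supported Φ) (p : S2) :
    frontMap Φ.symm (frontMap Φ p) = p := by
  rcases h.frontMap_cases p with ⟨e, h'⟩ | ⟨hp, hr, e⟩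
  · rw [e]
    rcases h.symm.frontMap_cases p with ⟨e, -⟩ | ⟨hp, hr, -⟩
    all_goals grind
  · rw [e, frontMap_wrap _ (h.mem hr), Φ.symm_apply_apply, wrap_planar hp]

theorem Supported.continuous_frontMap {Φ : ℝ × ℝ ≃ₜ ℝ × ℝ} (h : Supported Φ) :
    Continuous (frontMap Φ) := by
  have hA : IsClosed {p : S2 | 0 ≤ (p : Euc 3) 0 ∧ (p : Euc 3) 2 ^ 2 ≤ 9 / 10} := by
    refine IsClosed.and ?_ ?_ <;> exact isClosed_le (by fun_prop) (by fun_prop)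
  have hB : IsClosed {p : S2 | (p : Euc 3) 0 ≤ 0 ∨ 16 / 25 ≤ (p : Euc 3) 2 ^ 2} := by
    refine IsClosed.union (s₁ := {p : S2 | (p : Euc 3) 0 ≤ 0})
      (s₂ := {p : S2 | 16 / 25 ≤ (p : Euc 3) 2 ^ 2}) ?_ ?_ <;> exact isClosed_le (by fun_prop) (by fun_prop)
  have cA : ContinuousOn (frontMap Φ) {p : S2 | 0 ≤ (p : Euc 3) 0 ∧ (p : Euc 3) 2 ^ 2 ≤ 9 / 10} := by
    have : ContinuousOn (fun p => wrap (Φ (planar p)))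
        {p : S2 | 0 ≤ (p : Euc 3) 0 ∧ (p : Euc 3) 2 ^ 2 ≤ 9 / 10} :=
      continuous_wrap.comp_continuousOn (Φ.continuous.comp_continuousOn
        (continuousOn_planar.mono fun p hp => hp.2.trans_lt (by norm_num)))
    exact this.congr fun p hp => if_pos hp.1
  have cB : ContinuousOn (frontMap Φ) {p : S2 | (p : Euc 3) 0 ≤ 0 ∨ 16 / 25 ≤ (p : Euc 3) 2 ^ 2} := by
    refine continuousOn_id.congr fun p hp => ?_
    rcases h.frontMap_cases p with ⟨e, -⟩ | ⟨hp0, hr, -⟩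
    · exact e
    · exfalso
      have h2 := region_subset hr
      have h3 := wrap_zero_pos h2.1 h2.2
      rw [wrap_planar hp0] at h3
      rcases hp with hp | hp
      · linarith
      · have := hr.2
        simp only [planar, mem_Ioo] at this
        nlinarith
  have e : {p : S2 | 0 ≤ (p : Euc 3) 0 ∧ (p : Euc 3) 2 ^ 2 ≤ 9 / 10} ∪
      {p : S2 | (p : Euc 3) 0 ≤ 0 ∨ 16 / 25 ≤ (p : Euc 3) 2 ^ 2} = univ := by
    rw [eq_univ_iff_forall]
    grind
  rw [← continuousOn_univ, ← e]
  exact cA.union_of_isClosed cB hA hB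

/-- The homeomorphism of the sphere given by a homeomorphism of the plane with support on the front
half. -/
noncomputable def Supported.front {Φ : ℝ × ℝ ≃ₜ ℝ × ℝ} (h : Supported Φ) : S2 ≃ₜ S2 where
  toFun := frontMap Φ
  invFun := frontMap Φ.symm
  left_inv := h.frontMap_symm
  right_inv := h.symm.frontMap_symm
  continuous_toFun := h.continuous_frontMap
  continuous_invFun := h.symm.continuous_frontMap

theorem Supported.frontMap_ne_neg {Φ : ℝ × ℝ ≃ₜ ℝ × ℝ} (h : Supported Φ) (p : S2) :
    (frontMap Φ p : Euc 3) ≠ -p := by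
  intro hn
  rcases h.frontMap_cases p with ⟨e, -⟩ | ⟨hp, hr, e⟩
  · rw [e, eq_neg_iff_add_eq_zero, ← two_smul ℝ, smul_eq_zero_iff_right two_ne_zero] at hn
    have := p.2
    rw [hn] at this
    simp at this
  · have h1 := region_subset (h.mem hr)
    have h2 := wrap_zero_pos h1.1 h1.2
    rw [← e, hn] at h2
    simp only [PiLp.neg_apply] at h2
    linarith

/-- Self-maps of the sphere without antipodal points are homotopic to the identity. -/
theorem homotopic_id_of_ne_neg (T : S2 ≃ₜ S2) (h : ∀ p, (T p : Euc 3) ≠ -p) :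
    (T : C(S2, S2)).Homotopic (ContinuousMap.id S2) := by
  have hne : ∀ (t : unitInterval) (p : S2), (1 - (t : ℝ)) • (T p : Euc 3) + (t : ℝ) • (p : Euc 3) ≠ 0 := by
    intro t p h0
    have e : (1 - (t : ℝ)) • (T p : Euc 3) = -((t : ℝ) • (p : Euc 3)) := eq_neg_of_add_eq_zero_left h0
    have hn := congrArg norm e
    rw [norm_neg, norm_smul, norm_smul, norm_eq_of_mem_sphere, norm_eq_of_mem_sphere, mul_one,
      mul_one, Real.norm_of_nonneg (by linarith [t.2.2]), Real.norm_of_nonneg t.2.1] at hn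
    have ht : (t : ℝ) = 1 / 2 := by linarith
    rw [ht, ← smul_neg, show 1 - (1 / 2 : ℝ) = 1 / 2 by norm_num] at e
    exact h p (smul_right_injective _ (by norm_num) e)
  refine ⟨⟨⟨fun x => ⟨‖(1 - (x.1 : ℝ)) • (T x.2 : Euc 3) + (x.1 : ℝ) • (x.2 : Euc 3)‖⁻¹ •
    ((1 - (x.1 : ℝ)) • (T x.2 : Euc 3) + (x.1 : ℝ) • (x.2 : Euc 3)), ?_⟩, ?_⟩, ?_, ?_⟩⟩
  · rw [mem_sphere_zero_iff_norm, norm_smul, norm_inv, norm_norm,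
      inv_mul_cancel₀ (norm_ne_zero_iff.2 (hne _ _))]
  · refine Continuous.subtype_mk ?_ _
    have hT := T.continuous
    refine Continuous.smul (Continuous.inv₀ (by fun_prop) fun x =>
      norm_ne_zero_iff.2 (hne _ _)) (by fun_prop)
  · intro p
    apply Subtype.ext
    simp
  · intro p
    apply Subtype.ext
    simp

/-! ### Decompositions from planar graphs -/

theorem exists_decomposition_of_planar {Γ V : Set S2} {Γ' V' : Set (ℝ × ℝ)} (T : S2 ≃ₜ S2)
    (hT : (T : C(S2, S2)).Homotopic (ContinuousMap.id S2)) (h : TypedGraph Γ' V')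
    (hΓ : T '' Γ = wrap '' Γ') (hV : T '' V = wrap '' V') : Nonempty (Decomposition Γ V) := by
  obtain ⟨Φ, hΦ, t, m, ρ, lev, hm, h0, hc, hn, hl, hlm, -, hΓ2, hV2⟩ := h.exists_stack
  have himg : ∀ A : Set S2, ∀ A' ⊆ Γ', T '' A = wrap '' A' →
      (T.trans hΦ.front) '' A = wrap '' (Φ '' A') := by
    intro A A' hA' e
    have : (T.trans hΦ.front) '' A = frontMap Φ '' (T '' A) := by rw [image_image]; rfl
    rw [this, e, image_image, image_image]
    exact image_congr fun z hz => frontMap_wrap Φ (h.subset_region (hA' hz))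
  have hplace : ∀ A : Pattern → Set (ℝ × ℝ), (∀ ρ, ∀ z ∈ A ρ, z.2 ∈ Icc (0 : ℝ) 1) →
      wrap '' (⋃ j, ⋃ (_ : j < m), stackPlace (lev j) (lev (j + 1)) (A (ρ j))) =
      ⋃ j : Fin m, place (lev j) (lev (j + 1)) (A (ρ j)) := by
    intro A hA
    rw [image_iUnion]
    simp only [image_iUnion]
    ext p
    simp only [mem_iUnion]
    have hp : ∀ j < m, place (lev j) (lev (j + 1)) (A (ρ j)) =
        wrap '' stackPlace (lev j) (lev (j + 1)) (A (ρ j)) := fun j hj =>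
      place_eq (by linarith [(hl j hj.le).1]) (hlm j hj) (by linarith [(hl (j + 1) hj).2]) (hA _)
    constructor
    · rintro ⟨j, hj, hz⟩
      exact ⟨⟨j, hj⟩, by rw [hp j hj]; exact hz⟩
    · rintro ⟨j, hz⟩
      exact ⟨j, j.2, by rw [← hp j j.2]; exact hz⟩
  refine ⟨{
    iso := T.trans hΦ.front
    orientation := ?_
    m := m
    m_pos := hm
    ρ := fun j => ρ j
    source_first := fun j hj => by rw [hj, h0]
    composable := fun i j hij => by rw [← hij]; exact hc i (by omega)
    target_last := fun j hj => by rw [← hn]; congr 2; omega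
    level := fun j => lev j
    level_mem := fun j => ?_
    level_strictMono := Fin.strictMono_iff_lt_succ.2 fun j => hlm j j.2
    graph_eq := ?_
    vertices_eq := ?_ }⟩
  · exact (homotopic_id_of_ne_neg hΦ.front hΦ.frontMap_ne_neg).comp hT
  · grind
  · rw [himg Γ Γ' subset_rfl hΓ, hΓ2]
    exact hplace Pattern.strands fun ρ z => Pattern.snd_mem_of_mem_strands
  · rw [himg V V' h.subset hV, hV2]
    exact hplace Pattern.vertices fun ρ z => Pattern.snd_mem_of_mem_vertices

end DefectBord

namespace DefectBord

/-! ### Smooth changes of coordinates of the sphere -/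

/-- Smooth maps of Euclidean space which restrict to inverse diffeomorphisms of the sphere. -/
structure SpherePair (S S' : Euc 3 → Euc 3) : Prop where
  contDiff : ContDiff ℝ ∞ S
  contDiff' : ContDiff ℝ ∞ S'
  mapsTo : MapsTo S (sphere 0 1) (sphere 0 1)
  mapsTo' : MapsTo S' (sphere 0 1) (sphere 0 1)
  left : ∀ x ∈ sphere (0 : Euc 3) 1, S' (S x) = x
  right : ∀ x ∈ sphere (0 : Euc 3) 1, S (S' x) = x

namespace SpherePair

variable {S S' : Euc 3 → Euc 3}

/-- The homeomorphism of the sphere. -/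
def homeo (h : SpherePair S S') : S2 ≃ₜ S2 where
  toFun p := ⟨S p, h.mapsTo p.2⟩
  invFun p := ⟨S' p, h.mapsTo' p.2⟩
  left_inv p := Subtype.ext (h.left p p.2)
  right_inv p := Subtype.ext (h.right p p.2)
  continuous_toFun := (h.contDiff.continuous.comp continuous_subtype_val).subtype_mk _
  continuous_invFun := (h.contDiff'.continuous.comp continuous_subtype_val).subtype_mk _

theorem homeo_coe (h : SpherePair S S') (p : S2) : (h.homeo p : Euc 3) = S p := rfl

theorem deriv_ne_zero (h : SpherePair S S') {c : ℝ → Euc 3} (hc : ContDiff ℝ ∞ c)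
    (hs : ∀ s ∈ Icc (0 : ℝ) 1, c s ∈ sphere (0 : Euc 3) 1) {s : ℝ} (hs' : s ∈ Icc (0 : ℝ) 1)
    (hd : deriv c s ≠ 0) : deriv (S ∘ c) s ≠ 0 := by
  intro h0
  have dc : DifferentiableAt ℝ c s := hc.differentiable (by simp) s
  have d1 : DifferentiableAt ℝ (S ∘ c) s := (h.contDiff.differentiable (by simp) _).comp s dc
  have d2 : HasDerivAt (S' ∘ (S ∘ c)) 0 s := by
    have := ((h.contDiff'.differentiable (by simp)) ((S ∘ c) s)).hasFDerivAt.comp_hasDerivAt s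
      d1.hasDerivAt
    rwa [h0, map_zero] at this
  have d3 : HasDerivWithinAt c 0 (Icc 0 1) s :=
    d2.hasDerivWithinAt.congr (fun t ht => (h.left _ (hs t ht)).symm) (h.left _ (hs s hs')).symm
  exact hd ((uniqueDiffOn_Icc zero_lt_one s hs').eq_deriv _ dc.hasDerivAt.hasDerivWithinAt d3)

theorem isStarAt (h : SpherePair S S') {Γ : Set S2} {k : ℕ} {x : S2} (hx : IsStarAt Γ k x) :
    IsStarAt (h.homeo '' Γ) k (h.homeo x) := by
  obtain ⟨c, h1, h2, h3, h4, U, hU, h5⟩ := hx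
  have hinj : ∀ a b, ∀ s ∈ Icc (0 : ℝ) 1, ∀ t ∈ Icc (0 : ℝ) 1, S (c a s) = S (c b t) →
      c a s = c b t := fun a b s hs t ht e => by
    rw [← h.left _ (h3 a s hs).1, e, h.left _ (h3 b t ht).1]
  refine ⟨fun a => S ∘ c a, fun a => h.contDiff.comp (h1 a), fun a => by
    simp only [Function.comp_apply, h2]; rfl, fun a s hs => ⟨h.mapsTo (h3 a s hs).1,
      h.deriv_ne_zero (h1 a) (fun t ht => (h3 a t ht).1) hs (h3 a s hs).2⟩,
    fun a b s hs t ht e => h4 a b s hs t ht (hinj a b s hs t ht e), S' ⁻¹' U, ?_, ?_⟩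
  · refine h.contDiff'.continuous.continuousAt.preimage_mem_nhds ?_
    rw [h.homeo_coe, h.left _ x.2]; exact hU
  · ext p
    simp only [mem_inter_iff, mem_preimage, mem_iUnion, mem_image, Function.comp_apply]
    constructor
    · rintro ⟨⟨_, ⟨q, hq, rfl⟩, rfl⟩, hp⟩
      rw [h.homeo_coe, h.left _ q.2] at hp
      have : (q : Euc 3) ∈ (⋃ a, c a '' Icc (0 : ℝ) 1) ∩ U := h5 ▸ ⟨⟨q, hq, rfl⟩, hp⟩
      obtain ⟨a, s, hs, e⟩ := mem_iUnion.1 this.1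
      exact ⟨⟨a, s, hs, by rw [e]; rfl⟩, by rwa [h.homeo_coe, h.left _ q.2]⟩
    · rintro ⟨⟨a, s, hs, rfl⟩, hp⟩
      rw [h.left _ (h3 a s hs).1] at hp
      have : c a s ∈ Subtype.val '' Γ ∩ U := h5 ▸ ⟨mem_iUnion.2 ⟨a, s, hs, rfl⟩, hp⟩
      obtain ⟨q, hq, e⟩ := this.1
      exact ⟨⟨h.homeo q, ⟨q, hq, rfl⟩, by rw [h.homeo_coe, e]⟩, by rwa [h.left _ (h3 a s hs).1]⟩

theorem isTrivalentGraph (h : SpherePair S S') {Γ V : Set S2} (hΓ : IsTrivalentGraph Γ V) :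
    IsTrivalentGraph (h.homeo '' Γ) (h.homeo '' V) := by
  refine ⟨h.homeo.isClosed_image.2 hΓ.isClosed, hΓ.finite_vertices.image _,
    image_mono hΓ.subset, ?_, ?_⟩
  · rintro _ ⟨x, hx, rfl⟩
    exact h.isStarAt (hΓ.vertex x hx)
  · rintro _ ⟨⟨x, hx, rfl⟩, hV⟩
    exact h.isStarAt (hΓ.edge x ⟨hx, fun hc => hV ⟨x, hc, rfl⟩⟩)

end SpherePair

/-! ### Conformal boosts -/

open scoped RealInnerProductSpace

/-- A conformal map of the sphere pushing points towards `a`. -/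
noncomputable def boost (a : Euc 3) (β γ : ℝ) (x : Euc 3) : Euc 3 :=
  ((1 + β * ⟪a, x⟫) / ((1 + β * ⟪a, x⟫) ^ 2 + (‖x‖ ^ 2 - 1) ^ 2)) •
    (γ • x + (β + (1 - γ) * ⟪a, x⟫) • a)

theorem abs_inner_le {a x : Euc 3} (ha : ‖a‖ = 1) (hx : ‖x‖ = 1) : |⟪a, x⟫| ≤ 1 := by
  have := abs_real_inner_le_norm a x
  rwa [ha, hx, mul_one] at this

theorem boost_denom_pos {a x : Euc 3} (ha : ‖a‖ = 1) (hx : ‖x‖ = 1) {β : ℝ} (hβ : |β| < 1) :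
    0 < 1 + β * ⟪a, x⟫ := by
  have h1 := abs_inner_le ha hx
  have h2 : |β * ⟪a, x⟫| < 1 := by
    rw [abs_mul]
    nlinarith [abs_nonneg β, abs_nonneg ⟪a, x⟫]
  linarith [(abs_lt.1 h2).1]

theorem contDiff_boost {a : Euc 3} (ha : ‖a‖ = 1) {β γ : ℝ} (hβ : |β| < 1) :
    ContDiff ℝ ∞ (boost a β γ) := by
  unfold boost
  have h1 : ContDiff ℝ ∞ fun x : Euc 3 => ‖x‖ ^ 2 := contDiff_norm_sq ℝ
  have h2 : ContDiff ℝ ∞ fun x : Euc 3 => ⟪a, x⟫ := contDiff_const.inner ℝ contDiff_id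
  have h3 : ContDiff ℝ ∞ fun x : Euc 3 => (1 + β * ⟪a, x⟫) ^ 2 + (‖x‖ ^ 2 - 1) ^ 2 := by fun_prop
  have h4 : ContDiff ℝ ∞ fun x : Euc 3 => 1 + β * ⟪a, x⟫ := by fun_prop
  have h5 : ContDiff ℝ ∞ fun x : Euc 3 => γ • x + (β + (1 - γ) * ⟪a, x⟫) • a := by fun_prop
  refine (h4.div h3 fun x => ?_).smul h5
  by_cases hx : ‖x‖ = 1
  · have := boost_denom_pos ha hx hβ
    positivity
  · have : 0 < (‖x‖ ^ 2 - 1) ^ 2 := by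
      refine sq_pos_of_ne_zero fun h0 => hx ?_
      have h3 : (‖x‖ - 1) * (‖x‖ + 1) = 0 := by linarith
      rcases mul_eq_zero.1 h3 with h | h
      · linarith
      · linarith [norm_nonneg x]
    positivity

theorem boost_eq {a x : Euc 3} (ha : ‖a‖ = 1) (hx : ‖x‖ = 1) {β γ : ℝ} (hβ : |β| < 1) :
    boost a β γ x = (1 + β * ⟪a, x⟫)⁻¹ • (γ • x + (β + (1 - γ) * ⟪a, x⟫) • a) := by
  have := boost_denom_pos ha hx hβ
  rw [boost, hx]
  congr 1
  field_simp
  ring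

theorem inner_boost {a x : Euc 3} (ha : ‖a‖ = 1) (hx : ‖x‖ = 1) {β γ : ℝ} (hβ : |β| < 1) :
    ⟪a, boost a β γ x⟫ = (⟪a, x⟫ + β) / (1 + β * ⟪a, x⟫) := by
  rw [boost_eq ha hx hβ, inner_smul_right, inner_add_right, inner_smul_right, inner_smul_right,
    real_inner_self_eq_norm_sq, ha]
  field_simp
  ring

theorem norm_boost {a x : Euc 3} (ha : ‖a‖ = 1) (hx : ‖x‖ = 1) {β γ : ℝ} (hβ : |β| < 1)
    (hγ : β ^ 2 + γ ^ 2 = 1) : ‖boost a β γ x‖ = 1 := by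
  have hpos := boost_denom_pos ha hx hβ
  have h : ‖γ • x + (β + (1 - γ) * ⟪a, x⟫) • a‖ ^ 2 = (1 + β * ⟪a, x⟫) ^ 2 := by
    rw [norm_add_sq_real, norm_smul, norm_smul, ha, hx, inner_smul_left, inner_smul_right,
      real_inner_comm a x, mul_one, mul_one, Real.norm_eq_abs, Real.norm_eq_abs, sq_abs, sq_abs]
    simp only [conj_trivial]
    linear_combination (1 - ⟪a, x⟫ ^ 2) * hγ
  rw [boost_eq ha hx hβ, norm_smul, (pow_left_inj₀ (norm_nonneg _) hpos.le two_ne_zero).1 h,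
    norm_inv, Real.norm_of_nonneg hpos.le, inv_mul_cancel₀ hpos.ne']

theorem boost_boost {a x : Euc 3} (ha : ‖a‖ = 1) (hx : ‖x‖ = 1) {β γ : ℝ} (hβ : |β| < 1)
    (hγ : β ^ 2 + γ ^ 2 = 1) : boost a (-β) γ (boost a β γ x) = x := by
  have hpos := boost_denom_pos ha hx hβ
  have hβ' : |-β| < 1 := by rwa [abs_neg]
  have hγ0 : 0 < γ ^ 2 := by nlinarith [sq_abs β, abs_nonneg β]
  have hy := norm_boost ha hx hβ hγ
  have hpos' := boost_denom_pos ha hy hβ'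
  rw [boost_eq ha hy hβ', inner_boost ha hx hβ, boost_eq ha hx hβ]
  rw [inner_boost ha hx hβ] at hpos'
  have e : 1 + -β * ((⟪a, x⟫ + β) / (1 + β * ⟪a, x⟫)) = γ ^ 2 / (1 + β * ⟪a, x⟫) := by
    rw [eq_div_iff hpos.ne', add_mul, mul_assoc, div_mul_cancel₀ _ hpos.ne']
    linear_combination -hγ
  rw [e]
  set ξ := ⟪a, x⟫
  have e2 : (γ ^ 2 / (1 + β * ξ))⁻¹ • (γ • (1 + β * ξ)⁻¹ • (γ • x + (β + (1 - γ) * ξ) • a) +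
      (-β + (1 - γ) * ((ξ + β) / (1 + β * ξ))) • a) =
      ((γ ^ 2 / (1 + β * ξ))⁻¹ * γ * (1 + β * ξ)⁻¹ * γ) • x +
      ((γ ^ 2 / (1 + β * ξ))⁻¹ * (γ * (1 + β * ξ)⁻¹ * (β + (1 - γ) * ξ) +
        (-β + (1 - γ) * ((ξ + β) / (1 + β * ξ))))) • a := by module
  rw [e2]
  have hγ1 : γ ≠ 0 := fun h => by rw [h] at hγ0; norm_num at hγ0
  have e3 : (γ ^ 2 / (1 + β * ξ))⁻¹ * γ * (1 + β * ξ)⁻¹ * γ = 1 := by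
    field_simp
  have e4 : γ * (1 + β * ξ)⁻¹ * (β + (1 - γ) * ξ) +
        (-β + (1 - γ) * ((ξ + β) / (1 + β * ξ))) = 0 := by
    field_simp
    linear_combination (-ξ) * hγ
  rw [e3, e4, one_smul, mul_zero, zero_smul, add_zero]

theorem spherePair_boost {a : Euc 3} (ha : ‖a‖ = 1) {β γ : ℝ} (hβ : |β| < 1)
    (hγ : β ^ 2 + γ ^ 2 = 1) : SpherePair (boost a β γ) (boost a (-β) γ) := by
  have hβ' : |-β| < 1 := by rwa [abs_neg]
  have hγ' : (-β) ^ 2 + γ ^ 2 = 1 := by rwa [neg_sq]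
  simp only [← mem_sphere_zero_iff_norm] at *
  refine ⟨contDiff_boost (by simpa using ha) hβ, contDiff_boost (by simpa using ha) hβ',
    fun x hx => ?_, fun x hx => ?_, fun x hx => ?_, fun x hx => ?_⟩ <;>
  rw [mem_sphere_zero_iff_norm] at *
  · exact norm_boost ha hx hβ hγ
  · exact norm_boost ha hx hβ' hγ'
  · exact boost_boost ha hx hβ hγ
  · have := boost_boost ha hx hβ' hγ'
    rwa [neg_neg] at this

theorem boost_ne_neg {a x : Euc 3} (ha : ‖a‖ = 1) (hx : ‖x‖ = 1) {β γ : ℝ} (hβ : |β| < 1)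
    (hγ0 : 0 < γ) (hγ : β ^ 2 + γ ^ 2 = 1) : boost a β γ x ≠ -x := by
  intro h
  have hpos := boost_denom_pos ha hx hβ
  have h1 := inner_boost (γ := γ) ha hx hβ
  rw [h, inner_neg_right, eq_div_iff hpos.ne'] at h1
  have h2 := congrArg (fun y => ⟪x, y⟫) h
  simp only [boost_eq ha hx hβ, inner_smul_right, inner_add_right, inner_neg_right,
    real_inner_self_eq_norm_sq, hx, real_inner_comm] at h2
  rw [inv_mul_eq_iff_eq_mul₀ hpos.ne'] at h2
  set ξ := ⟪a, x⟫
  have h4 : γ * (1 - ξ ^ 2) + (1 + β * ξ) * (1 - ξ ^ 2) = 0 := by linear_combination h2 + ξ * h1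
  have h5 : 1 - ξ ^ 2 = 0 := by
    have : (γ + (1 + β * ξ)) * (1 - ξ ^ 2) = 0 := by linarith
    exact (mul_eq_zero.1 this).resolve_left (by positivity)
  have h6 : (2 : ℝ) * ξ + β * (1 + ξ ^ 2) = 0 := by linarith
  have h7 : ξ = -β := by linarith [show ξ ^ 2 = 1 by linarith, congrArg (β * ·) (show ξ ^ 2 = 1 by linarith)]
  rw [h7] at h5
  nlinarith

/-! ### Rotations -/

/-- The rotation taking the unit vector `a` to the unit vector `b`. -/
noncomputable def rot (a b x : Euc 3) : Euc 3 :=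
  x - ((⟪a, x⟫ + ⟪b, x⟫) / (1 + ⟪a, b⟫)) • (a + b) + (2 * ⟪a, x⟫) • b

variable {a b : Euc 3}

theorem contDiff_rot : ContDiff ℝ ∞ (rot a b) := by
  unfold rot
  have h2 : ∀ a : Euc 3, ContDiff ℝ ∞ fun x : Euc 3 => ⟪a, x⟫ := fun a =>
    contDiff_const.inner ℝ contDiff_id
  have h4 := h2 b
  fun_prop

theorem inner_rot_right (hb : ‖b‖ = 1) (h : 0 < 1 + ⟪a, b⟫) (x : Euc 3) :
    ⟪b, rot a b x⟫ = ⟪a, x⟫ := by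
  rw [rot, inner_add_right, inner_sub_right, inner_smul_right, inner_smul_right, inner_add_right,
    real_inner_self_eq_norm_sq, hb, real_inner_comm a b]
  field_simp
  ring

theorem inner_rot_left (ha : ‖a‖ = 1) (h : 0 < 1 + ⟪a, b⟫) (x : Euc 3) :
    ⟪a, rot a b x⟫ = 2 * ⟪a, b⟫ * ⟪a, x⟫ - ⟪b, x⟫ := by
  rw [rot, inner_add_right, inner_sub_right, inner_smul_right, inner_smul_right, inner_add_right,
    real_inner_self_eq_norm_sq, ha]
  field_simp
  ring

theorem norm_rot_sq (ha : ‖a‖ = 1) (hb : ‖b‖ = 1) (h : 0 < 1 + ⟪a, b⟫) (x : Euc 3) :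
    ‖rot a b x‖ ^ 2 = ‖x‖ ^ 2 := by
  rw [← real_inner_self_eq_norm_sq]
  nth_rewrite 1 [rot]
  rw [inner_add_left, inner_sub_left, inner_smul_left, inner_smul_left, inner_add_left,
    inner_rot_right hb h, inner_rot_left ha h]
  have : ⟪x, rot a b x⟫ = ‖x‖ ^ 2 - ((⟪a, x⟫ + ⟪b, x⟫) / (1 + ⟪a, b⟫)) * (⟪a, x⟫ + ⟪b, x⟫) +
      2 * ⟪a, x⟫ * ⟪b, x⟫ := by
    rw [rot, inner_add_right, inner_sub_right, inner_smul_right, inner_smul_right,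
      inner_add_right, real_inner_self_eq_norm_sq, real_inner_comm a x, real_inner_comm b x]
  rw [this]
  simp only [conj_trivial]
  field_simp
  ring

theorem rot_rot (ha : ‖a‖ = 1) (hb : ‖b‖ = 1) (h : 0 < 1 + ⟪a, b⟫) (x : Euc 3) :
    rot b a (rot a b x) = x := by
  rw [rot, inner_rot_right hb h, inner_rot_left ha h, rot, real_inner_comm a b]
  have e : ((⟪a, x⟫ + (2 * ⟪a, b⟫ * ⟪a, x⟫ - ⟪b, x⟫)) / (1 + ⟪a, b⟫)) =
    2 * ⟪a, x⟫ - (⟪a, x⟫ + ⟪b, x⟫) / (1 + ⟪a, b⟫) := by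
    field_simp
    ring
  rw [e]
  module

theorem spherePair_rot (ha : ‖a‖ = 1) (hb : ‖b‖ = 1) (h : 0 < 1 + ⟪a, b⟫) :
    SpherePair (rot a b) (rot b a) := by
  have h' : 0 < 1 + ⟪b, a⟫ := by rwa [real_inner_comm]
  refine ⟨contDiff_rot, contDiff_rot, fun x hx => ?_, fun x hx => ?_,
    fun x hx => rot_rot ha hb h x, fun x hx => rot_rot hb ha h' x⟩ <;>
  rw [mem_sphere_zero_iff_norm] at *
  · rw [← pow_left_inj₀ (norm_nonneg _) zero_le_one two_ne_zero, norm_rot_sq ha hb h, hx]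
  · rw [← pow_left_inj₀ (norm_nonneg _) zero_le_one two_ne_zero, norm_rot_sq hb ha h', hx]

theorem rot_sub (h : 0 < 1 + ⟪a, b⟫) (x : Euc 3) :
    rot a b x - x = (1 + ⟪a, b⟫)⁻¹ • ((⟪a, x⟫ + ⟪b, x⟫) • (b - a) +
      (2 * (⟪a, b⟫ * ⟪a, x⟫ - ⟪b, x⟫)) • b) := by
  have e : 2 * ⟪a, x⟫ = (1 + ⟪a, b⟫)⁻¹ * (2 * ⟪a, x⟫ * (1 + ⟪a, b⟫)) := by field_simp
  rw [rot, e]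
  module

theorem norm_rot_sub_le (ha : ‖a‖ = 1) (hb : ‖b‖ = 1) (h : 0 ≤ ⟪a, b⟫) {x : Euc 3}
    (hx : ‖x‖ = 1) : ‖rot a b x - x‖ ≤ 6 * ‖a - b‖ := by
  have h1 := abs_inner_le ha hx
  have h2 := abs_inner_le hb hx
  have h0 := abs_inner_le ha hb
  rw [abs_le] at h0
  have hn : 0 ≤ ‖a - b‖ := norm_nonneg _
  have hc : |⟪a, b⟫ * ⟪a, x⟫ - ⟪b, x⟫| ≤ 2 * ‖a - b‖ := by
    have e : ⟪a, b⟫ * ⟪a, x⟫ - ⟪b, x⟫ = ⟪a - b, x⟫ - ⟪a, a - b⟫ * ⟪a, x⟫ := by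
      rw [inner_sub_left, inner_sub_right, real_inner_self_eq_norm_sq, ha]; ring
    have h3 := abs_real_inner_le_norm (a - b) x
    have h4 := abs_real_inner_le_norm a (a - b)
    rw [hx, mul_one] at h3
    rw [ha, one_mul] at h4
    rw [e]
    refine (abs_sub _ _).trans ?_
    rw [abs_mul]
    nlinarith [abs_nonneg ⟪a, x⟫]
  rw [rot_sub (by linarith), norm_smul, norm_inv, Real.norm_of_nonneg (by linarith)]
  have h5 : ‖(⟪a, x⟫ + ⟪b, x⟫) • (b - a) + (2 * (⟪a, b⟫ * ⟪a, x⟫ - ⟪b, x⟫)) • b‖ ≤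
      6 * ‖a - b‖ := by
    refine (norm_add_le _ _).trans ?_
    rw [norm_smul, norm_smul, hb, mul_one, norm_sub_rev b a, Real.norm_eq_abs, Real.norm_eq_abs,
      abs_mul, abs_two]
    have := abs_add_le ⟪a, x⟫ ⟪b, x⟫
    nlinarith
  have h6 : (1 + ⟪a, b⟫)⁻¹ ≤ 1 := inv_le_one_of_one_le₀ (by linarith)
  have h7 : 0 ≤ (1 + ⟪a, b⟫)⁻¹ := by positivity
  nlinarith

end DefectBord

namespace DefectBord

open scoped RealInnerProductSpace

/-! ### General position -/

/-- Finitely many smooth arcs in the sphere whose union contains `Γ`. -/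
structure IsCover {ι : Type} (Γ : Set S2) (c : ι → ℝ → Euc 3) : Prop where
  contDiff : ∀ i, ContDiff ℝ ∞ (c i)
  mem : ∀ i, ∀ s ∈ Icc (0 : ℝ) 1, c i s ∈ sphere (0 : Euc 3) 1 ∧ deriv (c i) s ≠ 0
  surj : ∀ x ∈ Γ, ∃ i, ∃ s ∈ Icc (0 : ℝ) 1, c i s = x

theorem IsTrivalentGraph.exists_cover {Γ V : Set S2} (h : IsTrivalentGraph Γ V) :
    ∃ (ι : Type) (_ : Finite ι) (c : ι → ℝ → Euc 3), IsCover Γ c := by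
  have hstar : ∀ x : S2, x ∈ Γ → ∃ k, IsStarAt Γ k x := by
    intro x hx
    by_cases hV : x ∈ V
    · exact ⟨3, h.vertex x hV⟩
    · exact ⟨2, h.edge x ⟨hx, hV⟩⟩
  choose! k hk using hstar
  choose! c h1 h2 h3 h4 U hU h5 using hk
  obtain ⟨t, hcov⟩ := h.isClosed.isCompact.elim_nhds_subcover'
    (fun x _ => Subtype.val ⁻¹' U x) (fun x hx =>
      continuous_subtype_val.continuousAt.preimage_mem_nhds (hU x hx))
  refine ⟨Σ x : t, Fin (k x.1), inferInstance, fun i => c i.1.1 i.2, fun i => h1 _ i.1.1.2 _,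
    fun i => h3 _ i.1.1.2 _, fun x hx => ?_⟩
  obtain ⟨y, hy, hxy⟩ := mem_iUnion₂.1 (hcov hx)
  have : (x : Euc 3) ∈ (⋃ a, c y a '' Icc (0 : ℝ) 1) ∩ U y := h5 y y.2 ▸ ⟨⟨x, hx, rfl⟩, hxy⟩
  obtain ⟨a, s, hs, e⟩ := mem_iUnion.1 this.1
  exact ⟨⟨⟨y, hy⟩, a⟩, s, hs, e⟩

theorem dense_compl_iUnion_range {ι : Type} [Finite ι] {f : ι → ℝ × ℝ → Euc 3}
    (hf : ∀ i, ContDiff ℝ 1 (f i)) : Dense (⋃ i, range (f i))ᶜ := by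
  refine dense_compl_of_dimH_lt_finrank ?_
  rw [dimH_iUnion]
  refine lt_of_le_of_lt (iSup_le fun i => (hf i).dimH_range_le) ?_
  simp only [Module.finrank_prod, Module.finrank_self, finrank_euclideanSpace_fin]
  norm_num

theorem norm_normalize_sub_le {E : Type*} [NormedAddCommGroup E] [NormedSpace ℝ E] {v e : E}
    (he : ‖e‖ = 1) (hv : v ≠ 0) : ‖‖v‖⁻¹ • v - e‖ ≤ 2 * ‖v - e‖ := by
  have hn : 0 < ‖v‖ := norm_pos_iff.2 hv
  have h1 : ‖‖v‖⁻¹ • v - v‖ ≤ ‖v - e‖ := by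
    have : ‖v‖⁻¹ • v - v = (‖v‖⁻¹ - 1) • v := by module
    rw [this, norm_smul, ← abs_norm v, Real.norm_eq_abs, ← abs_mul, abs_norm, sub_mul,
      inv_mul_cancel₀ hn.ne', one_mul, ← he, norm_sub_rev v e]
    exact abs_norm_sub_norm_le e v
  calc ‖‖v‖⁻¹ • v - e‖ = ‖(‖v‖⁻¹ • v - v) + (v - e)‖ := by congr 1; abel
    _ ≤ _ := by linarith [norm_add_le (‖v‖⁻¹ • v - v) (v - e)]

theorem IsCover.exists_direction {ι : Type} [Finite ι] {Γ : Set S2} {c : ι → ℝ → Euc 3}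
    (h : IsCover Γ c) {e : Euc 3} (he : ‖e‖ = 1) {ε : ℝ} (hε : 0 < ε) :
    ∃ a : Euc 3, ‖a‖ = 1 ∧ ‖a - e‖ < ε ∧ ∀ x ∈ Γ, (x : Euc 3) ≠ -a := by
  have hd := dense_compl_iUnion_range (f := fun i (z : ℝ × ℝ) => z.1 • c i z.2) (fun i =>
    contDiff_fst.smul (((h.contDiff i).of_le (by norm_cast)).comp contDiff_snd))
  obtain ⟨v, hv, hvε⟩ := hd.exists_dist_lt (-e) (show 0 < min (ε / 2) 1 by positivity)
  rw [lt_min_iff, dist_eq_norm, norm_sub_rev, sub_neg_eq_add] at hvε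
  have hv0 : -v ≠ 0 := by
    intro h0
    rw [neg_eq_zero] at h0
    rw [h0, zero_add, he] at hvε
    linarith [hvε.2]
  have hn := norm_pos_iff.2 hv0
  refine ⟨‖-v‖⁻¹ • -v, ?_, ?_, fun x hx hxa => hv ?_⟩
  · rw [norm_smul, norm_inv, norm_norm, inv_mul_cancel₀ hn.ne']
  · have h1 := norm_normalize_sub_le he hv0
    have h2 : ‖-v - e‖ = ‖v + e‖ := by rw [← norm_neg]; congr 1; abel
    rw [h2] at h1
    linarith [hvε.1]
  · obtain ⟨i, s, -, e⟩ := h.surj x hx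
    refine mem_iUnion.2 ⟨i, (‖-v‖, s), ?_⟩
    simp only
    rw [e, hxa, smul_neg, smul_smul, mul_inv_cancel₀ hn.ne', one_smul, neg_neg]

theorem exists_boost {Γ : Set S2} (hΓ : IsClosed Γ) {a : Euc 3} (ha : ‖a‖ = 1)
    (hne : ∀ x ∈ Γ, (x : Euc 3) ≠ -a) {ε : ℝ} (hε : 0 < ε) :
    ∃ β γ : ℝ, |β| < 1 ∧ 0 < γ ∧ β ^ 2 + γ ^ 2 = 1 ∧ ∀ x ∈ Γ, ‖boost a β γ x - a‖ < ε := by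
  obtain ⟨η, hη, hηΓ⟩ : ∃ η > 0, ∀ x ∈ Γ, η ≤ 1 + ⟪a, (x : Euc 3)⟫ := by
    rcases Γ.eq_empty_or_nonempty with rfl | hn
    · grind
    obtain ⟨x, hx, hmin⟩ := hΓ.isCompact.exists_isMinOn hn
      (f := fun x : S2 => 1 + ⟪a, (x : Euc 3)⟫) (by fun_prop)
    refine ⟨_, ?_, hmin⟩
    have h1 := abs_inner_le ha (norm_eq_of_mem_sphere x)
    rw [abs_le] at h1
    refine lt_of_le_of_ne (by linarith) fun h0 => hne x hx ?_
    have h2 := (inner_eq_neg_one_iff_of_norm_eq_one (𝕜 := ℝ) ha (norm_eq_of_mem_sphere x)).1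
      (by linarith)
    rw [h2, neg_neg]
  set κ := min (1 / 2) (η * ε ^ 2 / 16) with hκ
  have hκ0 : 0 < κ := by positivity
  have hκ1 : κ ≤ 1 / 2 := min_le_left _ _
  have hκ2 : κ ≤ η * ε ^ 2 / 16 := min_le_right _ _
  have hβ : |1 - κ| < 1 := by rw [abs_lt]; constructor <;> linarith
  have hγ : 0 < 1 - (1 - κ) ^ 2 := by nlinarith
  have hγ2 : (1 - κ) ^ 2 + Real.sqrt (1 - (1 - κ) ^ 2) ^ 2 = 1 := by rw [Real.sq_sqrt hγ.le]; ring
  refine ⟨1 - κ, Real.sqrt (1 - (1 - κ) ^ 2), hβ, Real.sqrt_pos.2 hγ, hγ2, fun x hx => ?_⟩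
  have hx1 := norm_eq_of_mem_sphere x
  have h1 := abs_inner_le ha hx1
  rw [abs_le] at h1
  have h2 := hηΓ x hx
  have hpos := boost_denom_pos ha hx1 hβ
  refine lt_of_pow_lt_pow_left₀ 2 hε.le ?_
  rw [norm_sub_sq_real, norm_boost ha hx1 hβ hγ2, ha, real_inner_comm, inner_boost ha hx1 hβ]
  set ξ := ⟪a, (x : Euc 3)⟫
  have e : (1 : ℝ) ^ 2 - 2 * ((ξ + (1 - κ)) / (1 + (1 - κ) * ξ)) + 1 ^ 2 =
      2 * κ * (1 - ξ) / (1 + (1 - κ) * ξ) := by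
    grind
  rw [e, div_lt_iff₀ hpos]
  have h3 : η / 2 ≤ 1 + (1 - κ) * ξ := by nlinarith
  nlinarith [mul_pos hη (pow_pos hε 2)]

theorem eq_smul_of_orthogonal {v x y : Euc 3} (hx : ⟪v, x⟫ = 0) (hy : ⟪v, y⟫ = 0) {w : Euc 3}
    (h0 : w 0 = x 1 * y 2 - x 2 * y 1) (h1 : w 1 = x 2 * y 0 - x 0 * y 2)
    (h2 : w 2 = x 0 * y 1 - x 1 * y 0) (hw : w ≠ 0) : ∃ r : ℝ, v = r • w := by
  simp only [PiLp.inner_apply, Fin.sum_univ_three, RCLike.inner_apply, conj_trivial] at hx hy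
  have hn : w 0 ^ 2 + w 1 ^ 2 + w 2 ^ 2 ≠ 0 := by
    intro h
    apply hw
    ext i
    fin_cases i
    all_goals simp; nlinarith [sq_nonneg (w 0), sq_nonneg (w 1), sq_nonneg (w 2)]
  refine ⟨(v 0 * w 0 + v 1 * w 1 + v 2 * w 2) / (w 0 ^ 2 + w 1 ^ 2 + w 2 ^ 2), ?_⟩
  have c0 : v 1 * w 2 - v 2 * w 1 = 0 := by rw [h1, h2]; linear_combination x 0 * hy - y 0 * hx
  have c1 : v 2 * w 0 - v 0 * w 2 = 0 := by rw [h0, h2]; linear_combination x 1 * hy - y 1 * hx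
  have c2 : v 0 * w 1 - v 1 * w 0 = 0 := by rw [h0, h1]; linear_combination x 2 * hy - y 2 * hx
  ext i
  fin_cases i <;> simp only [PiLp.smul_apply, smul_eq_mul, Fin.zero_eta, Fin.mk_one,
    Fin.reduceFinMk, Fin.isValue] <;> field_simp
  · linear_combination w 1 * c2 - w 2 * c1
  · linear_combination w 2 * c0 - w 0 * c2
  · linear_combination w 0 * c1 - w 1 * c0

/-- Velocity and acceleration of a regular curve on the sphere are linearly independent. -/
theorem cross_ne_zero {c : ℝ → Euc 3} (hc : ContDiff ℝ ∞ c)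
    (hs : ∀ s ∈ Icc (0 : ℝ) 1, c s ∈ sphere (0 : Euc 3) 1) {s : ℝ} (hs' : s ∈ Icc (0 : ℝ) 1)
    (hd : deriv c s ≠ 0) {w : Euc 3}
    (h0 : w 0 = deriv c s 1 * deriv (deriv c) s 2 - deriv c s 2 * deriv (deriv c) s 1)
    (h1 : w 1 = deriv c s 2 * deriv (deriv c) s 0 - deriv c s 0 * deriv (deriv c) s 2)
    (h2 : w 2 = deriv c s 0 * deriv (deriv c) s 1 - deriv c s 1 * deriv (deriv c) s 0) :
    w ≠ 0 := by
  have d1 : ContDiff ℝ ∞ (deriv c) := (contDiff_infty_iff_deriv.1 hc).2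
  have d2 : ContDiff ℝ ∞ (deriv (deriv c)) := (contDiff_infty_iff_deriv.1 d1).2
  have hc1 : ∀ t, HasDerivAt c (deriv c t) t := fun t => (hc.differentiable (by simp) t).hasDerivAt
  have hc2 : ∀ t, HasDerivAt (deriv c) (deriv (deriv c) t) t := fun t =>
    (d1.differentiable (by simp) t).hasDerivAt
  have hclos : closure (Ioo (0 : ℝ) 1) = Icc 0 1 := closure_Ioo zero_ne_one
  have e1 : ∀ t ∈ Ioo (0 : ℝ) 1, ⟪c t, deriv c t⟫ = 0 := by
    intro t ht
    have hdt := (hc1 t).inner ℝ (hc1 t)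
    have hconst : HasDerivAt (fun t => ⟪c t, c t⟫) 0 t := by
      refine (hasDerivAt_const t (1 : ℝ)).congr_of_eventuallyEq ?_
      filter_upwards [Ioo_mem_nhds ht.1 ht.2] with r hr
      rw [real_inner_self_eq_norm_sq, norm_eq_of_mem_sphere ⟨c r, hs r ⟨hr.1.le, hr.2.le⟩⟩]
      norm_num
    have := hdt.unique hconst
    rw [real_inner_comm] at this
    linarith [real_inner_comm (c t) (deriv c t)]
  have e2 : ∀ t ∈ Ioo (0 : ℝ) 1, ⟪c t, deriv (deriv c) t⟫ + ⟪deriv c t, deriv c t⟫ = 0 := by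
    intro t ht
    have hdt := (hc1 t).inner ℝ (hc2 t)
    have hconst : HasDerivAt (fun t => ⟪c t, deriv c t⟫) 0 t := by
      refine (hasDerivAt_const t (0 : ℝ)).congr_of_eventuallyEq ?_
      filter_upwards [Ioo_mem_nhds ht.1 ht.2] with r hr
      exact e1 r hr
    exact hdt.unique hconst
  have e1' : ⟪c s, deriv c s⟫ = 0 := by
    have hcl : IsClosed {t | ⟪c t, deriv c t⟫ = 0} :=
      isClosed_eq (hc.continuous.inner d1.continuous) continuous_const
    exact hcl.closure_subset_iff.2 e1 (hclos ▸ hs')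
  have e2' : ⟪c s, deriv (deriv c) s⟫ + ⟪deriv c s, deriv c s⟫ = 0 := by
    have hcl : IsClosed {t | ⟪c t, deriv (deriv c) t⟫ + ⟪deriv c t, deriv c t⟫ = 0} :=
      isClosed_eq ((hc.continuous.inner d2.continuous).add (d1.continuous.inner d1.continuous))
        continuous_const
    exact hcl.closure_subset_iff.2 e2 (hclos ▸ hs')
  rintro rfl
  simp only [PiLp.zero_apply] at h0 h1 h2
  simp only [PiLp.inner_apply, Fin.sum_univ_three, RCLike.inner_apply, conj_trivial] at e1' e2'
  have key : (deriv c s 0 ^ 2 + deriv c s 1 ^ 2 + deriv c s 2 ^ 2) *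
      (deriv c s 0 ^ 2 + deriv c s 1 ^ 2 + deriv c s 2 ^ 2) = 0 := by
    generalize deriv c s = x at *
    generalize deriv (deriv c) s = y at *
    generalize c s = z at *
    linear_combination (x 0 ^ 2 + x 1 ^ 2 + x 2 ^ 2) * e2' -
      (x 0 * y 0 + x 1 * y 1 + x 2 * y 2) * e1' -
      (z 0 * x 1 - z 1 * x 0) * h2 - (z 1 * x 2 - z 2 * x 1) * h0 - (z 2 * x 0 - z 0 * x 2) * h1
  have key' := mul_self_eq_zero.1 key
  apply hd
  ext i
  fin_cases i
  all_goals simp; nlinarith [sq_nonneg (deriv c s 0), sq_nonneg (deriv c s 1), sq_nonneg (deriv c s 2)]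

theorem IsCover.exists_generic {ι : Type} [Finite ι] {Γ : Set S2} {c : ι → ℝ → Euc 3}
    (h : IsCover Γ c) {e : Euc 3} (he : ‖e‖ = 1) {ε : ℝ} (hε : 0 < ε) :
    ∃ a : Euc 3, ‖a‖ = 1 ∧ ‖a - e‖ < ε ∧ ∀ i, ∀ s ∈ Icc (0 : ℝ) 1,
      ⟪a, deriv (c i) s⟫ ≠ 0 ∨ ⟪a, deriv (deriv (c i)) s⟫ ≠ 0 := by
  set w : ι → ℝ → Euc 3 := fun i s =>
    !₂[deriv (c i) s 1 * deriv (deriv (c i)) s 2 - deriv (c i) s 2 * deriv (deriv (c i)) s 1,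
      deriv (c i) s 2 * deriv (deriv (c i)) s 0 - deriv (c i) s 0 * deriv (deriv (c i)) s 2,
      deriv (c i) s 0 * deriv (deriv (c i)) s 1 - deriv (c i) s 1 * deriv (deriv (c i)) s 0] with hw
  have cw : ∀ i, ContDiff ℝ 1 (w i) := by
    intro i
    have d1 : ContDiff ℝ ∞ (deriv (c i)) := (contDiff_infty_iff_deriv.1 (h.contDiff i)).2
    have d2 : ContDiff ℝ ∞ (deriv (deriv (c i))) := (contDiff_infty_iff_deriv.1 d1).2
    have d1' : ∀ j, ContDiff ℝ 1 fun s => deriv (c i) s j := fun j =>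
      (contDiff_euclidean.1 d1 j).of_le (by norm_cast)
    have d2' : ∀ j, ContDiff ℝ 1 fun s => deriv (deriv (c i)) s j := fun j =>
      (contDiff_euclidean.1 d2 j).of_le (by norm_cast)
    rw [contDiff_euclidean]
    intro j
    fin_cases j
    · exact ((d1' 1).mul (d2' 2)).sub ((d1' 2).mul (d2' 1))
    · exact ((d1' 2).mul (d2' 0)).sub ((d1' 0).mul (d2' 2))
    · exact ((d1' 0).mul (d2' 1)).sub ((d1' 1).mul (d2' 0))
  have hd := dense_compl_iUnion_range (f := fun i (z : ℝ × ℝ) => z.1 • w i z.2) (fun i =>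
    contDiff_fst.smul ((cw i).comp contDiff_snd))
  obtain ⟨v, hv, hvε⟩ := hd.exists_dist_lt e (show 0 < min (ε / 2) 1 by positivity)
  rw [lt_min_iff, dist_eq_norm, norm_sub_rev] at hvε
  have hv0 : v ≠ 0 := by
    rintro rfl
    rw [zero_sub, norm_neg, he] at hvε
    linarith [hvε.2]
  have hn := norm_pos_iff.2 hv0
  refine ⟨‖v‖⁻¹ • v, ?_, ?_, fun i s hs => ?_⟩
  · rw [norm_smul, norm_inv, norm_norm, inv_mul_cancel₀ hn.ne']
  · linarith [norm_normalize_sub_le he hv0, hvε.1]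
  · by_contra! hcon
    simp only [inner_smul_left, conj_trivial, mul_eq_zero, inv_eq_zero, norm_eq_zero, hv0,
      false_or] at hcon
    have hwne : w i s ≠ 0 := cross_ne_zero (h.contDiff i) (fun t ht => (h.mem i t ht).1) hs
      (h.mem i s hs).2 rfl rfl rfl
    obtain ⟨r, hr⟩ := eq_smul_of_orthogonal hcon.1 hcon.2 (w := w i s) rfl rfl rfl hwne
    exact hv (mem_iUnion.2 ⟨i, (r, s), hr.symm⟩)

/-- After a homeomorphism of the sphere, the graph lies on the front and the height has only
nondegenerate critical points along it. -/
theorem IsTrivalentGraph.exists_position {Γ V : Set S2} (h : IsTrivalentGraph Γ V) :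
    ∃ T : S2 ≃ₜ S2, (T : C(S2, S2)).Homotopic (ContinuousMap.id S2) ∧
      IsTrivalentGraph (T '' Γ) (T '' V) ∧ (∀ p ∈ T '' Γ, 4 / 5 < (p : Euc 3) 0) ∧
      ∃ (ι : Type) (_ : Finite ι) (c : ι → ℝ → Euc 3), IsCover (T '' Γ) c ∧
        ∀ i, ∀ s ∈ Icc (0 : ℝ) 1, deriv (fun t => c i t 2) s ≠ 0 ∨
          deriv (deriv fun t => c i t 2) s ≠ 0 := by
  have n0 : ‖(EuclideanSpace.single 0 1 : Euc 3)‖ = 1 := by simp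
  have n2 : ‖(EuclideanSpace.single 2 1 : Euc 3)‖ = 1 := by simp
  obtain ⟨ι, _, c, hc⟩ := h.exists_cover
  obtain ⟨a, ha, hae, hne⟩ := hc.exists_direction n0 (show (0 : ℝ) < 1 / 100 by norm_num)
  obtain ⟨β, γ, hβ, hγ0, hγ, hb⟩ := exists_boost h.isClosed ha hne
    (show (0 : ℝ) < 1 / 100 by norm_num)
  have hM := spherePair_boost ha hβ hγ
  have h1 := hM.isTrivalentGraph h
  obtain ⟨κ, _, d, hd⟩ := h1.exists_cover
  obtain ⟨v, hv, hve, hgen⟩ := hd.exists_generic n2 (show (0 : ℝ) < 1 / 100 by norm_num)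
  set b : Euc 3 := EuclideanSpace.single 2 1 with hbdef
  have hvb : 1 / 2 ≤ ⟪v, b⟫ := by
    have := norm_sub_sq_real v b
    rw [hv, n2] at this
    nlinarith [norm_nonneg (v - b)]
  have hpos : 0 < 1 + ⟪v, b⟫ := by linarith
  have hR := spherePair_rot hv n2 hpos
  have h2 := hR.isTrivalentGraph h1
  have e : ∀ A : Set S2, (hM.homeo.trans hR.homeo) '' A = hR.homeo '' (hM.homeo '' A) := fun A => by
    rw [image_image]; rfl
  have hheight : ∀ x : Euc 3, rot v b x 2 = ⟪v, x⟫ := by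
    intro x
    have := inner_rot_right n2 hpos x
    rw [hbdef, EuclideanSpace.inner_single_left] at this
    simpa using this
  refine ⟨hM.homeo.trans hR.homeo, ?_, by rw [e, e]; exact h2, ?_, κ, inferInstance,
    fun i => rot v b ∘ d i, ⟨fun i => hR.contDiff.comp (hd.contDiff i), fun i s hs =>
      ⟨hR.mapsTo (hd.mem i s hs).1, hR.deriv_ne_zero (hd.contDiff i)
        (fun t ht => (hd.mem i t ht).1) hs (hd.mem i s hs).2⟩, ?_⟩, fun i s hs => ?_⟩
  · refine (homotopic_id_of_ne_neg hR.homeo fun p hp => ?_).comp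
      (homotopic_id_of_ne_neg hM.homeo fun p => boost_ne_neg ha (norm_eq_of_mem_sphere p) hβ hγ0 hγ)
    have hp1 := norm_eq_of_mem_sphere p
    have hle := norm_rot_sub_le hv n2 (by linarith) hp1
    rw [hR.homeo_coe] at hp
    rw [hp, ← neg_add', norm_neg, ← two_smul ℝ, norm_smul, hp1] at hle
    norm_num at hle
    linarith
  · rw [e]
    rintro _ ⟨_, ⟨x, hx, rfl⟩, rfl⟩
    have hx1 := norm_eq_of_mem_sphere (hM.homeo x)
    have hle := norm_rot_sub_le hv n2 (by linarith) hx1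
    rw [hR.homeo_coe]
    have h3 := hb x hx
    rw [← hM.homeo_coe] at h3
    set y : Euc 3 := (hM.homeo x).1
    have h4 : ‖rot v b y - EuclideanSpace.single 0 1‖ < 1 / 5 := by
      calc ‖rot v b y - EuclideanSpace.single 0 1‖ =
          ‖(rot v b y - y) + (y - a) + (a - EuclideanSpace.single 0 1)‖ := by congr 1; abel
        _ ≤ ‖rot v b y - y‖ + ‖y - a‖ + ‖a - EuclideanSpace.single 0 1‖ := norm_add₃_le
        _ < 1 / 5 := by linarith
    have h5 := PiLp.norm_apply_le (rot v b y - EuclideanSpace.single 0 1) 0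
    simp only [PiLp.sub_apply, PiLp.single_apply, if_true, Real.norm_eq_abs] at h5
    grind
  · rw [e]
    rintro _ ⟨x, hx, rfl⟩
    obtain ⟨i, s, hs, e⟩ := hd.surj x hx
    exact ⟨i, s, hs, by rw [Function.comp_apply, e]; rfl⟩
  · have d0 : ∀ t, HasDerivAt (d i) (deriv (d i) t) t := fun t =>
      ((hd.contDiff i).differentiable (by simp) t).hasDerivAt
    have d1 : ContDiff ℝ ∞ (deriv (d i)) := (contDiff_infty_iff_deriv.1 (hd.contDiff i)).2
    have e1 : deriv (fun t => (rot v b ∘ d i) t 2) = fun t => ⟪v, deriv (d i) t⟫ := by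
      ext t
      simp only [Function.comp_apply, hheight]
      have := (hasDerivAt_const t v).inner ℝ (d0 t)
      simp only [inner_zero_left, add_zero] at this
      exact this.deriv
    have e2 : deriv (fun t => ⟪v, deriv (d i) t⟫) s = ⟪v, deriv (deriv (d i)) s⟫ := by
      have := (hasDerivAt_const s v).inner ℝ (d1.differentiable (by simp) s).hasDerivAt
      simp only [inner_zero_left, add_zero] at this
      exact this.deriv
    rw [e1, e2]
    exact hgen i s hs

end DefectBord

namespace DefectBord

/-! ### Heights along the branches of a star -/

theorem tendsto_height_ratio {c : ℝ → Euc 3} (hc : ContDiff ℝ ∞ c) {s : ℝ} (hd : deriv c s ≠ 0) :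
    Filter.Tendsto (fun t => (c t 2 - c s 2) ^ 2 / ‖c t - c s‖ ^ 2) (𝓝[≠] s)
      (𝓝 (deriv (fun t => c t 2) s ^ 2 / ‖deriv c s‖ ^ 2)) := by
  have h1 : Filter.Tendsto (slope (fun t => c t 2) s) (𝓝[≠] s) (𝓝 (deriv (fun t => c t 2) s)) :=
    hasDerivAt_iff_tendsto_slope.1
      (((contDiff_euclidean.1 hc 2).differentiable (by simp)) s).hasDerivAt
  have h2 : Filter.Tendsto (slope c s) (𝓝[≠] s) (𝓝 (deriv c s)) :=
    hasDerivAt_iff_tendsto_slope.1 ((hc.differentiable (by simp)) s).hasDerivAt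
  refine ((h1.pow 2).div (h2.norm.pow 2) (pow_ne_zero 2 (norm_ne_zero_iff.2 hd))).congr' ?_
  filter_upwards [self_mem_nhdsWithin] with t ht
  have ht' : t - s ≠ 0 := sub_ne_zero.2 ht
  simp only [Pi.div_apply, slope_def_module, norm_smul, smul_eq_mul, norm_inv, mul_pow, Real.norm_eq_abs,
    inv_pow, sq_abs]
  grind

theorem tendsto_height_ratio_of_deriv_eq_zero {c : ℝ → Euc 3} (hc : ContDiff ℝ ∞ c) {s : ℝ}
    (hd : deriv c s ≠ 0) (h0 : deriv (fun t => c t 2) s = 0) :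
    Filter.Tendsto (fun t => (c t 2 - c s 2) / ‖c t - c s‖ ^ 2) (𝓝[≠] s)
      (𝓝 (deriv (deriv fun t => c t 2) s / 2 / ‖deriv c s‖ ^ 2)) := by
  set f : ℝ → ℝ := fun t => c t 2 with hf
  have cf : ContDiff ℝ ∞ f := contDiff_euclidean.1 hc 2
  have h1 : Filter.Tendsto (fun t => (f t - f s) / (t - s) ^ 2) (𝓝[≠] s)
      (𝓝 (deriv (deriv f) s / 2)) := by
    have h := Real.taylor_tendsto (f := f) (x₀ := s) (n := 2) (s := univ) convex_univ (mem_univ s)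
      (cf.of_le (by norm_cast)).contDiffOn
    rw [nhdsWithin_univ] at h
    have h' := (h.mono_left (nhdsWithin_le_nhds (s := {s}ᶜ))).add_const (deriv (deriv f) s / 2)
    rw [zero_add] at h'
    refine h'.congr' ?_
    filter_upwards [self_mem_nhdsWithin] with t ht
    have ht' : t - s ≠ 0 := sub_ne_zero.2 ht
    rw [taylorWithinEval_succ, taylorWithinEval_succ, taylor_within_zero_eval]
    simp only [iteratedDerivWithin_univ, iteratedDeriv_succ, iteratedDeriv_zero, h0, smul_eq_mul,
      Nat.factorial]
    grind
  have h2 : Filter.Tendsto (slope c s) (𝓝[≠] s) (𝓝 (deriv c s)) :=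
    hasDerivAt_iff_tendsto_slope.1 ((hc.differentiable (by simp)) s).hasDerivAt
  refine (h1.div (h2.norm.pow 2) (pow_ne_zero 2 (norm_ne_zero_iff.2 hd))).congr' ?_
  filter_upwards [self_mem_nhdsWithin] with t ht
  have ht' : t - s ≠ 0 := sub_ne_zero.2 ht
  simp only [Pi.div_apply, slope_def_module, norm_smul, norm_inv, mul_pow, Real.norm_eq_abs, inv_pow,
    sq_abs, hf]
  grind

/-- A regular curve which near its start is covered by curves with nondegenerate heights has
nondegenerate height at the start. -/
theorem IsCover.nondegenerate {ι : Type} [Finite ι] {Γ : Set S2} {c : ι → ℝ → Euc 3}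
    (h : IsCover Γ c) (hn : ∀ i, ∀ s ∈ Icc (0 : ℝ) 1, deriv (fun t => c i t 2) s ≠ 0 ∨
      deriv (deriv fun t => c i t 2) s ≠ 0) {b : ℝ → Euc 3} (hb : ContDiff ℝ ∞ b)
    (hd : deriv b 0 ≠ 0) (hne : ∀ᶠ t in 𝓝[>] (0 : ℝ), b t ≠ b 0)
    (hΓ : ∀ᶠ t in 𝓝[>] (0 : ℝ), b t ∈ Subtype.val '' Γ) :
    deriv (fun t => b t 2) 0 ≠ 0 ∨ deriv (deriv fun t => b t 2) 0 ≠ 0 := by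
  have h1 : ∃ᶠ t in 𝓝[>] (0 : ℝ), ∃ i, b t ≠ b 0 ∧ ∃ s ∈ Icc (0 : ℝ) 1, c i s = b t := by
    refine Filter.Eventually.frequently ?_
    filter_upwards [hne, hΓ] with t ht ⟨x, hx, e⟩
    obtain ⟨i, s, hs, e'⟩ := h.surj x hx
    grind
  obtain ⟨i, hi⟩ : ∃ i, ∃ᶠ t in 𝓝[>] (0 : ℝ), b t ≠ b 0 ∧ ∃ s ∈ Icc (0 : ℝ) 1, c i s = b t := by
    by_contra! hcon
    refine h1 ?_
    filter_upwards [Filter.eventually_all.2 hcon] with t ht ⟨i, hti, s, hs, e⟩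
    exact ht i hti s hs e
  obtain ⟨t, ht, hts⟩ := Filter.exists_seq_forall_of_frequently hi
  choose hbt s hs hcs using hts
  obtain ⟨s₀, hs₀, φ, hφ, hlim⟩ := isCompact_Icc.tendsto_subseq hs
  have ht' : Filter.Tendsto (t ∘ φ) Filter.atTop (𝓝[≠] 0) :=
    (ht.comp hφ.tendsto_atTop).mono_right (nhdsWithin_mono _ fun x hx => (ne_of_gt hx))
  have hc0 : c i s₀ = b 0 := by
    have h2 := ((h.contDiff i).continuous.tendsto s₀).comp hlim
    have h3 := (hb.continuous.tendsto 0).comp (ht'.mono_right nhdsWithin_le_nhds)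
    refine tendsto_nhds_unique h2 (h3.congr fun n => (hcs (φ n)).symm)
  have hs' : Filter.Tendsto (s ∘ φ) Filter.atTop (𝓝[≠] s₀) := by
    refine tendsto_nhdsWithin_iff.2 ⟨hlim, Filter.Eventually.of_forall fun n => ?_⟩
    grind
  have hdi := (h.mem i s₀ hs₀).2
  by_contra! hcon
  have r1 := (tendsto_height_ratio hb hd).comp ht'
  have r2 := (tendsto_height_ratio (h.contDiff i) hdi).comp hs'
  have r3 := tendsto_nhds_unique r1 (r2.congr fun n => by simp only [Function.comp_apply, hcs, hc0])
  rw [hcon.1, zero_pow two_ne_zero, zero_div, eq_comm, div_eq_zero_iff] at r3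
  have r4 : deriv (fun t => c i t 2) s₀ = 0 := by
    rcases r3 with h | h
    · exact pow_eq_zero_iff two_ne_zero |>.1 h
    · exact absurd h (pow_ne_zero 2 (norm_ne_zero_iff.2 hdi))
  have r5 := (tendsto_height_ratio_of_deriv_eq_zero hb hd hcon.1).comp ht'
  have r6 := (tendsto_height_ratio_of_deriv_eq_zero (h.contDiff i) hdi r4).comp hs'
  have r7 := tendsto_nhds_unique r5 (r6.congr fun n => by simp only [Function.comp_apply, hcs, hc0])
  rw [hcon.2, zero_div, zero_div, eq_comm, div_eq_zero_iff, div_eq_zero_iff] at r7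
  rcases r7 with (h | h) | h
  · exact (hn i s₀ hs₀).resolve_left (not_not.2 r4) h
  · norm_num at h
  · exact absurd h (pow_ne_zero 2 (norm_ne_zero_iff.2 hdi))

theorem eventually_deriv_pos {f : ℝ → ℝ} (hf : ContDiff ℝ ∞ f)
    (h : 0 < deriv f 0 ∨ (deriv f 0 = 0 ∧ 0 < deriv (deriv f) 0)) :
    ∀ᶠ t in 𝓝[>] (0 : ℝ), 0 < deriv f t := by
  have d1 : ContDiff ℝ ∞ (deriv f) := (contDiff_infty_iff_deriv.1 hf).2
  rcases h with h | ⟨h0, h⟩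
  · exact nhdsWithin_le_nhds (d1.continuous.continuousAt.eventually (lt_mem_nhds h))
  · have hs : Filter.Tendsto (slope (deriv f) 0) (𝓝[>] 0) (𝓝 (deriv (deriv f) 0)) :=
      (hasDerivAt_iff_tendsto_slope.1 (d1.differentiable (by simp) 0).hasDerivAt).mono_left
        (nhdsWithin_mono _ fun x hx => (ne_of_gt hx))
    filter_upwards [hs.eventually (lt_mem_nhds h), self_mem_nhdsWithin] with t ht ht0
    rw [slope_def_field, h0, sub_zero, sub_zero] at ht
    exact (div_pos_iff_of_pos_right ht0).1 ht

theorem exists_strictMonoOn {f : ℝ → ℝ} (hf : ContDiff ℝ ∞ f)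
    (h : 0 < deriv f 0 ∨ (deriv f 0 = 0 ∧ 0 < deriv (deriv f) 0)) :
    ∃ δ > 0, StrictMonoOn f (Icc 0 δ) := by
  obtain ⟨δ, hδ, hpos⟩ := mem_nhdsGT_iff_exists_Ioc_subset.1 (eventually_deriv_pos hf h)
  refine ⟨δ, hδ, strictMonoOn_of_deriv_pos (convex_Icc _ _) hf.continuous.continuousOn ?_⟩
  intro t ht
  rw [interior_Icc] at ht
  exact hpos ⟨ht.1, ht.2.le⟩

theorem exists_strictMonoOn_or {f : ℝ → ℝ} (hf : ContDiff ℝ ∞ f)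
    (h : deriv f 0 ≠ 0 ∨ deriv (deriv f) 0 ≠ 0) :
    ∃ δ > 0, StrictMonoOn f (Icc 0 δ) ∨ StrictAntiOn f (Icc 0 δ) := by
  have hcase : (0 < deriv f 0 ∨ (deriv f 0 = 0 ∧ 0 < deriv (deriv f) 0)) ∨
      (0 < deriv (fun t => -f t) 0 ∨
        (deriv (fun t => -f t) 0 = 0 ∧ 0 < deriv (deriv fun t => -f t) 0)) := by
    have e1 : deriv (fun t => -f t) = fun t => -deriv f t := by ext t; exact deriv.fun_neg
    have e2 : deriv (fun t => -deriv f t) 0 = -deriv (deriv f) 0 := deriv.fun_neg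
    grind
  rcases hcase with h | h
  · obtain ⟨δ, hδ, hm⟩ := exists_strictMonoOn hf h
    grind
  · obtain ⟨δ, hδ, hm⟩ := exists_strictMonoOn hf.neg h
    exact ⟨δ, hδ, Or.inr fun a ha b hb hab => neg_lt_neg_iff.1 (hm ha hb hab)⟩

/-! ### Monotone branches give strands -/

theorem exists_strand_up {q : ℝ → ℝ × ℝ} (hc : ContinuousOn q (Icc 0 1))
    (hm : StrictMonoOn (fun t => (q t).2) (Icc 0 1)) :
    ∃ g : ℝ → ℝ, Continuous g ∧ g (q 0).2 = (q 0).1 ∧ ∃ ε > 0, ∀ w : ℝ × ℝ, w.2 < (q 0).2 + ε →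
      ((∃ t ∈ Icc (0 : ℝ) 1, w = q t) ↔ w = q 0 ∨ ((q 0).2 < w.2 ∧ w.1 = g w.2)) := by
  set κ : ℝ → ℝ := fun t => max 0 (min 1 t) with hκ
  have cκ : Continuous κ := by simp only [hκ]; fun_prop
  have κmem : ∀ t, κ t ∈ Icc (0 : ℝ) 1 := fun t =>
    ⟨le_max_left _ _, max_le zero_le_one (min_le_left _ _)⟩
  have κid : ∀ t ∈ Icc (0 : ℝ) 1, κ t = t := fun t ht => by
    grind
  have κmono : Monotone κ := fun a b hab => max_le_max le_rfl (min_le_min le_rfl hab)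
  have κexp : ∀ a b, a ≤ b → κ b - κ a ≤ b - a := by
    grind
  set F : ℝ → ℝ := fun t => (q (κ t)).2 + (t - κ t) with hF
  have cq : Continuous fun t => q (κ t) := hc.comp_continuous cκ κmem
  have cF : Continuous F := (continuous_snd.comp cq).add (continuous_id.sub cκ)
  have mF : StrictMono F := by
    intro a b hab
    simp only [hF]
    have h1 := κexp a b hab.le
    rcases (κmono hab.le).lt_or_eq with h | h
    · have := hm (κmem a) (κmem b) h
      grind
    · rw [h]; linarith
  have hbd : ∃ C, ∀ t, |(q (κ t)).2 - κ t| ≤ C := by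
    obtain ⟨C, hC⟩ := isCompact_Icc.exists_bound_of_continuousOn
      (f := fun t => (q t).2 - t) ((continuous_snd.comp_continuousOn hc).sub continuousOn_id)
    exact ⟨C, fun t => hC _ (κmem t)⟩
  obtain ⟨C, hC⟩ := hbd
  have sF : Function.Surjective F := by
    refine cF.surjective ?_ ?_
    · refine Filter.tendsto_atTop_mono (f := fun t => t - C) (fun t => ?_)
        (Filter.tendsto_atTop_add_const_right _ (-C) Filter.tendsto_id)
      have := (abs_le.1 (hC t)).1
      grind
    · refine Filter.tendsto_atBot_mono (g := F) (f := fun t => t + C) (fun t => ?_)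
        (Filter.tendsto_atBot_add_const_right _ C Filter.tendsto_id)
      have := (abs_le.1 (hC t)).2
      grind
  set e := (mF.orderIsoOfSurjective F sF).toHomeomorph with he
  have heF : ∀ t, e t = F t := fun t => rfl
  have Fid : ∀ t ∈ Icc (0 : ℝ) 1, F t = (q t).2 := fun t ht => by
    grind
  have i0 : (0 : ℝ) ∈ Icc (0 : ℝ) 1 := by simp
  have i1 : (1 : ℝ) ∈ Icc (0 : ℝ) 1 := by simp
  have hge : ∀ t ∈ Icc (0 : ℝ) 1, (q (κ (e.symm (q t).2))).1 = (q t).1 := by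
    intro t ht
    rw [← Fid t ht, ← heF, e.symm_apply_apply, κid t ht]
  refine ⟨fun y => (q (κ (e.symm y))).1, continuous_fst.comp (cq.comp e.symm.continuous),
    hge 0 i0, (q 1).2 - (q 0).2, sub_pos.2 (hm i0 i1 zero_lt_one), fun w hw => ⟨?_, ?_⟩⟩
  · rintro ⟨t, ht, rfl⟩
    rcases ht.1.eq_or_lt with rfl | h0
    · exact Or.inl rfl
    · exact Or.inr ⟨hm i0 ht h0, (hge t ht).symm⟩
  · rintro (rfl | ⟨h0, h1⟩)
    · grind
    · have h2 : e.symm w.2 ∈ Icc (0 : ℝ) 1 := by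
        constructor
        · rw [← mF.le_iff_le, ← heF, ← heF, e.apply_symm_apply, heF, Fid 0 i0]; exact h0.le
        · rw [← mF.le_iff_le, ← heF, ← heF, e.apply_symm_apply, heF, Fid 1 i1]; linarith
      refine ⟨e.symm w.2, h2, Prod.ext ?_ ?_⟩
      · grind
      · rw [← Fid _ h2, ← heF, e.apply_symm_apply]

theorem exists_strand_down {q : ℝ → ℝ × ℝ} (hc : ContinuousOn q (Icc 0 1))
    (hm : StrictAntiOn (fun t => (q t).2) (Icc 0 1)) :
    ∃ g : ℝ → ℝ, Continuous g ∧ g (q 0).2 = (q 0).1 ∧ ∃ ε > 0, ∀ w : ℝ × ℝ, (q 0).2 - ε < w.2 →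
      ((∃ t ∈ Icc (0 : ℝ) 1, w = q t) ↔ w = q 0 ∨ (w.2 < (q 0).2 ∧ w.1 = g w.2)) := by
  obtain ⟨g, cg, g0, ε, hε, H⟩ := exists_strand_up (q := fun t => flip (q t))
    (flip.continuous.comp_continuousOn hc)
    (fun a ha b hb hab => by simpa using hm ha hb hab)
  refine ⟨fun y => g (-y), cg.comp continuous_neg, by simpa using g0, ε, hε, fun w hw => ?_⟩
  have := H (flip w) (by simp only [flip_apply]; linarith)
  simp only [EmbeddingLike.apply_eq_iff_eq] at this
  rw [this]
  simp

theorem exists_sorting {ι : Type} [Fintype ι] {u : ι → ℝ → ℝ} (hu : ∀ i, Continuous (u i))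
    {c d : ℝ} (hcd : c < d) (hinj : ∀ y ∈ Ioo c d, Function.Injective fun i => u i y) :
    ∃ e : Fin (Fintype.card ι) ≃ ι, ∀ y ∈ Ioo c d, StrictMono fun k => u (e k) y := by
  obtain ⟨y₀, hy₀⟩ := exists_between hcd
  let : LinearOrder ι := LinearOrder.lift' (fun i => u i y₀) (hinj y₀ hy₀)
  let e := Fintype.orderIsoFinOfCardEq ι rfl
  refine ⟨e.toEquiv, fun y hy k l hkl => ?_⟩
  have h0 : u (e k) y₀ < u (e l) y₀ := e.lt_iff_lt.2 hkl
  by_contra! hcon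
  obtain ⟨z, hz, he⟩ := isPreconnected_Ioo.intermediate_value₂ hy₀ hy (hu (e k)).continuousOn
    (hu (e l)).continuousOn h0.le hcon
  exact hkl.ne (e.injective (hinj z hz he))

theorem hasType_of_branches {Γ : Set (ℝ × ℝ)} {z : ℝ × ℝ} {k : ℕ} (hk : k ≠ 0)
    {q : Fin k → ℝ → ℝ × ℝ} (hc : ∀ a, ContinuousOn (q a) (Icc 0 1)) (h0 : ∀ a, q a 0 = z)
    (hm : ∀ a, StrictMonoOn (fun t => (q a t).2) (Icc 0 1) ∨
      StrictAntiOn (fun t => (q a t).2) (Icc 0 1))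
    (hinj : ∀ a b, ∀ s ∈ Icc (0 : ℝ) 1, ∀ t ∈ Icc (0 : ℝ) 1, q a s = q b t →
      (a = b ∧ s = t) ∨ (s = 0 ∧ t = 0))
    (hloc : ∀ᶠ w in 𝓝 z, w ∈ Γ ↔ ∃ a, ∃ t ∈ Icc (0 : ℝ) 1, w = q a t) :
    ∃ m n, m + n = k ∧ HasType Γ m n z := by
  classical
  set M : Fin k → Prop := fun a => StrictMonoOn (fun t => (q a t).2) (Icc 0 1)
  have hup : ∀ a : {a // M a}, _ := fun a => exists_strand_up (hc a) a.2
  have hdown : ∀ a : {a // ¬ M a}, _ := fun a =>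
    exists_strand_down (hc a) ((hm a).resolve_left a.2)
  simp only [h0] at hup hdown
  choose h ch hz ε₁ hε₁ H using hup
  choose g cg gz ε₂ hε₂ G using hdown
  obtain ⟨ε, hε, hεH, hεG⟩ : ∃ ε > 0, (∀ a, ε ≤ ε₁ a) ∧ ∀ a, ε ≤ ε₂ a := by
    have h1 : ∀ᶠ ε in 𝓝[>] (0 : ℝ), ∀ a, ε ≤ ε₁ a := Filter.eventually_all.2 fun a =>
      nhdsWithin_le_nhds (ge_mem_nhds (hε₁ a))
    have h2 : ∀ᶠ ε in 𝓝[>] (0 : ℝ), ∀ a, ε ≤ ε₂ a := Filter.eventually_all.2 fun a =>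
      nhdsWithin_le_nhds (ge_mem_nhds (hε₂ a))
    obtain ⟨ε, h3, h4, h5⟩ := ((eventually_mem_nhdsWithin (s := Ioi (0 : ℝ))).and (h1.and h2)).exists
    grind
  have hne : ∀ a b, ∀ s ∈ Icc (0 : ℝ) 1, ∀ t ∈ Icc (0 : ℝ) 1, q a s = q b t → q a s ≠ z → a = b := by
    grind
  obtain ⟨σ, hσ⟩ := exists_sorting ch (show z.2 < z.2 + ε by linarith) (by
    intro y hy a b hab
    simp only at hab
    obtain ⟨s, hs, e1⟩ := (H a (h a y, y) (by have := hεH a; simp only; linarith [hy.2])).2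
      (Or.inr ⟨hy.1, rfl⟩)
    obtain ⟨t, ht, e2⟩ := (H b (h a y, y) (by have := hεH b; simp only; linarith [hy.2])).2
      (Or.inr ⟨hy.1, hab⟩)
    refine Subtype.ext (hne a b s hs t ht (e1.symm.trans e2) ?_)
    rw [← e1]
    exact fun e => hy.1.ne (congrArg Prod.snd e).symm)
  obtain ⟨τ, hτ⟩ := exists_sorting cg (show z.2 - ε < z.2 by linarith) (by
    intro y hy a b hab
    simp only at hab
    obtain ⟨s, hs, e1⟩ := (G a (g a y, y) (by have := hεG a; simp only; linarith [hy.1])).2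
      (Or.inr ⟨hy.2, rfl⟩)
    obtain ⟨t, ht, e2⟩ := (G b (g a y, y) (by have := hεG b; simp only; linarith [hy.1])).2
      (Or.inr ⟨hy.2, hab⟩)
    refine Subtype.ext (hne a b s hs t ht (e1.symm.trans e2) ?_)
    rw [← e1]
    exact fun e => hy.2.ne (congrArg Prod.snd e))
  refine ⟨Fintype.card {a // ¬ M a}, Fintype.card {a // M a}, ?_, fun k => g (τ k),
    fun k => h (σ k), fun k => cg _, fun k => ch _, fun k => gz _, fun k => hz _, ?_, ?_, ?_⟩
  · rw [Fintype.card_subtype_compl, Fintype.card_fin]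
    have := Fintype.card_subtype_le M
    rw [Fintype.card_fin] at this
    omega
  · filter_upwards [Ioo_mem_nhdsLT (show z.2 - ε < z.2 by linarith)] with y hy using hτ y hy
  · filter_upwards [Ioo_mem_nhdsGT (show z.2 < z.2 + ε by linarith)] with y hy using hσ y hy
  · have hband : ∀ᶠ w : ℝ × ℝ in 𝓝 z, w.2 ∈ Ioo (z.2 - ε) (z.2 + ε) :=
      continuous_snd.continuousAt.eventually (Ioo_mem_nhds (by linarith) (by linarith))
    filter_upwards [hloc, hband] with w hw hb
    rw [hw]
    constructor
    · rintro ⟨a, ht⟩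
      by_cases ha : M a
      · rcases (H ⟨a, ha⟩ w (by have := hεH ⟨a, ha⟩; linarith [hb.2])).1 ht with h | h
        · exact Or.inl h
        · exact Or.inr (Or.inr ⟨h.1, σ.symm ⟨a, ha⟩, by simpa using h.2⟩)
      · rcases (G ⟨a, ha⟩ w (by have := hεG ⟨a, ha⟩; linarith [hb.1])).1 ht with h | h
        · exact Or.inl h
        · exact Or.inr (Or.inl ⟨h.1, τ.symm ⟨a, ha⟩, by simpa using h.2⟩)
    · rintro (rfl | ⟨hl, k, e⟩ | ⟨hl, k, e⟩)
      · exact ⟨⟨0, Nat.pos_of_ne_zero hk⟩, 0, by simp, (h0 _).symm⟩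
      all_goals grind

end DefectBord

namespace DefectBord

/-! ### Existence of decompositions -/

theorem continuousOn_planar_coords : ContinuousOn (fun v : Euc 3 =>
    ((1 / 2 + Real.arcsin (v 1 / Real.sqrt (1 - v 2 ^ 2)) / Real.pi, v 2) : ℝ × ℝ))
    {v | v 2 ^ 2 < 1} := by
  refine ContinuousOn.prodMk (continuousOn_const.add ((Real.continuous_arcsin.comp_continuousOn
    (ContinuousOn.div (by fun_prop) (by fun_prop) ?_)).div_const _)) (by fun_prop)
  grind

theorem S2.two_sq_lt {p : S2} (h : 4 / 5 < (p : Euc 3) 0) : (p : Euc 3) 2 ^ 2 < 9 / 25 := by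
  nlinarith [p.sq_add_sq, sq_nonneg ((p : Euc 3) 1)]

theorem planar_mem_region {p : S2} (h : 4 / 5 < (p : Euc 3) 0) : planar p ∈ region := by
  have h2 := S2.two_sq_lt h
  have hr : 0 < 1 - (p : Euc 3) 2 ^ 2 := by linarith
  have h1 : |(p : Euc 3) 1 / Real.sqrt (1 - (p : Euc 3) 2 ^ 2)| < 1 := by
    rw [← sq_lt_one_iff_abs_lt_one, div_pow, Real.sq_sqrt hr.le, div_lt_one hr]
    nlinarith [p.sq_add_sq]
  rw [abs_lt] at h1
  have h3 := Real.arcsin_lt_pi_div_two.2 h1.2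
  have h4 := Real.neg_pi_div_two_lt_arcsin.2 h1.1
  have hπ := Real.pi_pos
  refine ⟨⟨?_, ?_⟩, ?_, ?_⟩
  · simp only [planar]
    have : -1 / 2 < Real.arcsin ((p : Euc 3) 1 / Real.sqrt (1 - (p : Euc 3) 2 ^ 2)) / Real.pi := by
      rw [lt_div_iff₀ hπ]; linarith
    linarith
  · simp only [planar]
    have : Real.arcsin ((p : Euc 3) 1 / Real.sqrt (1 - (p : Euc 3) 2 ^ 2)) / Real.pi < 1 / 2 := by
      rw [div_lt_iff₀ hπ]; linarith
    linarith
  · simp only [planar]; nlinarith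
  · simp only [planar]; nlinarith

theorem hasType_of_star {ι : Type} [Finite ι] {Γ : Set S2} {c : ι → ℝ → Euc 3}
    (h : IsCover Γ c) (hn : ∀ i, ∀ s ∈ Icc (0 : ℝ) 1, deriv (fun t => c i t 2) s ≠ 0 ∨
      deriv (deriv fun t => c i t 2) s ≠ 0) (hΓ : ∀ p ∈ Γ, 4 / 5 < (p : Euc 3) 0) {k : ℕ}
    (hk : k ≠ 0) {x : S2} (hxΓ : x ∈ Γ) (hx : IsStarAt Γ k x) :
    ∃ m n, m + n = k ∧ HasType (planar '' Γ) m n (planar x) := by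
  obtain ⟨b, hb, hb0, hb1, hinj, U, hU, hUΓ⟩ := hx
  set P : Euc 3 → ℝ × ℝ := fun v =>
    (1 / 2 + Real.arcsin (v 1 / Real.sqrt (1 - v 2 ^ 2)) / Real.pi, v 2)
  have i0 : (0 : ℝ) ∈ Icc (0 : ℝ) 1 := by simp
  have hnear : ∀ a, ∀ᶠ t in 𝓝[>] (0 : ℝ), b a t ∈ Subtype.val '' Γ ∧ b a t ≠ b a 0 := by
    intro a
    have h1 : ∀ᶠ t in 𝓝[>] (0 : ℝ), b a t ∈ U := nhdsWithin_le_nhds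
      ((hb a).continuous.continuousAt.eventually (by rw [hb0]; exact hU))
    filter_upwards [h1, Ioo_mem_nhdsGT (show (0 : ℝ) < 1 by norm_num)] with t ht ht1
    have ht' : t ∈ Icc (0 : ℝ) 1 := ⟨ht1.1.le, ht1.2.le⟩
    have : b a t ∈ Subtype.val '' Γ ∩ U := hUΓ ▸ ⟨mem_iUnion.2 ⟨a, t, ht', rfl⟩, ht⟩
    refine ⟨this.1, fun e => ?_⟩
    grind
  have hmono : ∀ a, ∃ δ > 0, StrictMonoOn (fun t => b a t 2) (Icc 0 δ) ∨
      StrictAntiOn (fun t => b a t 2) (Icc 0 δ) := fun a =>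
    exists_strictMonoOn_or (contDiff_euclidean.1 (hb a) 2) (h.nondegenerate hn (hb a)
      (hb1 a 0 i0).2 ((hnear a).mono fun t ht => ht.2) ((hnear a).mono fun t ht => ht.1))
  have hδ : ∀ a, ∃ δ, 0 < δ ∧ δ ≤ 1 ∧ (StrictMonoOn (fun t => b a t 2) (Icc 0 δ) ∨
      StrictAntiOn (fun t => b a t 2) (Icc 0 δ)) ∧ ∀ t ∈ Icc 0 δ, b a t ∈ Subtype.val '' Γ := by
    intro a
    obtain ⟨δ₁, h1, h2⟩ := hmono a
    obtain ⟨δ₂, h3, h4⟩ := mem_nhdsGT_iff_exists_Ioc_subset.1 (hnear a)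
    refine ⟨min (min δ₁ δ₂) 1, by simp only [mem_Ioi] at h3; positivity, min_le_right _ _, ?_,
      fun t ht => ?_⟩
    · have hsub : Icc 0 (min (min δ₁ δ₂) 1) ⊆ Icc 0 δ₁ :=
        Icc_subset_Icc le_rfl ((min_le_left _ _).trans (min_le_left _ _))
      exact h2.imp (fun h => h.mono hsub) fun h => h.mono hsub
    · rcases ht.1.eq_or_lt with rfl | ht0
      · exact ⟨x, hxΓ, (hb0 a).symm⟩
      · exact (h4 ⟨ht0, ht.2.trans ((min_le_left _ _).trans (min_le_right _ _))⟩).1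
  choose δ hδ0 hδ1 hδm hδΓ using hδ
  have hscale : ∀ a, ∀ t ∈ Icc (0 : ℝ) 1, δ a * t ∈ Icc 0 (δ a) := fun a t ht =>
    ⟨mul_nonneg (hδ0 a).le ht.1, mul_le_of_le_one_right (hδ0 a).le ht.2⟩
  have hscale' : ∀ a, ∀ t ∈ Icc (0 : ℝ) 1, δ a * t ∈ Icc (0 : ℝ) 1 := fun a t ht =>
    ⟨(hscale a t ht).1, (hscale a t ht).2.trans (hδ1 a)⟩
  have hwrap : ∀ v ∈ Subtype.val '' Γ, (wrap (P v) : Euc 3) = v := by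
    rintro _ ⟨p, hp, rfl⟩
    exact congrArg Subtype.val (wrap_planar (by linarith [hΓ p hp]))
  refine hasType_of_branches hk (q := fun a t => P (b a (δ a * t))) (fun a => ?_) (fun a => ?_)
    (fun a => ?_) (fun a a' s hs t ht e => ?_) ?_
  · refine continuousOn_planar_coords.comp ((hb a).continuous.comp (by fun_prop)).continuousOn ?_
    intro t ht
    obtain ⟨p, hp, e⟩ := hδΓ a _ (hscale a t ht)
    have := S2.two_sq_lt (hΓ p hp)
    rw [e] at this
    exact this.trans (by norm_num)
  · simp only [mul_zero, hb0]
    rfl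
  · refine (hδm a).imp (fun h s hs t ht hst => ?_) fun h s hs t ht hst => ?_
    · exact h (hscale a s hs) (hscale a t ht) (mul_lt_mul_of_pos_left hst (hδ0 a))
    · exact h (hscale a s hs) (hscale a t ht) (mul_lt_mul_of_pos_left hst (hδ0 a))
  · have e' : b a (δ a * s) = b a' (δ a' * t) := by
      grind
    rcases hinj a a' _ (hscale' a s hs) _ (hscale' a' t ht) e' with ⟨rfl, h⟩ | ⟨h1, h2⟩
    · grind
    · exact Or.inr ⟨(mul_eq_zero.1 h1).resolve_left (hδ0 a).ne',
        (mul_eq_zero.1 h2).resolve_left (hδ0 a').ne'⟩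
  · have hx0 : wrap (planar x) = x := wrap_planar (by linarith [hΓ x hxΓ])
    have h1 : ∀ᶠ w in 𝓝 (planar x), (wrap w : Euc 3) ∈ U :=
      (continuous_subtype_val.comp continuous_wrap).continuousAt.eventually (by
        simp only [Function.comp_apply, hx0]; exact hU)
    have h2 : ∀ᶠ w in 𝓝 (planar x), ∀ a, (wrap w : Euc 3) ∉ b a '' Icc (δ a) 1 := by
      refine Filter.eventually_all.2 fun a => ?_
      refine (continuous_subtype_val.comp continuous_wrap).continuousAt.eventually
        ((isCompact_Icc.image (hb a).continuous).isClosed.isOpen_compl.mem_nhds ?_)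
      rintro ⟨t, ht, e⟩
      simp only [Function.comp_apply, hx0] at e
      have := hinj a a t ⟨(hδ0 a).le.trans ht.1, ht.2⟩ 0 i0 (by rw [e, hb0])
      have ht0 : t = 0 := this.elim (fun h => h.2) fun h => h.1
      grind
    filter_upwards [h1, h2] with w hw1 hw2
    constructor
    · rintro ⟨p, hp, rfl⟩
      have hp' : wrap (planar p) = p := wrap_planar (by linarith [hΓ p hp])
      rw [hp'] at hw1 hw2
      have : (p : Euc 3) ∈ (⋃ a, b a '' Icc (0 : ℝ) 1) ∩ U := hUΓ ▸ ⟨⟨p, hp, rfl⟩, hw1⟩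
      obtain ⟨a, s, hs, e⟩ := mem_iUnion.1 this.1
      have hsδ : s < δ a := by
        by_contra! hcon
        exact hw2 a ⟨s, ⟨hcon, hs.2⟩, e⟩
      refine ⟨a, s / δ a, ⟨div_nonneg hs.1 (hδ0 a).le, (div_le_one (hδ0 a)).2 hsδ.le⟩, ?_⟩
      rw [mul_div_cancel₀ _ (hδ0 a).ne', e]
      rfl
    · rintro ⟨a, t, ht, rfl⟩
      obtain ⟨p, hp, e⟩ := hδΓ a _ (hscale a t ht)
      exact ⟨p, hp, by rw [← e]; rfl⟩

theorem IsTrivalentGraph.nonempty_decomposition {Γ V : Set S2} (h : IsTrivalentGraph Γ V) :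
    Nonempty (Decomposition Γ V) := by
  obtain ⟨T, hT, h1, h2, ι, _, c, hc, hn⟩ := h.exists_position
  have hwrap : ∀ p ∈ T '' Γ, wrap (planar p) = p := fun p hp => wrap_planar (by linarith [h2 p hp])
  have himg : ∀ A ⊆ T '' Γ, A = wrap '' (planar '' A) := by
    intro A hA
    rw [image_image]
    ext p
    constructor
    · exact fun hp => ⟨p, hp, hwrap p (hA hp)⟩
    · rintro ⟨q, hq, rfl⟩
      simpa only [hwrap q (hA hq)] using hq
  refine exists_decomposition_of_planar T hT (Γ' := planar '' (T '' Γ)) (V' := planar '' (T '' V))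
    ⟨?_, ?_, h1.finite_vertices.image _, image_mono h1.subset, ?_, ?_⟩ (himg _ subset_rfl)
    (himg _ h1.subset)
  · refine h1.isClosed.isCompact.image_of_continuousOn (continuousOn_planar.mono fun p hp => ?_)
    exact (S2.two_sq_lt (h2 p hp)).trans (by norm_num)
  · rintro _ ⟨p, hp, rfl⟩
    exact planar_mem_region (h2 p hp)
  · rintro _ ⟨p, hp, rfl⟩
    exact hasType_of_star hc hn h2 (by norm_num) (h1.subset hp) (h1.vertex p hp)
  · rintro _ ⟨p, hp, rfl⟩ hV
    exact hasType_of_star hc hn h2 (by norm_num) hp (h1.edge p ⟨hp, fun hc => hV ⟨p, hc, rfl⟩⟩)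

end DefectBord

namespace DefectBord

/-! ### Regular cell complexes -/

theorem _root_.Set.InjOn.disjoint_image_of_disjoint {α β : Type*} {f : α → β} {u s t : Set α}
    (hf : InjOn f u) (hs : s ⊆ u) (ht : t ⊆ u) (h : Disjoint s t) : Disjoint (f '' s) (f '' t) := by
  rw [Set.disjoint_left]
  rintro _ ⟨x, hx, rfl⟩ ⟨y, hy, e⟩
  exact Set.disjoint_left.1 h hx (hf (ht hy) (hs hx) e ▸ hy)

namespace CellComplex

variable {X : Type} [TopologicalSpace X]

/-- A cell complex of dimension at most `n` whose characteristic maps are injective on closed balls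
and in which boundaries are unions of cells of lower dimension. -/
structure Regular (n : ℕ) (K : CellComplex X) : Prop where
  isEmpty : ∀ k, n < k → IsEmpty (K.Cell k)
  inj : ∀ {k : ℕ} (c : K.Cell k), InjOn (K.map c) (closedBall 0 1)
  bd : ∀ {k : ℕ} (c : K.Cell k), ∃ S : Set (Σ n, K.Cell n), (∀ d ∈ S, d.1 < k) ∧
    K.boundary c = ⋃ d ∈ S, K.closedCell d.2

namespace Regular

variable {n : ℕ} {K : CellComplex X} {k : ℕ}

/-- The inverse of a characteristic map. -/
noncomputable def inv (K : CellComplex X) (c : K.Cell k) : X → Euc k :=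
  Function.invFunOn (K.map c) (closedBall 0 1)

theorem inv_map (h : Regular n K) (c : K.Cell k) {y : Euc k} (hy : y ∈ closedBall (0 : Euc k) 1) :
    inv K c (K.map c y) = y :=
  (h.inj c).leftInvOn_invFunOn hy

theorem map_inv (c : K.Cell k) {p : X} (hp : p ∈ K.closedCell c) : K.map c (inv K c p) = p :=
  Function.invFunOn_eq hp

theorem inv_mem (c : K.Cell k) {p : X} (hp : p ∈ K.closedCell c) :
    inv K c p ∈ closedBall (0 : Euc k) 1 :=
  Function.invFunOn_mem hp

theorem injOn_inv (c : K.Cell k) : InjOn (inv K c) (K.closedCell c) := fun p hp q hq e => by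
  rw [← map_inv c hp, e, map_inv c hq]

theorem continuousOn_inv [T2Space X] (h : Regular n K) (c : K.Cell k) :
    ContinuousOn (inv K c) (K.closedCell c) := by
  rw [continuousOn_iff_isClosed]
  intro t ht
  refine ⟨K.map c '' (closedBall 0 1 ∩ t), (((isCompact_closedBall _ _).inter_right ht).image_of_continuousOn
    ((K.continuousOn c).mono inter_subset_left)).isClosed, ?_⟩
  ext p
  constructor
  · rintro ⟨hp, hc⟩
    exact ⟨⟨_, ⟨inv_mem c hc, hp⟩, map_inv c hc⟩, hc⟩
  · rintro ⟨⟨y, ⟨hy, hyt⟩, rfl⟩, hc⟩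
    exact ⟨by rwa [mem_preimage, h.inv_map c hy], hc⟩

theorem boundary_subset (c : K.Cell k) : K.boundary c ⊆ K.closedCell c :=
  image_mono sphere_subset_closedBall

/-- The cell decomposition of the boundary sphere of a cell. -/
noncomputable def boundaryComplex [T2Space X] (h : Regular n K) (c : K.Cell (k + 1)) :
    CellComplex (Euc (k + 1)) where
  Cell j := {d : K.Cell j // j ≤ k ∧ K.closedCell d ⊆ K.boundary c}
  finite := by
    have := K.finite
    refine Finite.of_injective (fun d => (⟨d.1, d.2.1⟩ : Σ n, K.Cell n)) ?_
    rintro ⟨i, d⟩ ⟨j, e⟩ hde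
    simp only [Sigma.mk.injEq] at hde
    obtain ⟨rfl, hde⟩ := hde
    grind
  map d x := inv K c (K.map d.1 x)
  continuousOn d := (h.continuousOn_inv c).comp (K.continuousOn d.1)
    fun _ hx => boundary_subset c (d.2.2 (mem_image_of_mem _ hx))
  injOn d := (injOn_inv c).comp (K.injOn d.1) fun _ hx =>
    boundary_subset c (d.2.2 (mem_image_of_mem _ (ball_subset_closedBall hx)))
  disjoint_boundary d := by
    have hs := d.2.2.trans (boundary_subset c)
    have := (injOn_inv c).disjoint_image_of_disjoint ((image_mono ball_subset_closedBall).trans hs)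
      ((image_mono sphere_subset_closedBall).trans hs) (K.disjoint_boundary d.1)
    rwa [image_image, image_image] at this
  disjoint_interior d e hde := by
    have hs := fun d : Σ j, {d : K.Cell j // j ≤ k ∧ K.closedCell d ⊆ K.boundary c} =>
      (image_mono ball_subset_closedBall).trans (d.2.2.2.trans (boundary_subset c))
    have := (injOn_inv c).disjoint_image_of_disjoint (hs d) (hs e)
      (K.disjoint_interior ⟨d.1, d.2.1⟩ ⟨e.1, e.2.1⟩ fun hde' => hde ?_)
    · rwa [image_image, image_image] at this
    obtain ⟨i, d⟩ := d
    obtain ⟨j, e⟩ := e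
    simp only [Sigma.mk.injEq] at hde'
    obtain ⟨rfl, hde'⟩ := hde'
    grind
  boundary_eq {j} d := by
    obtain ⟨S, hS, e⟩ := h.bd d.1
    refine ⟨{a | (⟨a.1, a.2.1⟩ : Σ n, K.Cell n) ∈ S}, ?_⟩
    simp only [← Function.comp_def, image_comp]
    rw [show K.map d.1 '' sphere 0 1 = _ from e]
    ext y
    simp only [image_iUnion, mem_iUnion, mem_ofPred_eq, exists_prop]
    constructor
    · rintro ⟨a, ha, hy⟩
      have hsub : K.closedCell a.2 ⊆ K.boundary d.1 := by
        rw [e]; exact subset_iUnion₂ (s := fun a _ => K.closedCell a.2) a ha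
      exact ⟨⟨a.1, a.2, (hS a ha).le.trans d.2.1, hsub.trans ((boundary_subset _).trans d.2.2)⟩,
        ha, hy⟩
    · rintro ⟨a, ha, hy⟩
      exact ⟨_, ha, hy⟩

variable [T2Space X]

theorem boundaryComplex_map (h : Regular n K) (c : K.Cell (k + 1)) {j : ℕ}
    (d : (h.boundaryComplex c).Cell j) {x : Euc j} (hx : x ∈ closedBall (0 : Euc j) 1) :
    K.map c ((h.boundaryComplex c).map d x) = K.map d.1 x :=
  map_inv c (boundary_subset c (d.2.2 (mem_image_of_mem _ hx)))

theorem mem_openCell_iff (h : Regular n K) (c : K.Cell (k + 1)) {j : ℕ}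
    (d : (h.boundaryComplex c).Cell j) {u : Euc (k + 1)} (hu : u ∈ closedBall (0 : Euc (k + 1)) 1) :
    u ∈ (h.boundaryComplex c).openCell d ↔ K.map c u ∈ K.openCell d.1 := by
  constructor
  · rintro ⟨x, hx, rfl⟩
    exact ⟨x, hx, (h.boundaryComplex_map c d (ball_subset_closedBall hx)).symm⟩
  · rintro ⟨x, hx, e⟩
    refine ⟨x, hx, ?_⟩
    change inv K c (K.map d.1 x) = u
    rw [e, h.inv_map c hu]

theorem regular_boundaryComplex (h : Regular n K) (c : K.Cell (k + 1)) :
    Regular k (h.boundaryComplex c) := by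
  refine ⟨fun j hj => ⟨fun d => absurd d.2.1 (by omega)⟩, fun d => ?_, fun {j} d => ?_⟩
  · exact (injOn_inv c).comp (h.inj d.1) fun _ hx =>
      boundary_subset c (d.2.2 (mem_image_of_mem _ hx))
  · obtain ⟨S, hS, e⟩ := h.bd d.1
    refine ⟨{a | (⟨a.1, a.2.1⟩ : Σ n, K.Cell n) ∈ S}, fun a ha => hS _ ha, ?_⟩
    have e1 : (h.boundaryComplex c).boundary d = inv K c '' K.boundary d.1 := by
      simp only [boundary, image_image]; rfl
    have e2 : ∀ {j} (a : (h.boundaryComplex c).Cell j), (h.boundaryComplex c).closedCell a =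
        inv K c '' K.closedCell a.1 := fun a => by
      simp only [closedCell, image_image]; rfl
    simp only [e1, e2]
    rw [e]
    ext y
    simp only [image_iUnion, mem_iUnion, mem_ofPred_eq, exists_prop]
    constructor
    · rintro ⟨a, ha, hy⟩
      have hsub : K.closedCell a.2 ⊆ K.boundary d.1 := by
        rw [e]; exact subset_iUnion₂ (s := fun a _ => K.closedCell a.2) a ha
      exact ⟨⟨a.1, a.2, (hS a ha).le.trans d.2.1, hsub.trans ((boundary_subset _).trans d.2.2)⟩,
        ha, hy⟩
    grind

theorem isBoundaryDecomposition (h : Regular n K) (c : K.Cell (k + 1)) :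
    K.IsBoundaryDecomposition c (h.boundaryComplex c) := by
  constructor
  · ext u
    simp only [support, mem_iUnion]
    constructor
    · rintro ⟨j, d, x, hx, rfl⟩
      obtain ⟨u, hu, e⟩ := d.2.2 (mem_image_of_mem _ hx)
      change inv K c (K.map d.1 x) ∈ _
      rw [← e, h.inv_map c (sphere_subset_closedBall hu)]
      exact hu
    · intro hu
      obtain ⟨S, hS, e⟩ := h.bd c
      have h1 : K.map c u ∈ K.boundary c := mem_image_of_mem _ hu
      rw [e] at h1
      obtain ⟨d, hd, x, hx, e'⟩ := mem_iUnion₂.1 h1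
      have hsub : K.closedCell d.2 ⊆ K.boundary c := by
        rw [e]; exact subset_iUnion₂ (s := fun a _ => K.closedCell a.2) d hd
      refine ⟨d.1, ⟨d.2, Nat.lt_succ_iff.1 (hS d hd), hsub⟩, x, hx, ?_⟩
      change inv K c (K.map d.2 x) = u
      rw [e', h.inv_map c (sphere_subset_closedBall hu)]
  · intro j d
    have e : ∀ A : Set (Euc j), A ⊆ closedBall 0 1 →
        K.map c '' ((h.boundaryComplex c).map d '' A) = K.map d.1 '' A := fun A hA => by
      rw [image_image]
      exact image_congr fun x hx => h.boundaryComplex_map c d (hA hx)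
    refine ⟨d.1, e _ subset_rfl, e _ ball_subset_closedBall, (h.inj c).mono ?_⟩
    rintro _ ⟨x, hx, rfl⟩
    exact inv_mem c (boundary_subset c (d.2.2 (mem_image_of_mem _ (ball_subset_closedBall hx))))

end Regular

theorem Regular.isPLCW {n : ℕ} : ∀ {X : Type} [TopologicalSpace X] [T2Space X] {K : CellComplex X},
    Regular n K → IsPLCW n K := by
  induction n with
  | zero => exact fun h => h.isEmpty
  | succ n ih =>
    intro X _ _ K h
    refine ⟨h.isEmpty, fun k c => ⟨h.boundaryComplex c, ih ?_, h.isBoundaryDecomposition c⟩⟩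
    have hk : k ≤ n := by
      by_contra! hcon
      exact (h.isEmpty (k + 1) (by omega)).false c
    have := h.regular_boundaryComplex c
    exact ⟨fun j hj => this.isEmpty j (by omega), this.inj, this.bd⟩

/-! ### Complexes of dimension two -/

/-- Points, arcs and discs which form a regular complex of dimension two.  Each point of the space
lies in the interior of at most one cell. -/
structure CellData (X : Type) [TopologicalSpace X] where
  I₀ : Type
  I₁ : Type
  I₂ : Type
  finite : Finite (I₀ ⊕ I₁ ⊕ I₂)
  f₀ : I₀ → X
  f₁ : I₁ → Euc 1 → X
  f₂ : I₂ → Euc 2 → X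
  continuousOn₁ : ∀ c, ContinuousOn (f₁ c) (closedBall 0 1)
  continuousOn₂ : ∀ c, ContinuousOn (f₂ c) (closedBall 0 1)
  inj₁ : ∀ c, InjOn (f₁ c) (closedBall 0 1)
  inj₂ : ∀ c, InjOn (f₂ c) (closedBall 0 1)
  R : I₀ ⊕ I₁ ⊕ I₂ → Set X
  unique : ∀ p i j, p ∈ R i → p ∈ R j → i = j
  mem₀ : ∀ c, f₀ c ∈ R (Sum.inl c)
  mem₁ : ∀ c, ∀ x ∈ ball (0 : Euc 1) 1, f₁ c x ∈ R (Sum.inr (Sum.inl c))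
  mem₂ : ∀ c, ∀ x ∈ ball (0 : Euc 2) 1, f₂ c x ∈ R (Sum.inr (Sum.inr c))
  bd₁ : ∀ c, ∃ S : Set I₀, f₁ c '' sphere 0 1 = f₀ '' S
  bd₂ : ∀ c, ∃ S : Set I₁, f₂ c '' sphere 0 1 = ⋃ e ∈ S, f₁ e '' closedBall 0 1

namespace CellData

variable (M : CellData X)

/-- The cells of dimension `n`. -/
def Cell : ℕ → Type
  | 0 => M.I₀
  | 1 => M.I₁
  | 2 => M.I₂
  | _ => Empty

/-- The index of a cell. -/
def index : (Σ n, M.Cell n) → M.I₀ ⊕ M.I₁ ⊕ M.I₂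
  | ⟨0, c⟩ => Sum.inl c
  | ⟨1, c⟩ => Sum.inr (Sum.inl c)
  | ⟨2, c⟩ => Sum.inr (Sum.inr c)
  | ⟨_ + 3, c⟩ => Empty.elim c

theorem index_injective : Function.Injective M.index := by
  rintro ⟨_ | _ | _ | i, c⟩ ⟨_ | _ | _ | j, d⟩ h
  all_goals first
    | exact Empty.elim c
    | exact Empty.elim d
    | (cases h <;> rfl)

/-- The characteristic maps. -/
def map : ∀ {n : ℕ}, M.Cell n → Euc n → X
  | 0, c => fun _ => M.f₀ c
  | 1, c => M.f₁ c
  | 2, c => M.f₂ c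
  | _ + 3, c => Empty.elim c

theorem map_mem {n : ℕ} (c : M.Cell n) {x : Euc n} (hx : x ∈ ball (0 : Euc n) 1) :
    M.map c x ∈ M.R (M.index ⟨n, c⟩) := by
  match n, c with
  | 0, c => exact M.mem₀ c
  | 1, c => exact M.mem₁ c x hx
  | 2, c => exact M.mem₂ c x hx
  | _ + 3, c => exact Empty.elim c

theorem injOn_map {n : ℕ} (c : M.Cell n) : InjOn (M.map c) (closedBall 0 1) := by
  match n, c with
  | 0, c => exact fun x _ y _ _ => Subsingleton.elim x y
  | 1, c => exact M.inj₁ c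
  | 2, c => exact M.inj₂ c
  | _ + 3, c => exact Empty.elim c

theorem closedBall_zero : closedBall (0 : Euc 0) 1 = univ :=
  eq_univ_of_forall fun x => by rw [Subsingleton.elim x 0]; simp

theorem exists_bd {n : ℕ} (c : M.Cell n) : ∃ S : Set (Σ n, M.Cell n), (∀ d ∈ S, d.1 < n) ∧
    M.map c '' sphere 0 1 = ⋃ d ∈ S, M.map d.2 '' closedBall 0 1 := by
  match n, c with
  | 0, c =>
    refine ⟨∅, by simp, ?_⟩
    have : sphere (0 : Euc 0) 1 = ∅ := by
      rw [eq_empty_iff_forall_notMem]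
      intro x hx
      rw [Subsingleton.elim x 0] at hx
      simp at hx
    simp [this]
  | 1, c =>
    obtain ⟨S, hS⟩ := M.bd₁ c
    refine ⟨(fun d : M.I₀ => (⟨0, d⟩ : Σ n, M.Cell n)) '' S,
      by rintro _ ⟨d, -, rfl⟩; exact Nat.zero_lt_one, ?_⟩
    refine Eq.trans hS ?_
    rw [biUnion_image]
    ext p
    simp only [mem_image, mem_iUnion, exists_prop, closedBall_zero, mem_univ, true_and]
    refine exists_congr fun d => and_congr_right fun _ => ?_
    exact ⟨fun h => ⟨0, h⟩, fun ⟨_, h⟩ => h⟩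
  | 2, c =>
    obtain ⟨S, hS⟩ := M.bd₂ c
    refine ⟨(fun d : M.I₁ => (⟨1, d⟩ : Σ n, M.Cell n)) '' S,
      by rintro _ ⟨d, -, rfl⟩; exact Nat.one_lt_two, ?_⟩
    refine Eq.trans hS ?_
    rw [biUnion_image]
    rfl
  | _ + 3, c => exact Empty.elim c

/-- The cell complex. -/
def complex : CellComplex X where
  Cell := M.Cell
  finite := by
    have := M.finite
    exact Finite.of_injective _ M.index_injective
  map := M.map
  continuousOn {n} c := by
    match n, c with
    | 0, c => exact continuousOn_const
    | 1, c => exact M.continuousOn₁ c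
    | 2, c => exact M.continuousOn₂ c
    | _ + 3, c => exact Empty.elim c
  injOn c := (M.injOn_map c).mono ball_subset_closedBall
  disjoint_boundary {n} c := (M.injOn_map c).disjoint_image_of_disjoint
    ball_subset_closedBall sphere_subset_closedBall sphere_disjoint_ball.symm
  disjoint_interior c d hcd := by
    rw [Set.disjoint_left]
    rintro _ ⟨x, hx, rfl⟩ ⟨y, hy, e⟩
    exact hcd (M.index_injective (M.unique _ _ _ (M.map_mem c.2 hx) (e ▸ M.map_mem d.2 hy)))
  boundary_eq c := by
    obtain ⟨S, -, hS⟩ := M.exists_bd c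
    exact ⟨S, hS⟩

theorem regular : Regular 2 M.complex := by
  refine ⟨fun k hk => ?_, fun c => M.injOn_map c, fun c => M.exists_bd c⟩
  match k, hk with
  | k + 3, _ => exact inferInstanceAs (IsEmpty Empty)

end CellData

end CellComplex

end DefectBord

namespace DefectBord

/-! ### Characteristic maps of convex polygons -/

theorem exists_convex_disc {P : Set (ℝ × ℝ)} (hP : Convex ℝ P) (hc : IsCompact P) {o : ℝ × ℝ}
    (ho : o ∈ interior P) {G : Euc 2 → ℝ × ℝ} (hG : Continuous G) (hb : Function.Bijective G)
    (hh : ∀ t : ℝ, 0 ≤ t → ∀ p, G (t • p) = t • G p) :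
    ∃ f : Euc 2 → ℝ × ℝ, Continuous f ∧ Function.Injective f ∧ f '' ball 0 1 = interior P ∧
      f '' sphere 0 1 = frontier P ∧ f 0 = o ∧
      ∀ u : Euc 2, ‖u‖ = 1 → ∀ x ∈ frontier P, ∀ μ : ℝ, 0 < μ → G u = μ • (x - o) →
        f u = x ∧ ∀ p, f p ∈ segment ℝ o x ↔ p ∈ segment ℝ 0 u := by
  let τ : ℝ × ℝ ≃ₜ ℝ × ℝ := Homeomorph.addLeft o
  have hτ : ∀ y, τ y = o + y := fun _ => rfl
  set T : Set (ℝ × ℝ) := τ ⁻¹' P with hT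
  have hTc : Convex ℝ T := hP.translate_preimage_right o
  have hT0 : T ∈ 𝓝 (0 : ℝ × ℝ) := by
    refine τ.continuous.continuousAt.preimage_mem_nhds ?_
    rw [hτ, add_zero]
    exact mem_interior_iff_mem_nhds.1 ho
  have hTa : Absorbent ℝ T := absorbent_nhds_zero hT0
  obtain ⟨R, hR, hTR⟩ : ∃ R : ℝ, 0 < R ∧ T ⊆ closedBall 0 R := by
    obtain ⟨R, hR⟩ := hc.isBounded.subset_closedBall o
    refine ⟨max R 1, by positivity, fun y hy => ?_⟩
    have := hR hy
    rw [mem_closedBall, hτ, dist_eq_norm, add_sub_cancel_left] at this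
    rw [mem_closedBall_zero_iff]
    grind
  have hTb : Bornology.IsVonNBounded ℝ T :=
    NormedSpace.isVonNBounded_of_isBounded _ (isBounded_closedBall.subset hTR)
  have hG0 : G 0 = 0 := by simpa using hh 0 le_rfl 0
  have hGne : ∀ p, p ≠ 0 → G p ≠ 0 := fun p hp h => hp (hb.1 (h.trans hG0.symm))
  have hpos : ∀ y, y ≠ 0 → 0 < gauge T y := fun y hy => (gauge_pos hTa hTb).2 hy
  set F : Euc 2 → ℝ × ℝ := fun p => (‖p‖ / gauge T (G p)) • G p with hF
  have hF0 : F 0 = 0 := by simp [hF]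
  have hgF : ∀ p, gauge T (F p) = ‖p‖ := by
    intro p
    rcases eq_or_ne p 0 with rfl | hp
    · simp [hF0]
    · rw [hF, gauge_smul_of_nonneg (div_nonneg (norm_nonneg _) (gauge_nonneg _)), smul_eq_mul,
        div_mul_cancel₀ _ (hpos _ (hGne p hp)).ne']
  have hFh : ∀ t : ℝ, 0 ≤ t → ∀ p, F (t • p) = t • F p := by
    intro t ht p
    rcases ht.eq_or_lt with rfl | ht
    · simp [hF0]
    simp only [hF]
    rw [hh t ht.le, gauge_smul_of_nonneg ht.le, norm_smul, Real.norm_of_nonneg ht.le, smul_eq_mul,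
      mul_div_mul_left _ _ ht.ne', smul_comm]
  have hFc : Continuous F := by
    rw [continuous_iff_continuousAt]
    intro p
    rcases eq_or_ne p 0 with rfl | hp
    · rw [ContinuousAt, hF0]
      refine squeeze_zero_norm (a := fun p => R * ‖p‖) (fun p => ?_) ?_
      · have := le_gauge_of_subset_closedBall (x := F p) hTa hR.le hTR
        rwa [hgF, div_le_iff₀ hR, mul_comm] at this
      · have : Continuous fun p : Euc 2 => R * ‖p‖ := by fun_prop
        simpa using this.tendsto 0
    · have h1 : ContinuousAt (fun p => gauge T (G p)) p :=
        ((continuous_gauge hTc hT0).comp hG).continuousAt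
      exact (continuous_norm.continuousAt.div h1 (hpos _ (hGne p hp)).ne').smul hG.continuousAt
  have hFi : Function.Injective F := by
    intro p q h
    have hn : ‖p‖ = ‖q‖ := by rw [← hgF, h, hgF]
    rcases eq_or_ne p 0 with rfl | hp
    · rw [norm_zero, eq_comm, norm_eq_zero] at hn
      exact hn.symm
    have hp' : 0 < ‖p‖ := norm_pos_iff.2 hp
    have hq : q ≠ 0 := norm_pos_iff.1 (hn ▸ hp')
    have gp := hpos _ (hGne p hp)
    have gq := hpos _ (hGne q hq)
    have e : G p = G ((gauge T (G p) / gauge T (G q)) • q) := by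
      rw [hh _ (by positivity)]
      have h' := congrArg (fun y => (gauge T (G p) / ‖p‖) • y) h
      simp only [hF, smul_smul] at h'
      rw [div_mul_div_cancel₀ hp'.ne', div_self gp.ne', one_smul, ← hn,
        div_mul_div_cancel₀ hp'.ne'] at h'
      exact h'
    have e' := hb.1 e
    have e2 := congrArg norm e'
    rw [norm_smul, Real.norm_of_nonneg (by positivity), hn] at e2
    have : gauge T (G p) / gauge T (G q) = 1 := by
      have h3 : ‖q‖ ≠ 0 := norm_ne_zero_iff.2 hq
      field_simp at e2 ⊢
      linarith
    rw [e', this, one_smul]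
  have hFs : ∀ y, ∃ p, F p = y := by
    intro y
    rcases eq_or_ne y 0 with rfl | hy
    · exact ⟨0, hF0⟩
    obtain ⟨p, rfl⟩ := hb.2 y
    have hp : p ≠ 0 := fun h => hy (by rw [h, hG0])
    have gp := hpos _ hy
    have hp' : 0 < ‖p‖ := norm_pos_iff.2 hp
    refine ⟨(gauge T (G p) / ‖p‖) • p, ?_⟩
    rw [hFh _ (by positivity)]
    simp only [hF, smul_smul]
    rw [div_mul_div_cancel₀ hp'.ne', div_self gp.ne', one_smul]
  have him : ∀ (A : Set (Euc 2)) (B : Set (ℝ × ℝ)), (∀ p, p ∈ A ↔ F p ∈ τ ⁻¹' B) →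
      (fun p => o + F p) '' A = B := by
    intro A B hAB
    ext x
    constructor
    · rintro ⟨p, hp, rfl⟩
      exact (hAB p).1 hp
    · intro hx
      obtain ⟨p, hp⟩ := hFs (x - o)
      have e : o + F p = x := by rw [hp]; abel
      exact ⟨p, (hAB p).2 (by rw [mem_preimage, hτ, e]; exact hx), e⟩
  refine ⟨fun p => o + F p, by fun_prop, fun p q h => hFi (add_left_cancel h), ?_, ?_,
    by simp [hF0], ?_⟩
  · refine him _ _ fun p => ?_
    rw [τ.preimage_interior, ← gauge_lt_one_iff_mem_interior hTc hT0, hgF, mem_ball_zero_iff]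
  · refine him _ _ fun p => ?_
    rw [τ.preimage_frontier, ← gauge_eq_one_iff_mem_frontier hTc hT0, hgF, mem_sphere_zero_iff_norm]
  · intro u hu x hx μ hμ hGu
    have hxo : gauge T (x - o) = 1 := by
      rw [gauge_eq_one_iff_mem_frontier hTc hT0, hT, ← τ.preimage_frontier, mem_preimage, hτ]
      simpa using hx
    have e : F u = x - o := by
      simp only [hF]
      rw [hGu, gauge_smul_of_nonneg hμ.le, hxo, hu, smul_smul, smul_eq_mul, mul_one,
        one_div_mul_cancel hμ.ne', one_smul]
    refine ⟨by simp [e], fun p => ?_⟩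
    rw [segment_eq_image', segment_eq_image', ← e]
    constructor
    · rintro ⟨t, ht, h⟩
      refine ⟨t, ht, hFi ?_⟩
      simp only [zero_add, sub_zero]
      rw [hFh t ht.1]
      grind
    · rintro ⟨t, ht, rfl⟩
      refine ⟨t, ht, ?_⟩
      simp only [zero_add, sub_zero]
      rw [hFh t ht.1]

/-- The value at height `s` of the line from `(b, 0)` to `(t, 1)`. -/
def lin (b t s : ℝ) : ℝ := b + (t - b) * s

theorem lin_zero (b t : ℝ) : lin b t 0 = b := by simp [lin]

theorem lin_one (b t : ℝ) : lin b t 1 = t := by simp [lin]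

theorem lin_lt {b t b' t' s : ℝ} (hb : b < b') (ht : t < t') (hs : s ∈ Icc (0 : ℝ) 1) :
    lin b t s < lin b' t' s := by
  have := convex_pos (sub_pos.2 hb) (sub_pos.2 ht) hs.1 hs.2
  unfold lin
  linarith

theorem lin_le {b t b' t' s : ℝ} (hb : b ≤ b') (ht : t ≤ t') (hs : s ∈ Icc (0 : ℝ) 1) :
    lin b t s ≤ lin b' t' s := by
  unfold lin
  nlinarith [mul_nonneg (sub_nonneg.2 ht) hs.1, mul_nonneg (sub_nonneg.2 hb) (sub_nonneg.2 hs.2)]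

theorem lin_lt' {b t b' t' s : ℝ} (hb : b ≤ b') (ht : t ≤ t') (h : b < b' ∨ t < t')
    (hs : s ∈ Ioo (0 : ℝ) 1) : lin b t s < lin b' t' s := by
  unfold lin
  rcases h with h | h
  · nlinarith [mul_nonneg (sub_nonneg.2 ht) hs.1.le, mul_pos (sub_pos.2 h) (sub_pos.2 hs.2)]
  · nlinarith [mul_pos (sub_pos.2 h) hs.1, mul_nonneg (sub_nonneg.2 hb) (sub_nonneg.2 hs.2.le)]

/-- The quadrangle in the strip `0 ≤ s ≤ 1` with the given corners on the two boundary lines. -/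
def quad (b₀ t₀ b₁ t₁ : ℝ) : Set (ℝ × ℝ) :=
  {z | z.2 ∈ Icc (0 : ℝ) 1 ∧ z.1 ∈ Icc (lin b₀ t₀ z.2) (lin b₁ t₁ z.2)}

/-- The interior of `quad`. -/
def openQuad (b₀ t₀ b₁ t₁ : ℝ) : Set (ℝ × ℝ) :=
  {z | z.2 ∈ Ioo (0 : ℝ) 1 ∧ z.1 ∈ Ioo (lin b₀ t₀ z.2) (lin b₁ t₁ z.2)}

section Quad

variable {b₀ t₀ b₁ t₁ : ℝ}

theorem openQuad_subset : openQuad b₀ t₀ b₁ t₁ ⊆ quad b₀ t₀ b₁ t₁ := fun _ h =>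
  ⟨Ioo_subset_Icc_self h.1, Ioo_subset_Icc_self h.2⟩

theorem continuous_lin (b t : ℝ) : Continuous (lin b t) := by unfold lin; fun_prop

theorem isClosed_quad : IsClosed (quad b₀ t₀ b₁ t₁) :=
  (isClosed_Icc.preimage continuous_snd).inter
    ((isClosed_le ((continuous_lin _ _).comp continuous_snd) continuous_fst).inter
      (isClosed_le continuous_fst ((continuous_lin _ _).comp continuous_snd)))

theorem isCompact_quad : IsCompact (quad b₀ t₀ b₁ t₁) := by
  refine (isCompact_Icc (a := ((-|b₀| - |t₀| : ℝ), (0 : ℝ)))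
    (b := ((|b₁| + |t₁| : ℝ), (1 : ℝ)))).of_isClosed_subset isClosed_quad ?_
  rintro ⟨x, s⟩ ⟨⟨h0, h1⟩, h2, h3⟩
  have h0' : 0 ≤ 1 - s := sub_nonneg.2 h1
  unfold lin at h2 h3
  simp only at *
  refine ⟨⟨?_, h0⟩, ?_, h1⟩
  · simp only
    nlinarith [neg_abs_le b₀, neg_abs_le t₀, abs_nonneg b₀, abs_nonneg t₀, mul_le_mul_of_nonneg_right (neg_abs_le t₀) h0, mul_le_mul_of_nonneg_right (neg_abs_le b₀) h0', mul_nonneg (abs_nonneg b₀) h0, mul_nonneg (abs_nonneg t₀) h0']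
  · simp only
    nlinarith [le_abs_self b₁, le_abs_self t₁, mul_le_mul_of_nonneg_right (le_abs_self t₁) h0, mul_le_mul_of_nonneg_right (le_abs_self b₁) h0', mul_nonneg (abs_nonneg b₁) h0, mul_nonneg (abs_nonneg t₁) h0']

theorem convex_quad : Convex ℝ (quad b₀ t₀ b₁ t₁) := by
  rintro ⟨x, s⟩ ⟨⟨h0, h1⟩, h2, h3⟩ ⟨x', s'⟩ ⟨⟨h0', h1'⟩, h2', h3'⟩ a b ha hb hab
  obtain rfl : b = 1 - a := by linarith
  unfold lin at *
  simp only [quad, lin, mem_ofPred_eq, Prod.smul_mk, Prod.mk_add_mk, smul_eq_mul, mem_Icc] at *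
  refine ⟨⟨by positivity, by nlinarith⟩, ?_, ?_⟩
  · nlinarith [mul_le_mul_of_nonneg_left h2 ha, mul_le_mul_of_nonneg_left h2' hb]
  · nlinarith [mul_le_mul_of_nonneg_left h3 ha, mul_le_mul_of_nonneg_left h3' hb]

theorem interior_quad : interior (quad b₀ t₀ b₁ t₁) = openQuad b₀ t₀ b₁ t₁ := by
  refine Subset.antisymm ?_ (interior_maximal openQuad_subset ?_)
  · rintro ⟨x, s⟩ hz
    obtain ⟨ε, hε, hball⟩ := Metric.mem_nhds_iff.1 (mem_interior_iff_mem_nhds.1 hz)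
    have hm : ∀ u v : ℝ, |u| < ε → |v| < ε → (x + u, s + v) ∈ quad b₀ t₀ b₁ t₁ := fun u v hu hv =>
      hball (by
        rw [mem_ball, Prod.dist_eq, Real.dist_eq, Real.dist_eq, max_lt_iff]
        exact ⟨by simpa using hu, by simpa using hv⟩)
    have hp : |ε / 2| < ε := by rw [abs_of_pos (by positivity)]; linarith
    have hn : |-(ε / 2)| < ε := by rwa [abs_neg]
    have hz' : |(0 : ℝ)| < ε := by simpa
    have h1 := (hm 0 (ε / 2) hz' hp).1.2
    have h2 := (hm 0 (-(ε / 2)) hz' hn).1.1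
    have h3 := (hm (ε / 2) 0 hp hz').2.2
    have h4 := (hm (-(ε / 2)) 0 hn hz').2.1
    simp only [add_zero] at h1 h2 h3 h4
    refine ⟨⟨?_, ?_⟩, ?_, ?_⟩ <;> simp only <;> linarith
  · refine (isOpen_Ioo.preimage continuous_snd).inter
      ((isOpen_lt ((continuous_lin _ _).comp continuous_snd) continuous_fst).inter
      (isOpen_lt continuous_fst ((continuous_lin _ _).comp continuous_snd)))

theorem frontier_quad :
    frontier (quad b₀ t₀ b₁ t₁) = quad b₀ t₀ b₁ t₁ \ openQuad b₀ t₀ b₁ t₁ := by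
  rw [frontier, isClosed_quad.closure_eq, interior_quad]

end Quad

/-- A characteristic map of a quadrangle. -/
structure IsQuadDisc (b₀ t₀ b₁ t₁ : ℝ) (f : Euc 2 → ℝ × ℝ) : Prop where
  continuous : Continuous f
  injective : Function.Injective f
  image_ball : f '' ball 0 1 = openQuad b₀ t₀ b₁ t₁
  image_sphere : f '' sphere 0 1 = quad b₀ t₀ b₁ t₁ \ openQuad b₀ t₀ b₁ t₁

theorem IsQuadDisc.image_closedBall {b₀ t₀ b₁ t₁ : ℝ} {f : Euc 2 → ℝ × ℝ}
    (h : IsQuadDisc b₀ t₀ b₁ t₁ f) : f '' closedBall 0 1 = quad b₀ t₀ b₁ t₁ := by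
  rw [← ball_union_sphere, image_union, h.image_ball, h.image_sphere,
    union_sdiff_cancel openQuad_subset]

/-- Coordinates of the plane which are linear on both sides of the axis `p 0 = 0`. -/
noncomputable def bend (d e : ℝ × ℝ) (c : ℝ) (p : Euc 2) : ℝ × ℝ :=
  (p 0 * d.1 + (p 1 + c * |p 0|) * e.1, p 0 * d.2 + (p 1 + c * |p 0|) * e.2)

theorem exists_quadDisc {b₀ t₀ b₁ t₁ : ℝ} {o : ℝ × ℝ} (ho : o ∈ openQuad b₀ t₀ b₁ t₁)
    {d e : ℝ × ℝ} (c : ℝ) (hde : d.1 * e.2 - d.2 * e.1 ≠ 0) :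
    ∃ f, IsQuadDisc b₀ t₀ b₁ t₁ f ∧ f 0 = o ∧ ∀ u : Euc 2, ‖u‖ = 1 → ∀ x,
      x ∈ quad b₀ t₀ b₁ t₁ \ openQuad b₀ t₀ b₁ t₁ → ∀ μ : ℝ, 0 < μ → bend d e c u = μ • (x - o) →
        f u = x ∧ ∀ p, f p ∈ segment ℝ o x ↔ p ∈ segment ℝ 0 u := by
  have hb : Function.Bijective (bend d e c) := by
    constructor
    · intro p q h
      simp only [bend, Prod.mk.injEq] at h
      have e0 : (p 0 - q 0) * (d.1 * e.2 - d.2 * e.1) = 0 := by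
        linear_combination e.2 * h.1 - e.1 * h.2
      have e0' : p 0 = q 0 := sub_eq_zero.1 ((mul_eq_zero.1 e0).resolve_right hde)
      have e1 : (p 1 - q 1) * (d.1 * e.2 - d.2 * e.1) = 0 := by
        rw [e0'] at h
        linear_combination d.1 * h.2 - d.2 * h.1
      have e1' : p 1 = q 1 := sub_eq_zero.1 ((mul_eq_zero.1 e1).resolve_right hde)
      ext i
      fin_cases i
      all_goals grind
    · intro y
      obtain ⟨D, hD⟩ : ∃ D, D = d.1 * e.2 - d.2 * e.1 := ⟨_, rfl⟩
      rw [← hD] at hde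
      refine ⟨!₂[(y.1 * e.2 - y.2 * e.1) / D,
        (d.1 * y.2 - d.2 * y.1) / D - c * |(y.1 * e.2 - y.2 * e.1) / D|], ?_⟩
      apply Prod.ext <;> simp only [bend, Matrix.cons_val_zero, Matrix.cons_val_one,
        sub_add_cancel] <;> field_simp <;> rw [hD] <;> ring
  have hh : ∀ t : ℝ, 0 ≤ t → ∀ p, bend d e c (t • p) = t • bend d e c p := by
    intro t ht p
    simp only [bend, PiLp.smul_apply, smul_eq_mul, abs_mul, abs_of_nonneg ht, Prod.smul_mk]
    grind
  obtain ⟨f, h1, h2, h3, h4, h5, h6⟩ := exists_convex_disc convex_quad isCompact_quad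
    (interior_quad (b₀ := b₀) (t₀ := t₀) ▸ ho) (by unfold bend; fun_prop) hb hh
  rw [interior_quad] at h3
  rw [frontier_quad] at h4 h6
  exact ⟨f, ⟨h1, h2, h3, h4⟩, h5, h6⟩

end DefectBord

namespace DefectBord

open CellComplex

/-! ### Cutting a rectangle -/

theorem exists_floor {b : ℕ → ℝ} {x : ℝ} {A B : ℕ} (hAB : A < B) (h1 : b A ≤ x) (h2 : x ≤ b B) :
    ∃ k, A ≤ k ∧ k < B ∧ b k ≤ x ∧ x ≤ b (k + 1) := by
  induction B, hAB using Nat.le_induction with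
  | base => exact ⟨A, le_rfl, A.lt_succ_self, h1, h2⟩
  | succ B hB ih =>
    rcases le_total (b B) x with h | h
    · exact ⟨B, Nat.le_of_succ_le hB, B.lt_succ_self, h, h2⟩
    · obtain ⟨k, hk1, hk2, hk⟩ := ih h
      exact ⟨k, hk1, hk2.trans B.lt_succ_self, hk⟩

/-- The corners on a side of a rectangle (and its back) with `N` marked points. -/
noncomputable def grid (N k : ℕ) : ℝ :=
  if k = 0 then 0 else if k ≤ N + 1 then (2 * k - 1) / (2 * (N + 1)) else k - (N + 1)

theorem grid_zero (N : ℕ) : grid N 0 = 0 := if_pos rfl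

theorem grid_mid {N k : ℕ} (h : 1 ≤ k) (h' : k ≤ N + 1) :
    grid N k = (2 * k - 1) / (2 * (N + 1)) := by
  rw [grid, if_neg (by omega), if_pos h']

theorem grid_front (N : ℕ) : grid N (N + 2) = 1 := by
  rw [grid, if_neg (by omega), if_neg (by omega)]; push_cast; ring

theorem grid_back (N : ℕ) : grid N (N + 3) = 2 := by
  rw [grid, if_neg (by omega), if_neg (by omega)]; push_cast; ring

theorem strictMono_grid (N : ℕ) : StrictMono (grid N) := by
  refine strictMono_nat_of_lt_succ fun k => ?_
  unfold grid
  rw [if_neg (Nat.succ_ne_zero k)]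
  rcases Nat.eq_zero_or_pos k with rfl | hk
  · simp only [if_true, zero_add, show 1 ≤ N + 1 by omega]
    push_cast
    have : (0 : ℝ) < 2 * 1 - 1 := by norm_num
    positivity
  rw [if_neg hk.ne']
  split_ifs with h1 h2 h2
  · gcongr; linarith
  · obtain rfl : k = N + 1 := by omega
    push_cast
    rw [div_lt_iff₀ (by positivity)]
    nlinarith
  all_goals grind

theorem tick_lt_grid {N k m : ℕ} (hk : k ≤ N) (h : k < m) : tick N k < grid N m := by
  refine lt_of_lt_of_le ?_ ((strictMono_grid N).monotone h)
  rw [Nat.succ_eq_add_one, grid_mid (by omega) (by omega), tick, div_lt_div_iff₀ (by positivity)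
    (by positivity)]
  push_cast
  nlinarith

theorem grid_lt_tick {N k m : ℕ} (h0 : 1 ≤ k) (hk : k ≤ N) (h : m ≤ k) : grid N m < tick N k := by
  refine lt_of_le_of_lt ((strictMono_grid N).monotone h) ?_
  rw [grid_mid (by omega) (by omega), tick, div_lt_div_iff₀ (by positivity) (by positivity)]
  nlinarith

/-- A cutting of a rectangle and its back by straight lines, the `a`-th of which runs from the
corner `β a` of the bottom side to the corner `τ a` of the top side. -/
structure Cuts where
  N : ℕ
  N' : ℕ
  K : ℕ
  β : ℕ → ℕ
  τ : ℕ → ℕ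
  monoβ : Monotone β
  monoτ : Monotone τ
  β_zero : β 0 = 0
  τ_zero : τ 0 = 0
  β_front : β (K + 1) = N + 2
  τ_front : τ (K + 1) = N' + 2
  β_back : β (K + 2) = N + 3
  τ_back : τ (K + 2) = N' + 3
  step : ∀ a < K + 2, β a < β (a + 1) ∨ τ a < τ (a + 1)

/-- The sides of the polygons of a cutting. -/
inductive Side
  | bot (k : ℕ)
  | top (k : ℕ)
  | cut (a : ℕ)

namespace Cuts

variable (C : Cuts)

/-- The `a`-th cut. -/
noncomputable def cut (a : ℕ) : ℝ → ℝ := lin (grid C.N (C.β a)) (grid C.N' (C.τ a))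

theorem cut_at_zero (a : ℕ) : C.cut a 0 = grid C.N (C.β a) := lin_zero _ _

theorem cut_at_one (a : ℕ) : C.cut a 1 = grid C.N' (C.τ a) := lin_one _ _

theorem cut_zero (s : ℝ) : C.cut 0 s = 0 := by simp [cut, C.β_zero, C.τ_zero, grid_zero, lin]

theorem cut_front (s : ℝ) : C.cut (C.K + 1) s = 1 := by
  simp [cut, C.β_front, C.τ_front, grid_front, lin]

theorem cut_back (s : ℝ) : C.cut (C.K + 2) s = 2 := by
  simp [cut, C.β_back, C.τ_back, grid_back, lin]

theorem cut_le {a b : ℕ} (h : a ≤ b) {s : ℝ} (hs : s ∈ Icc (0 : ℝ) 1) : C.cut a s ≤ C.cut b s :=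
  lin_le ((strictMono_grid _).monotone (C.monoβ h)) ((strictMono_grid _).monotone (C.monoτ h)) hs

theorem cut_lt_succ {a : ℕ} (ha : a < C.K + 2) {s : ℝ} (hs : s ∈ Ioo (0 : ℝ) 1) :
    C.cut a s < C.cut (a + 1) s :=
  lin_lt' ((strictMono_grid _).monotone (C.monoβ a.le_succ))
    ((strictMono_grid _).monotone (C.monoτ a.le_succ))
    ((C.step a ha).imp (fun h => strictMono_grid _ h) fun h => strictMono_grid _ h) hs

/-- The `a`-th polygon. -/
def cell (a : ℕ) : Set (ℝ × ℝ) :=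
  quad (grid C.N (C.β a)) (grid C.N' (C.τ a)) (grid C.N (C.β (a + 1))) (grid C.N' (C.τ (a + 1)))

/-- The interior of the `a`-th polygon. -/
def openCell (a : ℕ) : Set (ℝ × ℝ) :=
  openQuad (grid C.N (C.β a)) (grid C.N' (C.τ a)) (grid C.N (C.β (a + 1)))
    (grid C.N' (C.τ (a + 1)))

theorem mem_cell {a : ℕ} {x s : ℝ} : (x, s) ∈ C.cell a ↔
    s ∈ Icc (0 : ℝ) 1 ∧ C.cut a s ≤ x ∧ x ≤ C.cut (a + 1) s := Iff.rfl

theorem mem_openCell {a : ℕ} {x s : ℝ} : (x, s) ∈ C.openCell a ↔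
    s ∈ Ioo (0 : ℝ) 1 ∧ C.cut a s < x ∧ x < C.cut (a + 1) s := Iff.rfl

/-- A characteristic map of the `a`-th polygon. -/
def IsDisc (a : ℕ) (f : Euc 2 → ℝ × ℝ) : Prop :=
  IsQuadDisc (grid C.N (C.β a)) (grid C.N' (C.τ a)) (grid C.N (C.β (a + 1)))
    (grid C.N' (C.τ (a + 1))) f

/-- The sides of the `a`-th polygon. -/
def IsSide (a : ℕ) : Side → Prop
  | .bot k => C.β a ≤ k ∧ k < C.β (a + 1)
  | .top k => C.τ a ≤ k ∧ k < C.τ (a + 1)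
  | .cut b => b = a ∨ b = a + 1

/-- The interior of a side. -/
def openSide : Side → Set (ℝ × ℝ)
  | .bot k => {z | z.2 = 0 ∧ z.1 ∈ Ioo (grid C.N k) (grid C.N (k + 1))}
  | .top k => {z | z.2 = 1 ∧ z.1 ∈ Ioo (grid C.N' k) (grid C.N' (k + 1))}
  | .cut a => {z | z.2 ∈ Ioo (0 : ℝ) 1 ∧ z.1 = C.cut a z.2}

/-- A closed side. -/
def closedSide : Side → Set (ℝ × ℝ)
  | .bot k => {z | z.2 = 0 ∧ z.1 ∈ Icc (grid C.N k) (grid C.N (k + 1))}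
  | .top k => {z | z.2 = 1 ∧ z.1 ∈ Icc (grid C.N' k) (grid C.N' (k + 1))}
  | .cut a => {z | z.2 ∈ Icc (0 : ℝ) 1 ∧ z.1 = C.cut a z.2}

variable {C}

theorem IsDisc.image {a : ℕ} {f : Euc 2 → ℝ × ℝ} (hf : C.IsDisc a f) :
    f '' closedBall 0 1 = C.cell a :=
  hf.image_closedBall

theorem IsDisc.mem {a : ℕ} {f : Euc 2 → ℝ × ℝ} (hf : C.IsDisc a f) {p : Euc 2}
    (hp : p ∈ closedBall (0 : Euc 2) 1) : f p ∈ C.cell a :=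
  hf.image ▸ mem_image_of_mem f hp

theorem closedSide_subset {a : ℕ} {l : Side} (h : C.IsSide a l) :
    C.closedSide l ⊆ C.cell a \ C.openCell a := by
  rintro ⟨x, s⟩ hz
  rw [mem_sdiff, mem_cell, mem_openCell]
  have hm := fun N => (strictMono_grid N).monotone
  cases l with
  | bot k =>
    obtain ⟨rfl, h1, h2⟩ := hz
    rw [cut_at_zero, cut_at_zero]
    exact ⟨⟨by simp, (hm _ h.1).trans h1, h2.trans (hm _ h.2)⟩, fun h => lt_irrefl _ h.1.1⟩
  | top k =>
    obtain ⟨rfl, h1, h2⟩ := hz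
    rw [cut_at_one, cut_at_one]
    exact ⟨⟨by simp, (hm _ h.1).trans h1, h2.trans (hm _ h.2)⟩, fun h => lt_irrefl _ h.1.2⟩
  | cut b =>
    obtain ⟨hs, rfl : x = C.cut b s⟩ := hz
    rcases h with rfl | rfl
    · exact ⟨⟨hs, le_rfl, C.cut_le (Nat.le_succ _) hs⟩, fun h => lt_irrefl _ h.2.1⟩
    · exact ⟨⟨hs, C.cut_le (Nat.le_succ _) hs, le_rfl⟩, fun h => lt_irrefl _ h.2.2⟩

theorem openSide_subset {a : ℕ} {l : Side} (h : C.IsSide a l) :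
    C.openSide l ⊆ C.cell a \ C.openCell a := by
  refine Subset.trans ?_ (closedSide_subset h)
  cases l <;> exact fun z hz => by
    first
    | exact ⟨hz.1, Ioo_subset_Icc_self hz.2⟩
    | exact ⟨Ioo_subset_Icc_self hz.1, hz.2⟩

theorem exists_side {a : ℕ} {z : ℝ × ℝ} (hz : z ∈ C.cell a \ C.openCell a) :
    ∃ l, C.IsSide a l ∧ z ∈ C.closedSide l := by
  obtain ⟨x, s⟩ := z
  rw [mem_sdiff, mem_cell, mem_openCell] at hz
  obtain ⟨⟨hs, h1, h2⟩, h3⟩ := hz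
  rcases h1.eq_or_lt with h1 | h1
  · exact ⟨.cut a, Or.inl rfl, hs, h1.symm⟩
  rcases h2.eq_or_lt with h2 | h2
  · exact ⟨.cut (a + 1), Or.inr rfl, hs, h2⟩
  rcases hs.1.eq_or_lt with rfl | h0
  · rw [cut_at_zero] at h1 h2
    obtain ⟨k, hk, hk', h⟩ := exists_floor ((strictMono_grid _).lt_iff_lt.1 (h1.trans h2)) h1.le h2.le
    exact ⟨.bot k, ⟨hk, hk'⟩, rfl, h⟩
  · obtain rfl : s = 1 := by
      grind
    rw [cut_at_one] at h1 h2
    obtain ⟨k, hk, hk', h⟩ := exists_floor ((strictMono_grid _).lt_iff_lt.1 (h1.trans h2)) h1.le h2.le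
    exact ⟨.top k, ⟨hk, hk'⟩, rfl, h⟩

/-- The `a`-th polygon is a basic-gon with respect to the lines `Q` and the vertices `W`. -/
def HasModel (C : Cuts) (Q W : Set (ℝ × ℝ)) (a : ℕ) : Prop :=
  ∃ f, C.IsDisc a f ∧ ((∀ z ∈ C.cell a, z ∉ Q) ∨
    ((∀ z ∈ C.cell a, z ∉ W) ∧ (∀ p ∈ closedBall (0 : Euc 2) 1, f p ∈ Q ↔ p 1 = 0) ∧
      ∃ l l', l ≠ l' ∧ C.IsSide a l ∧ C.IsSide a l' ∧ f !₂[1, 0] ∈ C.openSide l ∧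
        f !₂[-1, 0] ∈ C.openSide l') ∨
    ((∀ p ∈ closedBall (0 : Euc 2) 1, f p ∈ Q ↔ ∃ k, p ∈ segment ℝ 0 (tripod k)) ∧
      (∀ p ∈ closedBall (0 : Euc 2) 1, f p ∈ W ↔ p = 0) ∧
      ∃ l : Fin 3 → Side, Function.Injective l ∧ (∀ x, C.IsSide a x → ∃ k, x = l k) ∧
        ∀ k, C.IsSide a (l k) ∧ f (tripod k) ∈ C.openSide (l k)))

/-- All polygons are basic-gons, and the cuts are transversal to the lines. -/
structure Fits (C : Cuts) (Q W : Set (ℝ × ℝ)) : Prop where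
  fst_mem : ∀ z ∈ Q, z.1 ∈ Ioo (0 : ℝ) 1
  subset : W ⊆ Q
  subsingleton : ∀ a ≤ C.K + 2, ∀ s ∈ Icc (0 : ℝ) 1, ∀ s' ∈ Icc (0 : ℝ) 1,
    (C.cut a s, s) ∈ Q → (C.cut a s', s') ∈ Q → s = s'
  not_mem : ∀ a ≤ C.K + 2, ∀ s ∈ Icc (0 : ℝ) 1, (C.cut a s, s) ∉ W
  model : ∀ a < C.K + 2, C.HasModel Q W a

theorem hasModel_empty {Q W : Set (ℝ × ℝ)} {a : ℕ} (ha : a < C.K + 2)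
    (h : ∀ x s, (x, s) ∈ C.cell a → (x, s) ∉ Q) : C.HasModel Q W a := by
  have h2 : (1 / 2 : ℝ) ∈ Ioo (0 : ℝ) 1 := by norm_num
  have hl := C.cut_lt_succ ha h2
  obtain ⟨f, hf, -⟩ := exists_quadDisc (o := ((C.cut a (1 / 2) + C.cut (a + 1) (1 / 2)) / 2, 1 / 2))
    ((C.mem_openCell (a := a)).2 ⟨h2, by linarith, by linarith⟩) (d := (1, 0)) (e := (0, 1)) 0 (by norm_num)
  exact ⟨f, hf, Or.inl fun z hz => h z.1 z.2 hz⟩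

theorem mem_segment_axis {p : Euc 2} (hp : p ∈ closedBall (0 : Euc 2) 1) :
    (p ∈ segment ℝ 0 !₂[(1 : ℝ), 0] ∨ p ∈ segment ℝ 0 !₂[(-1 : ℝ), 0]) ↔ p 1 = 0 := by
  rw [segment_eq_image', segment_eq_image']
  constructor
  · rintro (⟨t, ht, rfl⟩ | ⟨t, ht, rfl⟩) <;> simp
  · intro h
    have hn : |p 0| ≤ 1 := by
      rw [mem_closedBall_zero_iff, EuclideanSpace.norm_eq, Fin.sum_univ_two, h] at hp
      simpa [Real.sqrt_sq_eq_abs] using hp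
    rw [abs_le] at hn
    rcases le_total 0 (p 0) with h0 | h0
    · refine Or.inl ⟨p 0, ⟨h0, hn.2⟩, ?_⟩
      ext i; fin_cases i <;> simp [h]
    · refine Or.inr ⟨-p 0, ⟨by linarith, by linarith⟩, ?_⟩
      ext i; fin_cases i <;> simp [h]

theorem hasModel_arc {Q W : Set (ℝ × ℝ)} {a : ℕ} {o x x' d e : ℝ × ℝ} {c : ℝ}
    (ho : o ∈ C.openCell a) (hde : d.1 * e.2 - d.2 * e.1 ≠ 0)
    (hx : x = (o.1 + d.1 + c * e.1, o.2 + d.2 + c * e.2))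
    (hx' : x' = (o.1 - d.1 + c * e.1, o.2 - d.2 + c * e.2))
    (hQ : ∀ z ∈ C.cell a, z ∈ Q ↔ z ∈ segment ℝ o x ∨ z ∈ segment ℝ o x')
    (hW : ∀ z ∈ C.cell a, z ∉ W) {l l' : Side} (hl : l ≠ l') (h : C.IsSide a l)
    (h' : C.IsSide a l') (hm : x ∈ C.openSide l) (hm' : x' ∈ C.openSide l') :
    C.HasModel Q W a := by
  obtain ⟨f, hf, -, H⟩ := exists_quadDisc ho (d := d) (e := e) c hde
  have H1 := H !₂[1, 0] (by simp [EuclideanSpace.norm_eq]) x (openSide_subset h hm) 1 one_pos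
    (by subst hx; apply Prod.ext <;> simp [bend] <;> ring)
  have H2 := H !₂[-1, 0] (by simp [EuclideanSpace.norm_eq]) x' (openSide_subset h' hm') 1 one_pos
    (by subst hx'; apply Prod.ext <;> simp [bend] <;> ring)
  refine ⟨f, hf, Or.inr (Or.inl ⟨hW, fun p hp => ?_, l, l', hl, h, h', by rwa [H1.1],
    by rwa [H2.1]⟩)⟩
  rw [hQ _ (IsDisc.mem hf hp), H1.2, H2.2, mem_segment_axis hp]

theorem hasModel_straight {Q W : Set (ℝ × ℝ)} {a : ℕ} {c₀ c₁ s₁ s₂ : ℝ} (h0 : 0 ≤ s₁)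
    (h12 : s₁ < s₂) (h1 : s₂ ≤ 1) (hleft : C.cut a ((s₁ + s₂) / 2) < lin c₀ c₁ ((s₁ + s₂) / 2))
    (hright : lin c₀ c₁ ((s₁ + s₂) / 2) < C.cut (a + 1) ((s₁ + s₂) / 2))
    (hQ : ∀ x s, (x, s) ∈ C.cell a → ((x, s) ∈ Q ↔ (s₁ ≤ s ∧ s ≤ s₂) ∧ x = lin c₀ c₁ s))
    (hW : ∀ x s, (x, s) ∈ C.cell a → (x, s) ∉ W) {l l' : Side} (hl : l ≠ l') (h : C.IsSide a l)
    (h' : C.IsSide a l') (hm : (lin c₀ c₁ s₁, s₁) ∈ C.openSide l)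
    (hm' : (lin c₀ c₁ s₂, s₂) ∈ C.openSide l') : C.HasModel Q W a := by
  refine hasModel_arc (o := (lin c₀ c₁ ((s₁ + s₂) / 2), (s₁ + s₂) / 2))
    (d := ((c₁ - c₀) * (s₁ - s₂) / 2, (s₁ - s₂) / 2)) (e := (-(s₁ - s₂) / 2, (c₁ - c₀) * (s₁ - s₂) / 2))
    (c := 0) (C.mem_openCell.2 ⟨⟨by linarith, by linarith⟩, hleft, hright⟩) ?_ ?_ ?_ ?_
    (fun z hz => hW z.1 z.2 hz) hl h h' hm hm'
  · have h2 : 0 < (s₁ - s₂) ^ 2 / 4 := by have := (sub_neg.2 h12).ne; positivity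
    have h3 := mul_nonneg (sq_nonneg (c₁ - c₀)) h2.le
    grind
  · apply Prod.ext <;> simp only [lin] <;> ring
  · apply Prod.ext <;> simp only [lin] <;> ring
  · rintro ⟨x, s⟩ hz
    rw [hQ x s hz, segment_symm, mem_segment_iff (by linarith), mem_segment_iff (by linarith)]
    have e1 : ∀ u v, u < v → lin c₀ c₁ u + (lin c₀ c₁ v - lin c₀ c₁ u) * ((s - u) / (v - u)) =
        lin c₀ c₁ s := by
      intro u v huv
      have : v - u ≠ 0 := (sub_pos.2 huv).ne'
      unfold lin
      field_simp
      ring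
    rw [e1 _ _ (by linarith), e1 _ _ (by linarith)]
    constructor
    · grind
    · rintro (⟨h3, h4, rfl⟩ | ⟨h3, h4, rfl⟩)
      all_goals grind

theorem norm_tripod (k : Fin 3) : ‖tripod k‖ = 1 := by
  simp [tripod, EuclideanSpace.norm_eq]

theorem tripod_zero : tripod 0 = !₂[1, 0] := by simp [tripod]

theorem tripod_one : tripod 1 = !₂[-1 / 2, √3 / 2] := by
  have e : 2 * Real.pi * ((1 : Fin 3) : ℕ) / 3 = Real.pi - Real.pi / 3 := by simp; ring
  rw [tripod, e, Real.cos_pi_sub, Real.sin_pi_sub, Real.cos_pi_div_three, Real.sin_pi_div_three]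
  norm_num

theorem tripod_two : tripod 2 = !₂[-1 / 2, -(√3 / 2)] := by
  have e : 2 * Real.pi * ((2 : Fin 3) : ℕ) / 3 = Real.pi / 3 + Real.pi := by simp; ring
  rw [tripod, e, Real.cos_add_pi, Real.sin_add_pi, Real.cos_pi_div_three, Real.sin_pi_div_three]
  norm_num

theorem hasModel_tripod {Q W : Set (ℝ × ℝ)} {a : ℕ} {o : ℝ × ℝ} {x : Fin 3 → ℝ × ℝ}
    {μ : Fin 3 → ℝ} (ho : o ∈ C.openCell a) (hμ : ∀ k, 0 < μ k)
    (h₁ : μ 0 * (x 0 - o).1 + μ 1 * (x 1 - o).1 + μ 2 * (x 2 - o).1 = 0)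
    (h₂ : μ 0 * (x 0 - o).2 + μ 1 * (x 1 - o).2 + μ 2 * (x 2 - o).2 = 0)
    (hdet : (x 0 - o).1 * (x 1 - o).2 - (x 0 - o).2 * (x 1 - o).1 ≠ 0)
    (hQ : ∀ z ∈ C.cell a, z ∈ Q ↔ ∃ k, z ∈ segment ℝ o (x k))
    (hW : ∀ z ∈ C.cell a, z ∈ W ↔ z = o) {l : Fin 3 → Side} (hl : Function.Injective l)
    (hs : ∀ y, C.IsSide a y → ∃ k, y = l k) (h : ∀ k, C.IsSide a (l k))
    (hm : ∀ k, x k ∈ C.openSide (l k)) : C.HasModel Q W a := by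
  have h3 : √3 ≠ 0 := by positivity
  obtain ⟨f, hf, hf0, H⟩ := exists_quadDisc ho (d := μ 0 • (x 0 - o))
    (e := (√3)⁻¹ • (μ 1 • (x 1 - o) - μ 2 • (x 2 - o))) 0 (by
      have e : (μ 0 • (x 0 - o)).1 * ((√3)⁻¹ • (μ 1 • (x 1 - o) - μ 2 • (x 2 - o))).2 -
          (μ 0 • (x 0 - o)).2 * ((√3)⁻¹ • (μ 1 • (x 1 - o) - μ 2 • (x 2 - o))).1 =
          2 * (√3)⁻¹ * μ 0 * μ 1 *
            ((x 0 - o).1 * (x 1 - o).2 - (x 0 - o).2 * (x 1 - o).1) := by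
        simp only [Prod.smul_fst, Prod.smul_snd, Prod.fst_sub, Prod.snd_sub, smul_eq_mul] at *
        grind
      rw [e]
      have := (hμ 0).ne'
      have := (hμ 1).ne'
      positivity)
  have H' : ∀ k, f (tripod k) = x k ∧ ∀ p, f p ∈ segment ℝ o (x k) ↔ p ∈ segment ℝ 0 (tripod k) := by
    intro k
    refine H _ (norm_tripod k) _ (openSide_subset (h k) (hm k)) (μ k) (hμ k) ?_
    simp only [Prod.fst_sub, Prod.snd_sub] at h₁ h₂
    fin_cases k
    · apply Prod.ext <;> simp [tripod_zero, bend]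
    · apply Prod.ext <;> simp [tripod_one, bend] <;> field_simp <;> linarith
    · apply Prod.ext <;> simp [tripod_two, bend] <;> field_simp <;> linarith
  refine ⟨f, hf, Or.inr (Or.inr ⟨fun p hp => ?_, fun p hp => ?_, l, hl, hs, fun k =>
    ⟨h k, by rw [(H' k).1]; exact hm k⟩⟩)⟩
  · rw [hQ _ (IsDisc.mem hf hp)]
    exact exists_congr fun k => (H' k).2 p
  · rw [hW _ (IsDisc.mem hf hp), ← hf0, hf.injective.eq_iff]

end Cuts

end DefectBord

namespace DefectBord

namespace Cuts

variable {C : Cuts} {Q W : Set (ℝ × ℝ)} {L : ℕ} {c : ℕ → ℝ → ℝ} {P : ℕ → ℝ → Prop}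

/-- The set `Q` consists of the graphs of the curves `c 1, …, c L`, restricted to the heights which
satisfy `P`. -/
def IsPicture (Q : Set (ℝ × ℝ)) (L : ℕ) (c : ℕ → ℝ → ℝ) (P : ℕ → ℝ → Prop) : Prop :=
  ∀ x s, (x, s) ∈ Q ↔ s ∈ Icc (0 : ℝ) 1 ∧ ∃ k, 1 ≤ k ∧ k ≤ L ∧ x = c k s ∧ P k s

/-- The `a`-th cut separates the first `m` curves from the others. -/
def Gap (C : Cuts) (L : ℕ) (c : ℕ → ℝ → ℝ) (P : ℕ → ℝ → Prop) (m a : ℕ) : Prop :=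
  ∀ s ∈ Icc (0 : ℝ) 1, ∀ k, 1 ≤ k → k ≤ L → P k s →
    (k ≤ m → c k s < C.cut a s) ∧ (m < k → C.cut a s < c k s)

theorem Gap.not_mem (hQ : IsPicture Q L c P) {m a : ℕ} (h : Gap C L c P m a) {s : ℝ} :
    (C.cut a s, s) ∉ Q := by
  rw [hQ]
  rintro ⟨hs, k, h1, h2, e, hP⟩
  rcases le_or_gt k m with hk | hk
  · exact ((h s hs k h1 h2 hP).1 hk).ne' e
  · exact ((h s hs k h1 h2 hP).2 hk).ne e

theorem Gap.fst_mem (hQ : IsPicture Q L c P) (h : Gap C L c P 0 0) (h' : Gap C L c P L (C.K + 1))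
    (z : ℝ × ℝ) (hz : z ∈ Q) : z.1 ∈ Ioo (0 : ℝ) 1 := by
  obtain ⟨hs, k, h1, h2, e, hP⟩ := (hQ z.1 z.2).1 hz
  rw [e]
  exact ⟨(C.cut_zero _).symm.trans_lt ((h _ hs k h1 h2 hP).2 h1),
    ((h' _ hs k h1 h2 hP).1 h2).trans_eq (C.cut_front _)⟩

theorem Gap.hasModel (hQ : IsPicture Q L c P) {m a : ℕ} (ha : a < C.K + 2) (h : Gap C L c P m a)
    (h' : Gap C L c P m (a + 1)) : C.HasModel Q W a := by
  refine hasModel_empty ha fun x s hz hzQ => ?_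
  obtain ⟨hs, h1, h2⟩ := mem_cell (C := C).1 hz
  obtain ⟨-, k, hk1, hk2, rfl, hP⟩ := (hQ _ _).1 hzQ
  rcases le_or_gt k m with hk | hk
  · exact ((h s hs k hk1 hk2 hP).1 hk).not_ge h1
  · exact ((h' s hs k hk1 hk2 hP).2 hk).not_ge h2

theorem Gap.hasModel_succ (hQ : IsPicture Q L c P) {m a : ℕ} (h : Gap C L c P m a)
    (h' : Gap C L c P (m + 1) (a + 1)) (hm : m + 1 ≤ L) {c₀ c₁ : ℝ}
    (hc : ∀ s, c (m + 1) s = lin c₀ c₁ s) (hP : ∀ s, P (m + 1) s)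
    (hW : ∀ x s, (x, s) ∈ W → s ∈ Icc (0 : ℝ) 1 ∧
      ∃ k, 1 ≤ k ∧ k ≤ L ∧ k ≠ m + 1 ∧ x = c k s ∧ P k s)
    (hβ : C.β (a + 1) = C.β a + 1) (hτ : C.τ (a + 1) = C.τ a + 1) : C.HasModel Q W a := by
  have key : ∀ s ∈ Icc (0 : ℝ) 1, C.cut a s < lin c₀ c₁ s ∧ lin c₀ c₁ s < C.cut (a + 1) s := by
    intro s hs
    rw [← hc]
    exact ⟨(h s hs _ (Nat.le_add_left 1 m) hm (hP s)).2 m.lt_succ_self,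
      (h' s hs _ (Nat.le_add_left 1 m) hm (hP s)).1 le_rfl⟩
  have hne : ∀ s ∈ Icc (0 : ℝ) 1, ∀ k, 1 ≤ k → k ≤ L → P k s → k ≠ m + 1 →
      (c k s, s) ∉ C.cell a := by
    intro s hs k h1 h2 hPk hk hz
    obtain ⟨-, hz1, hz2⟩ := mem_cell (C := C).1 hz
    rcases lt_or_gt_of_ne hk with hk | hk
    · exact ((h s hs k h1 h2 hPk).1 (Nat.lt_succ_iff.1 hk)).not_ge hz1
    · exact ((h' s hs k h1 h2 hPk).2 hk).not_ge hz2
  have h0 := key 0 (by simp)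
  have h1 := key 1 (by simp)
  have h2 := key ((0 + 1) / 2) (by norm_num)
  rw [cut_at_zero, cut_at_zero, hβ] at h0
  rw [cut_at_one, cut_at_one, hτ] at h1
  refine hasModel_straight le_rfl zero_lt_one le_rfl h2.1 h2.2 (fun x s hz => ?_)
    (fun x s hz hzW => ?_) (l := .bot (C.β a)) (l' := .top (C.τ a)) Side.noConfusion
    ⟨le_rfl, by omega⟩ ⟨le_rfl, by omega⟩ ⟨rfl, h0⟩ ⟨rfl, h1⟩
  · have hs := (mem_cell (C := C).1 hz).1
    constructor
    · intro hzQ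
      obtain ⟨-, k, hk1, hk2, rfl, hPk⟩ := (hQ _ _).1 hzQ
      grind
    · rintro ⟨-, rfl⟩
      exact (hQ _ _).2 ⟨hs, m + 1, by omega, hm, (hc s).symm, hP s⟩
  grind

theorem lin_lt_mergeCurve {a t : ℕ → ℝ} {v b t' s : ℝ} {j k : ℕ} (h : k = j ∨ k = j + 1)
    (h0 : b < a k) (h1 : (b + t') / 2 < v) (h2 : s ≤ 1 / 2 ∨ t' < t k) (hs : s ∈ Icc (0 : ℝ) 1) :
    lin b t' s < mergeCurve a t v j k s := by
  unfold lin
  rcases le_or_gt s (1 / 2) with hs' | hs'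
  · rw [mergeCurve_lower h hs']
    linarith [convex_pos (u := 2 * s) (sub_pos.2 h0) (sub_pos.2 h1) (by linarith [hs.1])
      (by linarith)]
  · rw [mergeCurve_upper h hs'.le]
    linarith [convex_pos (u := 2 * s - 1) (sub_pos.2 h1) (sub_pos.2 (h2.resolve_left hs'.not_ge))
      (by linarith) (by linarith [hs.2])]

theorem mergeCurve_lt_lin {a t : ℕ → ℝ} {v b t' s : ℝ} {j k : ℕ} (h : k = j ∨ k = j + 1)
    (h0 : a k < b) (h1 : v < (b + t') / 2) (h2 : s ≤ 1 / 2 ∨ t k < t') (hs : s ∈ Icc (0 : ℝ) 1) :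
    mergeCurve a t v j k s < lin b t' s := by
  unfold lin
  rcases le_or_gt s (1 / 2) with hs' | hs'
  · rw [mergeCurve_lower h hs']
    linarith [convex_pos (u := 2 * s) (sub_pos.2 h0) (sub_pos.2 h1) (by linarith [hs.1])
      (by linarith)]
  · rw [mergeCurve_upper h hs'.le]
    linarith [convex_pos (u := 2 * s - 1) (sub_pos.2 h1) (sub_pos.2 (h2.resolve_left hs'.not_ge))
      (by linarith) (by linarith [hs.2])]

theorem gap_mergeCurve {t : ℕ → ℝ} {v : ℝ} {j m a : ℕ}
    (hst : ∀ k, 1 ≤ k → k ≤ C.N → k ≠ j → k ≠ j + 1 →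
      (k ≤ m → k < C.β a ∧ t k < grid C.N' (C.τ a)) ∧ (m < k → C.β a ≤ k ∧ grid C.N' (C.τ a) < t k))
    (hm : ∀ k, 1 ≤ k → k ≤ C.N → k = j ∨ k = j + 1 →
      (k ≤ m → k < C.β a ∧ v < (grid C.N (C.β a) + grid C.N' (C.τ a)) / 2 ∧
        ∀ s, P k s → s ≤ 1 / 2 ∨ t k < grid C.N' (C.τ a)) ∧
      (m < k → C.β a ≤ k ∧ (grid C.N (C.β a) + grid C.N' (C.τ a)) / 2 < v ∧
        ∀ s, P k s → s ≤ 1 / 2 ∨ grid C.N' (C.τ a) < t k)) :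
    Gap C C.N (mergeCurve (tick C.N) t v j) P m a := by
  intro s hs k h1 h2 hP
  by_cases h : k = j ∨ k = j + 1
  · refine ⟨fun hk => ?_, fun hk => ?_⟩
    · have := (hm k h1 h2 h).1 hk
      exact mergeCurve_lt_lin h (tick_lt_grid h2 this.1) this.2.1 (this.2.2 s hP) hs
    · have := (hm k h1 h2 h).2 hk
      exact lin_lt_mergeCurve h (grid_lt_tick h1 h2 this.1) this.2.1 (this.2.2 s hP) hs
  · rw [mergeCurve_of_ne h]
    rw [not_or] at h
    refine ⟨fun hk => ?_, fun hk => ?_⟩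
    · have := (hst k h1 h2 h.1 h.2).1 hk
      exact lin_lt (tick_lt_grid h2 this.1) this.2 hs
    · have := (hst k h1 h2 h.1 h.2).2 hk
      exact lin_lt (grid_lt_tick h1 h2 this.1) this.2 hs

/-! ### The identity -/

/-- The cutting of `I n`. -/
def identity (n : ℕ) : Cuts where
  N := n
  N' := n
  K := n + 1
  β a := a
  τ a := a
  monoβ := monotone_id
  monoτ := monotone_id
  β_zero := rfl
  τ_zero := rfl
  β_front := rfl
  τ_front := rfl
  β_back := rfl
  τ_back := rfl
  step a _ := Or.inl a.lt_succ_self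

theorem fits_identity (n : ℕ) : (identity n).Fits (Pattern.I n).strands ∅ := by
  have hQ : IsPicture (Pattern.I n).strands n (fun k _ => tick n k) (fun _ _ => True) := by
    intro x s
    rw [Pattern.mem_strands_I]
    simp
  have hlin : ∀ b s : ℝ, lin b b s = b := by simp [lin]
  have hg : ∀ a, Gap (identity n) n (fun k _ => tick n k) (fun _ _ => True) (min (a - 1) n) a := by
    intro a s _ k h1 h2 _
    have e : (identity n).cut a s = grid n a := hlin _ _
    simp only [e]
    exact ⟨fun h => tick_lt_grid h2 (by omega), fun h => grid_lt_tick h1 h2 (by omega)⟩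
  have hn := hg (n + 2)
  rw [show min (n + 2 - 1) n = n by omega] at hn
  have h0 := hg 0
  rw [show min (0 - 1) n = 0 by omega] at h0
  refine ⟨h0.fst_mem hQ hn, empty_subset _, fun a _ s _ s' _ h => absurd h ((hg a).not_mem hQ), fun _ _ _ _ => notMem_empty _,
    fun a ha => ?_⟩
  by_cases h : 1 ≤ a ∧ a ≤ n
  · have h1 := hg a
    have h2 := hg (a + 1)
    rw [show min (a - 1) n = a - 1 by omega] at h1
    rw [show min (a + 1 - 1) n = a - 1 + 1 by omega] at h2
    exact h1.hasModel_succ hQ h2 (by omega) (fun s => (hlin _ s).symm) (fun _ => trivial)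
      (fun _ _ h => absurd h (notMem_empty _)) rfl rfl
  · have h2 := hg (a + 1)
    rw [show min (a + 1 - 1) n = min (a - 1) n by omega] at h2
    exact (hg a).hasModel hQ ha h2

/-! ### The arc -/

/-- The cutting of `beta n i`. -/
def arc (n i : ℕ) (hi : i ≤ n) : Cuts where
  N := n + 2
  N' := n
  K := n + 2
  β a := if a ≤ i + 1 then a else a + 1
  τ a := if a ≤ i + 1 then a else a - 1
  monoβ := by intro a b h; dsimp only; split_ifs <;> omega
  monoτ := by intro a b h; dsimp only; split_ifs <;> omega
  β_zero := by simp
  τ_zero := by simp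
  β_front := if_neg (by omega)
  τ_front := if_neg (by omega)
  β_back := if_neg (by omega)
  τ_back := if_neg (by omega)
  step a _ := by left; split_ifs <;> omega

theorem two_mul_grid {n i : ℕ} (hi : i ≤ n) :
    2 * grid (n + 2) (i + 2) = tick (n + 2) (i + 1) + tick (n + 2) (i + 2) := by
  rw [grid_mid (by omega) (by omega), tick, tick]
  grind

theorem arc_ineq {n i : ℕ} (hi : i ≤ n) :
    (grid (n + 2) (i + 1) + grid n (i + 1)) / 2 < grid (n + 2) (i + 2) ∧
    grid (n + 2) (i + 2) < (grid (n + 2) (i + 3) + grid n (i + 1)) / 2 := by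
  have hi' : (i : ℝ) ≤ n := by exact_mod_cast hi
  rw [grid_mid (N := n + 2) (k := i + 1) (by omega) (by omega),
    grid_mid (N := n + 2) (k := i + 2) (by omega) (by omega),
    grid_mid (N := n + 2) (k := i + 3) (by omega) (by omega),
    grid_mid (N := n) (k := i + 1) (by omega) (by omega)]
  push_cast
  constructor
  · have : (2 * ((i : ℝ) + 1) - 1) / (2 * (n + 1)) < (2 * (i + 3) - 1) / (2 * (n + 2 + 1)) := by
      rw [div_lt_div_iff₀ (by positivity) (by positivity)]; nlinarith
    grind
  · have : (2 * ((i : ℝ) + 1) - 1) / (2 * (n + 2 + 1)) < (2 * (i + 1) - 1) / (2 * (n + 1)) := by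
      rw [div_lt_div_iff₀ (by positivity) (by positivity)]; nlinarith
    grind

theorem fits_arc {n i : ℕ} (hi : i ≤ n) : (arc n i hi).Fits (Pattern.betaStrands n i) ∅ := by
  set P : ℕ → ℝ → Prop := fun k s => k = i + 1 ∨ k = i + 1 + 1 → s ≤ 1 / 2 with hP
  have hQ : IsPicture (Pattern.betaStrands n i) (n + 2) (betaCurve n (i + 1) 0) P := fun x s =>
    Pattern.mem_betaStrands (Nat.lt_succ_of_le hi) 0
  have hv : (tick (n + 2) (i + 1) + tick (n + 2) (i + 2)) / 2 = grid (n + 2) (i + 2) := by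
    rw [← two_mul_grid hi]; ring
  obtain ⟨i1, i2⟩ := arc_ineq hi
  have hmN := (strictMono_grid (n + 2)).monotone
  have hmn := (strictMono_grid n).monotone
  have hg1 : ∀ a ≤ i + 1, Gap (arc n i hi) (n + 2) (betaCurve n (i + 1) 0) P (a - 1) a := by
    intro a ha
    have hβ : (arc n i hi).β a = a := if_pos ha
    have hτ : (arc n i hi).τ a = a := if_pos ha
    refine gap_mergeCurve (C := arc n i hi) (fun k h1 h2 h3 h4 => ?_) fun k h1 h2 h => ?_
    · rw [hβ, hτ]
      change k ≤ n + 2 at h2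
      change (_ → _ ∧ _ < grid n a) ∧ (_ → _ ∧ grid n a < _)
      unfold betaEnd
      refine ⟨fun h => ⟨by omega, ?_⟩, fun h => ⟨by omega, ?_⟩⟩
      · rw [if_pos (by omega)]
        exact tick_lt_grid (by omega) (by omega)
      · split_ifs
        · exact grid_lt_tick h1 (by omega) (by omega)
        · omega
        · exact grid_lt_tick (by omega) (by omega) (by omega)
    · rw [hβ, hτ]
      refine ⟨by omega, fun _ => ⟨by omega, ?_, fun s hs => Or.inl (hs h)⟩⟩
      rw [hv]
      change (grid (n + 2) a + grid n a) / 2 < _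
      linarith [hmN ha, hmn ha]
  have hg2 : ∀ a, i + 2 ≤ a →
      Gap (arc n i hi) (n + 2) (betaCurve n (i + 1) 0) P (min a (n + 2)) a := by
    intro a ha
    have hβ : (arc n i hi).β a = a + 1 := if_neg (by omega)
    have hτ : (arc n i hi).τ a = a - 1 := if_neg (by omega)
    refine gap_mergeCurve (C := arc n i hi) (fun k h1 h2 h3 h4 => ?_) fun k h1 h2 h => ?_
    · rw [hβ, hτ]
      change k ≤ n + 2 at h2
      change (_ → _ ∧ _ < grid n _) ∧ (_ → _ ∧ grid n _ < _)
      unfold betaEnd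
      refine ⟨fun h => ⟨by omega, ?_⟩, fun h => ⟨by omega, ?_⟩⟩
      · split_ifs
        · exact tick_lt_grid (by omega) (by omega)
        · omega
        · exact tick_lt_grid (by omega) (by omega)
      · rw [if_neg (by omega), if_neg (by omega)]
        exact grid_lt_tick (by omega) (by omega) (by omega)
    · change k ≤ n + 2 at h2
      rw [hβ, hτ]
      refine ⟨fun _ => ⟨by omega, ?_, fun s hs => Or.inl (hs h)⟩, by omega⟩
      rw [hv]
      change _ < (grid (n + 2) (a + 1) + grid n (a - 1)) / 2
      linarith [hmN (show i + 3 ≤ a + 1 by omega), hmn (show i + 1 ≤ a - 1 by omega)]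
  have hst : ∀ k, k ≠ i + 1 → k ≠ i + 1 + 1 → (∀ s, betaCurve n (i + 1) 0 k s =
      lin (tick (n + 2) k) (betaEnd n (i + 1) 0 k) s) ∧ ∀ s, P k s := fun k h h' =>
    ⟨fun s => mergeCurve_of_ne (by omega) s, fun s h'' => absurd h'' (by omega)⟩
  have hne : ∀ a s, ((arc n i hi).cut a s, s) ∉ Pattern.betaStrands n i := fun a s => by
    rcases le_or_gt a (i + 1) with h | h
    · exact (hg1 a h).not_mem hQ
    · exact (hg2 a h).not_mem hQ
  have hn := hg2 (n + 3) (by omega)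
  rw [show min (n + 3) (n + 2) = n + 2 by omega] at hn
  refine ⟨(hg1 0 (by omega)).fst_mem hQ hn, empty_subset _,
    fun a _ s _ s' _ h => absurd h (hne a s), fun _ _ _ _ => notMem_empty _, fun a ha => ?_⟩
  have ha' : a < n + 4 := ha
  rcases lt_trichotomy a (i + 1) with h | rfl | h
  · rcases Nat.eq_zero_or_pos a with rfl | h0
    · exact (hg1 0 (by omega)).hasModel hQ ha (hg1 1 (by omega))
    · have h2 := hg1 (a + 1) (by omega)
      rw [show a + 1 - 1 = a - 1 + 1 by omega] at h2
      have hs := hst (a - 1 + 1) (by omega) (by omega)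
      refine (hg1 a (by omega)).hasModel_succ hQ h2 (by omega) hs.1 hs.2
        (fun _ _ h => absurd h (notMem_empty _)) ?_ ?_ <;>
      · simp only [arc]
        grind
  · have hβ : (arc n i hi).β (i + 1) = i + 1 := if_pos le_rfl
    have hβ' : (arc n i hi).β (i + 1 + 1) = i + 3 := if_neg (by omega)
    have hs1 := (hg1 (i + 1) le_rfl)
    have hs2 := (hg2 (i + 1 + 1) le_rfl)
    have e : ∀ s, (arc n i hi).cut (i + 1) s = lin (grid (n + 2) (i + 1)) (grid n (i + 1)) s := by
      intro s
      simp [cut, arc]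
    have e' : ∀ s, (arc n i hi).cut (i + 1 + 1) s =
        lin (grid (n + 2) (i + 3)) (grid n (i + 1)) s := by
      intro s
      simp [cut, arc]
    obtain ⟨x₀, hx₀⟩ : ∃ x, x = grid (n + 2) (i + 2) := ⟨_, rfl⟩
    obtain ⟨x₁, hx₁⟩ : ∃ x, x = tick (n + 2) (i + 1) := ⟨_, rfl⟩
    obtain ⟨x₂, hx₂⟩ : ∃ x, x = tick (n + 2) (i + 2) := ⟨_, rfl⟩
    have h2 := two_mul_grid hi
    have hlt : x₁ < x₂ := by rw [hx₁, hx₂]; exact tick_lt (by omega)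
    have hside : ∀ k, k = i + 1 ∨ k = i + 2 →
        (tick (n + 2) k, (0 : ℝ)) ∈ (arc n i hi).openSide (.bot k) := fun k hk =>
      ⟨rfl, grid_lt_tick (by omega) (show k ≤ n + 2 by omega) le_rfl,
        tick_lt_grid (show k ≤ n + 2 by omega) (Nat.lt_succ_self k)⟩
    refine hasModel_arc (o := (x₀, 1 / 2)) (x := (x₂, 0)) (x' := (x₁, 0))
      (d := ((x₂ - x₁) / 2, 0)) (e := (0, 1)) (c := -1 / 2)
      ((arc n i hi).mem_openCell.2 ⟨by norm_num, ?_, ?_⟩) ?_ ?_ ?_ ?_ (fun _ _ => notMem_empty _)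
      (l := .bot (i + 2)) (l' := .bot (i + 1)) (by simp) ?_ ?_ (hx₂ ▸ hside _ (Or.inr rfl))
      (hx₁ ▸ hside _ (Or.inl rfl))
    · rw [e, lin]; linarith
    · rw [e', lin]; linarith
    · simp only; linarith
    · rw [Prod.mk.injEq]; constructor <;> linarith
    · rw [Prod.mk.injEq]; constructor <;> linarith
    · rintro ⟨x, s⟩ hz
      obtain ⟨hs, hz1, hz2⟩ := mem_cell _ |>.1 hz
      have hm : ∀ b : ℝ, (x, s) ∈ segment ℝ (x₀, (1 / 2 : ℝ)) (b, (0 : ℝ)) ↔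
          s ≤ 1 / 2 ∧ x = b + (x₀ - b) * (2 * s) := by
        intro b
        rw [segment_symm, mem_segment_lower]
        grind
      rw [hm, hm, hQ]
      have hc : ∀ k, k = i + 1 ∨ k = i + 1 + 1 → s ≤ 1 / 2 → betaCurve n (i + 1) 0 k s =
          tick (n + 2) k + (x₀ - tick (n + 2) k) * (2 * s) := by
        intro k hk hs'
        rw [betaCurve, mergeCurve_lower hk hs', hv, hx₀]
      constructor
      · rintro ⟨-, k, hk1, hk2, rfl, hPk⟩
        have hk : k = i + 1 ∨ k = i + 1 + 1 := by
          by_contra hk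
          rcases lt_or_ge k (i + 1) with h | h
          · exact ((hs1 s hs k hk1 hk2 hPk).1 (by omega)).not_ge hz1
          · exact ((hs2 s hs k hk1 hk2 hPk).2 (by omega)).not_ge hz2
        grind
      grind
    · change _ ≤ _ ∧ _ < _
      rw [hβ, hβ']; omega
    · change _ ≤ _ ∧ _ < _
      rw [hβ, hβ']; omega
  · have hβ : (arc n i hi).β (a + 1) = (arc n i hi).β a + 1 := by
      simp only [arc]; rw [if_neg (by omega), if_neg (by omega)]
    have hτ : (arc n i hi).τ (a + 1) = (arc n i hi).τ a + 1 := by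
      simp only [arc]; rw [if_neg (by omega), if_neg (by omega)]; omega
    have h1 := hg2 a h
    have h2 := hg2 (a + 1) (by omega)
    by_cases han : a < n + 2
    · rw [show min a (n + 2) = a by omega] at h1
      rw [show min (a + 1) (n + 2) = a + 1 by omega] at h2
      have hs := hst (a + 1) (by omega) (by omega)
      exact h1.hasModel_succ hQ h2 (by omega) hs.1 hs.2 (fun _ _ h => absurd h (notMem_empty _))
        hβ hτ
    · rw [show min (a + 1) (n + 2) = min a (n + 2) by omega] at h2
      exact h1.hasModel hQ ha h2

end Cuts

end DefectBord

namespace DefectBord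

namespace Cuts

/-! ### Turning a picture upside down -/

/-- The reflection of the strip `0 ≤ s ≤ 1`. -/
def reflect (z : ℝ × ℝ) : ℝ × ℝ := (z.1, 1 - z.2)

theorem reflect_reflect (z : ℝ × ℝ) : reflect (reflect z) = z := by simp [reflect]

theorem lin_one_sub (b t s : ℝ) : lin b t (1 - s) = lin t b s := by unfold lin; ring

theorem image_reflect {A B : Set (ℝ × ℝ)} (h : ∀ z, reflect z ∈ A ↔ z ∈ B) : reflect '' A = B := by
  ext z
  rw [← h]
  exact ⟨by rintro ⟨w, hw, rfl⟩; rwa [reflect_reflect], fun hz => ⟨_, hz, reflect_reflect z⟩⟩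

theorem reflect_mem_quad {b₀ t₀ b₁ t₁ : ℝ} (z : ℝ × ℝ) :
    reflect z ∈ quad b₀ t₀ b₁ t₁ ↔ z ∈ quad t₀ b₀ t₁ b₁ := by
  simp only [quad, reflect, mem_ofPred_eq, lin_one_sub, mem_Icc, sub_nonneg, sub_le_self_iff]
  grind

theorem reflect_mem_openQuad {b₀ t₀ b₁ t₁ : ℝ} (z : ℝ × ℝ) :
    reflect z ∈ openQuad b₀ t₀ b₁ t₁ ↔ z ∈ openQuad t₀ b₀ t₁ b₁ := by
  simp only [openQuad, reflect, mem_ofPred_eq, lin_one_sub, mem_Ioo, sub_pos, sub_lt_self_iff]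
  grind

theorem _root_.DefectBord.IsQuadDisc.reflect {b₀ t₀ b₁ t₁ : ℝ} {f : Euc 2 → ℝ × ℝ}
    (h : IsQuadDisc b₀ t₀ b₁ t₁ f) : IsQuadDisc t₀ b₀ t₁ b₁ (reflect ∘ f) where
  continuous := by
    have := h.continuous
    unfold Cuts.reflect
    fun_prop
  injective := (Function.LeftInverse.injective reflect_reflect).comp h.injective
  image_ball := by
    rw [image_comp, h.image_ball, image_reflect reflect_mem_openQuad]
  image_sphere := by
    rw [image_comp, h.image_sphere]
    exact image_reflect fun z => by
      rw [mem_sdiff, mem_sdiff, reflect_mem_openQuad, reflect_mem_quad]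

variable (C : Cuts)

/-- The reflected cutting. -/
def flip : Cuts where
  N := C.N'
  N' := C.N
  K := C.K
  β := C.τ
  τ := C.β
  monoβ := C.monoτ
  monoτ := C.monoβ
  β_zero := C.τ_zero
  τ_zero := C.β_zero
  β_front := C.τ_front
  τ_front := C.β_front
  β_back := C.τ_back
  τ_back := C.β_back
  step a ha := (C.step a ha).symm

theorem flip_cut (a : ℕ) (s : ℝ) : C.flip.cut a s = C.cut a (1 - s) := (lin_one_sub _ _ _).symm

variable {C}

theorem reflect_mem_cell {a : ℕ} (z : ℝ × ℝ) : reflect z ∈ C.cell a ↔ z ∈ C.flip.cell a :=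
  reflect_mem_quad z

/-- The reflection of a side. -/
def _root_.DefectBord.Side.flip : Side → Side
  | .bot k => .top k
  | .top k => .bot k
  | .cut a => .cut a

theorem _root_.DefectBord.Side.flip_flip (l : Side) : l.flip.flip = l := by cases l <;> rfl

theorem _root_.DefectBord.Side.flip_injective : Function.Injective Side.flip :=
  Function.LeftInverse.injective Side.flip_flip

theorem isSide_flip {a : ℕ} {l : Side} : C.flip.IsSide a l.flip ↔ C.IsSide a l := by
  cases l <;> exact Iff.rfl

theorem reflect_mem_openSide {l : Side} {z : ℝ × ℝ} (h : z ∈ C.openSide l) :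
    reflect z ∈ C.flip.openSide l.flip := by
  cases l with
  | bot k => exact ⟨by simp [reflect, h.1], h.2⟩
  | top k => exact ⟨by simp [reflect, h.1], h.2⟩
  | cut a =>
    refine ⟨⟨sub_pos.2 h.1.2, sub_lt_self _ h.1.1⟩, ?_⟩
    rw [flip_cut]
    simp [reflect, h.2]

theorem Fits.flip {Q W Q' W' : Set (ℝ × ℝ)} (h : C.Fits Q W) (hQ : ∀ z, z ∈ Q' ↔ reflect z ∈ Q)
    (hW : ∀ z, z ∈ W' ↔ reflect z ∈ W) : C.flip.Fits Q' W' := by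
  have hm : ∀ s ∈ Icc (0 : ℝ) 1, 1 - s ∈ Icc (0 : ℝ) 1 := fun s hs =>
    ⟨sub_nonneg.2 hs.2, sub_le_self _ hs.1⟩
  refine ⟨fun z hz => h.fst_mem (reflect z) ((hQ z).1 hz), fun z hz => (hQ z).2 (h.subset ((hW z).1 hz)),
    fun a ha s hs s' hs' h1 h2 => ?_, fun a ha s hs h1 => ?_, fun a ha => ?_⟩
  · rw [hQ, flip_cut] at h1 h2
    linarith [h.subsingleton a ha _ (hm s hs) _ (hm s' hs') h1 h2]
  · rw [hW, flip_cut] at h1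
    exact h.not_mem a ha _ (hm s hs) h1
  · obtain ⟨f, hf, H⟩ := h.model a ha
    have hrQ : ∀ p, (reflect ∘ f) p ∈ Q' ↔ f p ∈ Q := fun p => by
      rw [hQ, Function.comp, reflect_reflect]
    have hrW : ∀ p, (reflect ∘ f) p ∈ W' ↔ f p ∈ W := fun p => by
      rw [hW, Function.comp, reflect_reflect]
    refine ⟨reflect ∘ f, hf.reflect, ?_⟩
    rcases H with H | ⟨h1, h2, l, l', h3, h4, h5, h6, h7⟩ | ⟨h1, h2, l, h3, h4, h5⟩
    · exact Or.inl fun z hz hzQ => H _ ((reflect_mem_cell z).2 hz) ((hQ z).1 hzQ)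
    · exact Or.inr (Or.inl ⟨fun z hz hzW => h1 _ ((reflect_mem_cell z).2 hz) ((hW z).1 hzW),
        fun p hp => (hrQ p).trans (h2 p hp), l.flip, l'.flip, Side.flip_injective.ne h3,
        isSide_flip.2 h4, isSide_flip.2 h5, reflect_mem_openSide h6, reflect_mem_openSide h7⟩)
    · refine Or.inr (Or.inr ⟨fun p hp => (hrQ p).trans (h1 p hp),
        fun p hp => (hrW p).trans (h2 p hp), Side.flip ∘ l, Side.flip_injective.comp h3,
        fun x hx => ?_, fun k => ⟨isSide_flip.2 (h5 k).1, reflect_mem_openSide (h5 k).2⟩⟩)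
      rw [← x.flip_flip, isSide_flip] at hx
      obtain ⟨k, hk⟩ := h4 _ hx
      exact ⟨k, by rw [Function.comp, ← hk, x.flip_flip]⟩

/-! ### The trivalent vertex -/

/-- The cutting of `mu n i`. -/
def vertex (n i : ℕ) (hi : i ≤ n) : Cuts where
  N := n + 2
  N' := n + 1
  K := n + 4
  β a := if a ≤ i + 2 then a else a - 1
  τ a := if a ≤ i + 1 then a else if a ≤ i + 3 then a - 1 else a - 2
  monoβ := by intro a b h; dsimp only; split_ifs <;> omega
  monoτ := by intro a b h; dsimp only; split_ifs <;> omega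
  β_zero := by simp
  τ_zero := by simp
  β_front := if_neg (by omega)
  τ_front := by rw [if_neg (by omega), if_neg (by omega)]; omega
  β_back := if_neg (by omega)
  τ_back := by rw [if_neg (by omega), if_neg (by omega)]; omega
  step a _ := by split_ifs <;> omega

theorem exists_crossing {a w v l : ℝ} (h0 : a < w) (h1 : (w + l) / 2 < v) (h2 : l < v) :
    ∃ σ, 0 < σ ∧ σ < 1 / 2 ∧ ∀ s, s ≤ 1 → ∀ y, (s ≤ 1 / 2 → y = lin a (2 * v - a) s) →
      (1 / 2 ≤ s → y = v) → (y ≤ lin w l s ↔ s ≤ σ) ∧ (lin w l s ≤ y ↔ σ ≤ s) := by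
  obtain ⟨D, hD⟩ : ∃ D, D = 2 * (w - a) + (2 * v - (w + l)) := ⟨_, rfl⟩
  have hD0 : 0 < D := by linarith
  have hσ : (w - a) / D < 1 / 2 := by rw [div_lt_iff₀ hD0]; linarith
  refine ⟨(w - a) / D, div_pos (by linarith) hD0, hσ, fun s hs y hy1 hy2 => ?_⟩
  rcases le_total s (1 / 2) with hs' | hs'
  · have e : lin w l s - y = D * ((w - a) / D - s) := by
      rw [hy1 hs', mul_sub, mul_div_cancel₀ _ hD0.ne', hD]
      unfold lin
      ring
    have e' : y - lin w l s = D * (s - (w - a) / D) := by linarith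
    constructor
    · rw [← sub_nonneg, e, mul_nonneg_iff_of_pos_left hD0, sub_nonneg]
    · rw [← sub_nonneg, e', mul_nonneg_iff_of_pos_left hD0, sub_nonneg]
  · have e : lin w l s < y := by
      rw [hy2 hs']
      unfold lin
      linarith [convex_pos (u := 2 * s - 1) (sub_pos.2 h1) (sub_pos.2 h2) (by linarith)
        (by linarith)]
    grind

theorem vertex_ineq {n i : ℕ} (hi : i ≤ n) :
    tick (n + 2) (i + 1) < tick (n + 1) (i + 1) ∧ tick (n + 1) (i + 1) < tick (n + 2) (i + 2) ∧
    (grid (n + 2) (i + 2) + grid (n + 1) (i + 1)) / 2 < tick (n + 1) (i + 1) ∧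
    tick (n + 1) (i + 1) < (grid (n + 2) (i + 2) + grid (n + 1) (i + 2)) / 2 := by
  have hi' : (i : ℝ) ≤ n := by exact_mod_cast hi
  rw [grid_mid (N := n + 2) (by omega) (by omega),
    grid_mid (N := n + 1) (k := i + 1) (by omega) (by omega),
    grid_mid (N := n + 1) (k := i + 2) (by omega) (by omega)]
  unfold tick
  push_cast
  refine ⟨?_, ?_, ?_, ?_⟩
  · gcongr; linarith
  · rw [div_lt_div_iff₀ (by positivity) (by positivity)]; nlinarith
  · have : (2 * ((i : ℝ) + 2) - 1) / (2 * (n + 2 + 1)) < (2 * (i + 2) - 1) / (2 * (n + 1 + 1)) := by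
      rw [div_lt_div_iff₀ (by positivity) (by positivity)]; nlinarith
    have e : (2 * ((i : ℝ) + 2) - 1) / (2 * (n + 1 + 1)) + (2 * (i + 1) - 1) / (2 * (n + 1 + 1)) =
        2 * (((i : ℝ) + 1) / (n + 1 + 1)) := by field_simp; ring
    linarith
  · have : (2 * ((i : ℝ) + 1) - 1) / (2 * (n + 1 + 1)) < (2 * (i + 2) - 1) / (2 * (n + 2 + 1)) := by
      rw [div_lt_div_iff₀ (by positivity) (by positivity)]; nlinarith
    have e : (2 * ((i : ℝ) + 2) - 1) / (2 * (n + 1 + 1)) + (2 * (i + 1) - 1) / (2 * (n + 1 + 1)) =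
        2 * (((i : ℝ) + 1) / (n + 1 + 1)) := by field_simp; ring
    linarith

section Vertex

variable {n i : ℕ} (hi : i ≤ n)

theorem gap_vertex_left {a : ℕ} (ha : a ≤ i + 1) :
    Gap (vertex n i hi) (n + 2) (muCurve n (i + 1)) (fun _ _ => True) (a - 1) a := by
  obtain ⟨i1, i2, i3, i4⟩ := vertex_ineq hi
  have hmN := (strictMono_grid (n + 2)).monotone
  have hmn := (strictMono_grid (n + 1)).monotone
  have hβ : (vertex n i hi).β a = a := if_pos (by omega)
  have hτ : (vertex n i hi).τ a = a := if_pos ha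
  refine gap_mergeCurve (C := vertex n i hi) (fun k h1 h2 h3 h4 => ?_) fun k h1 h2 h => ?_
  all_goals
    rw [hβ, hτ]
    change k ≤ n + 2 at h2
  · change (_ → _ ∧ _ < grid (n + 1) a) ∧ (_ → _ ∧ grid (n + 1) a < _)
    unfold muTop
    refine ⟨fun h => ⟨by omega, ?_⟩, fun h => ⟨by omega, ?_⟩⟩
    · rw [if_pos (by omega)]
      exact tick_lt_grid (by omega) (by omega)
    · split_ifs
      · exact grid_lt_tick h1 (by omega) (by omega)
      · exact grid_lt_tick (by omega) (by omega) (by omega)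
  · refine ⟨by omega, fun _ => ⟨by omega, ?_, fun s hs => Or.inr ?_⟩⟩
    · change (grid (n + 2) a + grid (n + 1) a) / 2 < _
      linarith [hmN (show a ≤ i + 2 by omega), hmn ha]
    · change grid (n + 1) a < _
      unfold muTop
      split_ifs
      · exact grid_lt_tick h1 (by omega) (by omega)
      · exact grid_lt_tick (by omega) (by omega) (by omega)

theorem gap_vertex_right {a : ℕ} (ha : i + 4 ≤ a) :
    Gap (vertex n i hi) (n + 2) (muCurve n (i + 1)) (fun _ _ => True) (min (a - 2) (n + 2)) a := by
  obtain ⟨i1, i2, i3, i4⟩ := vertex_ineq hi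
  have hmN := (strictMono_grid (n + 2)).monotone
  have hmn := (strictMono_grid (n + 1)).monotone
  have hβ : (vertex n i hi).β a = a - 1 := if_neg (by omega)
  have hτ : (vertex n i hi).τ a = a - 2 :=
    (if_neg (by omega)).trans (if_neg (by omega))
  refine gap_mergeCurve (C := vertex n i hi) (fun k h1 h2 h3 h4 => ?_) fun k h1 h2 h => ?_
  all_goals
    rw [hβ, hτ]
    change k ≤ n + 2 at h2
  · change (_ → _ ∧ _ < grid (n + 1) _) ∧ (_ → _ ∧ grid (n + 1) _ < _)
    unfold muTop
    refine ⟨fun h => ⟨by omega, ?_⟩, fun h => ⟨by omega, ?_⟩⟩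
    · split_ifs
      · exact tick_lt_grid (by omega) (by omega)
      · exact tick_lt_grid (by omega) (by omega)
    · rw [if_neg (by omega)]
      exact grid_lt_tick (by omega) (by omega) (by omega)
  · refine ⟨fun _ => ⟨by omega, ?_, fun s hs => Or.inr ?_⟩, by omega⟩
    · change _ < (grid (n + 2) (a - 1) + grid (n + 1) (a - 2)) / 2
      linarith [hmN (show i + 2 ≤ a - 1 by omega), hmn (show i + 2 ≤ a - 2 by omega)]
    · change _ < grid (n + 1) (a - 2)
      unfold muTop
      split_ifs
      · exact tick_lt_grid (by omega) (by omega)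
      · exact tick_lt_grid (by omega) (by omega)

end Vertex

end Cuts

end DefectBord

namespace DefectBord

namespace Cuts

theorem muCurve_near {n i k : ℕ} (hk : k = i + 1 ∨ k = i + 2) : (∀ s, s ≤ 1 / 2 →
    muCurve n (i + 1) k s = lin (tick (n + 2) k) (2 * tick (n + 1) (i + 1) - tick (n + 2) k) s) ∧
    ∀ s, 1 / 2 ≤ s → muCurve n (i + 1) k s = tick (n + 1) (i + 1) := by
  have ht : muTop n (i + 1) k = tick (n + 1) (i + 1) := by
    rcases hk with rfl | rfl
    · exact if_pos le_rfl
    · exact if_neg (by omega)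
  refine ⟨fun s hs => ?_, fun s hs => ?_⟩
  · rw [muCurve, mergeCurve_lower hk hs, lin]; ring
  · rw [muCurve, mergeCurve_upper hk hs, ht]; ring

theorem fits_vertex (n : ℕ) (j : Fin (n + 1)) :
    (vertex n j (Nat.le_of_lt_succ j.2)).Fits (Pattern.mu n j).strands (Pattern.mu n j).vertices := by
  obtain ⟨i, hj⟩ := j
  have hi : i ≤ n := Nat.le_of_lt_succ hj
  change (vertex n i hi).Fits _ _
  have hQ : IsPicture (Pattern.mu n ⟨i, hj⟩).strands (n + 2) (muCurve n (i + 1))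
      (fun _ _ => True) := fun x s => by
    rw [Pattern.mem_strands_mu]; simp
  generalize (Pattern.mu n ⟨i, hj⟩).strands = Q at hQ ⊢
  have hW : ∀ x s, (x, s) ∈ (Pattern.mu n ⟨i, hj⟩).vertices ↔
      s = 1 / 2 ∧ x = muCurve n (i + 1) (i + 1) s := fun x s => Pattern.mem_vertices_mu
  generalize (Pattern.mu n ⟨i, hj⟩).vertices = W at hW ⊢
  obtain ⟨i1, i2, i3, i4⟩ := vertex_ineq hi
  have a1w : tick (n + 2) (i + 1) < grid (n + 2) (i + 2) := tick_lt_grid (by omega) (by omega)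
  have wa2 : grid (n + 2) (i + 2) < tick (n + 2) (i + 2) :=
    grid_lt_tick (by omega) (by omega) le_rfl
  have ga1 : grid (n + 2) (i + 1) < tick (n + 2) (i + 1) :=
    grid_lt_tick (by omega) (by omega) le_rfl
  have a2g : tick (n + 2) (i + 2) < grid (n + 2) (i + 3) := tick_lt_grid (by omega) (by omega)
  have lv : grid (n + 1) (i + 1) < tick (n + 1) (i + 1) := grid_lt_tick (by omega) (by omega) le_rfl
  have vr : tick (n + 1) (i + 1) < grid (n + 1) (i + 2) := tick_lt_grid (by omega) (by omega)
  have c1 := muCurve_near (n := n) (i := i) (Or.inl rfl)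
  have c2 := muCurve_near (n := n) (i := i) (Or.inr rfl)
  have e2 : ∀ s, (vertex n i hi).cut (i + 2) s =
      lin (grid (n + 2) (i + 2)) (grid (n + 1) (i + 1)) s := fun s => by simp [cut, vertex]
  have e3 : ∀ s, (vertex n i hi).cut (i + 3) s =
      lin (grid (n + 2) (i + 2)) (grid (n + 1) (i + 2)) s := fun s => by simp [cut, vertex]
  have F4 : ∀ s ∈ Icc (0 : ℝ) 1, (vertex n i hi).cut (i + 2) s < muCurve n (i + 1) (i + 2) s := by
    intro s hs
    rw [e2]
    refine lin_lt_mergeCurve (Or.inr rfl) wa2 i3 (Or.inr ?_) hs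
    rw [muTop, if_neg (by omega)]; exact lv
  have F5 : ∀ s ∈ Icc (0 : ℝ) 1, muCurve n (i + 1) (i + 1) s < (vertex n i hi).cut (i + 3) s := by
    intro s hs
    rw [e3]
    refine mergeCurve_lt_lin (Or.inl rfl) a1w i4 (Or.inr ?_) hs
    rw [muTop, if_pos le_rfl]; exact vr
  obtain ⟨σ, σ0, σ1, K⟩ := exists_crossing a1w i3 lv
  replace K : ∀ s, s ≤ 1 →
      (muCurve n (i + 1) (i + 1) s ≤ (vertex n i hi).cut (i + 2) s ↔ s ≤ σ) ∧
      ((vertex n i hi).cut (i + 2) s ≤ muCurve n (i + 1) (i + 1) s ↔ σ ≤ s) := fun s hs => by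
    grind
  obtain ⟨σ', σ0', σ1', K'⟩ := exists_crossing (a := -tick (n + 2) (i + 2))
    (w := -grid (n + 2) (i + 2)) (v := -tick (n + 1) (i + 1)) (l := -grid (n + 1) (i + 2))
    (by linarith) (by linarith) (by linarith)
  replace K' : ∀ s, s ≤ 1 →
      ((vertex n i hi).cut (i + 3) s ≤ muCurve n (i + 1) (i + 2) s ↔ s ≤ σ') ∧
      (muCurve n (i + 1) (i + 2) s ≤ (vertex n i hi).cut (i + 3) s ↔ σ' ≤ s) := fun s hs => by
    have := K' s hs (-muCurve n (i + 1) (i + 2) s)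
      (fun h => by rw [c2.1 s h]; unfold lin; ring) (fun h => by rw [c2.2 s h])
    have e : lin (-grid (n + 2) (i + 2)) (-grid (n + 1) (i + 2)) s =
        -lin (grid (n + 2) (i + 2)) (grid (n + 1) (i + 2)) s := by unfold lin; ring
    grind
  have G1 := gap_vertex_left hi le_rfl
  have G4 := gap_vertex_right hi (a := i + 4) le_rfl
  rw [show i + 1 - 1 = i by omega] at G1
  rw [show min (i + 4 - 2) (n + 2) = i + 2 by omega] at G4
  have hmem : ∀ k, k = i + 1 ∨ k = i + 2 → ∀ s ∈ Icc (0 : ℝ) 1, (muCurve n (i + 1) k s, s) ∈ Q :=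
    fun k hk s hs => (hQ _ _).2 ⟨hs, k, by omega, by omega, rfl, trivial⟩
  have hloc : ∀ x s, (vertex n i hi).cut (i + 1) s ≤ x → x ≤ (vertex n i hi).cut (i + 4) s →
      (x, s) ∈ Q → x = muCurve n (i + 1) (i + 1) s ∨ x = muCurve n (i + 1) (i + 2) s := by
    intro x s h1 h4 hx
    obtain ⟨hs, k, hk1, hk2, rfl, -⟩ := (hQ _ _).1 hx
    have h5 := (G1 s hs k hk1 hk2 trivial).1
    have h6 := (G4 s hs k hk1 hk2 trivial).2
    rcases lt_trichotomy k (i + 1) with h | rfl | h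
    all_goals grind
  have hle : ∀ a b s, a ≤ b → s ∈ Icc (0 : ℝ) 1 →
      (vertex n i hi).cut a s ≤ (vertex n i hi).cut b s := fun a b s h hs => cut_le _ h hs
  have on2 : ∀ s ∈ Icc (0 : ℝ) 1, ((vertex n i hi).cut (i + 2) s, s) ∈ Q → s = σ := by
    grind
  have on3 : ∀ s ∈ Icc (0 : ℝ) 1, ((vertex n i hi).cut (i + 3) s, s) ∈ Q → s = σ' := by
    grind
  have hWQ : ∀ x s, (x, s) ∈ W → s = 1 / 2 ∧ (x, s) ∈ Q := fun x s h => by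
    grind
  have hWg : ∀ m, m ≠ i → ∀ x s, (x, s) ∈ W → s ∈ Icc (0 : ℝ) 1 ∧
      ∃ k, 1 ≤ k ∧ k ≤ n + 2 ∧ k ≠ m + 1 ∧ x = muCurve n (i + 1) k s ∧ True := by
    grind
  have hst : ∀ k, k ≠ i + 1 → k ≠ i + 2 → ∀ s, muCurve n (i + 1) k s =
      lin (tick (n + 2) k) (muTop n (i + 1) k) s := fun k h h' s => mergeCurve_of_ne (by omega) s
  have hgap : ∀ a s, ((vertex n i hi).cut a s, s) ∈ Q → a = i + 2 ∨ a = i + 3 := by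
    intro a s h
    by_contra hcon
    rcases le_or_gt a (i + 1) with ha | ha
    · exact (gap_vertex_left hi ha).not_mem hQ h
    · exact (gap_vertex_right hi (by omega)).not_mem hQ h
  have hn := gap_vertex_right hi (a := n + 5) (by omega)
  rw [show min (n + 5 - 2) (n + 2) = n + 2 by omega] at hn
  refine ⟨(gap_vertex_left hi (a := 0) (by omega)).fst_mem hQ hn, fun z hz => (hWQ z.1 z.2 hz).2,
    fun a _ s hs s' hs' h h' => ?_, fun a _ s hs h => ?_, fun a ha => ?_⟩
  · grind
  · grind
  change a < n + 6 at ha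
  rcases le_or_gt a i with h | h
  · rcases Nat.eq_zero_or_pos a with rfl | h0
    · exact (gap_vertex_left hi (by omega)).hasModel hQ ha (gap_vertex_left hi (a := 1) (by omega))
    · have h2 := gap_vertex_left hi (a := a + 1) (by omega)
      rw [show a + 1 - 1 = a - 1 + 1 by omega] at h2
      refine (gap_vertex_left hi (by omega)).hasModel_succ hQ h2 (by omega)
        (hst (a - 1 + 1) (by omega) (by omega)) (fun _ => trivial) (hWg _ (by omega)) ?_ ?_ <;>
      · simp only [vertex]
        grind
  obtain rfl | rfl | rfl | h : a = i + 1 ∨ a = i + 2 ∨ a = i + 3 ∨ i + 4 ≤ a := by omega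
  · have hσ : (σ + 0) / 2 < 1 / 2 := by linarith
    have hm : (0 + σ) / 2 ∈ Icc (0 : ℝ) 1 := ⟨by linarith, by linarith⟩
    refine hasModel_straight (C := vertex n i hi) (c₀ := tick (n + 2) (i + 1))
      (c₁ := 2 * tick (n + 1) (i + 1) - tick (n + 2) (i + 1)) le_rfl σ0 (by linarith) ?_ ?_
      (fun x s hz => ?_) (fun x s hz hzW => ?_) (l := .bot (i + 1)) (l' := .cut (i + 2))
      Side.noConfusion ?_ (Or.inr rfl) ⟨rfl, ?_⟩ ⟨⟨σ0, by linarith⟩, ?_⟩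
    · rw [← c1.1 _ (by linarith)]
      exact (G1 _ hm _ (by omega) (by omega) trivial).2 (by omega)
    · grind
    · obtain ⟨hs, hz1, hz2⟩ := (mem_cell (vertex n i hi)).1 hz
      constructor
      all_goals grind
    · obtain ⟨rfl, rfl⟩ := (hW _ _).1 hzW
      exact σ1.not_ge ((K _ (by norm_num)).1.1 ((mem_cell (vertex n i hi)).1 hz).2.2)
    · simp [IsSide, vertex]
    · rw [lin_zero]; exact ⟨ga1, a1w⟩
    grind
  · have p0 : 0 < tick (n + 1) (i + 1) - tick (n + 2) (i + 1) := sub_pos.2 i1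
    have q0 : 0 < tick (n + 2) (i + 2) - tick (n + 1) (i + 1) := sub_pos.2 i2
    have s0 : 0 < 1 - 2 * σ := by linarith
    have s0' : 0 < 1 - 2 * σ' := by linarith
    have hh : (1 / 2 : ℝ) ∈ Icc (0 : ℝ) 1 := by norm_num
    refine hasModel_tripod (C := vertex n i hi) (o := (tick (n + 1) (i + 1), 1 / 2))
      (x := ![(tick (n + 1) (i + 1), 1), (muCurve n (i + 1) (i + 1) σ, σ),
        (muCurve n (i + 1) (i + 2) σ', σ')])
      (μ := ![tick (n + 2) (i + 2) - tick (n + 2) (i + 1),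
        (tick (n + 2) (i + 2) - tick (n + 1) (i + 1)) / (1 - 2 * σ),
        (tick (n + 1) (i + 1) - tick (n + 2) (i + 1)) / (1 - 2 * σ')])
      (l := ![.top (i + 1), .cut (i + 2), .cut (i + 3)])
      ((mem_openCell _).2 ⟨by norm_num, ?_, ?_⟩) ?_ ?_ ?_ ?_ ?_ ?_ ?_ ?_ ?_ ?_
    · grind
    · grind
    · intro k
      fin_cases k
      · exact sub_pos.2 (by linarith)
      · exact div_pos q0 s0
      · exact div_pos p0 s0'
    · simp [c1.1 σ σ1.le, c2.1 σ' σ1'.le, lin]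
      field_simp
      ring
    · simp
      field_simp
      ring
    · simp [c1.1 σ σ1.le, lin]
      constructor <;> intro <;> nlinarith
    · rintro ⟨x, s⟩ hz
      obtain ⟨hs, hz1, hz2⟩ := (mem_cell (vertex n i hi)).1 hz
      have hseg : ∀ k, k = i + 1 ∨ k = i + 2 → ∀ τ < (1 / 2 : ℝ),
          ((x, s) ∈ segment ℝ (tick (n + 1) (i + 1), (1 / 2 : ℝ)) (muCurve n (i + 1) k τ, τ) ↔
            τ ≤ s ∧ s ≤ 1 / 2 ∧ x = muCurve n (i + 1) k s) := by
        intro k hk τ hτ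
        have ck := muCurve_near (n := n) hk
        rw [segment_symm, mem_segment_iff hτ]
        refine and_congr_right fun _ => and_congr_right fun h2 => ?_
        rw [ck.1 s h2, ck.1 τ hτ.le]
        have h3 : 1 / 2 - τ ≠ 0 := (sub_pos.2 hτ).ne'
        have e : lin (tick (n + 2) k) (2 * tick (n + 1) (i + 1) - tick (n + 2) k) τ +
            (tick (n + 1) (i + 1) -
              lin (tick (n + 2) k) (2 * tick (n + 1) (i + 1) - tick (n + 2) k) τ) *
            ((s - τ) / (1 / 2 - τ)) =
            lin (tick (n + 2) k) (2 * tick (n + 1) (i + 1) - tick (n + 2) k) s := by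
          have h4 : tick (n + 1) (i + 1) -
              lin (tick (n + 2) k) (2 * tick (n + 1) (i + 1) - tick (n + 2) k) τ =
              2 * (tick (n + 1) (i + 1) - tick (n + 2) k) * (1 / 2 - τ) := by unfold lin; ring
          rw [h4, mul_assoc, mul_div_cancel₀ _ h3]
          unfold lin; ring
        rw [e]
      have e3' : (x, s) ∈ segment ℝ (tick (n + 1) (i + 1), (1 / 2 : ℝ)) (tick (n + 1) (i + 1), 1) ↔
          1 / 2 ≤ s ∧ x = tick (n + 1) (i + 1) := by
        rw [mem_segment_upper]
        simp [hs.2]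
      simp only [Fin.exists_fin_succ, Matrix.cons_val_zero, Matrix.cons_val_succ, IsEmpty.exists_iff,
        or_false]
      rw [e3', hseg _ (Or.inl rfl) σ σ1, hseg _ (Or.inr rfl) σ' σ1']
      constructor
      · intro hx
        rcases le_total s (1 / 2) with h | h
        · rcases hloc x s ((hle _ _ s (by omega) hs).trans hz1)
            (hz2.trans (hle _ _ s (by omega) hs)) hx with rfl | rfl
          all_goals grind
        grind
      · rintro (⟨h, rfl⟩ | ⟨-, -, rfl⟩ | ⟨-, -, rfl⟩)
        all_goals grind
    · grind
    · intro k k' h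
      fin_cases k <;> fin_cases k' <;> simp at h ⊢
    · rintro (k | k | k) hk
      · simp only [IsSide, vertex] at hk
        grind
      · simp only [IsSide, vertex] at hk
        rw [if_neg (by omega), if_pos (by omega), if_neg (by omega), if_pos (by omega)] at hk
        exact ⟨0, by rw [show k = i + 1 by omega]; rfl⟩
      · rcases hk with rfl | rfl
        · exact ⟨1, rfl⟩
        · exact ⟨2, rfl⟩
    · intro k
      fin_cases k
      · simp [IsSide, vertex]
      · exact Or.inl rfl
      · exact Or.inr rfl
    · intro k
      fin_cases k
      · exact ⟨rfl, lv, vr⟩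
      · refine ⟨⟨σ0, σ1.trans (by norm_num)⟩, ?_⟩
        exact le_antisymm ((K σ (by linarith)).1.2 le_rfl) ((K σ (by linarith)).2.2 le_rfl)
      · refine ⟨⟨σ0', σ1'.trans (by norm_num)⟩, ?_⟩
        exact le_antisymm ((K' σ' (by linarith)).2.2 le_rfl) ((K' σ' (by linarith)).1.2 le_rfl)
  · have hm : (0 + σ') / 2 ∈ Icc (0 : ℝ) 1 := ⟨by linarith, by linarith⟩
    refine hasModel_straight (C := vertex n i hi) (c₀ := tick (n + 2) (i + 2))
      (c₁ := 2 * tick (n + 1) (i + 1) - tick (n + 2) (i + 2)) le_rfl σ0' (by linarith) ?_ ?_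
      (fun x s hz => ?_) (fun x s hz hzW => ?_) (l := .bot (i + 2)) (l' := .cut (i + 3))
      Side.noConfusion ?_ (Or.inl rfl) ⟨rfl, ?_⟩ ⟨⟨σ0', by linarith⟩, ?_⟩
    · grind
    · rw [← c2.1 _ (by linarith)]
      exact (G4 _ hm _ (by omega) (by omega) trivial).1 (by omega)
    · obtain ⟨hs, hz1, hz2⟩ := (mem_cell (vertex n i hi)).1 hz
      grind
    · obtain ⟨rfl, rfl⟩ := (hW _ _).1 hzW
      have h := ((mem_cell (vertex n i hi)).1 hz).2.1
      grind
    · simp [IsSide, vertex]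
    · rw [lin_zero]; exact ⟨wa2, a2g⟩
    grind
  · have hβ : (vertex n i hi).β (a + 1) = (vertex n i hi).β a + 1 := by
      simp only [vertex]; rw [if_neg (by omega), if_neg (by omega)]; omega
    have hτ : (vertex n i hi).τ (a + 1) = (vertex n i hi).τ a + 1 := by
      simp only [vertex]
      grind
    have h1 := gap_vertex_right hi h
    have h2 := gap_vertex_right hi (show i + 4 ≤ a + 1 by omega)
    by_cases han : a < n + 4
    · rw [show min (a - 2) (n + 2) = a - 2 by omega] at h1
      rw [show min (a + 1 - 2) (n + 2) = a - 2 + 1 by omega] at h2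
      exact h1.hasModel_succ hQ h2 (by omega) (hst (a - 2 + 1) (by omega) (by omega))
        (fun _ => trivial) (hWg _ (by omega)) hβ hτ
    · rw [show min (a + 1 - 2) (n + 2) = min (a - 2) (n + 2) by omega] at h2
      exact h1.hasModel hQ ha h2

/-- Every pattern has a cutting. -/
theorem exists_fits (ρ : Pattern) :
    ∃ C : Cuts, C.N = ρ.source ∧ C.N' = ρ.target ∧ C.Fits ρ.strands ρ.vertices := by
  cases ρ with
  | I n => exact ⟨identity n, rfl, rfl, fits_identity n⟩
  | mu n i => exact ⟨vertex n i (Nat.le_of_lt_succ i.2), rfl, rfl, fits_vertex n i⟩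
  | beta n i => exact ⟨arc n i (Nat.le_of_lt_succ i.2), rfl, rfl, fits_arc _⟩
  | gamma n i =>
    exact ⟨(arc n i (Nat.le_of_lt_succ i.2)).flip, rfl, rfl,
      (fits_arc _).flip (fun _ => Iff.rfl) fun _ => Iff.rfl⟩

end Cuts

end DefectBord

namespace DefectBord

/-! ### Coordinates on the sphere -/

theorem wrap_injective {x x' y y' : ℝ} (hx : |x - x'| < 2) (hy : y ∈ Ioo (-1 : ℝ) 1)
    (hy' : y' ∈ Ioo (-1 : ℝ) 1) (h : wrap (x, y) = wrap (x', y')) : x = x' ∧ y = y' := by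
  have m := Ioo_subset_Icc_self hy
  have m' := Ioo_subset_Icc_self hy'
  obtain rfl : y = y' := by
    have := congrArg (fun p : S2 => (p : Euc 3) 2) h
    simpa only [wrap_two (z := (x, y)) m, wrap_two (z := (x', y')) m'] using this
  refine ⟨?_, rfl⟩
  have hr : √(1 - y ^ 2) ≠ 0 := (Real.sqrt_pos.2 (by nlinarith [hy.1, hy.2])).ne'
  have e0 := congrArg (fun p : S2 => (p : Euc 3) 0) h
  have e1 := congrArg (fun p : S2 => (p : Euc 3) 1) h
  simp only [wrap_zero (z := (x, y)) m, wrap_zero (z := (x', y)) m, wrap_one (z := (x, y)) m,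
    wrap_one (z := (x', y)) m, mul_right_inj' hr] at e0 e1
  have hpi := Real.pi_pos
  rw [abs_lt] at hx
  have h1 : Real.cos (Real.pi * (x - 1 / 2) - Real.pi * (x' - 1 / 2)) = 1 := by
    rw [Real.cos_sub, e0, e1, ← sq, ← sq, Real.cos_sq_add_sin_sq]
  rw [Real.cos_eq_one_iff_of_lt_of_lt (by nlinarith) (by nlinarith)] at h1
  grind

theorem wrap_add_two (x y : ℝ) : wrap (x + 2, y) = wrap (x, y) := by
  have e : Real.pi * (x + 2 - 1 / 2) = Real.pi * (x - 1 / 2) + 2 * Real.pi := by ring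
  apply Subtype.ext
  simp only [wrap, cyl, e, Real.cos_add_two_pi, Real.sin_add_two_pi]

theorem exists_longitude (p : S2) : ∃ x ∈ Ico (0 : ℝ) 2, wrap (x, (p : Euc 3) 2) = p := by
  have hb : ∀ q : S2, (planar q).1 ∈ Icc (0 : ℝ) 1 := fun q => by
    have h1 := Real.arcsin_mem_Icc ((q : Euc 3) 1 / √(1 - (q : Euc 3) 2 ^ 2))
    have hpi := Real.pi_pos
    have h2 : -1 / 2 ≤ Real.arcsin ((q : Euc 3) 1 / √(1 - (q : Euc 3) 2 ^ 2)) / Real.pi := by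
      rw [le_div_iff₀ hpi]; linarith [h1.1]
    have h3 : Real.arcsin ((q : Euc 3) 1 / √(1 - (q : Euc 3) 2 ^ 2)) / Real.pi ≤ 1 / 2 := by
      rw [div_le_iff₀ hpi]; linarith [h1.2]
    constructor <;> simp only [planar] <;> linarith
  rcases le_or_gt 0 ((p : Euc 3) 0) with h | h
  · exact ⟨_, ⟨(hb p).1, by linarith [(hb p).2]⟩, wrap_planar h⟩
  · have hq : !₂[-(p : Euc 3) 0, -(p : Euc 3) 1, (p : Euc 3) 2] ∈ sphere (0 : Euc 3) 1 := by
      rw [mem_sphere_iff]; simpa using p.sq_add_sq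
    obtain ⟨q, hq'⟩ : ∃ q : S2, (q : Euc 3) = !₂[-(p : Euc 3) 0, -(p : Euc 3) 1, (p : Euc 3) 2] :=
      ⟨⟨_, hq⟩, rfl⟩
    have hw := wrap_planar (p := q) (by rw [hq']; simpa using h.le)
    have e2 : (planar q).2 = (p : Euc 3) 2 := by simp [planar, hq']
    have hm : (planar q).2 ∈ Icc (-1 : ℝ) 1 := by rw [e2]; exact p.two_mem
    have key : wrap ((planar q).1 + 1, (p : Euc 3) 2) = p := by
      have e : Real.pi * ((planar q).1 + 1 - 1 / 2) =
        Real.pi * ((planar q).1 - 1 / 2) + Real.pi := by ring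
      have w0 := wrap_zero hm
      have w1 := wrap_one hm
      rw [hw, hq', e2] at w0 w1
      rw [e2] at hm
      apply S2.ext
      · rw [wrap_zero hm, e, Real.cos_add_pi]; simp at w0 ⊢; linarith
      · rw [wrap_one hm, e, Real.sin_add_pi]; simp at w1 ⊢; linarith
      · rw [wrap_two hm]
    rcases (hb q).2.eq_or_lt with h1 | h1
    · rw [h1, show (1 : ℝ) + 1 = 0 + 2 by norm_num, wrap_add_two] at key
      grind
    grind

/-- The longitude of a point. -/
noncomputable def longitude (p : S2) : ℝ := (exists_longitude p).choose

theorem longitude_mem (p : S2) : longitude p ∈ Ico (0 : ℝ) 2 := (exists_longitude p).choose_spec.1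

theorem wrap_longitude (p : S2) : wrap (longitude p, (p : Euc 3) 2) = p :=
  (exists_longitude p).choose_spec.2

theorem longitude_wrap {x y : ℝ} (hx : x ∈ Ico (0 : ℝ) 2) (hy : y ∈ Ioo (-1 : ℝ) 1) :
    longitude (wrap (x, y)) = x := by
  have h := wrap_longitude (wrap (x, y))
  rw [wrap_two (Ioo_subset_Icc_self hy)] at h
  have h1 := longitude_mem (wrap (x, y))
  exact (wrap_injective (abs_lt.2 ⟨by linarith [h1.1, hx.2], by linarith [h1.2, hx.1]⟩) hy hy h).1

/-! ### Caps -/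

/-- The inverse stereographic projection, from the north pole or (if `b`) from the south pole. -/
noncomputable def cap (κ : ℝ) (b : Bool) (p : Euc 2) : S2 :=
  ⟨!₂[2 * κ * p 0 / (κ ^ 2 * (p 0 ^ 2 + p 1 ^ 2) + 1), 2 * κ * p 1 / (κ ^ 2 * (p 0 ^ 2 + p 1 ^ 2) + 1),
    cond b (-1) 1 * (1 - 2 / (κ ^ 2 * (p 0 ^ 2 + p 1 ^ 2) + 1))], by
    have h : κ ^ 2 * (p 0 ^ 2 + p 1 ^ 2) + 1 ≠ 0 := by positivity
    rw [mem_sphere_iff]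
    cases b <;> simp <;> field_simp <;> ring⟩

theorem continuous_cap (κ : ℝ) (b : Bool) : Continuous (cap κ b) := by
  refine Continuous.subtype_mk ?_ _
  have h : ∀ p : Euc 2, κ ^ 2 * (p 0 ^ 2 + p 1 ^ 2) + 1 ≠ 0 := fun p => by positivity
  fun_prop (disch := exact h _)

theorem cap_injective {κ : ℝ} (hκ : 0 < κ) (b : Bool) : Function.Injective (cap κ b) := by
  intro p q h
  have h' := fun i => congrArg (fun x : S2 => (x : Euc 3) i) h
  have h0 := h' 0
  have h1 := h' 1
  have h2 := h' 2
  have hp : κ ^ 2 * (p 0 ^ 2 + p 1 ^ 2) + 1 ≠ 0 := by positivity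
  have hq : κ ^ 2 * (q 0 ^ 2 + q 1 ^ 2) + 1 ≠ 0 := by positivity
  have e : κ ^ 2 * (p 0 ^ 2 + p 1 ^ 2) + 1 = κ ^ 2 * (q 0 ^ 2 + q 1 ^ 2) + 1 := by
    have : 2 / (κ ^ 2 * (p 0 ^ 2 + p 1 ^ 2) + 1) = 2 / (κ ^ 2 * (q 0 ^ 2 + q 1 ^ 2) + 1) := by
      cases b <;> simpa [cap] using h2
    rwa [div_eq_div_iff hp hq, mul_right_inj' two_ne_zero, eq_comm] at this
  simp only [cap, Matrix.cons_val_zero, Matrix.cons_val_one, e, div_left_inj' hq,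
    mul_right_inj' (mul_pos two_pos hκ).ne'] at h0 h1
  ext i
  fin_cases i
  exacts [h0, h1]

theorem image_cap {τ : ℝ} (hτ : τ ∈ Ioo (-1 : ℝ) 1) (b : Bool) : ∃ κ : ℝ, 0 < κ ∧
    cap κ b '' ball 0 1 = {p : S2 | cond b (-1) 1 * (p : Euc 3) 2 < τ} ∧
    cap κ b '' sphere 0 1 = {p : S2 | cond b (-1) 1 * (p : Euc 3) 2 = τ} := by
  have h1 : 0 < 1 - τ := by linarith [hτ.2]
  have h2 : 0 < 1 + τ := by linarith [hτ.1]
  have hκ2 : √((1 + τ) / (1 - τ)) ^ 2 = (1 + τ) / (1 - τ) := Real.sq_sqrt (by positivity)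
  have hκ : 0 < √((1 + τ) / (1 - τ)) := Real.sqrt_pos.2 (by positivity)
  generalize √((1 + τ) / (1 - τ)) = κ at hκ hκ2
  have hb : (cond b (-1) 1 : ℝ) * cond b (-1) 1 = 1 := by cases b <;> simp
  have hz : ∀ p : Euc 2, (cond b (-1) 1 : ℝ) * (cap κ b p : Euc 3) 2 - τ =
      2 * (1 + τ) / (κ ^ 2 * (p 0 ^ 2 + p 1 ^ 2) + 1) * (p 0 ^ 2 + p 1 ^ 2 - 1) / 2 := by
    intro p
    have h : κ ^ 2 * (p 0 ^ 2 + p 1 ^ 2) + 1 ≠ 0 := by positivity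
    have e : (cond b (-1) 1 : ℝ) * (cap κ b p : Euc 3) 2 =
        1 - 2 / (κ ^ 2 * (p 0 ^ 2 + p 1 ^ 2) + 1) := by
      simp only [cap, Matrix.cons_val]
      grind
    rw [e]
    field_simp
    grind
  have hn : ∀ p : Euc 2, ‖p‖ ^ 2 = p 0 ^ 2 + p 1 ^ 2 := fun p => by
    rw [EuclideanSpace.norm_sq_eq, Fin.sum_univ_two, Real.norm_eq_abs, Real.norm_eq_abs, sq_abs,
      sq_abs]
  have hsurj : ∀ x : S2, (cond b (-1) 1 : ℝ) * (x : Euc 3) 2 ≤ τ → ∃ p, cap κ b p = x := by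
    intro x hx
    obtain ⟨w, hw⟩ : ∃ w, w = (cond b (-1) 1 : ℝ) * (x : Euc 3) 2 := ⟨_, rfl⟩
    rw [← hw] at hx
    have hw2 : (x : Euc 3) 0 ^ 2 + (x : Euc 3) 1 ^ 2 = (1 - w) * (1 + w) := by
      have := x.sq_add_sq
      rw [hw]
      linear_combination this + (x : Euc 3) 2 ^ 2 * hb
    have h3 : 0 < 1 - w := by linarith
    have h4 : κ ^ 2 * (((x : Euc 3) 0 / (κ * (1 - w))) ^ 2 + ((x : Euc 3) 1 / (κ * (1 - w))) ^ 2) + 1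
        = 2 / (1 - w) := by
      field_simp
      rw [hw2]
      field_simp
      ring
    refine ⟨!₂[(x : Euc 3) 0 / (κ * (1 - w)), (x : Euc 3) 1 / (κ * (1 - w))], S2.ext ?_ ?_ ?_⟩
    · simp only [cap, Matrix.cons_val_zero, Matrix.cons_val_one, h4]; field_simp
    · simp only [cap, Matrix.cons_val_zero, Matrix.cons_val_one, h4]; field_simp
    · simp only [cap, Matrix.cons_val_zero, Matrix.cons_val_one, Matrix.cons_val, h4]
      grind
  have hpos : ∀ p : Euc 2, 0 < 2 * (1 + τ) / (κ ^ 2 * (p 0 ^ 2 + p 1 ^ 2) + 1) := fun p => by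
    positivity
  refine ⟨κ, hκ, ?_, ?_⟩ <;> ext x <;> constructor
  · rintro ⟨p, hp, rfl⟩
    rw [mem_ball_zero_iff, ← sq_lt_one_iff₀ (norm_nonneg _), hn] at hp
    have := mul_neg_of_pos_of_neg (hpos p) (sub_neg.2 hp)
    rw [mem_ofPred_eq]
    linarith [hz p]
  · intro hx
    obtain ⟨p, rfl⟩ := hsurj x (le_of_lt hx)
    refine ⟨p, ?_, rfl⟩
    rw [mem_ball_zero_iff, ← sq_lt_one_iff₀ (norm_nonneg _), hn]
    by_contra! hc
    have := mul_nonneg (hpos p).le (sub_nonneg.2 hc)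
    have hx' : (cond b (-1) 1 : ℝ) * (cap κ b p : Euc 3) 2 < τ := hx
    linarith [hz p]
  · rintro ⟨p, hp, rfl⟩
    rw [mem_sphere_zero_iff_norm] at hp
    have := hz p
    rw [← hn, hp] at this
    rw [mem_ofPred_eq]
    linarith
  · intro hx
    obtain ⟨p, rfl⟩ := hsurj x (le_of_eq hx)
    refine ⟨p, ?_, rfl⟩
    have hx' : (cond b (-1) 1 : ℝ) * (cap κ b p : Euc 3) 2 = τ := hx
    have := hz p
    rw [hx', sub_self, eq_comm, div_eq_zero_iff, mul_eq_zero, or_assoc] at this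
    have h5 := (this.resolve_left (hpos p).ne').resolve_right two_ne_zero
    rw [mem_sphere_zero_iff_norm, ← sq_eq_sq₀ (norm_nonneg _) zero_le_one, hn]
    linarith

/-! ### Intervals -/

/-- The map from the standard one-dimensional ball to the unit interval. -/
noncomputable def unit (x : Euc 1) : ℝ := (1 + x 0) / 2

theorem unit_injective : Function.Injective unit := fun x y h => by
  ext i
  fin_cases i
  simp only [unit] at h
  grind

theorem norm_eq_abs_unit (x : Euc 1) : ‖x‖ = |2 * unit x - 1| := by
  rw [EuclideanSpace.norm_eq, Fin.sum_univ_one, Real.norm_eq_abs, Real.sqrt_sq (abs_nonneg _), unit]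
  congr 1
  ring

theorem exists_unit (s : ℝ) : ∃ x, unit x = s := ⟨!₂[2 * s - 1], by simp [unit]⟩

theorem image_unit_ball : unit '' ball 0 1 = Ioo 0 1 := by
  rw [← image_preimage_eq (Ioo 0 1) exists_unit]
  congr 1
  ext x
  rw [mem_ball_zero_iff, norm_eq_abs_unit, abs_lt, mem_preimage, mem_Ioo]
  grind

theorem image_unit_sphere : unit '' sphere 0 1 = {0, 1} := by
  rw [← image_preimage_eq {0, 1} exists_unit]
  congr 1
  ext x
  rw [mem_sphere_zero_iff_norm, norm_eq_abs_unit, abs_eq zero_le_one, mem_preimage,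
    mem_insert_iff, mem_singleton_iff, or_comm]
  grind

theorem image_unit_closedBall : unit '' closedBall 0 1 = Icc 0 1 := by
  rw [← ball_union_sphere, image_union, image_unit_ball, image_unit_sphere, Ioo_union_both zero_le_one]

theorem floor_unique {b : ℕ → ℝ} {M : ℕ} (hb : ∀ k < M, b k < b (k + 1)) {x : ℝ} {k k' : ℕ}
    (hk : k < M) (hk' : k' < M) (h : b k ≤ x ∧ x < b (k + 1)) (h' : b k' ≤ x ∧ x < b (k' + 1)) :
    k = k' := by
  have mono : ∀ i j, i ≤ j → j ≤ M → b i ≤ b j := by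
    intro i j hij
    induction j, hij using Nat.le_induction with
    | base => exact fun _ => le_rfl
    | succ j _ ih => exact fun hj => (ih (by omega)).trans (hb j hj).le
  by_contra hne
  rcases lt_or_gt_of_ne hne with hlt | hlt
  all_goals grind

end DefectBord

namespace DefectBord

open CellComplex

theorem Pattern.snd_of_mem_vertices {ρ : Pattern} {z : ℝ × ℝ} (h : z ∈ ρ.vertices) :
    z.2 = 1 / 2 := by
  cases ρ with
  | mu n i => exact (Pattern.mem_vertices_mu.1 h).1
  | I _ => exact h.elim
  | beta _ _ => exact h.elim
  | gamma _ _ => exact h.elim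

theorem exists_lin {a b : ℝ} (h : a < b) (x : ℝ) : ∃ s, lin a b s = x ∧
    (s ∈ Icc (0 : ℝ) 1 ↔ x ∈ Icc a b) ∧ (s ∈ Ioo (0 : ℝ) 1 ↔ x ∈ Ioo a b) := by
  have h0 := sub_pos.2 h
  refine ⟨(x - a) / (b - a), ?_, ?_, ?_⟩
  · rw [lin, mul_div_cancel₀ _ h0.ne']; ring
  · rw [mem_Icc, mem_Icc, le_div_iff₀ h0, div_le_iff₀ h0]
    grind
  · rw [mem_Ioo, mem_Ioo, lt_div_iff₀ h0, div_lt_iff₀ h0]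
    grind

theorem lin_injective {a b : ℝ} (h : a < b) : Function.Injective (lin a b) := fun s s' e => by
  unfold lin at e
  grind

theorem image_lin {a b : ℝ} (h : a < b) : lin a b '' Icc 0 1 = Icc a b ∧
    lin a b '' Ioo 0 1 = Ioo a b := by
  have key : ∀ A B : Set ℝ, (∀ s x, lin a b s = x → (s ∈ A ↔ x ∈ B)) → lin a b '' A = B := by
    intro A B hAB
    ext x
    obtain ⟨s, hs, -⟩ := exists_lin h x
    grind
  constructor <;> refine key _ _ fun s x e => ?_ <;> obtain ⟨s', h1, h2, h3⟩ := exists_lin h x <;>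
    obtain rfl := lin_injective h (h1.trans e.symm)
  exacts [h2, h3]

/-- A presentation as a stack of pictures, together with cuttings of the pictures. -/
structure Tower (Γ V : Set S2) where
  iso : S2 ≃ₜ S2
  m : ℕ
  m_pos : 0 < m
  ρ : ℕ → Pattern
  t : ℕ → ℝ
  t_mem : ∀ j ≤ m, t j ∈ Ioo (-1 : ℝ) 1
  t_mono : StrictMono t
  first : (ρ 0).source = 0
  comp : ∀ j, j + 1 < m → (ρ j).target = (ρ (j + 1)).source
  last : (ρ (m - 1)).target = 0
  mem_Γ : ∀ p, p ∈ Γ ↔ ∃ j < m, ∃ z ∈ (ρ j).strands,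
    iso p = wrap (z.1, lin (t j) (t (j + 1)) z.2)
  mem_V : ∀ p, p ∈ V ↔ ∃ j < m, ∃ z ∈ (ρ j).vertices,
    iso p = wrap (z.1, lin (t j) (t (j + 1)) z.2)
  C : ℕ → Cuts
  hN : ∀ j, (C j).N = (ρ j).source
  hN' : ∀ j, (C j).N' = (ρ j).target
  fits : ∀ j, (C j).Fits (ρ j).strands (ρ j).vertices

namespace Tower

variable {Γ V : Set S2} (T : Tower Γ V)

/-- The number of points of the graph on the cross-sections. -/
def n (j : ℕ) : ℕ := if j < T.m then (T.ρ j).source else 0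

theorem n_source {j : ℕ} (hj : j < T.m) : T.n j = (T.ρ j).source := if_pos hj

theorem n_target {j : ℕ} (hj : j < T.m) : T.n (j + 1) = (T.ρ j).target := by
  rw [n]
  split_ifs with h
  · exact (T.comp j h).symm
  · rw [← T.last]
    congr 2
    omega

theorem n_zero : T.n 0 = 0 := (T.n_source T.m_pos).trans T.first

theorem n_last : T.n T.m = 0 := if_neg (lt_irrefl _)

/-- The point with given longitude and height. -/
noncomputable def G (z : ℝ × ℝ) : S2 := T.iso.symm (wrap z)

/-- The height. -/
def Y (p : S2) : ℝ := (T.iso p : Euc 3) 2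

/-- The longitude. -/
noncomputable def X (p : S2) : ℝ := longitude (T.iso p)

theorem continuous_G : Continuous T.G := T.iso.symm.continuous.comp continuous_wrap

theorem X_mem (p : S2) : T.X p ∈ Ico (0 : ℝ) 2 := longitude_mem _

theorem G_eq (p : S2) : T.G (T.X p, T.Y p) = p := by
  rw [G, X, Y, wrap_longitude, T.iso.symm_apply_apply]

theorem G_inj {x x' y y' : ℝ} (hx : |x - x'| < 2) (hy : y ∈ Ioo (-1 : ℝ) 1)
    (hy' : y' ∈ Ioo (-1 : ℝ) 1) (h : T.G (x, y) = T.G (x', y')) : x = x' ∧ y = y' :=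
  wrap_injective hx hy hy' (T.iso.symm.injective h)

theorem Y_G {x y : ℝ} (hy : y ∈ Ioo (-1 : ℝ) 1) : T.Y (T.G (x, y)) = y := by
  rw [Y, G, T.iso.apply_symm_apply, wrap_two (Ioo_subset_Icc_self hy)]

theorem X_G {x y : ℝ} (hx : x ∈ Ico (0 : ℝ) 2) (hy : y ∈ Ioo (-1 : ℝ) 1) : T.X (T.G (x, y)) = x := by
  rw [X, G, T.iso.apply_symm_apply, longitude_wrap hx hy]

theorem G_two (y : ℝ) : T.G (2, y) = T.G (0, y) := by
  have := wrap_add_two 0 y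
  rw [zero_add] at this
  rw [G, G, this]

/-- The height in the `j`-th cylinder. -/
noncomputable def lev (j : ℕ) : ℝ → ℝ := lin (T.t j) (T.t (j + 1))

/-- The coordinates of the `j`-th cylinder. -/
noncomputable def chart (j : ℕ) (z : ℝ × ℝ) : S2 := T.G (z.1, T.lev j z.2)

theorem continuous_chart (j : ℕ) : Continuous (T.chart j) :=
  T.continuous_G.comp (by unfold lev lin; fun_prop)

theorem chart_zero (j : ℕ) (x : ℝ) : T.chart j (x, 0) = T.G (x, T.t j) := by
  rw [chart, lev, lin_zero]

theorem chart_one (j : ℕ) (x : ℝ) : T.chart j (x, 1) = T.G (x, T.t (j + 1)) := by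
  rw [chart, lev, lin_one]

theorem lev_mem_Icc (j : ℕ) {s : ℝ} (hs : s ∈ Icc (0 : ℝ) 1) :
    T.lev j s ∈ Icc (T.t j) (T.t (j + 1)) :=
  (image_lin (T.t_mono j.lt_succ_self)).1 ▸ mem_image_of_mem _ hs

theorem lev_mem {j : ℕ} (hj : j < T.m) {s : ℝ} (hs : s ∈ Icc (0 : ℝ) 1) :
    T.lev j s ∈ Ioo (-1 : ℝ) 1 :=
  ⟨(T.t_mem j hj.le).1.trans_le (T.lev_mem_Icc j hs).1,
    (T.lev_mem_Icc j hs).2.trans_lt (T.t_mem (j + 1) hj).2⟩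

theorem chart_inj {j : ℕ} (hj : j < T.m) {z z' : ℝ × ℝ} (hx : |z.1 - z'.1| < 2)
    (hz : z.2 ∈ Icc (0 : ℝ) 1) (hz' : z'.2 ∈ Icc (0 : ℝ) 1) (h : T.chart j z = T.chart j z') :
    z = z' := by
  have := T.G_inj hx (T.lev_mem hj hz) (T.lev_mem hj hz') h
  exact Prod.ext this.1 (lin_injective (T.t_mono j.lt_succ_self) this.2)

theorem lev_eq {j j' : ℕ} {s s' : ℝ} (hs : s ∈ Icc (0 : ℝ) 1) (hs' : s' ∈ Icc (0 : ℝ) 1)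
    (h : T.lev j s = T.lev j' s') (hj : j ≤ j') :
    (j = j' ∧ s = s') ∨ (j + 1 = j' ∧ s = 1 ∧ s' = 0) := by
  have hi := fun j => lin_injective (T.t_mono (Nat.lt_succ_self j))
  rcases hj.eq_or_lt with rfl | hj
  · exact Or.inl ⟨rfl, hi _ h⟩
  have h1 := (T.lev_mem_Icc j hs).2
  have h2 := (T.lev_mem_Icc j' hs').1
  have h3 := T.t_mono.monotone (Nat.succ_le_of_lt hj)
  refine Or.inr ⟨T.t_mono.injective (by linarith), hi j ?_, hi j' ?_⟩
  · rw [lin_one]; change T.lev j s = _; linarith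
  · rw [lin_zero]; change T.lev j' s' = _; linarith

theorem eq_or_of_chart_eq {j j' : ℕ} (hj : j < T.m) (hj' : j' < T.m) {x s : ℝ} {z : ℝ × ℝ}
    (hx : x ∈ Icc (0 : ℝ) 2) (hs : s ∈ Icc (0 : ℝ) 1) (hz : z ∈ (T.ρ j').strands)
    (h : T.iso (T.chart j (x, s)) = wrap (z.1, lin (T.t j') (T.t (j' + 1)) z.2)) :
    x = z.1 ∧ ((j = j' ∧ s = z.2) ∨ (j + 1 = j' ∧ s = 1 ∧ z.2 = 0) ∨
      (j' + 1 = j ∧ z.2 = 1 ∧ s = 0)) := by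
  have hz1 := (T.fits j').fst_mem z hz
  have hz2 := Pattern.snd_mem_of_mem_strands hz
  rw [chart, G, T.iso.apply_symm_apply] at h
  obtain ⟨h1, h2⟩ := wrap_injective (abs_lt.2 ⟨by linarith [hz1.2, hx.1], by linarith [hz1.1, hx.2]⟩)
    (T.lev_mem hj hs) (T.lev_mem hj' hz2) h
  refine ⟨h1, ?_⟩
  rcases le_total j j' with hjj | hjj
  · exact (T.lev_eq hs hz2 h2 hjj).imp_right Or.inl
  · rcases T.lev_eq hz2 hs h2.symm hjj with h | h
    all_goals grind

theorem chart_mem_Γ {j : ℕ} (hj : j < T.m) {x s : ℝ} (hx : x ∈ Icc (0 : ℝ) 2)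
    (hs : s ∈ Icc (0 : ℝ) 1) : T.chart j (x, s) ∈ Γ ↔ (x, s) ∈ (T.ρ j).strands := by
  rw [T.mem_Γ]
  constructor
  · rintro ⟨j', hj', ⟨x', s'⟩, hz, h⟩
    obtain ⟨rfl, ⟨rfl, rfl⟩ | ⟨rfl, rfl, rfl : s' = 0⟩ | ⟨rfl, rfl : s' = 1, rfl⟩⟩ :=
      T.eq_or_of_chart_eq hj hj' hx hs hz h
    · exact hz
    · rw [Pattern.mem_strands_top, T.comp j hj', ← Pattern.mem_strands_bottom]
      exact hz
    · rw [Pattern.mem_strands_bottom, ← T.comp j' hj, ← Pattern.mem_strands_top]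
      exact hz
  · exact fun h => ⟨j, hj, _, h, T.iso.apply_symm_apply _⟩

theorem chart_mem_V {j : ℕ} (hj : j < T.m) {x s : ℝ} (hx : x ∈ Icc (0 : ℝ) 2)
    (hs : s ∈ Icc (0 : ℝ) 1) : T.chart j (x, s) ∈ V ↔ (x, s) ∈ (T.ρ j).vertices := by
  rw [T.mem_V]
  constructor
  · rintro ⟨j', hj', ⟨x', s'⟩, hz, h⟩
    have h2 : s' = 1 / 2 := Pattern.snd_of_mem_vertices hz
    obtain ⟨rfl, ⟨rfl, rfl⟩ | ⟨-, -, h0 : s' = 0⟩ | ⟨-, h0 : s' = 1, -⟩⟩ :=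
      T.eq_or_of_chart_eq hj hj' hx hs ((T.fits j').subset hz) h
    all_goals grind
  · exact fun h => ⟨j, hj, _, h, T.iso.apply_symm_apply _⟩

theorem G_mem_Γ {j : ℕ} (hj : j ≤ T.m) {x : ℝ} (hx : x ∈ Icc (0 : ℝ) 2) : T.G (x, T.t j) ∈ Γ ↔
    ∃ k, 1 ≤ k ∧ k ≤ T.n j ∧ x = tick (T.n j) k := by
  rcases hj.lt_or_eq with hj | rfl
  · rw [← chart_zero, T.chart_mem_Γ hj hx (by simp), Pattern.mem_strands_bottom, T.n_source hj]
  · obtain ⟨j, hj⟩ := Nat.exists_eq_succ_of_ne_zero T.m_pos.ne'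
    have hj' : j < T.m := by omega
    rw [hj, Nat.succ_eq_add_one, ← chart_one, T.chart_mem_Γ hj' hx (by simp),
      Pattern.mem_strands_top, T.n_target hj']

theorem G_not_mem_V {j : ℕ} (hj : j ≤ T.m) {x : ℝ} (hx : x ∈ Icc (0 : ℝ) 2) :
    T.G (x, T.t j) ∉ V := by
  intro h
  rcases hj.lt_or_eq with hj | rfl
  · rw [← chart_zero, T.chart_mem_V hj hx (by simp)] at h
    have := Pattern.snd_of_mem_vertices h; norm_num at this
  · obtain ⟨j, hj⟩ := Nat.exists_eq_succ_of_ne_zero T.m_pos.ne'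
    rw [hj, Nat.succ_eq_add_one, ← chart_one, T.chart_mem_V (by omega) hx (by simp)] at h
    have := Pattern.snd_of_mem_vertices h; norm_num at this

theorem cap_not_mem_Γ {p : S2} (h : T.Y p ≤ T.t 0 ∨ T.t T.m ≤ T.Y p) : p ∉ Γ := by
  intro hp
  obtain ⟨j, hj, z, hz, e⟩ := (T.mem_Γ p).1 hp
  have hs := Pattern.snd_mem_of_mem_strands hz
  have hY : T.Y p = T.lev j z.2 := by
    rw [Y, e, wrap_two (Ioo_subset_Icc_self (T.lev_mem hj hs))]; rfl
  have h1 := T.lev_mem_Icc j hs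
  have h2 := T.t_mono.monotone j.zero_le
  have h3 := T.t_mono.monotone (Nat.succ_le_of_lt hj)
  have hx := Ico_subset_Icc_self (T.X_mem p)
  obtain ⟨i, hi, hn, hY'⟩ : ∃ i ≤ T.m, T.n i = 0 ∧ T.Y p = T.t i := by
    rcases h with h | h
    · exact ⟨0, T.m_pos.le, T.n_zero, by linarith [h1.1]⟩
    · exact ⟨T.m, le_rfl, T.n_last, le_antisymm (by rw [hY]; exact h1.2.trans h3) h⟩
  rw [← T.G_eq p, hY', T.G_mem_Γ hi hx, hn] at hp
  grind

/-! ### The cells -/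

/-- Position along a monotone sequence: at the `k`-th point, or between it and the next one. -/
def Pos (b : ℕ → ℝ) (v : Bool) (k : ℕ) (x : ℝ) : Prop := cond v (x = b k) (b k < x ∧ x < b (k + 1))

theorem Pos.unique {b : ℕ → ℝ} {M : ℕ} (hb : ∀ k < M, b k < b (k + 1)) {x : ℝ} {v v' : Bool}
    {k k' : ℕ} (hk : k < M) (hk' : k' < M) (h : Pos b v k x) (h' : Pos b v' k' x) :
    v = v' ∧ k = k' := by
  have key : ∀ v k, k < M → Pos b v k x → b k ≤ x ∧ x < b (k + 1) := by
    rintro (_ | _) k hk h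
    · exact ⟨h.1.le, h.2⟩
    · exact ⟨h.ge, (show x = b k from h) ▸ hb k hk⟩
  obtain rfl := floor_unique hb hk hk' (key v k hk h) (key v' k' hk' h')
  refine ⟨?_, rfl⟩
  cases v <;> cases v' <;> simp only [Pos, cond] at h h'
  all_goals grind

/-- The corners on a cross-section (if `l`) or the cuts in a cylinder at a given height. -/
noncomputable def bd (l : Bool) (j : ℕ) (y : ℝ) (k : ℕ) : ℝ :=
  cond l (grid (T.n j) k) ((T.C j).cut k ((y - T.t j) / (T.t (j + 1) - T.t j)))

/-- The number of points in `bd`. -/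
def num (l : Bool) (j : ℕ) : ℕ := cond l (T.n j + 3) ((T.C j).K + 2)

/-- The interiors of the cells. -/
def region (l v : Bool) (j k : ℕ) : Set S2 :=
  {p | Pos T.t l j (T.Y p) ∧ Pos (T.bd l j (T.Y p)) v k (T.X p)}

theorem region_unique {l v l' v' : Bool} {j k j' k' : ℕ} {p : S2} (h : p ∈ T.region l v j k)
    (h' : p ∈ T.region l' v' j' k') (hk : k < T.num l j) (hk' : k' < T.num l' j') :
    l = l' ∧ v = v' ∧ j = j' ∧ k = k' := by
  obtain ⟨rfl, rfl⟩ := Pos.unique (M := max j j' + 1) (fun i _ => T.t_mono i.lt_succ_self)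
    (by omega) (by omega) h.1 h'.1
  have hb : ∀ i < T.num l j, T.bd l j (T.Y p) i < T.bd l j (T.Y p) (i + 1) := by
    intro i hi
    cases l
    · have h1 := h.1
      have h0 := sub_pos.2 (T.t_mono j.lt_succ_self)
      exact (T.C j).cut_lt_succ hi ⟨div_pos (sub_pos.2 h1.1) h0,
        (div_lt_one h0).2 (sub_lt_sub_right h1.2 _)⟩
    · exact strictMono_grid _ i.lt_succ_self
  obtain ⟨rfl, rfl⟩ := Pos.unique hb hk hk' h.2 h'.2
  grind

theorem G_mem_region {j k : ℕ} (hj : j ≤ T.m) {x : ℝ} (hx : x ∈ Ico (0 : ℝ) 2) {v : Bool}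
    (h : Pos (grid (T.n j)) v k x) : T.G (x, T.t j) ∈ T.region true v j k := by
  refine ⟨T.Y_G (T.t_mem j hj), ?_⟩
  rw [T.X_G hx (T.t_mem j hj)]
  exact h

theorem chart_mem_region {j k : ℕ} (hj : j < T.m) {x s : ℝ} (hx : x ∈ Ico (0 : ℝ) 2)
    (hs : s ∈ Ioo (0 : ℝ) 1) {v : Bool} (h : Pos (fun k => (T.C j).cut k s) v k x) :
    T.chart j (x, s) ∈ T.region false v j k := by
  have hm := T.lev_mem hj (Ioo_subset_Icc_self hs)
  have ht := T.t_mono j.lt_succ_self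
  have h1 : T.lev j s ∈ Ioo (T.t j) (T.t (j + 1)) := (image_lin ht).2 ▸ mem_image_of_mem _ hs
  have h2 : (T.lev j s - T.t j) / (T.t (j + 1) - T.t j) = s := by
    rw [lev, lin, add_sub_cancel_left, mul_div_cancel_left₀ _ (sub_pos.2 ht).ne']
  simp only [chart, region, mem_ofPred_eq, T.Y_G hm, T.X_G hx hm]
  have e : T.bd false j (T.lev j s) = fun k => (T.C j).cut k s := by
    funext i; simp only [bd, cond, h2]
  refine ⟨h1, ?_⟩
  rw [e]
  exact h

/-- The interiors of the caps. -/
def capRegion (b : Bool) : Set S2 := {p | cond b (T.t T.m < T.Y p) (T.Y p < T.t 0)}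

theorem region_not_cap {l v b : Bool} {j k : ℕ} {p : S2} (h : p ∈ T.region l v j k)
    (hj : j < cond l (T.m + 1) T.m) : p ∉ T.capRegion b := by
  intro h'
  have h1 := h.1
  have h2 := T.t_mono.monotone j.zero_le
  cases l <;> cases b <;> simp only [Pos, capRegion, cond, mem_ofPred_eq] at h1 h' hj
  · linarith [h1.1]
  · linarith [h1.2, T.t_mono.monotone (Nat.succ_le_of_lt hj)]
  · linarith
  · linarith [T.t_mono.monotone (Nat.lt_succ_iff.1 hj)]

/-- Pairs of natural numbers bounded by `M` and `f`. -/
abbrev Idx (M : ℕ) (f : ℕ → ℕ) : Type := {c : ℕ × ℕ // c.1 < M ∧ c.2 < f c.1}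

instance (M : ℕ) (f : ℕ → ℕ) : Finite (Idx M f) := by
  refine Finite.of_injective (β := Σ j : Fin M, Fin (f j)) (fun c => ⟨⟨c.1.1, c.2.1⟩, ⟨c.1.2, c.2.2⟩⟩) ?_
  rintro ⟨⟨a, b⟩, h⟩ ⟨⟨a', b'⟩, h'⟩ e
  grind

/-- Corners. -/
abbrev I₀ : Type := Idx (T.m + 1) (T.num true)

/-- Cuts and polygons. -/
abbrev I₂ : Type := Idx T.m (T.num false)

/-- The corners. -/
noncomputable def f₀ (c : T.I₀) : S2 := T.G (grid (T.n c.1.1) c.1.2, T.t c.1.1)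

/-- The characteristic maps of the edges on the cross-sections and of the cuts. -/
noncomputable def f₁ : T.I₀ ⊕ T.I₂ → Euc 1 → S2
  | .inl c => fun x => T.G (lin (grid (T.n c.1.1) c.1.2) (grid (T.n c.1.1) (c.1.2 + 1)) (unit x),
      T.t c.1.1)
  | .inr c => fun x => T.chart c.1.1 ((T.C c.1.1).cut c.1.2 (unit x), unit x)

/-- The characteristic maps of the polygons in the strip. -/
noncomputable def disc (c : T.I₂) : Euc 2 → ℝ × ℝ := ((T.fits c.1.1).model c.1.2 c.2.2).choose

theorem capHeight_mem (b : Bool) : cond b (-T.t T.m) (T.t 0) ∈ Ioo (-1 : ℝ) 1 := by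
  have h1 := T.t_mem 0 T.m.zero_le
  have h2 := T.t_mem T.m le_rfl
  all_goals grind

/-- The characteristic maps of the polygons and the caps. -/
noncomputable def f₂ : T.I₂ ⊕ Bool → Euc 2 → S2
  | .inl c => fun p => T.chart c.1.1 (T.disc c p)
  | .inr b => fun p => T.iso.symm (cap (image_cap (T.capHeight_mem b) b).choose b p)

theorem isDisc (c : T.I₂) : (T.C c.1.1).IsDisc c.1.2 (T.disc c) :=
  ((T.fits c.1.1).model c.1.2 c.2.2).choose_spec.1

end Tower

end DefectBord

namespace DefectBord

open CellComplex

theorem CellComplex.CellData.eq_of_mem {X : Type} [TopologicalSpace X] (M : CellData X) {d e : M.I₁}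
    {p : X} (h : p ∈ M.f₁ d '' ball 0 1) (h' : p ∈ M.f₁ e '' closedBall 0 1) : d = e := by
  obtain ⟨x, hx, rfl⟩ := h
  rw [← ball_union_sphere, image_union] at h'
  rcases h' with ⟨y, hy, h'⟩ | h'
  · exact Sum.inl_injective (Sum.inr_injective (M.unique _ _ _ (M.mem₁ d x hx) (h' ▸ M.mem₁ e y hy)))
  · obtain ⟨S, hS⟩ := M.bd₁ e
    rw [hS] at h'
    obtain ⟨c, -, h'⟩ := h'
    exact (Sum.inr_ne_inl (M.unique _ _ _ (M.mem₁ d x hx) (h' ▸ M.mem₀ c))).elim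

theorem mem_unit {x : Euc 1} : (x ∈ closedBall (0 : Euc 1) 1 → unit x ∈ Icc (0 : ℝ) 1) ∧
    (x ∈ ball (0 : Euc 1) 1 → unit x ∈ Ioo (0 : ℝ) 1) ∧
    (x ∈ sphere (0 : Euc 1) 1 → unit x = 0 ∨ unit x = 1) :=
  ⟨fun h => image_unit_closedBall ▸ mem_image_of_mem _ h,
    fun h => image_unit_ball ▸ mem_image_of_mem _ h,
    fun h => (image_unit_sphere ▸ mem_image_of_mem _ h : unit x ∈ ({0, 1} : Set ℝ))⟩

theorem Cuts.openSide_unique {C : Cuts} {a : ℕ} (ha : a < C.K + 2) {l l' : Side} (h : C.IsSide a l)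
    (h' : C.IsSide a l') {z : ℝ × ℝ} (hz : z ∈ C.openSide l) (hz' : z ∈ C.openSide l') :
    l = l' := by
  have hg := fun N k k' (h : z.1 ∈ Ioo (grid N k) (grid N (k + 1)))
    (h' : z.1 ∈ Ioo (grid N k') (grid N (k' + 1))) =>
    floor_unique (M := max k k' + 1) (fun i _ => strictMono_grid N i.lt_succ_self) (by omega)
      (by omega) ⟨h.1.le, h.2⟩ ⟨h'.1.le, h'.2⟩
  cases l <;> cases l' <;> simp only [openSide, mem_ofPred_eq, mem_Ioo] at hz hz' <;> try linarith
  · grind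
  · grind
  · have := C.cut_lt_succ ha hz.1
    rcases h with rfl | rfl <;> rcases h' with rfl | rfl <;> first | rfl | linarith

namespace Tower

variable {Γ V : Set S2} (T : Tower Γ V)

theorem grid_mem {N k : ℕ} (h : k ≤ N + 3) : grid N k ∈ Icc (0 : ℝ) 2 :=
  ⟨grid_zero N ▸ (strictMono_grid N).monotone k.zero_le,
    grid_back N ▸ (strictMono_grid N).monotone h⟩

theorem corner_mem {j k : ℕ} (hj : j ≤ T.m) (hk : k ≤ T.n j + 3) :
    T.G (grid (T.n j) k, T.t j) ∈ range T.f₀ := by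
  rcases hk.lt_or_eq with hk | rfl
  · exact ⟨⟨(j, k), Nat.lt_succ_of_le hj, hk⟩, rfl⟩
  · exact ⟨⟨(j, 0), Nat.lt_succ_of_le hj, Nat.succ_pos _⟩, by rw [grid_back, G_two, f₀, grid_zero]⟩

theorem cut_corner_mem {j a : ℕ} (hj : j < T.m) (ha : a ≤ (T.C j).K + 2) {s : ℝ}
    (hs : s = 0 ∨ s = 1) : T.chart j ((T.C j).cut a s, s) ∈ range T.f₀ := by
  rcases hs with rfl | rfl
  · rw [chart_zero, Cuts.cut_at_zero, T.hN, ← T.n_source hj]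
    refine T.corner_mem hj.le (((T.C j).monoβ ha).trans_eq ?_)
    rw [(T.C j).β_back, T.hN, T.n_source hj]
  · rw [chart_one, Cuts.cut_at_one, T.hN', ← T.n_target hj]
    refine T.corner_mem hj (((T.C j).monoτ ha).trans_eq ?_)
    rw [(T.C j).τ_back, T.hN', T.n_target hj]

theorem image_f₁_inl (c : T.I₀) :
    T.f₁ (.inl c) '' closedBall 0 1 = (fun x => T.G (x, T.t c.1.1)) ''
      Icc (grid (T.n c.1.1) c.1.2) (grid (T.n c.1.1) (c.1.2 + 1)) ∧
    T.f₁ (.inl c) '' ball 0 1 = (fun x => T.G (x, T.t c.1.1)) ''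
      Ioo (grid (T.n c.1.1) c.1.2) (grid (T.n c.1.1) (c.1.2 + 1)) := by
  have h := image_lin (strictMono_grid (T.n c.1.1) c.1.2.lt_succ_self)
  rw [← h.1, ← h.2, ← image_unit_closedBall, ← image_unit_ball]
  simp only [image_image]
  exact ⟨rfl, rfl⟩

theorem graph_eq_image (g : ℝ → ℝ) (A : Set ℝ) :
    {z : ℝ × ℝ | z.2 ∈ A ∧ z.1 = g z.2} = (fun s => (g s, s)) '' A := by
  grind

theorem image_f₁_inr (c : T.I₂) :
    T.f₁ (.inr c) '' closedBall 0 1 = T.chart c.1.1 '' (T.C c.1.1).closedSide (.cut c.1.2) ∧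
    T.f₁ (.inr c) '' ball 0 1 = T.chart c.1.1 '' (T.C c.1.1).openSide (.cut c.1.2) := by
  simp only [Cuts.closedSide, Cuts.openSide, graph_eq_image, ← image_unit_closedBall, ← image_unit_ball, image_image]
  exact ⟨rfl, rfl⟩

theorem exists_edge {j a : ℕ} (hj : j < T.m) (ha : a < (T.C j).K + 2) {l : Side}
    (hl : (T.C j).IsSide a l) : ∃ e : T.I₀ ⊕ T.I₂,
      T.f₁ e '' closedBall 0 1 = T.chart j '' (T.C j).closedSide l ∧
      T.f₁ e '' ball 0 1 = T.chart j '' (T.C j).openSide l := by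
  have h : ∀ (y : ℝ) (A : Set ℝ), {z : ℝ × ℝ | z.2 = y ∧ z.1 ∈ A} = (fun x => (x, y)) '' A :=
    fun y A => by ext ⟨x, s⟩; simp [eq_comm, and_comm]
  cases l with
  | bot k =>
    have hk : k < T.n j + 3 := by
      rw [T.n_source hj, ← T.hN, ← (T.C j).β_back]
      exact hl.2.trans_le ((T.C j).monoβ ha)
    refine ⟨.inl ⟨(j, k), Nat.lt_succ_of_lt hj, hk⟩, ?_⟩
    simp only [image_f₁_inl, Cuts.closedSide, Cuts.openSide, h, image_image, chart_zero, T.hN,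
      T.n_source hj, and_self]
  | top k =>
    have hk : k < T.n (j + 1) + 3 := by
      rw [T.n_target hj, ← T.hN', ← (T.C j).τ_back]
      exact hl.2.trans_le ((T.C j).monoτ ha)
    refine ⟨.inl ⟨(j + 1, k), Nat.succ_lt_succ hj, hk⟩, ?_⟩
    simp only [image_f₁_inl, Cuts.closedSide, Cuts.openSide, h, image_image, chart_one, T.hN',
      T.n_target hj, and_self]
  | cut b =>
    have hb : b ≤ (T.C j).K + 2 := by rcases hl with rfl | rfl <;> omega
    rcases hb.lt_or_eq with hb | rfl
    · exact ⟨.inr ⟨(j, b), hj, hb⟩, T.image_f₁_inr _⟩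
    · refine ⟨.inr ⟨(j, 0), hj, Nat.succ_pos _⟩, ?_⟩
      simp only [image_f₁_inr, Cuts.closedSide, Cuts.openSide, graph_eq_image, image_image]
      simp only [chart, Cuts.cut_zero, Cuts.cut_back, G_two, and_self]

theorem exists_level_edge {i : ℕ} (hi : i ≤ T.m) {p : S2} (hp : T.Y p = T.t i) :
    ∃ e, T.f₁ e '' closedBall 0 1 ⊆ {p | T.Y p = T.t i} ∧ p ∈ T.f₁ e '' closedBall 0 1 := by
  have hx := T.X_mem p
  obtain ⟨k, -, hk, h⟩ := exists_floor (b := grid (T.n i)) (T.n i + 2).succ_pos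
    ((grid_zero (T.n i)).trans_le hx.1) (hx.2.le.trans_eq (grid_back (T.n i)).symm)
  refine ⟨.inl ⟨(i, k), Nat.lt_succ_of_le hi, hk⟩, ?_⟩
  rw [(T.image_f₁_inl _).1]
  refine ⟨?_, T.X p, h, ?_⟩
  · rintro _ ⟨x, -, rfl⟩
    exact T.Y_G (T.t_mem i hi)
  · simp only [← hp, G_eq]

theorem exists_union {A : Set S2}
    (h : ∀ p ∈ A, ∃ e, T.f₁ e '' closedBall 0 1 ⊆ A ∧ p ∈ T.f₁ e '' closedBall 0 1) :
    ∃ S : Set (T.I₀ ⊕ T.I₂), A = ⋃ e ∈ S, T.f₁ e '' closedBall 0 1 :=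
  ⟨{e | T.f₁ e '' closedBall 0 1 ⊆ A}, Subset.antisymm
    (fun p hp => (h p hp).elim fun _ he => mem_biUnion he.1 he.2) (iUnion₂_subset fun _ he => he)⟩

theorem image_f₂_inl (c : T.I₂) (A : Set (Euc 2)) :
    T.f₂ (.inl c) '' A = T.chart c.1.1 '' (T.disc c '' A) :=
  image_comp (T.chart c.1.1) (T.disc c) A

theorem image_f₂_inr (b : Bool) : T.f₂ (.inr b) '' ball 0 1 = T.capRegion b ∧
    T.f₂ (.inr b) '' sphere 0 1 = {p | T.Y p = T.t (cond b T.m 0)} := by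
  obtain ⟨-, h1, h2⟩ := (image_cap (T.capHeight_mem b) b).choose_spec
  rw [show T.f₂ (.inr b) = T.iso.symm ∘ cap _ b from rfl, image_comp, image_comp, h1, h2,
    T.iso.image_symm]
  cases b <;> simp [capRegion, Y]

theorem mono_range {b : ℕ → ℝ} {M k : ℕ} (hb : ∀ i j, i ≤ j → b i ≤ b j) (h0 : b 0 = 0)
    (h1 : b M = 1) (h2 : b (M + 1) = 2) (hk : k < M + 1) :
    (if k < M then 0 else 1) ≤ b k ∧ b (k + 1) ≤ (if k < M then 0 else 1) + 1 := by
  grind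

theorem Icc_grid {N k : ℕ} (hk : k < N + 3) {x x' : ℝ} (hx : x ∈ Icc (grid N k) (grid N (k + 1)))
    (hx' : x' ∈ Icc (grid N k) (grid N (k + 1))) : |x - x'| < 2 := by
  have h := mono_range (fun _ _ h => (strictMono_grid N).monotone h) (grid_zero N) (grid_front N)
    (grid_back N) hk
  grind

theorem mem_cell_range {C : Cuts} {a : ℕ} (ha : a < C.K + 2) {z z' : ℝ × ℝ} (hz : z ∈ C.cell a)
    (hz' : z' ∈ C.cell a) : z.1 ∈ Icc (0 : ℝ) 2 ∧ |z.1 - z'.1| < 2 := by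
  have h := fun s (hs : s ∈ Icc (0 : ℝ) 1) => mono_range (fun _ _ h => C.cut_le h hs) (C.cut_zero s)
    (C.cut_front s) (C.cut_back s) ha
  obtain ⟨hs, h1, h2⟩ := hz
  obtain ⟨hs', h1', h2'⟩ := hz'
  have h3 := h _ hs
  have h4 := h _ hs'
  have h5 : (0 : ℝ) ≤ (if a < C.K + 1 then 0 else 1) ∧ (if a < C.K + 1 then 0 else 1) ≤ (1 : ℝ) := by
    split_ifs <;> simp
  change C.cut a z.2 ≤ z.1 at h1
  change z.1 ≤ C.cut (a + 1) z.2 at h2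
  change C.cut a z'.2 ≤ z'.1 at h1'
  change z'.1 ≤ C.cut (a + 1) z'.2 at h2'
  grind

noncomputable def data : CellData S2 where
  I₀ := T.I₀
  I₁ := T.I₀ ⊕ T.I₂
  I₂ := T.I₂ ⊕ Bool
  finite := inferInstance
  f₀ := T.f₀
  f₁ := T.f₁
  f₂ := T.f₂
  continuousOn₁ c := by
    have hu : Continuous unit := by unfold unit; fun_prop
    cases c with
    | inl c => exact (T.continuous_G.comp (((continuous_lin _ _).comp hu).prodMk
        continuous_const)).continuousOn
    | inr c => exact ((T.continuous_chart _).comp (((continuous_lin _ _).comp hu).prodMk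
        hu)).continuousOn
  continuousOn₂ c := by
    cases c with
    | inl c => exact ((T.continuous_chart _).comp (T.isDisc c).continuous).continuousOn
    | inr b => exact (T.iso.symm.continuous.comp (continuous_cap _ _)).continuousOn
  inj₁ c := by
    intro x hx y hy h
    apply unit_injective
    cases c with
    | inl c =>
      have hl := strictMono_grid (T.n c.1.1) c.1.2.lt_succ_self
      have hm := fun {x : Euc 1} hx => (image_lin hl).1 ▸ mem_image_of_mem _ (mem_unit (x := x).1 hx)
      have ht := T.t_mem _ (Nat.lt_succ_iff.1 c.2.1)
      exact lin_injective hl (T.G_inj (Icc_grid c.2.2 (hm hx) (hm hy)) ht ht h).1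
    | inr c =>
      have hm := fun {x : Euc 1} hx => ((T.C c.1.1).mem_cell (a := c.1.2)).2 ⟨(mem_unit (x := x)).1 hx, le_rfl,
        (T.C c.1.1).cut_le (Nat.le_succ _) (mem_unit.1 hx)⟩
      exact congrArg Prod.snd (T.chart_inj c.2.1 (mem_cell_range c.2.2 (hm hx) (hm hy)).2 (hm hx).1
        (hm hy).1 h)
  inj₂ c := by
    cases c with
    | inl c =>
      intro x hx y hy h
      have hx := (T.isDisc c).mem hx
      have hy := (T.isDisc c).mem hy
      exact (T.isDisc c).injective
        (T.chart_inj c.2.1 (mem_cell_range c.2.2 hx hy).2 hx.1 hy.1 h)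
    | inr b => exact (T.iso.symm.injective.comp (cap_injective
        (image_cap (T.capHeight_mem b) b).choose_spec.1 b)).injOn
  R := Sum.elim (fun c => T.region true true c.1.1 c.1.2) (Sum.elim
    (Sum.elim (fun c => T.region true false c.1.1 c.1.2) fun c => T.region false true c.1.1 c.1.2)
    (Sum.elim (fun c => T.region false false c.1.1 c.1.2) T.capRegion))
  unique := by
    rintro p (c | (c | c) | (c | b)) (d | (d | d) | (d | b')) h h'
    all_goals first
      | exact absurd h' (T.region_not_cap h c.2.1)
      | exact absurd h (T.region_not_cap h' d.2.1)
      | (obtain ⟨h1, h2, h3, h4⟩ := T.region_unique h h' c.2.2 d.2.2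
         first
         | (cases h1; done)
         | (cases h2; done)
         | rw [Subtype.ext (Prod.ext h3 h4)])
      | (have ht := T.t_mono.monotone T.m.zero_le
         cases b <;> cases b' <;> first | rfl | (simp [capRegion] at h h'; linarith))
  mem₀ c := T.G_mem_region (Nat.lt_succ_iff.1 c.2.1)
    ⟨(grid_mem c.2.2.le).1, (strictMono_grid _ c.2.2).trans_eq (grid_back _)⟩ rfl
  mem₁ c x hx := by
    have hu := mem_unit.2.1 hx
    cases c with
    | inl c =>
      have hl := (image_lin (strictMono_grid (T.n c.1.1) c.1.2.lt_succ_self)).2 ▸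
        mem_image_of_mem _ hu
      exact T.G_mem_region (v := false) (Nat.lt_succ_iff.1 c.2.1)
        ⟨(grid_mem c.2.2.le).1.trans hl.1.le, hl.2.trans_le (grid_mem c.2.2).2⟩ hl
    | inr c =>
      have h := (T.C c.1.1).cut_le c.1.2.zero_le (Ioo_subset_Icc_self hu)
      have h' := (T.C c.1.1).cut_le c.2.2 (Ioo_subset_Icc_self hu)
      rw [Cuts.cut_zero] at h
      erw [Cuts.cut_back] at h'
      exact T.chart_mem_region (v := true) c.2.1
        ⟨h, ((T.C c.1.1).cut_lt_succ c.2.2 hu).trans_le h'⟩ hu rfl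
  mem₂ c x hx := by
    cases c with
    | inl c =>
      obtain ⟨hu, h1, h2⟩ : T.disc c x ∈ (T.C c.1.1).openCell c.1.2 :=
        (T.isDisc c).image_ball.subset (mem_image_of_mem _ hx)
      have h := (T.C c.1.1).cut_le c.1.2.zero_le (Ioo_subset_Icc_self hu)
      have h' := (T.C c.1.1).cut_le c.2.2 (Ioo_subset_Icc_self hu)
      rw [Cuts.cut_zero] at h
      erw [Cuts.cut_back] at h'
      exact T.chart_mem_region (v := false) c.2.1 ⟨h.trans h1.le, h2.trans_le h'⟩ hu ⟨h1, h2⟩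
    | inr b => exact (T.image_f₂_inr b).1.subset (mem_image_of_mem _ hx)
  bd₁ c := by
    suffices h : T.f₁ c '' sphere 0 1 ⊆ range T.f₀ by
      obtain ⟨S, hS⟩ := subset_range_iff_exists_image_eq.1 h
      exact ⟨S, hS.symm⟩
    rintro _ ⟨x, hx, rfl⟩
    have hu := mem_unit.2.2 hx
    cases c with
    | inl c =>
      have hj := Nat.lt_succ_iff.1 c.2.1
      rcases hu with hu | hu <;> simp only [f₁, hu, lin_zero, lin_one]
      exacts [T.corner_mem hj c.2.2.le, T.corner_mem hj c.2.2]
    | inr c => exact T.cut_corner_mem c.2.1 c.2.2.le hu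
  bd₂ c := by
    apply T.exists_union
    cases c with
    | inl c =>
      rw [T.image_f₂_inl, (T.isDisc c).image_sphere]
      rintro _ ⟨z, hz, rfl⟩
      obtain ⟨l, hl, hz⟩ := Cuts.exists_side hz
      obtain ⟨e, he, -⟩ := T.exists_edge c.2.1 c.2.2 hl
      exact ⟨e, he ▸ image_mono (Cuts.closedSide_subset hl), he ▸ mem_image_of_mem _ hz⟩
    | inr b =>
      rw [(T.image_f₂_inr b).2]
      exact fun p hp => T.exists_level_edge (by cases b <;> simp) hp

end Tower

end DefectBord

namespace DefectBord

open CellComplex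

namespace Tower

variable {Γ V : Set S2} (T : Tower Γ V)

theorem mem_grid_Icc {N k k' : ℕ} (h : 1 ≤ k') (h' : k' ≤ N) (hk : grid N k ≤ tick N k')
    (hk' : tick N k' ≤ grid N (k + 1)) : k' = k := by
  rcases lt_trichotomy k' k with hl | hl | hl
  · exact absurd hk (tick_lt_grid h' hl).not_ge
  · exact hl
  · exact absurd hk' (grid_lt_tick h h' hl).not_ge

theorem closedCell_inl (c : T.I₂) :
    T.data.complex.closedCell (n := 2) (Sum.inl c : T.I₂ ⊕ Bool) =
      T.chart c.1.1 '' (T.C c.1.1).cell c.1.2 :=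
  (T.image_f₂_inl c _).trans (congrArg _ (T.isDisc c).image)

theorem support_eq : T.data.complex.support = univ := by
  refine eq_univ_of_forall fun p => ?_
  suffices h : ∃ c : T.data.complex.Cell 2, p ∈ T.data.complex.closedCell c from
    mem_iUnion.2 ⟨2, mem_iUnion.2 h⟩
  have hcap : ∀ b, p ∈ T.capRegion b → ∃ c : T.data.complex.Cell 2, p ∈ T.data.complex.closedCell c :=
    fun b hp => ⟨(Sum.inr b : T.I₂ ⊕ Bool),
      image_mono ball_subset_closedBall ((T.image_f₂_inr b).1.superset hp)⟩
  by_cases h0 : T.Y p < T.t 0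
  · exact hcap false h0
  by_cases h1 : T.t T.m < T.Y p
  · exact hcap true h1
  obtain ⟨j, -, hj, hy⟩ := exists_floor T.m_pos (not_lt.1 h0) (not_lt.1 h1)
  obtain ⟨s, hs, hs', -⟩ := exists_lin (T.t_mono j.lt_succ_self) (T.Y p)
  have hs' := hs'.2 hy
  have hx := T.X_mem p
  obtain ⟨a, -, ha, h⟩ := exists_floor (b := fun a => (T.C j).cut a s) ((T.C j).K + 1).succ_pos
    (((T.C j).cut_zero s).trans_le hx.1) (hx.2.le.trans_eq ((T.C j).cut_back s).symm)
  refine ⟨(Sum.inl ⟨(j, a), hj, ha⟩ : T.I₂ ⊕ Bool), ?_⟩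
  rw [closedCell_inl]
  refine ⟨(T.X p, s), ⟨hs', h⟩, ?_⟩
  rw [chart, lev, hs, G_eq]

theorem one_cell (e : T.I₀ ⊕ T.I₂) : (T.f₁ e '' closedBall 0 1 ∩ Γ).Subsingleton ∧
    Disjoint (T.f₁ e '' closedBall 0 1) V := by
  rw [Set.disjoint_left]
  cases e with
  | inl c =>
    rw [(T.image_f₁_inl c).1]
    have hj := Nat.lt_succ_iff.1 c.2.1
    have hx : ∀ x ∈ Icc (grid (T.n c.1.1) c.1.2) (grid (T.n c.1.1) (c.1.2 + 1)), x ∈ Icc (0 : ℝ) 2 :=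
      fun x hx => ⟨(grid_mem c.2.2.le).1.trans hx.1, hx.2.trans (grid_mem c.2.2).2⟩
    have key : ∀ x ∈ Icc (grid (T.n c.1.1) c.1.2) (grid (T.n c.1.1) (c.1.2 + 1)),
        T.G (x, T.t c.1.1) ∈ Γ → x = tick (T.n c.1.1) c.1.2 := by
      intro x h hΓ
      obtain ⟨k, hk, hk', rfl⟩ := (T.G_mem_Γ hj (hx x h)).1 hΓ
      rw [mem_grid_Icc hk hk' h.1 h.2]
    refine ⟨?_, ?_⟩
    · rintro _ ⟨⟨x, h, rfl⟩, hΓ⟩ _ ⟨⟨x', h', rfl⟩, hΓ'⟩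
      simp only [key x h hΓ, key x' h' hΓ']
    · rintro _ ⟨x, h, rfl⟩
      exact T.G_not_mem_V hj (hx x h)
  | inr c =>
    rw [(T.image_f₁_inr c).1, Cuts.closedSide, graph_eq_image, image_image]
    have hx : ∀ s ∈ Icc (0 : ℝ) 1, (T.C c.1.1).cut c.1.2 s ∈ Icc (0 : ℝ) 2 := fun s hs =>
      ⟨(Cuts.cut_zero _ s).symm.trans_le ((T.C c.1.1).cut_le c.1.2.zero_le hs),
        ((T.C c.1.1).cut_le c.2.2.le hs).trans_eq (Cuts.cut_back _ s)⟩
    refine ⟨?_, ?_⟩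
    · rintro _ ⟨⟨s, h, rfl⟩, hΓ⟩ _ ⟨⟨s', h', rfl⟩, hΓ'⟩
      simp only [(T.fits c.1.1).subsingleton _ c.2.2.le s h s' h'
        ((T.chart_mem_Γ c.2.1 (hx s h) h).1 hΓ) ((T.chart_mem_Γ c.2.1 (hx s' h') h').1 hΓ')]
    · rintro _ ⟨s, h, rfl⟩ hV
      exact (T.fits c.1.1).not_mem _ c.2.2.le s h ((T.chart_mem_V c.2.1 (hx s h) h).1 hV)

/-- The edges of a polygon. -/
theorem exists_boundaryCell (c : T.I₂) {l : Side} (hl : (T.C c.1.1).IsSide c.1.2 l) :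
    ∃ d : (T.data.regular.boundaryComplex (k := 1) (Sum.inl c : T.I₂ ⊕ Bool)).Cell 1,
      T.data.complex.closedCell d.1 = T.chart c.1.1 '' (T.C c.1.1).closedSide l ∧
      ∀ p ∈ closedBall 0 1, T.disc c p ∈ (T.C c.1.1).openSide l ↔
        p ∈ (T.data.regular.boundaryComplex (k := 1) (Sum.inl c : T.I₂ ⊕ Bool)).openCell d := by
  obtain ⟨e, he, he'⟩ := T.exists_edge c.2.1 c.2.2 hl
  refine ⟨⟨e, le_rfl, ?_⟩, he, fun p hp => ?_⟩
  · refine (he.subset.trans (image_mono (Cuts.closedSide_subset hl))).trans ?_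
    exact ((T.image_f₂_inl c _).trans (congrArg _ (T.isDisc c).image_sphere)).superset
  · refine Iff.trans ?_ (T.data.regular.mem_openCell_iff (k := 1) (Sum.inl c : T.I₂ ⊕ Bool) _ hp).symm
    change _ ↔ T.chart c.1.1 (T.disc c p) ∈ T.f₁ e '' ball 0 1
    rw [he']
    refine ⟨mem_image_of_mem _, ?_⟩
    rintro ⟨z, hz, h⟩
    have hz' := (Cuts.openSide_subset hl hz).1
    have hp' := (T.isDisc c).mem hp
    rwa [← T.chart_inj c.2.1 (mem_cell_range c.2.2 hz' hp').2 hz'.1 hp'.1 h]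

theorem isBasicGon (c : T.I₂ ⊕ Bool) : T.data.complex.IsBasicGon Γ V c := by
  cases c with
  | inr b =>
    refine Or.inl (Set.disjoint_left.2 fun p hp => T.cap_not_mem_Γ ?_)
    have h : p ∈ T.f₂ (.inr b) '' closedBall 0 1 := hp
    rw [← ball_union_sphere, image_union, (T.image_f₂_inr b).1, (T.image_f₂_inr b).2] at h
    cases b
    · exact Or.inl (h.elim (fun h => le_of_lt h) fun h => le_of_eq h)
    · exact Or.inr (h.elim (fun h => le_of_lt h) fun h => ge_of_eq h)
  | inl c =>
    have hm : ∀ z ∈ (T.C c.1.1).cell c.1.2, (T.chart c.1.1 z ∈ Γ ↔ z ∈ (T.ρ c.1.1).strands) ∧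
        (T.chart c.1.1 z ∈ V ↔ z ∈ (T.ρ c.1.1).vertices) := fun z hz =>
      have hx := (mem_cell_range c.2.2 hz hz).1
      ⟨T.chart_mem_Γ c.2.1 hx hz.1, T.chart_mem_V c.2.1 hx hz.1⟩
    have hm' := fun p hp => hm _ ((T.isDisc c).mem (p := p) hp)
    have hd := T.data.regular.isBoundaryDecomposition (k := 1) (Sum.inl c : T.I₂ ⊕ Bool)
    have hball : Homeomorph.refl (Euc 2) '' closedBall 0 1 = closedBall 0 1 := image_id _
    have h01 : ∀ x : ℝ, x ^ 2 = 1 → !₂[x, 0] ∈ closedBall (0 : Euc 2) 1 := fun x hx => by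
      simp [EuclideanSpace.norm_eq, hx]
    rcases ((T.fits c.1.1).model c.1.2 c.2.2).choose_spec.2 with h | ⟨hW, hQ, l, l', hll, hl, hl', h, h'⟩ |
      ⟨hQ, hW, l, hl, hl', h⟩
    · refine Or.inl (Set.disjoint_left.2 fun p hp => ?_)
      rw [closedCell_inl] at hp
      obtain ⟨z, hz, rfl⟩ := hp
      exact fun hΓ => h z hz ((hm z hz).1.1 hΓ)
    · refine Or.inr (Or.inl ⟨?_, .refl _, hball, fun p hp => (hm' p hp).1.trans (hQ p hp), _, hd, ?_⟩)
      · rw [closedCell_inl, Set.disjoint_left]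
        rintro _ ⟨z, hz, rfl⟩ hΓ
        exact hW z hz ((hm z hz).2.1 hΓ)
      obtain ⟨d, -, hd⟩ := T.exists_boundaryCell c hl
      obtain ⟨d', -, hd'⟩ := T.exists_boundaryCell c hl'
      refine ⟨d, d', ?_, (hd _ (h01 _ (by norm_num))).1 h, (hd' _ (h01 _ (by norm_num))).1 h'⟩
      rintro rfl
      exact hll (Cuts.openSide_unique c.2.2 hl hl' h
        ((hd' _ (h01 _ (by norm_num))).2 ((hd _ (h01 _ (by norm_num))).1 h)))
    · refine Or.inr (Or.inr ⟨.refl _, hball, fun p hp => (hm' p hp).1.trans (hQ p hp),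
        fun p hp => (hm' p hp).2.trans (hW p hp), _, hd, ?_⟩)
      choose e he he' using fun k => T.exists_boundaryCell c (h k).1
      have ht : ∀ k, tripod k ∈ closedBall (0 : Euc 2) 1 := fun k => by simp [Cuts.norm_tripod]
      have hk := fun k => (he' k _ (ht k)).1 (h k).2
      refine ⟨Equiv.ofBijective e ⟨fun k k' hkk => hl ?_, fun d => ?_⟩, hk⟩
      · exact Cuts.openSide_unique c.2.2 (h k).1 (h k').1 (h k).2 ((he' k' _ (ht k)).2 (hkk ▸ hk k))
      · have h0 : T.f₁ d.1 0 ∈ T.f₁ d.1 '' ball 0 1 := mem_image_of_mem _ (by simp)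
        have h1 := d.2.2 (image_mono ball_subset_closedBall h0)
        obtain ⟨z, hz, hz'⟩ := ((T.image_f₂_inl c _).trans
          (congrArg _ (T.isDisc c).image_sphere)).subset h1
        obtain ⟨x, hx, hzx⟩ := Cuts.exists_side hz
        obtain ⟨k, rfl⟩ := hl' x hx
        exact ⟨k, Subtype.ext (T.data.eq_of_mem h0
          ((he k).superset ⟨z, hzx, hz'⟩)).symm⟩

theorem isDefectPLCW : T.data.complex.IsDefectPLCW Γ V where
  isPLCW := T.data.regular.isPLCW
  support_eq := T.support_eq
  zero_cell c := by
    rw [Set.disjoint_left]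
    rintro _ ⟨x, -, rfl⟩ hΓ
    change T.I₀ at c
    change T.G _ ∈ Γ at hΓ
    obtain ⟨k, hk, hk', e⟩ := (T.G_mem_Γ (Nat.lt_succ_iff.1 c.2.1) (grid_mem c.2.2.le)).1 hΓ
    rcases le_or_gt c.1.2 k with h | h
    · exact (grid_lt_tick hk hk' h).ne e
    · exact (tick_lt_grid hk' h).ne' e
  one_cell := T.one_cell
  two_cell := T.isBasicGon

end Tower

end DefectBord

namespace DefectBord

open CellComplex

variable {Γ V : Set S2}

/-- The heights of the cross-sections, continued to a strictly increasing sequence. -/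
noncomputable def Decomposition.height (D : Decomposition Γ V) (j : ℕ) : ℝ :=
  if h : j < D.m + 1 then D.level ⟨j, h⟩ else 1 + j

theorem Decomposition.strictMono_height (D : Decomposition Γ V) : StrictMono D.height := by
  refine strictMono_nat_of_lt_succ fun j => ?_
  unfold height
  split_ifs with h h' h'
  · exact D.level_strictMono (Fin.mk_lt_mk.2 j.lt_succ_self)
  · have := (D.level_mem ⟨j, h⟩).2
    push_cast
    linarith [(Nat.cast_nonneg j : (0 : ℝ) ≤ j)]
  · omega
  · push_cast; linarith

theorem Decomposition.height_coe (D : Decomposition Γ V) (j : Fin (D.m + 1)) :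
    D.height j = D.level j := dif_pos j.2

theorem Decomposition.height_mem (D : Decomposition Γ V) (j : ℕ) (hj : j ≤ D.m) :
    D.height j ∈ Ioo (-1 : ℝ) 1 := by
  rw [D.height_coe ⟨j, Nat.lt_succ_of_le hj⟩]
  exact D.level_mem _

theorem Decomposition.mem_place (D : Decomposition Γ V) (j : Fin D.m) {A : Set (ℝ × ℝ)}
    (hA : ∀ z ∈ A, z.2 ∈ Icc (0 : ℝ) 1) {p : S2} :
    p ∈ place (D.level j.castSucc) (D.level j.succ) A ↔
      ∃ z ∈ A, p = wrap (z.1, lin (D.height j) (D.height (j + 1)) z.2) := by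
  rw [place_eq (D.level_mem _).1 (D.level_strictMono j.castSucc_lt_succ) (D.level_mem _).2 hA,
    show D.height j = _ from D.height_coe j.castSucc, show D.height (j + 1) = _ from D.height_coe j.succ,
    stackPlace, image_image]
  simp only [mem_image, eq_comm, lin]

theorem Decomposition.exists_tower (D : Decomposition Γ V) :
    ∃ T : Tower Γ V, T.iso = D.iso ∧ T.m = D.m ∧ T.t = D.height := by
  choose C hN hN' hC using Cuts.exists_fits
  have hρ : ∀ j : Fin D.m, (if h : (j : ℕ) < D.m then D.ρ ⟨j, h⟩ else .I 0) = D.ρ j :=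
    fun j => dif_pos j.2
  have key : ∀ (B : Set S2) (F : Pattern → Set (ℝ × ℝ)), (∀ ρ, ∀ z ∈ F ρ, z.2 ∈ Icc (0 : ℝ) 1) →
      D.iso '' B = ⋃ j, place (D.level j.castSucc) (D.level j.succ) (F (D.ρ j)) →
      ∀ p, p ∈ B ↔ ∃ j < D.m, ∃ z ∈ F (if h : j < D.m then D.ρ ⟨j, h⟩ else .I 0),
        D.iso p = wrap (z.1, lin (D.height j) (D.height (j + 1)) z.2) := by
    intro B F hF e p
    rw [← D.iso.injective.mem_set_image, e, mem_iUnion]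
    constructor
    · rintro ⟨j, h⟩
      exact ⟨j, j.2, by rw [hρ]; exact (D.mem_place j (hF _)).1 h⟩
    · rintro ⟨j, hj, h⟩
      rw [hρ ⟨j, hj⟩] at h
      exact ⟨⟨j, hj⟩, (D.mem_place ⟨j, hj⟩ (hF _)).2 h⟩
  refine ⟨{
    iso := D.iso
    m := D.m
    m_pos := D.m_pos
    t := D.height
    ρ := fun j => if h : j < D.m then D.ρ ⟨j, h⟩ else .I 0
    t_mem := D.height_mem
    t_mono := D.strictMono_height
    first := ?_
    comp := fun j hj => ?_
    last := ?_
    mem_Γ := key Γ _ (fun ρ z => Pattern.snd_mem_of_mem_strands) D.graph_eq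
    mem_V := key V _ (fun ρ z h => ?_) D.vertices_eq
    C := fun j => C _
    hN := fun j => hN _
    hN' := fun j => hN' _
    fits := fun j => hC _ }, rfl, rfl, rfl⟩
  · rw [dif_pos D.m_pos]; exact D.source_first _ rfl
  · rw [dif_pos hj, dif_pos (Nat.lt_of_succ_lt hj)]; exact D.composable _ _ rfl
  · rw [dif_pos (Nat.sub_lt D.m_pos one_pos)]; exact D.target_last _ (Nat.sub_add_cancel D.m_pos)
  · rw [Pattern.snd_of_mem_vertices h]; norm_num

theorem Tower.isCompatible (T : Tower Γ V) (D : Decomposition Γ V) (hi : T.iso = D.iso)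
    (hm : T.m = D.m) (ht : T.t = D.height) : T.data.complex.IsCompatible D := by
  have hpart : ∀ (j : Fin D.m) (A : Set (ℝ × ℝ)), (∀ z ∈ A, z.2 ∈ Icc (0 : ℝ) 1) →
      D.part j A = T.chart j '' A := by
    intro j A hA
    ext p
    rw [Decomposition.part, mem_preimage, D.mem_place j hA, mem_image]
    refine exists_congr fun z => and_congr_right fun _ => ?_
    rw [Tower.chart, Tower.G, Tower.lev, ht, hi, Homeomorph.symm_apply_eq, eq_comm]
  have h01 : ∀ y ∈ Icc (0 : ℝ) 1, ∀ A : Set ℝ, ∀ z ∈ A ×ˢ {y}, z.2 ∈ Icc (0 : ℝ) 1 :=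
    fun y hy A z hz => (show z.2 = y from hz.2) ▸ hy
  have h0 : (0 : ℝ) ∈ Icc (0 : ℝ) 1 := by simp
  have h1 : (1 : ℝ) ∈ Icc (0 : ℝ) 1 := by simp
  have hIcc : ∀ A : Set ℝ, ∀ z ∈ A ×ˢ Icc (0 : ℝ) 1, z.2 ∈ Icc (0 : ℝ) 1 := fun A z hz => hz.2
  refine ⟨fun j => ?_, fun j => ?_, fun j => ?_⟩
  · have e : D.crossSection j = {p | T.Y p = T.t j} := by
      rw [ht, D.height_coe]; simp only [Decomposition.crossSection, Tower.Y, hi]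
    rw [e]
    exact T.exists_union fun p hp => T.exists_level_edge ((Nat.le_of_lt_succ j.2).trans_eq hm.symm) hp
  · refine ⟨(Sum.inl ⟨(j, (T.C j).K + 1), j.2.trans_eq hm.symm, Nat.lt_succ_self _⟩ : T.I₂ ⊕ Bool), ?_⟩
    rw [T.closedCell_inl, Decomposition.back, hpart _ _ (hIcc _)]
    congr 1
    ext ⟨x, s⟩
    rw [Cuts.mem_cell, Cuts.cut_front]
    erw [Cuts.cut_back]
    exact and_comm
  have hj : (j : ℕ) < T.m := j.2.trans_eq hm.symm
  refine ⟨(T.C j).K, fun a => (Sum.inl ⟨(j, a), hj, by dsimp only [Tower.num, cond]; omega⟩ : T.I₂ ⊕ Bool),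
    fun a => (Sum.inr ⟨(j, a), hj, a.2⟩ : T.I₀ ⊕ T.I₂), ?_⟩
  rw [Decomposition.rectangle, hpart _ _ (hIcc _), hpart _ _ (hIcc _), hpart _ _ (hIcc _),
    hpart _ _ (h01 0 h0 _), hpart _ _ (h01 1 h1 _)]
  have hside : ∀ a : Fin ((T.C j).K + 2), T.data.complex.closedCell (n := 1)
      (Sum.inr ⟨(j, a), hj, a.2⟩ : T.I₀ ⊕ T.I₂) = T.chart j '' (T.C j).closedSide (.cut a) :=
    fun a => (T.image_f₁_inr _).1
  have hx : ∀ a ≤ (T.C j).K, ∀ z ∈ (T.C j).cell a, z.1 ∈ Icc (0 : ℝ) 1 := fun a ha z hz =>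
    ⟨((Cuts.cut_zero _ z.2).symm.trans_le ((T.C j).cut_le a.zero_le hz.1)).trans hz.2.1,
      hz.2.2.trans (((T.C j).cut_le (Nat.succ_le_succ ha) hz.1).trans_eq (Cuts.cut_front _ z.2))⟩
  have hinj : ∀ z z' : ℝ × ℝ, z ∈ Icc (0 : ℝ) 1 ×ˢ Icc (0 : ℝ) 1 → z' ∈ Icc (0 : ℝ) 1 ×ˢ Icc (0 : ℝ) 1 →
      T.chart j z = T.chart j z' → z = z' := fun z z' hz hz' h =>
    T.chart_inj hj (abs_lt.2 ⟨by linarith [hz.1.1, hz'.1.2], by linarith [hz.1.2, hz'.1.1]⟩) hz.2 hz'.2 h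
  have hcell : ∀ a b : Fin ((T.C j).K + 1), T.chart j '' (T.C j).cell a ∩ T.chart j '' (T.C j).cell b =
      T.chart j '' ((T.C j).cell a ∩ (T.C j).cell b) := by
    intro a b
    have hs : ∀ a : Fin ((T.C j).K + 1), (T.C j).cell a ⊆ Icc (0 : ℝ) 1 ×ˢ Icc (0 : ℝ) 1 :=
      fun a z hz => ⟨hx a (Nat.lt_succ_iff.1 a.2) z hz, hz.1⟩
    exact (InjOn.image_inter (fun z hz z' => hinj z z' hz) (hs a) (hs b)).symm
  have hsub : ∀ a b, b = a ∨ b = a + 1 → (T.C j).closedSide (.cut b) ⊆ (T.C j).cell a :=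
    fun a b h => (Cuts.closedSide_subset (l := .cut b) h).trans sdiff_subset
  have hcut : ∀ i : Fin ((T.C j).K + 2), ∀ s ∈ Icc (0 : ℝ) 1, (T.C j).cut i s ∈ Icc (0 : ℝ) 1 := fun i s hs =>
    ⟨(Cuts.cut_zero _ s).symm.trans_le ((T.C j).cut_le i.1.zero_le hs),
      ((T.C j).cut_le (Nat.lt_succ_iff.1 i.2) hs).trans_eq (Cuts.cut_front _ s)⟩
  refine ⟨fun a b h => ?_, ?_, ?_, ?_, fun a => ?_, fun a => ?_, fun a b hab => ?_, fun a b hab => ?_,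
    fun i => ⟨⟨_, ⟨((T.C j).cut i 0, 0), ⟨hcut i 0 h0, rfl⟩, rfl⟩, _,
      ⟨((T.C j).cut i 1, 1), ⟨hcut i 1 h1, rfl⟩, rfl⟩, ?_⟩, ?_⟩⟩
  · exact Fin.ext (congrArg (fun c : T.I₂ => c.1.2) (Sum.inl_injective h))
  · simp only [T.closedCell_inl, ← image_iUnion]
    congr 1
    ext ⟨x, s⟩
    rw [mem_iUnion]
    constructor
    · rintro ⟨hxs, hs⟩
      obtain ⟨a, -, ha, h⟩ := exists_floor (b := fun a => (T.C j).cut a s) (T.C j).K.succ_pos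
        (((T.C j).cut_zero s).trans_le hxs.1) (hxs.2.trans_eq ((T.C j).cut_front s).symm)
      exact ⟨⟨a, ha⟩, hs, h⟩
    · rintro ⟨a, h⟩
      exact ⟨hx a (Nat.lt_succ_iff.1 a.2) _ h, h.1⟩
  · rw [hside]
    congr 1
    ext ⟨x, s⟩
    simp [Cuts.closedSide, Cuts.cut_zero, and_comm]
  · rw [hside]
    congr 1
    ext ⟨x, s⟩
    simp [Cuts.closedSide, Cuts.cut_front, and_comm]
  · rw [hside, T.closedCell_inl]
    exact image_mono (hsub _ _ (Or.inl rfl))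
  · rw [hside, T.closedCell_inl]
    exact image_mono (hsub _ _ (Or.inr rfl))
  · rw [hside, T.closedCell_inl, T.closedCell_inl, hcell]
    refine congrArg _ (Subset.antisymm ?_ (subset_inter (hsub _ _ (Or.inr rfl)) (hsub _ _ (Or.inl hab))))
    rintro z ⟨hz, hz'⟩
    refine ⟨hz.1, le_antisymm hz.2.2 ?_⟩
    have := hz'.2.1
    rwa [← hab] at this
  · rw [T.closedCell_inl, T.closedCell_inl, hcell]
    rintro _ ⟨⟨x, s⟩, ⟨⟨hs, -, hz⟩, -, hz', -⟩, rfl⟩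
    have ha : (a : ℕ) + 1 < (T.C j).K + 2 := by omega
    have h2 := hz'.trans hz
    have h3 := (T.C j).cut_le hab hs
    have hs' : s = 0 ∨ s = 1 := by
      by_contra! hcon
      have := (T.C j).cut_lt_succ ha ⟨hs.1.lt_of_ne' hcon.1, hs.2.lt_of_ne hcon.2⟩
      exact this.not_ge (h3.trans h2)
    have hx' : x = (T.C j).cut (a + 1) s :=
      le_antisymm hz (((T.C j).cut_le hab.le hs).trans hz')
    obtain ⟨c, hc⟩ := T.cut_corner_mem hj ha.le hs'
    exact mem_iUnion.2 ⟨c, 0, by simp, by rw [hx']; exact hc⟩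
  · ext p
    constructor
    · rintro ⟨x, hx, rfl⟩
      exact (mem_unit.2.2 hx).imp (fun h => by change T.chart j (_, unit x) = _; rw [h])
        fun h => by change T.chart j (_, unit x) = _; rw [h]
    · have hs : ∀ s ∈ ({0, 1} : Set ℝ), T.chart j ((T.C j).cut i s, s) ∈ T.f₁ (.inr ⟨(j, i), hj, i.2⟩) '' sphere 0 1 := by
        rw [← image_unit_sphere]
        rintro _ ⟨x, hx, rfl⟩
        exact ⟨x, hx, rfl⟩
      rintro (rfl | rfl)
      exacts [hs _ (Or.inl rfl), hs _ (Or.inr rfl)]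
  · rw [Set.disjoint_left]
    rintro p hp hq
    have hp := (T.image_f₁_inr ⟨(j, i), hj, i.2⟩).2.subset hp
    rw [← image_union] at hq
    obtain ⟨z, ⟨hz, hz'⟩, rfl⟩ := hp
    obtain ⟨w, hw, h⟩ := hq
    have hzI := Ioo_subset_Icc_self hz
    have hwI : w ∈ Icc (0 : ℝ) 1 ×ˢ Icc (0 : ℝ) 1 := hw.elim (fun h => ⟨h.1, h01 0 h0 _ _ h⟩) fun h => ⟨h.1, h01 1 h1 _ _ h⟩
    obtain rfl := hinj w z hwI ⟨hz' ▸ hcut i _ hzI, hzI⟩ h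
    rcases hw with ⟨-, hw⟩ | ⟨-, hw⟩
    · exact hz.1.ne' hw
    · exact hz.2.ne hw

theorem Decomposition.exists_complex (D : Decomposition Γ V) :
    ∃ K : CellComplex S2, K.IsDefectPLCW Γ V ∧ K.IsCompatible D := by
  obtain ⟨T, hi, hm, ht⟩ := D.exists_tower
  exact ⟨_, T.isDefectPLCW, T.isCompatible D hi hm ht⟩

end DefectBord

theorem mainTheorem12 (Γ V : Set DefectBord.S2) (hΓ : DefectBord.IsTrivalentGraph Γ V) :
    Nonempty (DefectBord.Decomposition Γ V) ∧
    ∀ D : DefectBord.Decomposition Γ V, ∃ K : DefectBord.CellComplex DefectBord.S2,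
      K.IsDefectPLCW Γ V ∧ K.IsCompatible D := by
  exact ⟨hΓ.nonempty_decomposition, fun D => D.exists_complex⟩
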